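/- **Setting.** For every $n$ let $p=p_n$ with $p_n\to\infty$, and let $X^\circ_i(t)=H(\mathcal F_i;t)\in\mathbb R^{p}$, $i\in\mathbb Z$, $t\in[0,1]$, where $\mathcal F_i=(\dots,\varepsilon_{i-1},\varepsilon_i)$, the $\varepsilon_i\in\mathbb R^p$ are i.i.d. and $H$ is jointly measurable ($H$, the law of $\varepsilon_0$ and the objects built from them may depend on $n$). We observe $X_i=X_i^\circ(i/n)$, $1\le i\le n$. Let $EX_0^\circ(t)=0$, $\Sigma(t)=(\sigma_{jk}(t))=E[X_0^\circ(t)X_0^\circ(t)^\top]$, $\Omega(t)=(\omega_{jk}(t))=\Sigma(t)^{-1}$. Write $|\cdot|_\infty$, $|\cdot|_1$ for the maximum and the sum of the absolute entries of a matrix, $|M|_{L^1}=\max_k\sum_j|m_{jk}|$, and $\|\cdot\|_a$ for the $L^a$ norm of a random variable. Fix constants $\iota\in\mathbb N_0$, $q>2$, $A,L,c_2>0$, $c_1\in(0,1)$, $\nu$, $M$ (independent of $n,p$) and assume for every $n$: * (*Piecewise smoothness*) There are $0=t^{(0)}<\dots<t^{(\iota+1)}=1$ such that on each piece $[t^{(l)},t^{(l+1)})$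 (the last one closed at $1$) $\max_j\|H_j(\mathcal F_0;t)-H_j(\mathcal F_0;t')\|_2\le L|t-t'|$, $|\Sigma(t)-\Sigma(t')|_\infty\le L|t-t'|$, and every $\sigma_{jk}$ is $C^2$ with $|\sigma_{jk}''|\le M$. * (*Dependence*) With $\theta_{m,a,j}=\sup_{t}\|X^\circ_{0j}(t)-X^\circ_{0j,\{m\}}(t)\|_a$, where $X^\circ_{0,\{m\}}(t)$ is $X_0^\circ(t)$ with $\varepsilon_{-m}$ replaced by an independent copy, and $\|X_{\cdot,j}\|_{a,A}=\sup_{m\ge0}(m+1)^A\sum_{i\ge m}\theta_{i,a,j}$: $\sup_t\max_jE|X^\circ_{0j}(t)|^{2q}\le\nu$ and $\max_j\|X_{\cdot,j}\|_{2q,A}<\infty$. Put $N_X=\max_j\|X_{\cdot,j}\|_{4,A}$ and $M_{X,q}=(\sum_j\|X_{\cdot,j}\|_{2q,A}^q)^{1/q}$. * (*Change points*) $\min_{0\le l\le\iota}(t^{(l+1)}-t^{(l)})\ge c_1$, and $|\Sigma(t^{(l)})-\Sigma(t^{(l)}-)|_\infty\ge c_2$ for $1\le l\le\iota$. * (*Sparsity*)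 $\Sigma(t)$ is invertible and $|\Omega(t)|_{L^1}\le\kappa_p$ for all $t\in[0,1]$; $\kappa_p$ may grow. * (*Kernel*) $K\ge0$ is a fixed symmetric function supported in $[-1,1]$, Lipschitz on $[-1,1]$, with $\int_{-1}^1K=1$. **Rates.** Let $J=M_{X,q}(p\varpi)^{1/q}$ with $\varpi=n$, $n(\log n)^{1+2q}$, $n^{q/2-Aq}$ if $A>$, $=$, $<\frac12-\frac1q$, respectively. Let $b_\sharp$ and $h=h_\diamond$ be of the form $C_1(J/n)^{1/3}+C_2N_X^{1/3}n^{-1/6}(\log p)^{1/6}$ and $b_\star$ of the form $C_1(J/n)^{1/2}+C_2N_X^{1/2}n^{-1/4}(\log p)^{1/4}$, each with its own arbitrary fixed constants $C_1,C_2>0$. **Change points.** Let $m=\lfloor nh\rfloor$, $D(\frac rn)=\frac1n\big(\sum_{i=0}^{m-1}X_{r-i}X_{r-i}^\top-\sum_{i=1}^{m}X_{r+i}X_{r+i}^\top\big)$ for $m\le r\le n-m$. Recursively, $\hat s_{l+1}$ is a maximizer of $|D(s)|_\infty$ over the grid points $s=r/n$ with $|s-\hat s_i|>2m/n$ for all $i\le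 l$; the procedure stops, with $\hat\iota=l$, as soon as $|D|_\infty<(1+L)h^2$ at all these points. Let $\hat{\mathcal T}_d(j)=[\hat s_j-d,\hat s_j+d)$, $$\mathcal S=[b_\sharp,1-b_\sharp]\cap\bigcap_{j\le\hat\iota}\hat{\mathcal T}_{h^2+b_\sharp}(j)^c,\qquad \mathcal N=[0,1]\cap\Big([0,b_\sharp)\cup\bigcup_{j\le\hat\iota}\big(\hat{\mathcal T}_{h^2+b_\sharp}(j)\setminus\hat{\mathcal T}_{h^2}(j)\big)\cup(1-b_\sharp,1]\Big).$$ **Estimators.** For a bandwidth $b$ let $\hat\Sigma(t)=\sum_{i=1}^nw(t,\frac in)\breve x_i\breve x_i^\top$ with $w(t,\frac in)=K(|\frac in-t|/b)/\sum_{l=1}^nK(|\frac ln-t|/b)$, where $\breve x_i=X_i$, except that, if $t\in\hat{\mathcal T}_{b+h^2}(j)$ and $(i-n\hat s_j)(nt-n\hat s_j)<0$, $\breve x_i=X_{2n\hat s_j-i}$ (observations with index outside $\{1,\dots,n\}$ are set to $0$). Let $\hat\Omega_\lambda(t)=(\hat\omega_{jk}(t))$ be a minimizer of $|W|_1$ subject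 to $|\hat\Sigma(t)W-I|_\infty\le\lambda$, $\tilde\omega_{jk}=\min(\hat\omega_{jk},\hat\omega_{kj})$ and $\hat g_{jk}(t;u)=1\{|\tilde\omega_{jk}(t)|\ge u\}$. **Theorem.** There is a constant $\Lambda$ such that for every $C_\lambda\ge\Lambda$ there is a constant $U$ such that for every $C_0\ge U$ the following holds as $n,p\to\infty$; $\Lambda$ and $U$ depend only on the constants fixed above and on $K$, not on $n$, $p$ or the models. (i) *Between change points.* Take $b=b_\sharp$, $\lambda=\lambda_\sharp=C_\lambda\kappa_pb_\sharp^2$, $u_\sharp=C_0\kappa_p^2b_\sharp^2$. If $u_\sharp\to0$ and $nb_\sharp\to\infty$, then $$\sup_{t\in\mathcal S}|\hat\Sigma(t)-\Sigma(t)|_\infty=O_P(b_\sharp^2),\qquad \sup_{t\in\mathcal S}|\hat\Omega_{\lambda_\sharp}(t)-\Omega(t)|_\infty=O_P(\kappa_p^2b_\sharp^2),$$ and, each with probability tending to one: for all $t\in\mathcal S$ and all $j,k$, $\omega_{jk}(t)=0$ implies $\hat g_{jk}(t;u_\sharp)=0$; for all $t\in\mathcal S$ and all $j,k$, $|\omega_{jk}(t)|>2u_\sharp$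 implies $\hat g_{jk}(t;u_\sharp)=1$. (ii) *Around change points.* Take $b=b_\star$, $\lambda=\lambda_\star=C_\lambda\kappa_pb_\star$, $u_\star=C_0\kappa_p^2b_\star$. If $u_\star\to0$ and $nb_\star\to\infty$, then $$\sup_{t\in\mathcal N}|\hat\Sigma(t)-\Sigma(t)|_\infty=O_P(b_\star),\qquad \sup_{t\in\mathcal N}|\hat\Omega_{\lambda_\star}(t)-\Omega(t)|_\infty=O_P(\kappa_p^2b_\star),$$ and, each with probability tending to one: for all $t\in\mathcal N$ and all $j,k$, $\omega_{jk}(t)=0$ implies $\hat g_{jk}(t;u_\star)=0$; for all $t\in\mathcal N$ and all $j,k$, $|\omega_{jk}(t)|>2u_\star$ implies $\hat g_{jk}(t;u_\star)=1$. -/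

import Mathlib

open MeasureTheory ProbabilityTheory Filter Topology Set
open scoped ENNReal NNReal

noncomputable section

namespace TVGraph

/-! ### Matrix norms -/

/-- `|M|_∞ = max_{j,k} |m_{jk}|`. -/
def maxNorm {p : ℕ} (M : Matrix (Fin p) (Fin p) ℝ) : ℝ :=
  ⨆ jk : Fin p × Fin p, |M jk.1 jk.2|

/-- `|M|_1 = ∑_{j,k} |m_{jk}|`. -/
def entryL1 {p : ℕ} (M : Matrix (Fin p) (Fin p) ℝ) : ℝ :=
  ∑ j, ∑ k, |M j k|

/-- `|M|_{L¹} = max_k ∑_j |m_{jk}|`. -/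
def colL1 {p : ℕ} (M : Matrix (Fin p) (Fin p) ℝ) : ℝ :=
  ⨆ k, ∑ j, |M j k|

/-! ### The time series model -/

/-- A causal process `X°_i(t) = H(ℱ_i; t)`, `ℱ_i = (…, ε_{i-1}, ε_i)`, driven by i.i.d. innovations
`ε_i ∈ ℝ^p`, together with an independent copy `ε'` of the innovations.
An infinite past `(e_0, e_{-1}, e_{-2}, …)` is coded as the function `k ↦ e_{-k}` on `ℕ`. -/
structure CausalProcess {Ω : Type*} [MeasurableSpace Ω] (μ : Measure Ω) (p : ℕ) where
  /-- the innovations -/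
  ε : ℤ → Ω → Fin p → ℝ
  /-- an independent copy of the innovations -/
  ε' : ℤ → Ω → Fin p → ℝ
  /-- the data generating mechanism -/
  H : (ℕ → Fin p → ℝ) → ℝ → Fin p → ℝ
  measurable_ε : ∀ i, Measurable (ε i)
  measurable_ε' : ∀ i, Measurable (ε' i)
  measurable_H : Measurable (Function.uncurry H)
  indep : iIndepFun (Sum.elim ε ε') μ
  identDistrib_ε : ∀ i, IdentDistrib (ε i) (ε 0) μ μ
  identDistrib_ε' : ∀ i, IdentDistrib (ε' i) (ε 0) μ μ

namespace CausalProcess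

variable {Ω : Type*} [MeasurableSpace Ω] {μ : Measure Ω} {p : ℕ} (P : CausalProcess μ p)

/-- The shift process `ℱ_i`. -/
def past (i : ℤ) (ω : Ω) : ℕ → Fin p → ℝ := fun k => P.ε (i - k) ω

/-- `ℱ_{i,{m}}`: the past `ℱ_i` with `ε_{i-m}` replaced by `ε'_{i-m}`. -/
def pastCoupled (i : ℤ) (m : ℕ) (ω : Ω) : ℕ → Fin p → ℝ :=
  Function.update (P.past i ω) m (P.ε' (i - m) ω)

/-- `X°_i(t)`. -/
def X (i : ℤ) (t : ℝ) (ω : Ω) : Fin p → ℝ := P.H (P.past i ω) t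

/-- `X°_{i,{m}}(t)`. -/
def XCoupled (i : ℤ) (m : ℕ) (t : ℝ) (ω : Ω) : Fin p → ℝ := P.H (P.pastCoupled i m ω) t

/-- The observations `X_{i,n} = X°_i(i/n)`, `1 ≤ i ≤ n` (set to `0` outside the sample). -/
def obs (n : ℕ) (ω : Ω) (i : ℤ) : Fin p → ℝ :=
  if 1 ≤ i ∧ i ≤ n then P.X i ((i : ℝ) / n) ω else 0

/-- The covariance matrix function `Σ(t)` (of the centred process). -/
def cov (t : ℝ) : Matrix (Fin p) (Fin p) ℝ :=
  Matrix.of fun j k => ∫ ω, P.X 0 t ω j * P.X 0 t ω k ∂μ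

/-- The precision matrix function `Ω(t) = Σ(t)⁻¹`. -/
def prec (t : ℝ) : Matrix (Fin p) (Fin p) ℝ := (P.cov t)⁻¹

/-- The jump matrix `Δ(t) = Σ(t) - Σ(t-)`. -/
def jump (t : ℝ) : Matrix (Fin p) (Fin p) ℝ :=
  Matrix.of fun j k => P.cov t j k - Function.leftLim (fun s => P.cov s j k) t

/-- The uniform functional dependence measure `θ_{m,a,j}`. -/
def theta (a : ℝ) (j : Fin p) (m : ℕ) : ℝ≥0∞ :=
  ⨆ t ∈ Icc (0 : ℝ) 1,
    eLpNorm (fun ω => P.X 0 t ω j - P.XCoupled 0 m t ω j) (ENNReal.ofReal a) μ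

/-- `Θ_{m,a,j} = ∑_{i ≥ m} θ_{i,a,j}`. -/
def Theta (a : ℝ) (j : Fin p) (m : ℕ) : ℝ≥0∞ := ∑' i : ℕ, P.theta a j (m + i)

/-- The dependence adjusted norm `‖X_{·,j}‖_{a,A} = sup_{m ≥ 0} (m+1)^A Θ_{m,a,j}`. -/
def dan (a A : ℝ) (j : Fin p) : ℝ≥0∞ := ⨆ m : ℕ, ((m : ℝ≥0∞) + 1) ^ A * P.Theta a j m

/-- The uniform moment `sup_{t ∈ [0,1]} max_j E|X°_j(t)|^a` (this is `ν_{2q}` for `a = 2q`). -/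
def moment (a : ℝ) : ℝ≥0∞ :=
  ⨆ t ∈ Icc (0 : ℝ) 1, ⨆ j : Fin p, ∫⁻ ω, ‖P.X 0 t ω j‖ₑ ^ a ∂μ

/-- `N_{X,a} = max_j ‖X_{·,j}‖_{a,A}`. -/
def maxDan (a A : ℝ) : ℝ≥0∞ := ⨆ j, P.dan a A j

/-- `N_X = N_{X,4}`. -/
def NX (A : ℝ) : ℝ := (P.maxDan 4 A).toReal

/-- `M_{X,q} = (∑_j ‖X_{·,j}‖_{2q,A}^q)^{1/q}`. -/
def MX (q A : ℝ) : ℝ := ((∑ j, P.dan (2 * q) A j ^ q) ^ (1 / q)).toReal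

end CausalProcess

/-- The pieces `[τ_l, τ_{l+1})`, `0 ≤ l ≤ ι`, the last one being closed at the end point of time. -/
def piece {ι : ℕ} (τ : Fin (ι + 2) → ℝ) (l : Fin (ι + 1)) : Set ℝ :=
  if l = Fin.last ι then Icc (τ l.castSucc) (τ l.succ) else Ico (τ l.castSucc) (τ l.succ)

/-! ### Rates -/

/-- `ϖ_{q,A}(n)`. -/
def varpi (q A : ℝ) (n : ℕ) : ℝ :=
  if 1 / 2 - 1 / q < A then (n : ℝ)
  else if A = 1 / 2 - 1 / q then (n : ℝ) * Real.log n ^ (1 + 2 * q)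
  else (n : ℝ) ^ (q / 2 - A * q)

namespace CausalProcess

variable {Ω : Type*} [MeasurableSpace Ω] {μ : Measure Ω} {p : ℕ} (P : CausalProcess μ p)

/-- `J_{q,A}(n,p) = M_{X,q} (p ϖ_{q,A}(n))^{1/q}`. -/
def J (q A : ℝ) (n : ℕ) : ℝ := P.MX q A * ((p : ℝ) * varpi q A n) ^ (1 / q)

/-- `C₁ (J_{q,A}(n,p)/n)^{1/3} + C₂ N_X^{1/3} n^{-1/6} (log p)^{1/6}`:
the form of `b_♯` and of `h_⋄`. -/
def cubeRootRate (q A C₁ C₂ : ℝ) (n : ℕ) : ℝ :=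
  C₁ * (P.J q A n / n) ^ (1 / 3 : ℝ)
    + C₂ * P.NX A ^ (1 / 3 : ℝ) * (n : ℝ) ^ (-(1 / 6) : ℝ) * Real.log p ^ (1 / 6 : ℝ)

/-- `C₁ (J_{q,A}(n,p)/n)^{1/2} + C₂ N_X^{1/2} n^{-1/4} (log p)^{1/4}`: the form of `b_⋆`. -/
def sqrtRate (q A C₁ C₂ : ℝ) (n : ℕ) : ℝ :=
  C₁ * (P.J q A n / n) ^ (1 / 2 : ℝ)
    + C₂ * P.NX A ^ (1 / 2 : ℝ) * (n : ℝ) ^ (-(1 / 4) : ℝ) * Real.log p ^ (1 / 4 : ℝ)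

/-! ### Assumptions on the process -/

/-- Piecewise smoothness with break points `0 = τ_0 < τ_1 < … < τ_ι < τ_{ι+1} = 1`: the process is
centred, on every piece it is stochastically Lipschitz and its covariance entries are `L`-Lipschitz
and `C²`, with second derivatives bounded by `M`. -/
structure PiecewiseSmooth {ι : ℕ} (τ : Fin (ι + 2) → ℝ) (L M : ℝ) : Prop where
  strictMono : StrictMono τ
  first : τ 0 = 0
  last : τ (Fin.last (ι + 1)) = 1
  centred : ∀ t ∈ Icc (0 : ℝ) 1, ∀ j, ∫ ω, P.X 0 t ω j ∂μ = 0
  lipschitz : ∀ l, ∀ t ∈ piece τ l, ∀ t' ∈ piece τ l, ∀ j,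
    eLpNorm (fun ω => P.X 0 t ω j - P.X 0 t' ω j) 2 μ ≤ ENNReal.ofReal (L * |t - t'|)
  cov_lipschitz : ∀ l, ∀ t ∈ piece τ l, ∀ t' ∈ piece τ l,
    maxNorm (P.cov t - P.cov t') ≤ L * |t - t'|
  contDiffOn : ∀ l j k, ContDiffOn ℝ 2 (fun t => P.cov t j k) (piece τ l)
  deriv2_le : ∀ l j k, ∀ t ∈ piece τ l,
    |iteratedDerivWithin 2 (fun s => P.cov s j k) (piece τ l) t| ≤ M

/-- Dependence and moment conditions: `ν_{2q} ≤ ν < ∞` and `N_{X,2q} < ∞`. -/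
structure Dependence (q A ν : ℝ) : Prop where
  moment_le : P.moment (2 * q) ≤ ENNReal.ofReal ν
  maxDan_lt : P.maxDan (2 * q) A < ∞

/-- Separability and sizeability of the change points `τ_1, …, τ_ι`. -/
structure Jumps {ι : ℕ} (τ : Fin (ι + 2) → ℝ) (c₁ c₂ : ℝ) : Prop where
  separated : ∀ l : Fin (ι + 1), c₁ ≤ τ l.succ - τ l.castSucc
  sizeable : ∀ l : Fin ι, c₂ ≤ maxNorm (P.jump (τ l.succ.castSucc))

/-- The precision matrices exist and have `L¹` norm at most `κ`. -/
structure Sparse (κ : ℝ) : Prop where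
  invertible : ∀ t ∈ Icc (0 : ℝ) 1, IsUnit (P.cov t).det
  colL1_le : ∀ t ∈ Icc (0 : ℝ) 1, colL1 (P.prec t) ≤ κ

end CausalProcess

/-- Regularity of the kernel: non-negative, symmetric, supported in `[-1,1]`, Lipschitz there, and
of integral one. -/
structure IsKernel (K : ℝ → ℝ) : Prop where
  nonneg : ∀ u, 0 ≤ K u
  symm : ∀ u, K (-u) = K u
  support : ∀ u, 1 < |u| → K u = 0
  lipschitz : ∃ C : ℝ≥0, LipschitzOnWith C K (Icc (-1) 1)
  integral : ∫ u in (-1 : ℝ)..1, K u = 1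

/-! ### Change point estimation

The data are `x : ℤ → ℝ^p`, of which `x 1, …, x n` matter. Time points `s = r/n` are coded by the
integer `r`, and `m` stands for the window length `hn`. -/

/-- The difference statistic `D(r/n)`. -/
def diffStat {p : ℕ} (x : ℤ → Fin p → ℝ) (n m : ℕ) (r : ℤ) : Matrix (Fin p) (Fin p) ℝ :=
  (n : ℝ)⁻¹ • (∑ i ∈ Finset.range m, Matrix.vecMulVec (x (r - i)) (x (r - i))
    - ∑ i ∈ Finset.Icc 1 m, Matrix.vecMulVec (x (r + i)) (x (r + i)))

/-- The search grid `𝒟_h(l)`: the points of `{h, h + 1/n, …, 1 - h}` that are more than `2h` away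
from the first `l` estimates. -/
def grid (n m : ℕ) (r : ℕ → ℤ) (l : ℕ) : Set ℤ :=
  {s | (m : ℤ) ≤ s ∧ s ≤ (n : ℤ) - m ∧ ∀ i < l, 2 * (m : ℤ) < |s - r i|}

/-- `r 0/n, …, r (k-1)/n` is an output of the change point procedure with threshold `thr`:
every estimate maximizes `|D|_∞` over the current grid (ties broken arbitrarily), and
the procedure stops the first time that `|D|_∞ < thr` on the whole current grid. -/
structure IsChangePointOutput {p : ℕ} (x : ℤ → Fin p → ℝ) (n m : ℕ) (thr : ℝ)
    (k : ℕ) (r : ℕ → ℤ) : Prop where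
  mem : ∀ l < k, r l ∈ grid n m r l
  argmax : ∀ l < k, ∀ s ∈ grid n m r l,
    maxNorm (diffStat x n m s) ≤ maxNorm (diffStat x n m (r l))
  continue_le : ∀ l < k, thr ≤ maxNorm (diffStat x n m (r l))
  stop_lt : ∀ s ∈ grid n m r k, maxNorm (diffStat x n m s) < thr

/-- `𝒯̂_d(j) = [ŝ_j - d, ŝ_j + d)` with `ŝ_j = r j/n`. -/
def nbhd (n : ℕ) (r : ℕ → ℤ) (d : ℝ) (j : ℕ) : Set ℝ :=
  Ico ((r j : ℝ) / n - d) ((r j : ℝ) / n + d)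

/-- `𝒮`: the times in `[b, 1-b]` outside all the `𝒯̂_{h²+b}(j)`. -/
def between (n : ℕ) (k : ℕ) (r : ℕ → ℤ) (b h : ℝ) : Set ℝ :=
  {t | t ∈ Icc b (1 - b) ∧ ∀ j < k, t ∉ nbhd n r (h ^ 2 + b) j}

/-- `𝒩`: the times in `[0,1]` that lie in `[0,b)`, in `(1-b,1]`, or in some
`𝒯̂_{h²+b}(j) \ 𝒯̂_{h²}(j)`. -/
def around (n : ℕ) (k : ℕ) (r : ℕ → ℤ) (b h : ℝ) : Set ℝ :=
  {t | t ∈ Icc (0 : ℝ) 1 ∧ (t < b ∨ 1 - b < t ∨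
    ∃ j < k, t ∈ nbhd n r (h ^ 2 + b) j ∧ t ∉ nbhd n r (h ^ 2) j)}

/-! ### Reflected kernel covariance estimator and tv-CLIME -/

/-- `K_b(i/n, t) = K(|i/n - t|/b)/b`. -/
def kernelAt (K : ℝ → ℝ) (n : ℕ) (b t : ℝ) (i : ℕ) : ℝ := K (|(i : ℝ) / n - t| / b) / b

/-- The kernel weights `w(t, i/n)`. -/
def weight (K : ℝ → ℝ) (n : ℕ) (b t : ℝ) (i : ℕ) : ℝ :=
  kernelAt K n b t i / ∑ l ∈ Finset.Icc 1 n, kernelAt K n b t l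

open Classical in
/-- The index used in place of `i` at time `t`: if `t ∈ 𝒯̂_d(j)` and `i/n`, `t` lie on opposite sides
of `ŝ_j`, then `i` is reflected at `n ŝ_j`. (If `t` is in several `𝒯̂_d(j)`, the first one is
used.) -/
def reflIndex (n : ℕ) (k : ℕ) (r : ℕ → ℤ) (d t : ℝ) (i : ℤ) : ℤ :=
  if hj : ∃ j, j < k ∧ t ∈ nbhd n r d j then
    if 0 ≤ ((i : ℝ) - r (Nat.find hj)) * (t * n - r (Nat.find hj)) then i
    else 2 * r (Nat.find hj) - i
  else i

/-- The reflected kernel covariance estimator `Σ̂(t)` with bandwidth `b`; the reflection is applied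
for `t ∈ 𝒯̂_{b+h²}(j)`. -/
def covHat {p : ℕ} (K : ℝ → ℝ) (x : ℤ → Fin p → ℝ) (n : ℕ) (k : ℕ) (r : ℕ → ℤ) (b h t : ℝ) :
    Matrix (Fin p) (Fin p) ℝ :=
  ∑ i ∈ Finset.Icc 1 n, weight K n b t i •
    Matrix.vecMulVec (x (reflIndex n k r (b + h ^ 2) t i)) (x (reflIndex n k r (b + h ^ 2) t i))

/-- The CLIME constraint set `{Ω : |S Ω - I|_∞ ≤ lam}`. -/
def feasible {p : ℕ} (S : Matrix (Fin p) (Fin p) ℝ) (lam : ℝ) : Set (Matrix (Fin p) (Fin p) ℝ) :=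
  {W | maxNorm (S * W - 1) ≤ lam}

/-- `W` is a CLIME estimate for `S`: a minimizer of `|·|_1` on the constraint set. (Nothing is
asked of `W` if the constraint set is empty.) -/
def IsClime {p : ℕ} (S : Matrix (Fin p) (Fin p) ℝ) (lam : ℝ) (W : Matrix (Fin p) (Fin p) ℝ) :
    Prop :=
  (feasible S lam).Nonempty → W ∈ feasible S lam ∧ ∀ W' ∈ feasible S lam, entryL1 W ≤ entryL1 W'

/-- The edge set `{(j,k) : ω_{jk} ≠ 0}`. -/
def edges {p : ℕ} (W : Matrix (Fin p) (Fin p) ℝ) : Set (Fin p × Fin p) :=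
  {jk | W jk.1 jk.2 ≠ 0}

/-- The significant edges `{(j,k) : |ω_{jk}| > u}`. -/
def sigEdges {p : ℕ} (W : Matrix (Fin p) (Fin p) ℝ) (u : ℝ) : Set (Fin p × Fin p) :=
  {jk | u < |W jk.1 jk.2|}

/-- The estimated edges `{(j,k) : |ω̃_{jk}| ≥ u}`, where `ω̃_{jk} = min(ω̂_{jk}, ω̂_{kj})`. -/
def estEdges {p : ℕ} (W : Matrix (Fin p) (Fin p) ℝ) (u : ℝ) : Set (Fin p × Fin p) :=
  {jk | u ≤ |min (W jk.1 jk.2) (W jk.2 jk.1)|}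

/-! ### Stochastic asymptotics -/

/-- `Y_n = O_ℙ(a_n)` as `n → ∞`, for `Y_n ≥ 0`. -/
def IsBigOP {Ω : ℕ → Type*} [∀ n, MeasurableSpace (Ω n)] (μ : ∀ n, Measure (Ω n))
    (Y : ∀ n, Ω n → ℝ≥0∞) (a : ℕ → ℝ) : Prop :=
  ∀ ε : ℝ, 0 < ε → ∃ C : ℝ, 0 < C ∧
    ∀ᶠ n in atTop, μ n {ω | ENNReal.ofReal (C * a n) < Y n ω} < ENNReal.ofReal ε

/-- The events `E_n` have probability tending to one. (Said through the complements, because the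
events may fail to be measurable when ties are broken in a non-measurable way.) -/
def WithProbToOne {Ω : ℕ → Type*} [∀ n, MeasurableSpace (Ω n)] (μ : ∀ n, Measure (Ω n))
    (E : ∀ n, Set (Ω n)) : Prop :=
  Tendsto (fun n => μ n (E n)ᶜ) atTop (𝓝 0)

end TVGraph

end

/-! Probability enters through one event. Call the centred products `X_{ij} X_{ik} - σ_{jk}(i/n)`
the noise and write `b = b_♯`. By `tendsto_measure_noise`, with probability tending to one, the sums
of the noise over all intervals of at most `n b / 2` indices, for all pairs of coordinates at once,
are below `15 n b³`. Everything after that is deterministic on this event.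

Change points. The difference statistic is a noisy tent near a jump, of height of order `h`, while
away from all jumps it is at most `L h²` plus noise. The threshold `(1 + L) h²` lies in between. As
the tent falls linearly, a maximizer is within `O(b³) + 1/n` of a break, and the exclusion radius
`2h` prevents a break from being found twice (`localization`, `abs_changePoint_sub_le`). This
precision is below `h²`.

Covariance. For `t ∈ 𝒮` the kernel window meets no break. The bias is then `O(b²)` by Taylor's
formula and the near symmetry of the window, and the noise contributes `n b³ / (n b) = b²`
(`abs_covHat_sub_le_of_far`). For `t ∈ 𝒩` reflection brings the window to the side of `t`. Only the
indices within the precision of the estimated break can still be on the wrong side, and with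
bandwidth `b' = b_⋆` they cost `O(b³ / b')`. The bias is `O(b')`, the noise is `O(b³ / b')`, and
`b³` is of the order of `b'²` (`abs_covHat_sub_le_of_reflected`, `exists_covHat_error_le`).

CLIME. If the covariance error is `ε` and `κ ε ≤ λ`, then the true precision matrix is feasible, so
the columns of the minimizer have norm at most `κ`, and its error is at most `2 κ λ`
(`IsClime.maxNorm_sub_le`). Thresholding above this error gives the two statements on edges
(`clime_consistency`).

The noise. After truncation at a level `T`, each product minus its mean is the sum over lags `r` of
the effects of single innovations. For a fixed lag these effects are martingale differences in
reversed time, so their sums obey a Burkholder bound. The lags in `[2^(l-1), 2^l)` give a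
`2^l`-dependent sequence. Its blocks of one parity are independent and satisfy a Fuk–Nagaev maximal
inequality, while incomplete blocks are handled by dyadic chaining. Summing over `l` with suitable
weights gives a polynomial and a Gaussian term (`exists_measure_window_le`). The polynomial term is
geometric in `l`; its ratio being below, at or above one produces the three cases of `ϖ`. When the
ratio is below one, the truncated variables are used with an exponent `Q > q`, which makes the term
vanish and not merely stay bounded. The Gaussian exponent is of order `log p / b`, since a window
holds only `n b` observations. This beats the number of pairs and of windows, whatever the constants
of the bandwidth.

Rates. `b_♯³`, `h_⋄³` and `b_⋆²` are all comparable to `rateSum`. Invertibility with `|Ω|_{L¹} ≤ κ`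
and bounded moments forces lower bounds on `κ` and on `N_X κ`. Hence `u → 0` implies `b → 0` and
`1/n ≤ b⁴`, which makes rounding to the grid harmless (`bandwidth_asymptotics`). -/

noncomputable section

namespace TVGraph

set_option linter.unusedSectionVars false

/-! ### Bounded measurable functions -/

/-- Bounded measurable real functions. -/
structure BddMeas {α : Type*} [MeasurableSpace α] (f : α → ℝ) : Prop where
  meas : Measurable f
  bdd : ∃ C, ∀ x, |f x| ≤ C

namespace BddMeas

variable {α β : Type*} [MeasurableSpace α] [MeasurableSpace β] {f g : α → ℝ}

theorem const (c : ℝ) : BddMeas (fun _ : α => c) := ⟨measurable_const, |c|, fun _ => le_rfl⟩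

theorem add (hf : BddMeas f) (hg : BddMeas g) : BddMeas (fun x => f x + g x) := by
  obtain ⟨mf, C, hC⟩ := hf
  obtain ⟨mg, D, hD⟩ := hg
  exact ⟨mf.add mg, C + D, fun x => (abs_add_le _ _).trans (add_le_add (hC x) (hD x))⟩

theorem neg (hf : BddMeas f) : BddMeas (fun x => -f x) := by
  obtain ⟨mf, C, hC⟩ := hf
  exact ⟨mf.neg, C, fun x => by simpa using hC x⟩

theorem sub (hf : BddMeas f) (hg : BddMeas g) : BddMeas (fun x => f x - g x) := by
  simpa only [sub_eq_add_neg] using hf.add hg.neg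

theorem mul (hf : BddMeas f) (hg : BddMeas g) : BddMeas (fun x => f x * g x) := by
  obtain ⟨mf, C, hC⟩ := hf
  obtain ⟨mg, D, hD⟩ := hg
  refine ⟨mf.mul mg, C * D, fun x => ?_⟩
  rw [abs_mul]
  exact mul_le_mul (hC x) (hD x) (abs_nonneg _) ((abs_nonneg _).trans (hC x))

theorem sum {ι : Type*} (s : Finset ι) {f : ι → α → ℝ} (hf : ∀ i ∈ s, BddMeas (f i)) :
    BddMeas (fun x => ∑ i ∈ s, f i x) := by
  classical
  induction s using Finset.induction_on with
  | empty => simpa using BddMeas.const (α := α) 0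
  | insert a s ha ih =>
    simp only [Finset.sum_insert ha]
    exact (hf a (by simp)).add (ih fun i hi => hf i (by simp [hi]))

theorem abs (hf : BddMeas f) : BddMeas (fun x => |f x|) := by
  obtain ⟨mf, C, hC⟩ := hf
  exact ⟨mf.abs, C, fun x => by simpa using hC x⟩

theorem max (hf : BddMeas f) (hg : BddMeas g) : BddMeas (fun x => Max.max (f x) (g x)) := by
  obtain ⟨mf, C, hC⟩ := hf
  obtain ⟨mg, D, hD⟩ := hg
  exact ⟨mf.max mg, Max.max C D, fun x => abs_max_le_max_abs_abs.trans (max_le_max (hC x) (hD x))⟩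

theorem comp (hf : BddMeas f) {φ : β → α} (hφ : Measurable φ) : BddMeas (fun x => f (φ x)) := by
  obtain ⟨mf, C, hC⟩ := hf
  exact ⟨mf.comp hφ, C, fun x => hC _⟩

/-- Post-composition with a continuous function. -/
theorem continuous_comp (hf : BddMeas f) {φ : ℝ → ℝ} (hφ : Continuous φ) :
    BddMeas (fun x => φ (f x)) := by
  obtain ⟨mf, C, hC⟩ := hf
  obtain ⟨D, hD⟩ := (isCompact_Icc (a := -C) (b := C)).exists_bound_of_continuousOn hφ.continuousOn
  exact ⟨hφ.measurable.comp mf, D, fun x => by simpa using hD _ (abs_le.1 (hC x))⟩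

theorem integrable (hf : BddMeas f) (μ : Measure α) [IsFiniteMeasure μ] : Integrable f μ := by
  obtain ⟨mf, C, hC⟩ := hf
  exact Integrable.of_bound mf.aestronglyMeasurable C (ae_of_all _ fun x => by simpa using hC x)

theorem rpow_abs (hf : BddMeas f) {a : ℝ} (ha : 0 ≤ a) : BddMeas (fun x => |f x| ^ a) :=
  hf.continuous_comp (φ := fun y => |y| ^ a) (continuous_abs.rpow_const fun _ => Or.inr ha)

theorem indicator (hf : BddMeas f) {s : Set α} (hs : MeasurableSet s) :
    BddMeas (s.indicator f) := by
  obtain ⟨mf, C, hC⟩ := hf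
  refine ⟨mf.indicator hs, Max.max C 0, fun x => ?_⟩
  by_cases hx : x ∈ s
  · simpa [hx] using Or.inl (hC x)
  · simp [hx]

end BddMeas

/-! ### I.i.d. sequences -/

section IID

variable {ι E : Type*} [MeasurableSpace E] (ν : Measure E) [IsProbabilityMeasure ν]

/-- The law of an i.i.d. family with marginal law `ν`. -/
abbrev iid (ι : Type*) {E : Type*} [MeasurableSpace E] (ν : Measure E) : Measure (ι → E) :=
  Measure.infinitePi fun _ : ι => ν

theorem measurePreserving_reindex {κ : Type*} {f : κ → ι} (hf : Function.Injective f) :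
    MeasurePreserving (fun (e : ι → E) i => e (f i)) (iid ι ν) (iid κ ν) :=
  ⟨by fun_prop, Measure.map_infinitePi_infinitePi_of_inj (P := fun _ : ι => ν) hf⟩

/-- It is enough to compare finite boxes, and a box over a disjoint union splits into its left and
right factors. -/
theorem measurePreserving_sumElim {κ : Type*} :
    MeasurePreserving (fun e : (ι → E) × (κ → E) => (Sum.elim e.1 e.2 : ι ⊕ κ → E))
      ((iid ι ν).prod (iid κ ν)) (iid (ι ⊕ κ) ν) := by
  classical
  have hm : Measurable (fun e : (ι → E) × (κ → E) => (Sum.elim e.1 e.2 : ι ⊕ κ → E)) := by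
    refine measurable_pi_iff.2 fun i => ?_
    cases i with
    | inl i => exact (measurable_pi_apply i).comp measurable_fst
    | inr i => exact (measurable_pi_apply i).comp measurable_snd
  refine ⟨hm, Measure.eq_infinitePi _ fun s t ht => ?_⟩
  rw [Measure.map_apply hm (MeasurableSet.pi s.countable_toSet fun i _ => ht i)]
  have : (fun e : (ι → E) × (κ → E) => (Sum.elim e.1 e.2 : ι ⊕ κ → E)) ⁻¹' (Set.pi s t)
      = (Set.pi s.toLeft fun i => t (.inl i)) ×ˢ (Set.pi s.toRight fun i => t (.inr i)) := by
    ext e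
    simp [Set.mem_pi]
  rw [this, Measure.prod_prod, Measure.infinitePi_pi _ fun i _ => ht _,
    Measure.infinitePi_pi _ fun i _ => ht _]
  conv_rhs => rw [← Finset.toLeft_disjSum_toRight (u := s), Finset.prod_disjSum]

theorem measurePreserving_sumSplit {κ : Type*} :
    MeasurePreserving (fun e : ι ⊕ κ → E => ((fun i => e (.inl i), fun i => e (.inr i))))
      (iid (ι ⊕ κ) ν) ((iid ι ν).prod (iid κ ν)) := by
  refine ⟨by fun_prop, ?_⟩
  have h := measurePreserving_sumElim (ι := ι) (κ := κ) ν
  rw [← h.map_eq, Measure.map_map (by fun_prop) h.measurable]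
  exact Measure.map_id

open Classical in
/-- Swapping the coordinates outside `S` of two independent i.i.d. sequences. -/
theorem measurePreserving_swap (S : Set ι) :
    MeasurePreserving (fun e : (ι → E) × (ι → E) => (S.piecewise e.1 e.2, S.piecewise e.2 e.1))
      ((iid ι ν).prod (iid ι ν)) ((iid ι ν).prod (iid ι ν)) := by
  -- The involution that exchanges the two copies of every index outside `S`. Reindexing an i.i.d.
  -- family along an injection preserves its law.
  let f : ι ⊕ ι → ι ⊕ ι := fun i => Sum.elim (fun i => if i ∈ S then .inl i else .inr i)
    (fun i => if i ∈ S then .inr i else .inl i) i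
  have hf : Function.Injective f := by
    intro i j h
    rcases i with i | i <;> rcases j with j | j <;> by_cases hi : i ∈ S <;> by_cases hj : j ∈ S <;>
      simp [f, hi, hj] at h ⊢ <;> grind
  have h := ((measurePreserving_sumSplit (ι := ι) (κ := ι) ν).comp
    (measurePreserving_reindex ν hf)).comp (measurePreserving_sumElim (ι := ι) (κ := ι) ν)
  convert h using 1
  funext e
  ext i <;> by_cases hi : i ∈ S <;> simp [f, hi]

open Classical in
theorem measurePreserving_piecewise (S : Set ι) :
    MeasurePreserving (fun e : (ι → E) × (ι → E) => S.piecewise e.1 e.2)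
      ((iid ι ν).prod (iid ι ν)) (iid ι ν) :=
  measurePreserving_fst.comp (measurePreserving_swap ν S)

open Classical in
/-- The conditional expectation of `f` given the coordinates in `S`. -/
def condOn (S : Set ι) (f : (ι → E) → ℝ) (e : ι → E) : ℝ :=
  ∫ e', f (S.piecewise e e') ∂(iid ι ν)

variable {ν}

variable {S T : Set ι} {f g : (ι → E) → ℝ}

theorem condOn_bddMeas (S : Set ι) (hf : BddMeas f) : BddMeas (condOn ν S f) := by
  classical
  obtain ⟨mf, C, hC⟩ := hf
  refine ⟨?_, C, fun e => ?_⟩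
  · have h1 : Measurable (fun e : (ι → E) × (ι → E) => f (S.piecewise e.1 e.2)) :=
      mf.comp (measurePreserving_piecewise ν S).measurable
    exact (h1.stronglyMeasurable.integral_prod_right' (ν := iid ι ν)).measurable
  · have := norm_integral_le_of_norm_le_const (μ := iid ι ν) (f := fun e' => f (S.piecewise e e'))
      (ae_of_all _ fun x => hC _)
    simpa [condOn] using this

theorem dependsOn_condOn (S : Set ι) (f : (ι → E) → ℝ) : DependsOn (condOn ν S f) S := by
  classical
  intro e e' h
  unfold condOn
  congr with u
  congr 1
  ext i
  by_cases hi : i ∈ S <;> simp [hi, h]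

theorem condOn_of_dependsOn (hf : DependsOn f S) : condOn ν S f = f := by
  classical
  ext e
  have : ∀ e', f (S.piecewise e e') = f e := fun e' => hf fun i hi => by simp [hi]
  simp [condOn, this]

theorem condOn_eq_integral (hf : DependsOn f T) (h : Disjoint S T) (e : ι → E) :
    condOn ν S f e = ∫ x, f x ∂(iid ι ν) := by
  classical
  unfold condOn
  congr with e'
  refine hf fun i hi => ?_
  have : i ∉ S := fun h' => h.le_bot ⟨h', hi⟩
  simp [this]

theorem condOn_insert_of_dependsOn {k : ι} (hf : DependsOn f {k}ᶜ) :
    condOn ν (insert k S) f = condOn ν S f := by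
  classical
  ext e
  unfold condOn
  congr with e'
  refine hf fun i hi => ?_
  have : i ≠ k := hi
  by_cases hi : i ∈ S <;> simp [this, hi, Set.piecewise]

/-- Conditional expectation is self-adjoint. -/
theorem integral_mul_condOn (hf : BddMeas f) (hg : BddMeas g) (S : Set ι) :
    ∫ e, g e * condOn ν S f e ∂(iid ι ν) = ∫ e, condOn ν S g e * f e ∂(iid ι ν) := by
  classical
  have key : ∀ {f g : (ι → E) → ℝ}, BddMeas f → BddMeas g →
      ∫ e, g e * condOn ν S f e ∂(iid ι ν)
        = ∫ e, g e.1 * f (S.piecewise e.1 e.2) ∂((iid ι ν).prod (iid ι ν)) := by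
    intro f g hf hg
    rw [integral_prod _ (((hg.comp measurable_fst).mul
      (hf.comp (measurePreserving_piecewise ν S).measurable)).integrable _)]
    simp only [condOn, integral_const_mul]
  rw [key hf hg]
  have h2 := key hg hf
  simp only [mul_comm (f _)] at h2
  rw [h2]
  have hb : BddMeas fun e : (ι → E) × (ι → E) => g e.1 * f (S.piecewise e.1 e.2) :=
    (hg.comp measurable_fst).mul (hf.comp (measurePreserving_piecewise ν S).measurable)
  -- Swapping outside `S` turns `g e.1 * f (S.piecewise e.1 e.2)` into `g (S.piecewise e.1 e.2) * f
  -- e.1`, which is the other side written as a double integral.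
  have hs := measurePreserving_swap (E := E) ν S
  have := integral_map (μ := (iid ι ν).prod (iid ι ν)) hs.measurable.aemeasurable
    (f := fun e : (ι → E) × (ι → E) => g e.1 * f (S.piecewise e.1 e.2))
    hb.meas.aestronglyMeasurable
  rw [hs.map_eq] at this
  rw [this]
  congr with e
  congr 2
  ext i
  by_cases hi : i ∈ S <;> simp [hi]

theorem integral_condOn (hf : BddMeas f) (S : Set ι) :
    ∫ e, condOn ν S f e ∂(iid ι ν) = ∫ e, f e ∂(iid ι ν) := by
  have := integral_mul_condOn (ν := ν) hf (BddMeas.const 1) S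
  simpa [condOn] using this

/-- Functions of disjoint sets of coordinates are independent. -/
theorem integral_mul_of_dependsOn (hf : BddMeas f) (hg : BddMeas g) (hfS : DependsOn f S)
    (hgT : DependsOn g T) (h : Disjoint S T) :
    ∫ e, f e * g e ∂(iid ι ν) = (∫ e, f e ∂(iid ι ν)) * ∫ e, g e ∂(iid ι ν) := by
  have := integral_mul_condOn (ν := ν) hg hf S
  rw [condOn_of_dependsOn hfS] at this
  rw [← this]
  simp only [condOn_eq_integral hgT h, integral_mul_const]

/-- Self-adjointness moves both conditional expectations onto `g`, where they agree because `g`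
ignores the coordinate `k`. This is the orthogonality behind every martingale argument below; no
filtration is needed, as `g` may use all other coordinates. -/
theorem integral_mul_condOn_sub (hf : BddMeas f) (hg : BddMeas g) {k : ι}
    (hgk : DependsOn g {k}ᶜ) :
    ∫ e, g e * (condOn ν (insert k S) f e - condOn ν S f e) ∂(iid ι ν) = 0 := by
  simp only [mul_sub]
  rw [integral_sub ((hg.mul (condOn_bddMeas _ hf)).integrable _)
    ((hg.mul (condOn_bddMeas _ hf)).integrable _), integral_mul_condOn hf hg,
    integral_mul_condOn hf hg, condOn_insert_of_dependsOn hgk, sub_self]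

open Classical in
/-- Revealing the coordinate `k` changes the conditional expectation by at most the effect of
replacing this coordinate by an independent copy. -/
theorem eLpNorm_condOn_sub_le (hf : BddMeas f) {k : ι} (hk : k ∉ S) {a : ℝ} (ha : 1 ≤ a) :
    eLpNorm (fun e => condOn ν (insert k S) f e - condOn ν S f e) (ENNReal.ofReal a) (iid ι ν)
      ≤ eLpNorm (fun e : (ι → E) × (ι → E) => f e.1 - f (Function.update e.1 k (e.2 k)))
        (ENNReal.ofReal a) ((iid ι ν).prod (iid ι ν)) := by
  generalize hS' : insert k S = S'
  have ha0 : 0 < a := by linarith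
  have hne : ENNReal.ofReal a ≠ 0 := by simpa using ha0
  have hm1 := hf.comp (measurePreserving_piecewise ν S').measurable
  have hm2 := hf.comp (measurePreserving_piecewise ν S).measurable
  have hswap := measurePreserving_swap (E := E) ν S'
  have hupd : Measurable fun e : (ι → E) × (ι → E) => Function.update e.1 k (e.2 k) := by
    refine measurable_pi_iff.2 fun i => ?_
    by_cases h : i = k
    · subst h; simp only [Function.update_self]; fun_prop
    · simp only [Function.update_of_ne h]; fun_prop
  have hm3 : BddMeas fun e : (ι → E) × (ι → E) => f e.1 - f (Function.update e.1 k (e.2 k)) :=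
    (hf.comp measurable_fst).sub (hf.comp hupd)
  -- In swapped variables the resampling of `k` becomes the passage from `S'.piecewise` to
  -- `S.piecewise`, so both conditional expectations integrate over the same second variable.
  rw [← eLpNorm_comp_measurePreserving hm3.meas.aestronglyMeasurable hswap]
  have heq : ∀ e : (ι → E) × (ι → E),
      ((fun e : (ι → E) × (ι → E) => f e.1 - f (Function.update e.1 k (e.2 k))) ∘
        fun e => (S'.piecewise e.1 e.2, S'.piecewise e.2 e.1)) e
      = f (S'.piecewise e.1 e.2) - f (S.piecewise e.1 e.2) := by
    intro e
    simp only [Function.comp]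
    congr 2
    ext i
    by_cases h : i = k
    · subst h; simp [hk, ← hS']
    · by_cases hi : i ∈ S <;> simp [h, hi, ← hS']
  rw [funext heq]
  rw [eLpNorm_eq_lintegral_rpow_enorm_toReal hne ENNReal.ofReal_ne_top,
    eLpNorm_eq_lintegral_rpow_enorm_toReal hne ENNReal.ofReal_ne_top,
    ENNReal.toReal_ofReal ha0.le]
  gcongr
  rw [lintegral_prod _ (by
    exact ((hm1.sub hm2).meas.enorm.pow_const a).aemeasurable)]
  refine lintegral_mono fun e => ?_
  have hb : BddMeas fun e' => f (S'.piecewise e e') - f (S.piecewise e e') :=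
    (hm1.sub hm2).comp (φ := fun e' => (e, e')) (by fun_prop)
  have h1 : condOn ν S' f e - condOn ν S f e
      = ∫ e', (f (S'.piecewise e e') - f (S.piecewise e e')) ∂(iid ι ν) := by
    rw [integral_sub]
    · rfl
    · exact (hm1.comp (φ := fun e' => (e, e')) (by fun_prop)).integrable _
    · exact (hm2.comp (φ := fun e' => (e, e')) (by fun_prop)).integrable _
  rw [h1]
  -- Jensen's inequality in the second variable, with the first one fixed.
  refine (ENNReal.rpow_le_rpow (enorm_integral_le_lintegral_enorm _) ha0.le).trans ?_
  have h2 := eLpNorm_le_eLpNorm_of_exponent_le (μ := iid ι ν) (p := 1) (q := ENNReal.ofReal a)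
    (by simpa using ha) hb.meas.aestronglyMeasurable
  rw [eLpNorm_one_eq_lintegral_enorm,
    eLpNorm_eq_lintegral_rpow_enorm_toReal hne ENNReal.ofReal_ne_top,
    ENNReal.toReal_ofReal ha0.le] at h2
  refine (ENNReal.rpow_le_rpow h2 ha0.le).trans ?_
  rw [← ENNReal.rpow_mul, one_div, inv_mul_cancel₀ ha0.ne', ENNReal.rpow_one]

end IID

/-! ### Moment inequalities -/

theorem exp_sub_one_le_mul_exp (v : ℝ) : Real.exp v - 1 ≤ v * Real.exp v := by
  have h := Real.add_one_le_exp (-v)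
  have h2 := mul_le_mul_of_nonneg_left h (Real.exp_pos v).le
  rw [← Real.exp_add, add_neg_cancel, Real.exp_zero] at h2
  nlinarith

theorem exp_le_one_add_add_sq {v w : ℝ} (hv : v ≤ w) (hw : 0 ≤ w) :
    Real.exp v ≤ 1 + v + v ^ 2 * Real.exp w := by
  have h1 := exp_sub_one_le_mul_exp v
  have hw1 : 1 ≤ Real.exp w := Real.one_le_exp hw
  rcases le_total 0 v with h | h
  · have h2 : v * (Real.exp v - 1) ≤ v * (v * Real.exp v) := mul_le_mul_of_nonneg_left h1 h
    have h3 : v ^ 2 * Real.exp v ≤ v ^ 2 * Real.exp w :=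
      mul_le_mul_of_nonneg_left (Real.exp_le_exp.2 hv) (sq_nonneg v)
    nlinarith
  · have h2 : v * (Real.exp v - 1) ≤ v * v := by
      apply mul_le_mul_of_nonpos_left _ h
      linarith [Real.add_one_le_exp v]
    nlinarith [sq_nonneg v]

/-- The constant of `abs_add_rpow_le`. -/
def taylorConst (Q : ℝ) : ℝ := 2 ^ Q + Q + Q ^ 2 * Real.exp Q

theorem one_le_taylorConst {Q : ℝ} (hQ : 2 ≤ Q) : 1 ≤ taylorConst Q := by
  unfold taylorConst
  have : 0 ≤ Q ^ 2 * Real.exp Q := by positivity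
  have : (0 : ℝ) < 2 ^ Q := by positivity
  linarith

/-- For `|z| ≤ 1` one has `(1 + z)^Q ≤ exp (Q z)`, and the exponential is expanded to second order.
For `|z| > 1` every term is dominated by `|z|^Q`. -/
theorem abs_one_add_rpow_le {Q : ℝ} (hQ : 2 ≤ Q) (z : ℝ) :
    |1 + z| ^ Q ≤ 1 + Q * z + taylorConst Q * (z ^ 2 + |z| ^ Q) := by
  have h2 : (0 : ℝ) < 2 ^ Q := by positivity
  have he : 0 < Q ^ 2 * Real.exp Q := by positivity
  have hzQ : 0 ≤ |z| ^ Q := by positivity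
  unfold taylorConst
  rcases le_or_gt |z| 1 with h | h
  · have hz := abs_le.1 h
    have h0 : 0 ≤ 1 + z := by linarith
    rw [abs_of_nonneg h0]
    have h1 : (1 + z) ^ Q ≤ Real.exp (Q * z) := by
      rw [mul_comm, Real.exp_mul]
      exact Real.rpow_le_rpow h0 (by linarith [Real.add_one_le_exp z]) (by linarith)
    have h3 := exp_le_one_add_add_sq (v := Q * z) (w := Q) (by nlinarith) (by linarith)
    nlinarith [mul_nonneg (add_pos h2 (by linarith : 0 < Q)).le (add_nonneg (sq_nonneg z) hzQ),
      mul_nonneg he.le hzQ]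
  · have h1 : |1 + z| ≤ 2 * |z| := by
      have := abs_add_le 1 z
      simp at this
      linarith
    have h3 : |1 + z| ^ Q ≤ 2 ^ Q * |z| ^ Q := by
      rw [← Real.mul_rpow (by norm_num) (abs_nonneg z)]
      exact Real.rpow_le_rpow (abs_nonneg _) h1 (by linarith)
    have h4 : |z| ≤ |z| ^ Q := by
      conv_lhs => rw [← Real.rpow_one |z|]
      exact Real.rpow_le_rpow_of_exponent_le h.le (by linarith)
    have h5 : -|z| ≤ z := neg_abs_le z
    have h6 : 0 ≤ (2 ^ Q + Q + Q ^ 2 * Real.exp Q) * z ^ 2 := by positivity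
    have h7 : 0 ≤ Q * z + Q * |z| ^ Q := by nlinarith
    nlinarith [mul_nonneg he.le hzQ]

/-- Homogeneity reduces this to `a = 1`, with `a = 0` treated apart. The linear term is kept exactly
because it integrates to zero against a martingale difference. -/
theorem abs_add_rpow_le {Q : ℝ} (hQ : 2 ≤ Q) (a d : ℝ) :
    |a + d| ^ Q ≤ |a| ^ Q + Q * (a * |a| ^ (Q - 2) * d)
      + taylorConst Q * (|a| ^ (Q - 2) * d ^ 2 + |d| ^ Q) := by
  have hC := one_le_taylorConst hQ
  rcases eq_or_ne a 0 with rfl | ha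
  · have h1 : (0 : ℝ) ≤ |(0 : ℝ)| ^ (Q - 2) * d ^ 2 := by positivity
    have h2 : 0 ≤ |d| ^ Q := by positivity
    simp only [zero_add, zero_mul, mul_zero, add_zero]
    have : 0 ≤ |(0 : ℝ)| ^ Q := by positivity
    nlinarith
  · have ha' : 0 < |a| := abs_pos.2 ha
    obtain ⟨z, rfl⟩ : ∃ z, d = a * z := ⟨d / a, by field_simp⟩
    have h := mul_le_mul_of_nonneg_left (abs_one_add_rpow_le hQ z) (Real.rpow_nonneg ha'.le Q)
    have e0 : |a| ^ Q = |a| ^ (Q - 2) * a ^ 2 := by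
      rw [← sq_abs a, ← Real.rpow_natCast, ← Real.rpow_add ha']; norm_num
    have e1 : |a + a * z| ^ Q = |a| ^ Q * |1 + z| ^ Q := by
      rw [← Real.mul_rpow ha'.le (abs_nonneg _), ← abs_mul]; ring_nf
    have e2 : |a * z| ^ Q = |a| ^ Q * |z| ^ Q := by
      rw [abs_mul, Real.mul_rpow ha'.le (abs_nonneg _)]
    rw [e1, e2]
    refine h.trans (le_of_eq ?_)
    have e3 : |a| ^ Q * z ^ 2 = |a| ^ (Q - 2) * (a * z) ^ 2 := by rw [e0]; ring
    have e4 : |a| ^ Q * z = a * |a| ^ (Q - 2) * (a * z) := by rw [e0]; ring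
    rw [← e3, ← e4]
    ring

theorem rpow_mul_sq_le {Q x y : ℝ} (hQ : 2 ≤ Q) (hx : 0 ≤ x) (hy : 0 ≤ y) :
    x ^ (Q - 2) * y ^ 2 ≤ x ^ Q + y ^ Q := by
  have e : ∀ z : ℝ, 0 ≤ z → z ^ (Q - 2) * z ^ 2 = z ^ Q := by
    intro z hz
    rw [← Real.rpow_natCast, ← Real.rpow_add_of_nonneg hz (by linarith) (by positivity)]
    norm_num
  rcases le_total x y with h | h
  · calc x ^ (Q - 2) * y ^ 2 ≤ y ^ (Q - 2) * y ^ 2 := by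
          gcongr
      _ = y ^ Q := e y hy
      _ ≤ _ := by linarith [Real.rpow_nonneg hx Q]
  · calc x ^ (Q - 2) * y ^ 2 ≤ x ^ (Q - 2) * x ^ 2 := by gcongr
      _ = x ^ Q := e x hx
      _ ≤ _ := by linarith [Real.rpow_nonneg hy Q]

section Moments

variable {Ω : Type*} [MeasurableSpace Ω] {μ : Measure Ω}

theorem eLpNorm_le_ofReal_iff [IsFiniteMeasure μ] {f : Ω → ℝ} (hf : BddMeas f) {Q B : ℝ}
    (hQ : 0 < Q) (hB : 0 ≤ B) :
    eLpNorm f (ENNReal.ofReal Q) μ ≤ ENNReal.ofReal B ↔ ∫ ω, |f ω| ^ Q ∂μ ≤ B ^ Q := by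
  have hne : ENNReal.ofReal Q ≠ 0 := by simpa using hQ
  rw [eLpNorm_eq_lintegral_rpow_enorm_toReal hne ENNReal.ofReal_ne_top,
    ENNReal.toReal_ofReal hQ.le]
  have h1 : ∫⁻ ω, ‖f ω‖ₑ ^ Q ∂μ = ENNReal.ofReal (∫ ω, |f ω| ^ Q ∂μ) := by
    rw [ofReal_integral_eq_lintegral_ofReal ((hf.rpow_abs hQ.le).integrable _)
      (ae_of_all _ fun ω => Real.rpow_nonneg (abs_nonneg _) _)]
    congr with ω
    rw [Real.enorm_eq_ofReal_abs, ENNReal.ofReal_rpow_of_nonneg (abs_nonneg _) hQ.le]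
  rw [h1, one_div, ENNReal.rpow_inv_le_iff hQ, ENNReal.ofReal_rpow_of_nonneg hB hQ.le,
    ENNReal.ofReal_le_ofReal_iff (Real.rpow_nonneg hB Q)]

/-- A Burkholder type inequality for bounded martingale differences. -/
theorem integral_abs_sum_rpow_le [IsProbabilityMeasure μ] {Q β : ℝ} (hQ : 2 ≤ Q) (hβ : 0 < β)
    {D : ℕ → Ω → ℝ} (hD : ∀ k, BddMeas (D k))
    (horth : ∀ k, ∀ φ : ℝ → ℝ, Continuous φ →
      ∫ ω, φ (∑ i ∈ Finset.range k, D i ω) * D k ω ∂μ = 0)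
    (hm : ∀ k, ∫ ω, |D k ω| ^ Q ∂μ ≤ β ^ Q) (n : ℕ) :
    ∫ ω, |∑ i ∈ Finset.range n, D i ω| ^ Q ∂μ ≤ (3 * taylorConst Q * n * β ^ 2) ^ (Q / 2) := by
  have hC := one_le_taylorConst hQ
  have hβQ : (β ^ 2) ^ (Q / 2) = β ^ Q := by
    rw [← Real.rpow_natCast, ← Real.rpow_mul hβ.le]; congr 1; push_cast; ring
  induction n with
  | zero =>
    have : (0 : ℝ) ^ Q = 0 := Real.zero_rpow (by linarith)
    simp [this]
    positivity
  | succ n ih =>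
    rcases Nat.eq_zero_or_pos n with rfl | hn
    · simp only [Finset.sum_range_succ, Finset.sum_range_zero, zero_add]
      refine (hm 0).trans ?_
      rw [← hβQ]
      apply Real.rpow_le_rpow (by positivity) _ (by linarith)
      push_cast
      nlinarith [sq_nonneg β]
    set S : Ω → ℝ := fun ω => ∑ i ∈ Finset.range n, D i ω with hS
    have hSb : BddMeas S := BddMeas.sum _ fun i _ => hD i
    -- `V` is the bound for the first `n` terms before the power `Q / 2`; its root `s` is the
    -- natural scale of the partial sum `S`.
    set V : ℝ := 3 * taylorConst Q * n * β ^ 2 with hV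
    have hn1 : (1 : ℝ) ≤ n := by exact_mod_cast hn
    have hVβ : β ^ 2 ≤ V := by
      rw [hV]
      nlinarith [sq_nonneg β, mul_nonneg (by linarith : 0 ≤ taylorConst Q - 1)
        (by linarith : (0 : ℝ) ≤ n)]
    have hVpos : 0 < V := lt_of_lt_of_le (by positivity) hVβ
    set s : ℝ := Real.sqrt V with hs
    have hspos : 0 < s := Real.sqrt_pos.2 hVpos
    have hsQ : s ^ Q = V ^ (Q / 2) := by
      rw [hs, Real.sqrt_eq_rpow, ← Real.rpow_mul hVpos.le]; congr 1; ring
    have hpt : ∀ ω, |∑ i ∈ Finset.range (n + 1), D i ω| ^ Q ≤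
        |S ω| ^ Q + Q * (S ω * |S ω| ^ (Q - 2) * D n ω) + taylorConst Q *
          (s ^ (Q - 2) * β ^ 2 * (|S ω| ^ Q / s ^ Q + |D n ω| ^ Q / β ^ Q) + |D n ω| ^ Q) := by
      intro ω
      rw [Finset.sum_range_succ]
      refine (abs_add_rpow_le hQ _ _).trans ?_
      have hgoal : |S ω| ^ (Q - 2) * D n ω ^ 2 ≤
          s ^ (Q - 2) * β ^ 2 * (|S ω| ^ Q / s ^ Q + |D n ω| ^ Q / β ^ Q) := ?_
      · have := mul_le_mul_of_nonneg_left hgoal (by linarith : 0 ≤ taylorConst Q)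
        simp only [hS] at this ⊢
        linarith
      -- Young's inequality after scaling by `s` and `β`: both resulting moments are then at most
      -- one, by the induction hypothesis and by `hm`.
      have := rpow_mul_sq_le hQ (x := |S ω| / s) (y := |D n ω| / β) (by positivity) (by positivity)
      rw [Real.div_rpow (abs_nonneg _) hspos.le, Real.div_rpow (abs_nonneg _) hspos.le,
        Real.div_rpow (abs_nonneg _) hβ.le] at this
      have h2 := mul_le_mul_of_nonneg_left this (by positivity : 0 ≤ s ^ (Q - 2) * β ^ 2)
      refine le_trans (le_of_eq ?_) h2
      have : s ^ (Q - 2) ≠ 0 := by positivity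
      rw [div_pow, sq_abs]
      field_simp
    have i1 : Integrable (fun ω => |S ω| ^ Q) μ := (hSb.rpow_abs (by linarith)).integrable _
    have i2 : Integrable (fun ω => |D n ω| ^ Q) μ := ((hD n).rpow_abs (by linarith)).integrable _
    have hφ : Continuous fun x : ℝ => x * |x| ^ (Q - 2) :=
      continuous_id.mul (continuous_abs.rpow_const fun _ => Or.inr (by linarith))
    have i3 : Integrable (fun ω => S ω * |S ω| ^ (Q - 2) * D n ω) μ :=
      ((hSb.continuous_comp hφ).mul (hD n)).integrable _
    have i4 : Integrable (fun ω => |S ω| ^ Q / s ^ Q + |D n ω| ^ Q / β ^ Q) μ :=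
      (i1.div_const _).add (i2.div_const _)
    have i5 : Integrable (fun ω => s ^ (Q - 2) * β ^ 2 *
        (|S ω| ^ Q / s ^ Q + |D n ω| ^ Q / β ^ Q)) μ := i4.const_mul _
    have i6 : Integrable (fun ω => |S ω| ^ Q + Q * (S ω * |S ω| ^ (Q - 2) * D n ω)) μ :=
      i1.add (i3.const_mul Q)
    have i7 : Integrable (fun ω => s ^ (Q - 2) * β ^ 2 *
        (|S ω| ^ Q / s ^ Q + |D n ω| ^ Q / β ^ Q) + |D n ω| ^ Q) μ := i5.add i2
    refine (integral_mono
      (((BddMeas.sum (Finset.range (n + 1)) fun i _ => hD i).rpow_abs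
        (by linarith : 0 ≤ Q)).integrable μ) (i6.add (i7.const_mul (taylorConst Q))) hpt).trans ?_
    rw [integral_add' i6 (i7.const_mul (taylorConst Q)), integral_add i1 (i3.const_mul Q),
      integral_const_mul, integral_const_mul,
      integral_add i5 i2, integral_const_mul, integral_add (i1.div_const _) (i2.div_const _),
      integral_div, integral_div, horth n _ hφ]
    have b1 : (∫ ω, |S ω| ^ Q ∂μ) / s ^ Q ≤ 1 := by
      rw [div_le_one (by positivity), hsQ]; exact ih
    have b2 : (∫ ω, |D n ω| ^ Q ∂μ) / β ^ Q ≤ 1 := by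
      rw [div_le_one (by positivity)]; exact hm n
    have e1 : s ^ (Q - 2) = V ^ (Q / 2 - 1) := by
      rw [hs, Real.sqrt_eq_rpow, ← Real.rpow_mul hVpos.le]; congr 1; ring
    have e2 : β ^ Q ≤ V ^ (Q / 2 - 1) * β ^ 2 := by
      rw [← hβQ]
      calc (β ^ 2) ^ (Q / 2) = (β ^ 2) ^ (Q / 2 - 1) * β ^ 2 := by
            rw [Real.rpow_sub_one (by positivity)]; field_simp
        _ ≤ _ := by
            gcongr
            linarith
    have b3 : s ^ (Q - 2) * β ^ 2 * ((∫ ω, |S ω| ^ Q ∂μ) / s ^ Q + (∫ ω, |D n ω| ^ Q ∂μ) / β ^ Q)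
        + ∫ ω, |D n ω| ^ Q ∂μ ≤ 3 * (V ^ (Q / 2 - 1) * β ^ 2) := by
      have h1 : s ^ (Q - 2) * β ^ 2 *
          ((∫ ω, |S ω| ^ Q ∂μ) / s ^ Q + (∫ ω, |D n ω| ^ Q ∂μ) / β ^ Q)
          ≤ s ^ (Q - 2) * β ^ 2 * 2 := by
        gcongr
        linarith
      rw [e1] at h1
      rw [e1]
      linarith [hm n]
    have b4 : V ^ (Q / 2) + 3 * taylorConst Q * (V ^ (Q / 2 - 1) * β ^ 2) ≤
        (3 * taylorConst Q * ↑(n + 1) * β ^ 2) ^ (Q / 2) := by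
      have hx : 3 * taylorConst Q * ↑(n + 1) * β ^ 2
          = V * (1 + 3 * taylorConst Q * β ^ 2 / V) := by
        rw [mul_add, mul_div_cancel₀ _ hVpos.ne', hV]
        push_cast
        ring
      -- Bernoulli's inequality with exponent `Q / 2 ≥ 1` closes the induction.
      have hb := one_add_mul_self_le_rpow_one_add (s := 3 * taylorConst Q * β ^ 2 / V)
        (by have : 0 ≤ 3 * taylorConst Q * β ^ 2 / V := by positivity
            linarith) (p := Q / 2) (by linarith)
      rw [hx, Real.mul_rpow hVpos.le (by positivity)]
      have h2 := mul_le_mul_of_nonneg_left hb (Real.rpow_nonneg hVpos.le (Q / 2))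
      refine le_trans ?_ h2
      rw [Real.rpow_sub_one hVpos.ne']
      have h3 : 0 ≤ (Q / 2 - 1) * (V ^ (Q / 2) * (3 * taylorConst Q * β ^ 2 / V)) := by
        have : 0 ≤ Q / 2 - 1 := by linarith
        positivity
      have h4 : 3 * taylorConst Q * (V ^ (Q / 2) / V * β ^ 2)
        = V ^ (Q / 2) * (3 * taylorConst Q * β ^ 2 / V) := by ring
      rw [h4]
      nlinarith
    refine le_trans ?_ b4
    have h5 := mul_le_mul_of_nonneg_left b3 (by linarith : 0 ≤ taylorConst Q)
    linarith

theorem eLpNorm_sum_le_of_orth [IsProbabilityMeasure μ] {Q β : ℝ} (hQ : 2 ≤ Q) (hβ : 0 < β)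
    {D : ℕ → Ω → ℝ} (hD : ∀ k, BddMeas (D k))
    (horth : ∀ k, ∀ φ : ℝ → ℝ, Continuous φ →
      ∫ ω, φ (∑ i ∈ Finset.range k, D i ω) * D k ω ∂μ = 0)
    (hm : ∀ k, eLpNorm (D k) (ENNReal.ofReal Q) μ ≤ ENNReal.ofReal β) (n : ℕ) :
    eLpNorm (fun ω => ∑ i ∈ Finset.range n, D i ω) (ENNReal.ofReal Q) μ
      ≤ ENNReal.ofReal (Real.sqrt (3 * taylorConst Q) * Real.sqrt n * β) := by
  have hC := one_le_taylorConst hQ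
  rw [eLpNorm_le_ofReal_iff (BddMeas.sum _ fun i _ => hD i) (by linarith) (by positivity)]
  refine (integral_abs_sum_rpow_le hQ hβ hD horth
    (fun k => (eLpNorm_le_ofReal_iff (hD k) (by linarith) hβ.le).1 (hm k)) n).trans (le_of_eq ?_)
  have : 3 * taylorConst Q * n * β ^ 2
      = (Real.sqrt (3 * taylorConst Q) * Real.sqrt n * β) ^ 2 := by
    rw [mul_pow, mul_pow, Real.sq_sqrt (by positivity), Real.sq_sqrt (by positivity)]
  rw [this, ← Real.rpow_natCast, ← Real.rpow_mul (by positivity)]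
  congr 1
  push_cast
  ring

/-- A majorant of the partial sums of `2 ^ l` consecutive terms of `f`, starting at `s`. -/
def chainMax (f : ℤ → Ω → ℝ) : ℕ → ℤ → Ω → ℝ
  | 0, s, ω => |f s ω|
  | l + 1, s, ω => |∑ i ∈ Finset.range (2 ^ l), f (s + i) ω|
      + max (chainMax f l s ω) (chainMax f l (s + 2 ^ l) ω)

theorem chainMax_nonneg (f : ℤ → Ω → ℝ) (l : ℕ) (s : ℤ) (ω : Ω) : 0 ≤ chainMax f l s ω := by
  induction l generalizing s with
  | zero => exact abs_nonneg _
  | succ l ih => exact add_nonneg (abs_nonneg _) (le_max_of_le_left (ih s))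

/-- A prefix either stays in the first half, or is the whole first half followed by a prefix of the
second. -/
theorem abs_sum_le_chainMax (f : ℤ → Ω → ℝ) (l : ℕ) (s : ℤ) (ω : Ω) {k : ℕ} (hk : k ≤ 2 ^ l) :
    |∑ i ∈ Finset.range k, f (s + i) ω| ≤ chainMax f l s ω := by
  induction l generalizing s k with
  | zero =>
    have hk' : k ≤ 1 := by simpa using hk
    interval_cases k
    · simpa using chainMax_nonneg f 0 s ω
    · simp [chainMax]
  | succ l ih =>
    rcases le_total k (2 ^ l) with h | h
    · exact (ih s h).trans ((le_max_left _ _).trans (le_add_of_nonneg_left (abs_nonneg _)))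
    · obtain ⟨j, rfl⟩ := Nat.exists_eq_add_of_le h
      rw [Finset.sum_range_add]
      refine (abs_add_le _ _).trans (add_le_add le_rfl (le_trans ?_ (le_max_right _ _)))
      have := ih (s + 2 ^ l) (k := j) (by rw [pow_succ] at hk; omega)
      refine le_trans (le_of_eq ?_) this
      push_cast
      simp only [add_assoc]

theorem chainMax_bddMeas {f : ℤ → Ω → ℝ} (hf : ∀ i, BddMeas (f i)) (l : ℕ) (s : ℤ) :
    BddMeas (chainMax f l s) := by
  induction l generalizing s with
  | zero => exact (hf s).abs
  | succ l ih =>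
    exact ((BddMeas.sum _ fun i _ => hf _).abs).add ((ih s).max (ih _))

/-- The constant of `eLpNorm_chainMax_le`. -/
def chainConst (Q : ℝ) : ℝ := 1 + 1 / (Real.sqrt 2 - 2 ^ (1 / Q))

theorem chainConst_gap {Q : ℝ} (hQ : 2 < Q) : 0 < Real.sqrt 2 - 2 ^ (1 / Q) := by
  rw [Real.sqrt_eq_rpow, sub_pos]
  exact Real.rpow_lt_rpow_of_exponent_lt (by norm_num)
    (one_div_lt_one_div_of_lt (by norm_num) hQ)

theorem one_le_chainConst {Q : ℝ} (hQ : 2 < Q) : 1 ≤ chainConst Q := by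
  have := chainConst_gap hQ
  unfold chainConst
  have : 0 ≤ 1 / (Real.sqrt 2 - 2 ^ (1 / Q)) := by positivity
  linarith

/-- The `Q`-th power of a maximum is at most the sum of the `Q`-th powers, hence the factor
`2^(1/Q)`. -/
theorem eLpNorm_max_le [IsFiniteMeasure μ] {f g : Ω → ℝ} (hf : BddMeas f) (hg : BddMeas g)
    {Q B : ℝ} (hQ : 0 < Q) (hB : 0 ≤ B)
    (h1 : eLpNorm f (ENNReal.ofReal Q) μ ≤ ENNReal.ofReal B)
    (h2 : eLpNorm g (ENNReal.ofReal Q) μ ≤ ENNReal.ofReal B) :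
    eLpNorm (fun ω => max (f ω) (g ω)) (ENNReal.ofReal Q) μ
      ≤ ENNReal.ofReal (2 ^ (1 / Q) * B) := by
  rw [eLpNorm_le_ofReal_iff hf hQ hB] at h1
  rw [eLpNorm_le_ofReal_iff hg hQ hB] at h2
  rw [eLpNorm_le_ofReal_iff (hf.max hg) hQ (by positivity), Real.mul_rpow (by positivity) hB,
    ← Real.rpow_mul (by norm_num), one_div_mul_cancel hQ.ne', Real.rpow_one, two_mul]
  have i1 := (hf.rpow_abs hQ.le).integrable μ
  have i2 := (hg.rpow_abs hQ.le).integrable μ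
  refine le_trans (integral_mono (((hf.max hg).rpow_abs hQ.le).integrable μ) (i1.add i2) ?_) ?_
  · intro ω
    simp only [Pi.add_apply]
    have a1 : 0 ≤ |f ω| ^ Q := by positivity
    have a2 : 0 ≤ |g ω| ^ Q := by positivity
    rcases max_choice (f ω) (g ω) with h | h <;> rw [h] <;> linarith
  · simp only [Pi.add_apply]
    rw [integral_add i1 i2]
    linarith

/-- Each doubling adds the norm `√2^l β` of a half and multiplies by `2^(1/Q)` for the maximum. As
`Q > 2`, this factor is below `√2`, so the recursion stays of order `√2^l` and no logarithm is lost.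
-/
theorem eLpNorm_chainMax_le [IsProbabilityMeasure μ] {Q β : ℝ} (hQ : 2 < Q) (hβ : 0 ≤ β)
    {f : ℤ → Ω → ℝ} (hf : ∀ i, BddMeas (f i))
    (hm : ∀ s : ℤ, ∀ k : ℕ, eLpNorm (fun ω => ∑ i ∈ Finset.range k, f (s + i) ω)
      (ENNReal.ofReal Q) μ ≤ ENNReal.ofReal (Real.sqrt k * β)) (l : ℕ) (s : ℤ) :
    eLpNorm (chainMax f l s) (ENNReal.ofReal Q) μ
      ≤ ENNReal.ofReal (chainConst Q * (Real.sqrt 2 ^ l * β)) := by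
  have hc := one_le_chainConst hQ
  have hgap := chainConst_gap hQ
  induction l generalizing s with
  | zero =>
    have h := hm s 1
    simp only [Finset.sum_range_one, Nat.cast_zero, add_zero, Nat.cast_one, Real.sqrt_one,
      one_mul] at h
    have e : eLpNorm (chainMax f 0 s) (ENNReal.ofReal Q) μ = eLpNorm (f s) (ENNReal.ofReal Q) μ :=
      eLpNorm_congr_norm_ae (ae_of_all _ fun ω => by simp [chainMax])
    rw [e]
    refine h.trans (ENNReal.ofReal_le_ofReal ?_)
    simp only [pow_zero, one_mul]
    nlinarith
  | succ l ih =>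
    have hb := fun s => chainMax_bddMeas hf l s
    have hsum : BddMeas fun ω => ∑ i ∈ Finset.range (2 ^ l), f (s + i) ω :=
      BddMeas.sum _ fun i _ => hf _
    have h1 := eLpNorm_add_le (μ := μ) (p := ENNReal.ofReal Q) hsum.abs.meas.aestronglyMeasurable
      ((hb s).max (hb (s + 2 ^ l))).meas.aestronglyMeasurable
      (by rw [← ENNReal.ofReal_one]; exact ENNReal.ofReal_le_ofReal (by linarith))
    refine le_trans h1 ?_
    have h2 := eLpNorm_max_le (hb s) (hb (s + 2 ^ l)) (by linarith) (by positivity) (ih s)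
      (ih (s + 2 ^ l))
    have h3 : eLpNorm (fun ω => |∑ i ∈ Finset.range (2 ^ l), f (s + i) ω|) (ENNReal.ofReal Q) μ
        ≤ ENNReal.ofReal (Real.sqrt 2 ^ l * β) := by
      have e := eLpNorm_congr_norm_ae (μ := μ) (p := ENNReal.ofReal Q)
        (f := fun ω => |∑ i ∈ Finset.range (2 ^ l), f (s + i) ω|)
        (g := fun ω => ∑ i ∈ Finset.range (2 ^ l), f (s + i) ω) (ae_of_all _ fun ω => by simp)
      rw [e]
      refine (hm s (2 ^ l)).trans (le_of_eq ?_)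
      congr 2
      push_cast
      rw [Real.sqrt_eq_rpow, Real.sqrt_eq_rpow, ← Real.rpow_natCast, ← Real.rpow_natCast,
        ← Real.rpow_mul (by norm_num), ← Real.rpow_mul (by norm_num), mul_comm]
    refine (add_le_add h3 h2).trans ?_
    rw [← ENNReal.ofReal_add (by positivity) (by positivity)]
    refine ENNReal.ofReal_le_ofReal ?_
    have key : 1 + 2 ^ (1 / Q) * chainConst Q ≤ chainConst Q * Real.sqrt 2 := by
      have : (Real.sqrt 2 - 2 ^ (1 / Q)) * chainConst Q
          = (Real.sqrt 2 - 2 ^ (1 / Q)) + 1 := by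
        unfold chainConst
        rw [mul_add, mul_one_div_cancel hgap.ne', mul_one]
      nlinarith
    have := mul_le_mul_of_nonneg_right key (by positivity : 0 ≤ Real.sqrt 2 ^ l * β)
    rw [pow_succ]
    linarith

theorem measure_lt_chain_le [IsProbabilityMeasure μ] {Q B x : ℝ} (hQ : 0 < Q) (hB : 0 ≤ B)
    (hx : 0 < x) {f : Ω → ℝ} (hf : BddMeas f)
    (hm : eLpNorm f (ENNReal.ofReal Q) μ ≤ ENNReal.ofReal B) :
    μ {ω | x ≤ |f ω|} ≤ ENNReal.ofReal (B ^ Q / x ^ Q) := by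
  have hne : ENNReal.ofReal Q ≠ 0 := by simpa using hQ
  have h := mul_meas_ge_le_pow_eLpNorm' μ hne ENNReal.ofReal_ne_top
    hf.meas.aestronglyMeasurable (ENNReal.ofReal x)
  rw [ENNReal.toReal_ofReal hQ.le] at h
  have hs : {ω | ENNReal.ofReal x ≤ ‖f ω‖ₑ} = {ω | x ≤ |f ω|} := by
    ext ω
    simp [Real.enorm_eq_ofReal_abs, ENNReal.ofReal_le_ofReal_iff (abs_nonneg _)]
  rw [hs] at h
  have hxQ : 0 < x ^ Q := by positivity
  rw [ENNReal.ofReal_div_of_pos hxQ, ENNReal.le_div_iff_mul_le (by simp [hxQ]) (by simp), mul_comm,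
    ← ENNReal.ofReal_rpow_of_nonneg hx.le hQ.le, ← ENNReal.ofReal_rpow_of_nonneg hB hQ.le]
  exact h.trans (ENNReal.rpow_le_rpow hm hQ.le)

end Moments

/-! ### A maximal inequality of Fuk–Nagaev type -/

/-- If `h u ≤ Q`, a second order expansion suffices. Beyond `Q / h` the function `exp (h u) / u^Q`
increases, so it is compared with its value at `y`. -/
theorem exp_mul_le_of_le {Q h u y : ℝ} (hQ : 0 < Q) (hh : 0 < h) (hy : 0 < y) (hu : u ≤ y) :
    Real.exp (h * u) ≤ 1 + h * u + (h * u) ^ 2 * Real.exp Q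
      + Real.exp (h * y) * (|u| ^ Q / y ^ Q) := by
  have hpos : 0 ≤ Real.exp (h * y) * (|u| ^ Q / y ^ Q) := by positivity
  rcases le_or_gt (h * u) Q with hc | hc
  · linarith [exp_le_one_add_add_sq hc hQ.le]
  · have hu0 : 0 < u := by
      by_contra hcon
      nlinarith
    have h1 : Real.exp (h * u) ≤ Real.exp (h * y) * (|u| ^ Q / y ^ Q) := by
      rw [abs_of_pos hu0, ← Real.div_rpow hu0.le hy.le, Real.rpow_def_of_pos (by positivity),
        ← Real.exp_add]
      refine Real.exp_le_exp.2 ?_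
      have h2 := Real.log_le_sub_one_of_pos (div_pos hy hu0)
      have h3 : Real.log (u / y) = -Real.log (y / u) := by
        rw [← Real.log_inv, inv_div]
      rw [h3]
      have h4 : y / u - 1 = (y - u) / u := by field_simp
      rw [h4] at h2
      have h5 : Q * Real.log (y / u) ≤ h * (y - u) := by
        calc Q * Real.log (y / u) ≤ (h * u) * Real.log (y / u) := by
              apply mul_le_mul_of_nonneg_right hc.le
              exact Real.log_nonneg (by rw [le_div_iff₀ hu0]; linarith)
          _ ≤ (h * u) * ((y - u) / u) := by
              apply mul_le_mul_of_nonneg_left h2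
              linarith
          _ = h * (y - u) := by field_simp
      nlinarith
    have h6 : 0 ≤ (h * u) ^ 2 * Real.exp Q := by positivity
    nlinarith

section

variable {ι E : Type*} [MeasurableSpace E] {ν : Measure E} [IsProbabilityMeasure ν]

/-- The exponential process `exp (h ∑_{u < n} ζ_u)`, stopped when the sum reaches `x`. -/
def stoppedExp {α : Type*} (ζ : ℕ → α → ℝ) (h x : ℝ) : ℕ → α → ℝ
  | 0, _ => 1
  | n + 1, e => stoppedExp ζ h x n e *
      ({e | ∃ k ≤ n, x ≤ ∑ u ∈ Finset.range k, ζ u e}ᶜ.indicator (fun e => Real.exp (h * ζ n e)) e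
        + {e | ∃ k ≤ n, x ≤ ∑ u ∈ Finset.range k, ζ u e}.indicator (fun _ => 1) e)

theorem measurableSet_crossing {α : Type*} [MeasurableSpace α] {ζ : ℕ → α → ℝ}
    (hζ : ∀ u, Measurable (ζ u)) (x : ℝ) (n : ℕ) :
    MeasurableSet {e | ∃ k ≤ n, x ≤ ∑ u ∈ Finset.range k, ζ u e} := by
  have : {e | ∃ k ≤ n, x ≤ ∑ u ∈ Finset.range k, ζ u e}
      = ⋃ k ∈ Set.Iic n, {e | x ≤ ∑ u ∈ Finset.range k, ζ u e} := by
    ext; simp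
  rw [this]
  refine MeasurableSet.biUnion (Set.to_countable _) fun k _ => ?_
  exact measurableSet_le measurable_const (Finset.measurable_sum _ fun u _ => hζ u)

theorem stoppedExp_bddMeas {α : Type*} [MeasurableSpace α] {ζ : ℕ → α → ℝ}
    (hζ : ∀ u, BddMeas (ζ u)) (h x : ℝ) (n : ℕ) : BddMeas (stoppedExp ζ h x n) := by
  induction n with
  | zero => exact BddMeas.const 1
  | succ n ih =>
    have hA := measurableSet_crossing (fun u => (hζ u).meas) x n
    exact ih.mul (((((BddMeas.const h).mul (hζ n)).continuous_comp
      Real.continuous_exp).indicator hA.compl).add ((BddMeas.const 1).indicator hA))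

theorem stoppedExp_nonneg {α : Type*} (ζ : ℕ → α → ℝ) (h x : ℝ) (n : ℕ) (e : α) :
    0 ≤ stoppedExp ζ h x n e := by
  induction n with
  | zero => exact zero_le_one
  | succ n ih =>
    refine mul_nonneg ih (add_nonneg ?_ ?_) <;> refine Set.indicator_nonneg (fun e _ => ?_) _
    · positivity
    · exact zero_le_one

theorem stoppedExp_congr {α : Type*} {ζ : ℕ → α → ℝ} (h x : ℝ) {n : ℕ} {e e' : α}
    (he : ∀ u < n, ζ u e = ζ u e') : stoppedExp ζ h x n e = stoppedExp ζ h x n e' := by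
  induction n with
  | zero => rfl
  | succ n ih =>
    have h1 : ∀ k ≤ n, ∑ u ∈ Finset.range k, ζ u e = ∑ u ∈ Finset.range k, ζ u e' := fun k hk =>
      Finset.sum_congr rfl fun u hu => he u (by have := Finset.mem_range.1 hu; omega)
    have h2 : (∃ k ≤ n, x ≤ ∑ u ∈ Finset.range k, ζ u e) ↔
        ∃ k ≤ n, x ≤ ∑ u ∈ Finset.range k, ζ u e' := by
      constructor <;> rintro ⟨k, hk, hx⟩ <;> exact ⟨k, hk, by rw [h1 k hk] at *; exact hx⟩
    simp only [stoppedExp, Set.indicator, Set.mem_compl_iff, Set.mem_ofPred_eq]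
    rw [ih fun u hu => he u (by omega), he n (by omega)]
    simp only [h2]

theorem stoppedExp_of_not_crossing {α : Type*} {ζ : ℕ → α → ℝ} (h x : ℝ) {n : ℕ} {e : α}
    (he : ∀ k < n, ∑ u ∈ Finset.range k, ζ u e < x) :
    stoppedExp ζ h x n e = Real.exp (h * ∑ u ∈ Finset.range n, ζ u e) := by
  induction n with
  | zero => simp [stoppedExp]
  | succ n ih =>
    have : ¬ ∃ k ≤ n, x ≤ ∑ u ∈ Finset.range k, ζ u e := by
      rintro ⟨k, hk, hx⟩
      exact absurd hx (not_le.2 (he k (by omega)))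
    simp only [stoppedExp, Set.indicator, Set.mem_compl_iff, Set.mem_ofPred_eq, this]
    rw [ih fun k hk => he k (by omega), Finset.sum_range_succ, mul_add (a := h), Real.exp_add]
    simp

theorem le_stoppedExp_of_crossing {α : Type*} {ζ : ℕ → α → ℝ} {h : ℝ} (hh : 0 ≤ h) (x : ℝ) {n : ℕ}
    {e : α} (he : ∃ k ≤ n, x ≤ ∑ u ∈ Finset.range k, ζ u e) :
    Real.exp (h * x) ≤ stoppedExp ζ h x n e := by
  induction n with
  | zero =>
    obtain ⟨k, hk, hx⟩ := he
    obtain rfl : k = 0 := by omega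
    simp only [Finset.range_zero, Finset.sum_empty] at hx
    simp only [stoppedExp, Real.exp_le_one_iff]
    exact mul_nonpos_of_nonneg_of_nonpos hh hx
  | succ n ih =>
    by_cases hc : ∃ k ≤ n, x ≤ ∑ u ∈ Finset.range k, ζ u e
    · simp only [stoppedExp, Set.indicator, Set.mem_compl_iff, Set.mem_ofPred_eq, hc]
      simpa using ih hc
    · push Not at hc
      rw [stoppedExp_of_not_crossing h x fun k hk => hc k (by omega)]
      obtain ⟨k, hk, hx⟩ := he
      have hkn : k = n + 1 := by
        by_contra hne
        exact absurd hx (not_le.2 (hc k (by omega)))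
      subst hkn
      exact Real.exp_le_exp.2 (mul_le_mul_of_nonneg_left hx hh)

/-- Before a crossing the next factor is independent of the past, with mean at most `exp (g n)`;
after a crossing the factor is one, and `g n ≥ 0`. -/
theorem integral_stoppedExp_le {ζ : ℕ → (ι → E) → ℝ} {S : ℕ → Set ι} (hζ : ∀ u, BddMeas (ζ u))
    (hS : ∀ u, DependsOn (ζ u) (S u)) (hdisj : Pairwise (Function.onFun Disjoint S)) {h : ℝ} (x : ℝ)
    {g : ℕ → ℝ} (hg : ∀ u, 0 ≤ g u)
    (hmgf : ∀ u, ∫ e, Real.exp (h * ζ u e) ∂(iid ι ν) ≤ Real.exp (g u)) (n : ℕ) :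
    ∫ e, stoppedExp ζ h x n e ∂(iid ι ν) ≤ Real.exp (∑ u ∈ Finset.range n, g u) := by
  induction n with
  | zero => simp [stoppedExp]
  | succ n ih =>
    set A : Set (ι → E) := {e | ∃ k ≤ n, x ≤ ∑ u ∈ Finset.range k, ζ u e} with hA
    have mA : MeasurableSet A := measurableSet_crossing (fun u => (hζ u).meas) x n
    have hb := stoppedExp_bddMeas hζ h x n
    have hexp : BddMeas fun e => Real.exp (h * ζ n e) :=
      ((BddMeas.const h).mul (hζ n)).continuous_comp Real.continuous_exp
    have hsplit : ∀ e, stoppedExp ζ h x (n + 1) e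
        = Aᶜ.indicator (stoppedExp ζ h x n) e * Real.exp (h * ζ n e)
          + A.indicator (stoppedExp ζ h x n) e := by
      intro e
      by_cases he : e ∈ A <;> simp [stoppedExp, ← hA, he]
    simp only [hsplit]
    rw [integral_add (((hb.indicator mA.compl).mul hexp).integrable _)
      ((hb.indicator mA).integrable _)]
    have hdep : DependsOn (Aᶜ.indicator (stoppedExp ζ h x n)) (⋃ u ∈ Set.Iio n, S u) := by
      intro e e' hee
      have h1 : ∀ u < n, ζ u e = ζ u e' := fun u hu =>
        hS u fun i hi => hee i (Set.mem_biUnion (show u ∈ Set.Iio n from hu) hi)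
      have h2 : ∀ k ≤ n, ∑ u ∈ Finset.range k, ζ u e = ∑ u ∈ Finset.range k, ζ u e' := fun k hk =>
        Finset.sum_congr rfl fun u hu => h1 u (by have := Finset.mem_range.1 hu; omega)
      have h3 : e ∈ A ↔ e' ∈ A := by
        simp only [hA, Set.mem_ofPred_eq]
        constructor <;> rintro ⟨k, hk, hx⟩ <;> exact ⟨k, hk, by rw [h2 k hk] at *; exact hx⟩
      simp only [Set.indicator, Set.mem_compl_iff, h3, stoppedExp_congr h x h1]
    have hdep2 : DependsOn (fun e => Real.exp (h * ζ n e)) (S n) := fun e e' hee => by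
      simp only [hS n hee]
    have hd : Disjoint (⋃ u ∈ Set.Iio n, S u) (S n) := by
      rw [Set.disjoint_iUnion₂_left]
      exact fun u hu => hdisj (ne_of_lt hu)
    rw [integral_mul_of_dependsOn (hb.indicator mA.compl) hexp hdep hdep2 hd]
    have p1 : 0 ≤ ∫ e, Aᶜ.indicator (stoppedExp ζ h x n) e ∂(iid ι ν) :=
      integral_nonneg fun e => Set.indicator_nonneg (fun e _ => stoppedExp_nonneg ζ h x n e) e
    have p2 : 0 ≤ ∫ e, A.indicator (stoppedExp ζ h x n) e ∂(iid ι ν) :=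
      integral_nonneg fun e => Set.indicator_nonneg (fun e _ => stoppedExp_nonneg ζ h x n e) e
    have hsum : ∫ e, Aᶜ.indicator (stoppedExp ζ h x n) e ∂(iid ι ν)
        + ∫ e, A.indicator (stoppedExp ζ h x n) e ∂(iid ι ν)
        = ∫ e, stoppedExp ζ h x n e ∂(iid ι ν) := by
      rw [← integral_add ((hb.indicator mA.compl).integrable _) ((hb.indicator mA).integrable _)]
      congr with e
      by_cases he : e ∈ A <;> simp [he]
    have hg1 : 1 ≤ Real.exp (g n) := Real.one_le_exp (hg n)
    rw [Finset.sum_range_succ, Real.exp_add]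
    calc _ ≤ (∫ e, Aᶜ.indicator (stoppedExp ζ h x n) e ∂(iid ι ν)) * Real.exp (g n)
          + (∫ e, A.indicator (stoppedExp ζ h x n) e ∂(iid ι ν)) * Real.exp (g n) := by
          gcongr
          · exact hmgf n
          · exact le_mul_of_one_le_right p2 hg1
      _ = (∫ e, stoppedExp ζ h x n e ∂(iid ι ν)) * Real.exp (g n) := by rw [← add_mul, hsum]
      _ ≤ _ := by gcongr

/-- Stopping freezes the exponential at a value of at least `exp (h x)` once the level has been
crossed, so Markov's inequality at the final time controls the whole maximum. -/
theorem measure_crossing_le {ζ : ℕ → (ι → E) → ℝ} {S : ℕ → Set ι} (hζ : ∀ u, BddMeas (ζ u))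
    (hS : ∀ u, DependsOn (ζ u) (S u)) (hdisj : Pairwise (Function.onFun Disjoint S)) {h : ℝ}
    (hh : 0 ≤ h) (x : ℝ) {g : ℕ → ℝ} (hg : ∀ u, 0 ≤ g u)
    (hmgf : ∀ u, ∫ e, Real.exp (h * ζ u e) ∂(iid ι ν) ≤ Real.exp (g u)) (n : ℕ) :
    iid ι ν {e | ∃ k ≤ n, x ≤ ∑ u ∈ Finset.range k, ζ u e}
      ≤ ENNReal.ofReal (Real.exp (-(h * x) + ∑ u ∈ Finset.range n, g u)) := by
  have hb := stoppedExp_bddMeas hζ h x n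
  have hM := mul_meas_ge_le_integral_of_nonneg (μ := iid ι ν)
    (ae_of_all _ (stoppedExp_nonneg ζ h x n)) (hb.integrable _) (Real.exp (h * x))
  have hle := hM.trans (integral_stoppedExp_le (ν := ν) hζ hS hdisj x hg hmgf n)
  have hsub : {e | ∃ k ≤ n, x ≤ ∑ u ∈ Finset.range k, ζ u e}
      ⊆ {e | Real.exp (h * x) ≤ stoppedExp ζ h x n e} :=
    fun e he => le_stoppedExp_of_crossing hh x he
  refine (measure_mono hsub).trans ?_
  rw [← ofReal_measureReal]
  refine ENNReal.ofReal_le_ofReal ?_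
  rw [Real.exp_add, Real.exp_neg, ← div_eq_inv_mul, le_div_iff₀ (Real.exp_pos _), mul_comm]
  exact hle

/-- Fuk–Nagaev inequality for the maximum of the partial sums of independent variables. -/
theorem fuk_nagaev {ξ : ℕ → (ι → E) → ℝ} {S : ℕ → Set ι} (hξ : ∀ u, BddMeas (ξ u))
    (hS : ∀ u, DependsOn (ξ u) (S u)) (hdisj : Pairwise (Function.onFun Disjoint S))
    (hmean : ∀ u, ∫ e, ξ u e ∂(iid ι ν) = 0) {Q x V B : ℝ} (hQ : 2 ≤ Q) (hx : 0 < x)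
    (hV : 0 < V) (hB : 0 < B) (N : ℕ)
    (hvar : ∑ u ∈ Finset.range N, ∫ e, ξ u e ^ 2 ∂(iid ι ν) ≤ V)
    (hmom : ∑ u ∈ Finset.range N, ∫ e, |ξ u e| ^ Q ∂(iid ι ν) ≤ B) :
    iid ι ν {e | ∃ k ≤ N, x ≤ ∑ u ∈ Finset.range k, ξ u e}
      ≤ ENNReal.ofReal (4 * (2 ^ Q * B / x ^ Q)
        + 3 * Real.exp (-(x ^ 2 / (4 * Real.exp Q * V)))) := by
  have hQ0 : 0 < Q := by linarith
  -- The variables are cut at half the target. That some variable exceeds `y` costs at most `b = B /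
  -- y^Q`; if `b ≥ 1`, the claim is trivial.
  set y := x / 2 with hy
  have hy0 : 0 < y := by positivity
  set b := B / y ^ Q with hb
  have hb0 : 0 < b := by positivity
  have hbe : 2 ^ Q * B / x ^ Q = b := by
    rw [hb, hy, Real.div_rpow hx.le (by norm_num)]
    field_simp
  rw [hbe]
  rcases le_or_gt 1 b with hb1 | hb1
  · refine (prob_le_one).trans ?_
    rw [← ENNReal.ofReal_one]
    refine ENNReal.ofReal_le_ofReal ?_
    have := Real.exp_pos (-(x ^ 2 / (4 * Real.exp Q * V)))
    linarith
  -- The first choice keeps the quadratic term below `h x / 2`, the second keeps `exp (h y) b` below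
  -- one. Whichever is active produces the Gaussian or the polynomial bound.
  set h := min (x / (2 * Real.exp Q * V)) (Real.log (1 / b) / y) with hh
  have hlog : 0 < Real.log (1 / b) := Real.log_pos (by rw [lt_div_iff₀ hb0]; linarith)
  have hh0 : 0 < h := lt_min (by positivity) (by positivity)
  let ζ : ℕ → (ι → E) → ℝ := fun u e => min (ξ u e) y
  have hζ : ∀ u, BddMeas (ζ u) := fun u =>
    (hξ u).continuous_comp (φ := fun t => min t y) (by fun_prop)
  have hζS : ∀ u, DependsOn (ζ u) (S u) := fun u e e' hee => by simp only [ζ, hS u hee]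
  have hζabs : ∀ u e, |ζ u e| ≤ |ξ u e| := by
    intro u e
    simp only [ζ]
    rcases le_total (ξ u e) y with h1 | h1
    · rw [min_eq_left h1]
    · rw [min_eq_right h1, abs_of_pos hy0]
      exact h1.trans (le_abs_self _)
  let g : ℕ → ℝ := fun u => h ^ 2 * Real.exp Q * (∫ e, ξ u e ^ 2 ∂(iid ι ν))
    + Real.exp (h * y) / y ^ Q * ∫ e, |ξ u e| ^ Q ∂(iid ι ν)
  have hsq0 : ∀ u, 0 ≤ ∫ e, ξ u e ^ 2 ∂(iid ι ν) := fun u => integral_nonneg fun e => sq_nonneg _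
  have hQi0 : ∀ u, 0 ≤ ∫ e, |ξ u e| ^ Q ∂(iid ι ν) := fun u =>
    integral_nonneg fun e => Real.rpow_nonneg (abs_nonneg _) _
  have hg : ∀ u, 0 ≤ g u := fun u =>
    add_nonneg (mul_nonneg (by positivity) (hsq0 u)) (mul_nonneg (by positivity) (hQi0 u))
  have hmgf : ∀ u, ∫ e, Real.exp (h * ζ u e) ∂(iid ι ν) ≤ Real.exp (g u) := by
    intro u
    have hpt : ∀ e, Real.exp (h * ζ u e) ≤ 1 + h * ξ u e + h ^ 2 * Real.exp Q * ξ u e ^ 2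
        + Real.exp (h * y) / y ^ Q * |ξ u e| ^ Q := by
      intro e
      have h1 := exp_mul_le_of_le hQ0 hh0 hy0 (min_le_right (ξ u e) y)
      refine h1.trans ?_
      have h2 : |min (ξ u e) y| ^ Q ≤ |ξ u e| ^ Q :=
        Real.rpow_le_rpow (abs_nonneg _) (hζabs u e) hQ0.le
      have h3 : min (ξ u e) y ^ 2 ≤ ξ u e ^ 2 := sq_le_sq.2 (hζabs u e)
      have h4 := mul_le_mul_of_nonneg_left h2 (by positivity : 0 ≤ Real.exp (h * y) / y ^ Q)
      have h5 := mul_le_mul_of_nonneg_left h3 (by positivity : 0 ≤ h ^ 2 * Real.exp Q)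
      have h6 : h * min (ξ u e) y ≤ h * ξ u e :=
        mul_le_mul_of_nonneg_left (min_le_left _ _) hh0.le
      have h7 : Real.exp (h * y) * (|min (ξ u e) y| ^ Q / y ^ Q)
          = Real.exp (h * y) / y ^ Q * |min (ξ u e) y| ^ Q := by ring
      rw [h7]
      linarith
    have i0 : Integrable (fun _ : ι → E => (1 : ℝ)) (iid ι ν) := integrable_const 1
    have i1 : Integrable (fun e => h * ξ u e) (iid ι ν) := ((hξ u).integrable _).const_mul h
    have i2 : Integrable (fun e => h ^ 2 * Real.exp Q * ξ u e ^ 2) (iid ι ν) :=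
      (((hξ u).continuous_comp (continuous_pow 2)).integrable _).const_mul _
    have i3 : Integrable (fun e => Real.exp (h * y) / y ^ Q * |ξ u e| ^ Q) (iid ι ν) :=
      (((hξ u).rpow_abs hQ0.le).integrable _).const_mul _
    have i4 : Integrable (fun e => 1 + h * ξ u e) (iid ι ν) := i0.add i1
    have i5 : Integrable (fun e => 1 + h * ξ u e + h ^ 2 * Real.exp Q * ξ u e ^ 2) (iid ι ν) :=
      i4.add i2
    have h1 := integral_mono ((((BddMeas.const h).mul (hζ u)).continuous_comp
      Real.continuous_exp).integrable (iid ι ν)) (i5.add i3) hpt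
    refine h1.trans ?_
    rw [integral_add' i5 i3, integral_add i4 i2, integral_add i0 i1, integral_const_mul,
      integral_const_mul, integral_const_mul, hmean]
    simp only [integral_const, probReal_univ, smul_eq_mul, mul_one, mul_zero, add_zero]
    have := Real.add_one_le_exp (g u)
    simp only [g] at this ⊢
    linarith
  have hcross := measure_crossing_le (ν := ν) hζ hζS hdisj hh0.le x hg hmgf N
  have hsub : {e | ∃ k ≤ N, x ≤ ∑ u ∈ Finset.range k, ξ u e}
      ⊆ {e | ∃ k ≤ N, x ≤ ∑ u ∈ Finset.range k, ζ u e}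
        ∪ ⋃ u ∈ Finset.range N, {e | y ≤ |ξ u e|} := by
    rintro e ⟨k, hk, hxk⟩
    by_cases hall : ∀ u < N, ξ u e ≤ y
    · left
      refine ⟨k, hk, hxk.trans (le_of_eq (Finset.sum_congr rfl fun u hu => ?_))⟩
      have := Finset.mem_range.1 hu
      exact (min_eq_left (hall u (by omega))).symm
    · right
      push Not at hall
      obtain ⟨u, hu, hlt⟩ := hall
      simp only [Finset.mem_range, Set.mem_iUnion, Set.mem_ofPred_eq]
      exact ⟨u, hu, hlt.le.trans (le_abs_self _)⟩
  have hbig : iid ι ν (⋃ u ∈ Finset.range N, {e | y ≤ |ξ u e|}) ≤ ENNReal.ofReal b := by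
    refine (measure_biUnion_finset_le _ _).trans ?_
    have h1 : ∀ u ∈ Finset.range N, iid ι ν {e | y ≤ |ξ u e|}
        ≤ ENNReal.ofReal ((∫ e, |ξ u e| ^ Q ∂(iid ι ν)) / y ^ Q) := by
      intro u _
      have h2 := mul_meas_ge_le_integral_of_nonneg (μ := iid ι ν)
        (f := fun e => |ξ u e| ^ Q) (ae_of_all _ fun e => Real.rpow_nonneg (abs_nonneg _) _)
        (((hξ u).rpow_abs hQ0.le).integrable _) (y ^ Q)
      have h3 : {e | y ≤ |ξ u e|} = {e | y ^ Q ≤ |ξ u e| ^ Q} := by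
        ext e
        exact (Real.rpow_le_rpow_iff hy0.le (abs_nonneg _) hQ0).symm
      rw [h3, ← ofReal_measureReal]
      refine ENNReal.ofReal_le_ofReal ?_
      rw [le_div_iff₀ (by positivity), mul_comm]
      exact h2
    refine (Finset.sum_le_sum h1).trans ?_
    rw [← ENNReal.ofReal_sum_of_nonneg fun u _ => div_nonneg (hQi0 u) (by positivity),
      ← Finset.sum_div]
    exact ENNReal.ofReal_le_ofReal (div_le_div_of_nonneg_right hmom (by positivity))
  have hexpo : Real.exp (-(h * x) + ∑ u ∈ Finset.range N, g u)
      ≤ 3 * b + 3 * Real.exp (-(x ^ 2 / (4 * Real.exp Q * V))) := by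
    have e1 : ∑ u ∈ Finset.range N, g u ≤ h ^ 2 * Real.exp Q * V + Real.exp (h * y) * b := by
      simp only [g, Finset.sum_add_distrib, ← Finset.mul_sum]
      have : Real.exp (h * y) * b = Real.exp (h * y) / y ^ Q * B := by rw [hb]; ring
      rw [this]
      gcongr
    have e2 : h ^ 2 * Real.exp Q * V ≤ h * x / 2 := by
      have h1 : h ≤ x / (2 * Real.exp Q * V) := min_le_left _ _
      rw [le_div_iff₀ (by positivity)] at h1
      nlinarith
    have e3 : Real.exp (h * y) * b ≤ 1 := by
      have h1 : h ≤ Real.log (1 / b) / y := min_le_right _ _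
      rw [le_div_iff₀ hy0] at h1
      have h2 := Real.exp_le_exp.2 h1
      rw [Real.exp_log (by positivity)] at h2
      calc Real.exp (h * y) * b ≤ 1 / b * b := by gcongr
        _ = 1 := by field_simp
    have e4 : Real.exp (-(h * x) + ∑ u ∈ Finset.range N, g u)
        ≤ 3 * Real.exp (-(h * x / 2)) := by
      calc _ ≤ Real.exp (1 + -(h * x / 2)) := Real.exp_le_exp.2 (by linarith)
        _ = Real.exp 1 * Real.exp (-(h * x / 2)) := Real.exp_add _ _
        _ ≤ _ := by
          gcongr
          linarith [Real.exp_one_lt_d9]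
    refine e4.trans ?_
    rcases min_choice (x / (2 * Real.exp Q * V)) (Real.log (1 / b) / y) with hm | hm
    · have : h * x / 2 = x ^ 2 / (4 * Real.exp Q * V) := by
        rw [hh, hm]; field_simp; norm_num
      rw [this]
      linarith
    -- As `y = x / 2`, the second choice of `h` gives exactly `exp (-(h x / 2)) = b`.
    · have : -(h * x / 2) = Real.log b := by
        rw [hh, hm, hy, one_div, Real.log_inv]; field_simp
      rw [this, Real.exp_log hb0]
      have := Real.exp_pos (-(x ^ 2 / (4 * Real.exp Q * V)))
      linarith
  refine (measure_mono hsub).trans ((measure_union_le _ _).trans ?_)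
  refine (add_le_add (hcross.trans (ENNReal.ofReal_le_ofReal hexpo)) hbig).trans ?_
  rw [← ENNReal.ofReal_add (by positivity) hb0.le]
  exact ENNReal.ofReal_le_ofReal (by linarith)

end

/-! ### Convergence of conditional expectations -/

section

variable {ι E : Type*} [mE : MeasurableSpace E] {ν : Measure E} [IsProbabilityMeasure ν]

/-- The `σ`-algebra of the coordinates in `S`. -/
abbrev coordAlgebra (E : Type*) [MeasurableSpace E] (S : Set ι) : MeasurableSpace (ι → E) :=
  MeasurableSpace.comap (fun (e : ι → E) (i : S) => e i) MeasurableSpace.pi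

theorem coordAlgebra_le (S : Set ι) : coordAlgebra E S ≤ MeasurableSpace.pi :=
  Measurable.comap_le (by fun_prop)

theorem coordAlgebra_mono {S T : Set ι} (h : S ⊆ T) : coordAlgebra E S ≤ coordAlgebra E T := by
  have : (fun (e : ι → E) (i : S) => e i)
      = (fun (y : T → E) (i : S) => y ⟨i, h i.2⟩) ∘ fun (e : ι → E) (i : T) => e i := rfl
  unfold coordAlgebra
  rw [this, ← MeasurableSpace.comap_comp]
  exact MeasurableSpace.comap_mono (Measurable.comap_le (by fun_prop))

theorem measurable_coordAlgebra_condOn {f : (ι → E) → ℝ} (hf : BddMeas f) (S : Set ι) :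
    Measurable[coordAlgebra E S] (condOn ν S f) := by
  classical
  obtain ⟨x₀⟩ : Nonempty E := ν.nonempty_of_neZero
  have hext : Measurable (fun (y : S → E) (i : ι) => if h : i ∈ S then y ⟨i, h⟩ else x₀) := by
    refine measurable_pi_iff.2 fun i => ?_
    by_cases h : i ∈ S
    · simpa only [h, dite_true] using measurable_pi_apply (⟨i, h⟩ : S)
    · simp only [h, dite_false]; exact measurable_const
  have heq : condOn ν S f = (condOn ν S f ∘
      fun (y : S → E) (i : ι) => if h : i ∈ S then y ⟨i, h⟩ else x₀) ∘
        fun (e : ι → E) (i : S) => e i := by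
    ext e
    exact dependsOn_condOn S f fun i hi => by simp [hi]
  rw [heq]
  exact ((condOn_bddMeas S hf).meas.comp hext).comp (comap_measurable _)

/-- Self-adjointness, tested on indicators of events in the coordinates of `S`. The identification
serves to make the martingale convergence theorem available. -/
theorem condOn_ae_eq_condExp {f : (ι → E) → ℝ} (hf : BddMeas f) (S : Set ι) :
    condOn ν S f =ᵐ[iid ι ν] (iid ι ν)[f | coordAlgebra E S] := by
  have hb := condOn_bddMeas (ν := ν) S hf
  refine ae_eq_condExp_of_forall_setIntegral_eq (coordAlgebra_le S) (hf.integrable _)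
    (fun s _ _ => (hb.integrable _).integrableOn) (fun s hs _ => ?_)
    (measurable_coordAlgebra_condOn hf S).stronglyMeasurable.aestronglyMeasurable
  have hs' : MeasurableSet s := coordAlgebra_le S s hs
  have hind : BddMeas (s.indicator fun _ : ι → E => (1 : ℝ)) := (BddMeas.const 1).indicator hs'
  have hdep : DependsOn (s.indicator fun _ : ι → E => (1 : ℝ)) S := by
    obtain ⟨B, -, rfl⟩ := hs
    intro e e' h
    have : (fun i : S => e i) = fun i : S => e' i := funext fun i => h i.1 i.2
    have hm : e ∈ (fun (e : ι → E) (i : S) => e i) ⁻¹' B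
        ↔ e' ∈ (fun (e : ι → E) (i : S) => e i) ⁻¹' B := by
      change (fun i : S => e i) ∈ B ↔ (fun i : S => e' i) ∈ B
      rw [this]
    by_cases he : e ∈ (fun (e : ι → E) (i : S) => e i) ⁻¹' B
    · rw [indicator_of_mem he, indicator_of_mem (hm.1 he)]
    · rw [indicator_of_notMem he, indicator_of_notMem fun h' => he (hm.2 h')]
  have key := integral_mul_condOn (ν := ν) hf hind S
  rw [condOn_of_dependsOn hdep] at key
  rw [← integral_indicator hs', ← integral_indicator hs']
  convert key using 2 <;> ext e <;> by_cases he : e ∈ s <;> simp [he]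

/-- Lévy's upward theorem: the coordinate algebras of the sets `S n` generate the product algebra.
-/
theorem tendsto_eLpNorm_condOn_sub {f : (ι → E) → ℝ} (hf : BddMeas f) {S : ℕ → Set ι}
    (hS : Monotone S) (hU : ⋃ n, S n = univ) :
    Tendsto (fun n => eLpNorm (fun e => condOn ν (S n) f e - f e) 1 (iid ι ν)) atTop (𝓝 0) := by
  let ℱ : Filtration ℕ (MeasurableSpace.pi : MeasurableSpace (ι → E)) :=
    ⟨fun n => coordAlgebra E (S n), fun _ _ h => coordAlgebra_mono (hS h),
      fun n => coordAlgebra_le (S n)⟩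
  have hsup : (⨆ n, ℱ n) = MeasurableSpace.pi := by
    refine le_antisymm (iSup_le fun n => coordAlgebra_le (S n)) (iSup_le fun i => ?_)
    have hi : i ∈ ⋃ n, S n := hU ▸ mem_univ i
    obtain ⟨n, hn⟩ := mem_iUnion.1 hi
    refine le_trans ?_ (le_iSup (fun n => (ℱ n : MeasurableSpace (ι → E))) n)
    have : (fun e : ι → E => e i) = (fun y : S n → E => y ⟨i, hn⟩) ∘ fun e j => e j := rfl
    rw [this, ← MeasurableSpace.comap_comp]
    exact MeasurableSpace.comap_mono (measurable_pi_apply _).comap_le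
  have h := Integrable.tendsto_eLpNorm_condExp (μ := iid ι ν) (ℱ := ℱ) (hf.integrable _)
    (by rw [hsup]; exact hf.meas.stronglyMeasurable)
  refine h.congr fun n => eLpNorm_congr_ae ?_
  filter_upwards [condOn_ae_eq_condExp (ν := ν) hf (S n)] with e he
  simp only [Pi.sub_apply, he]
  rfl

end

/-! ### Causal functions of an i.i.d. sequence -/

section Causal

variable {E : Type*} [mE : MeasurableSpace E] {ν : Measure E} [IsProbabilityMeasure ν]

/-- The effect of the innovation with lag `r` on the function `f` of the past of time `i`. -/
def lagDiff (ν : Measure E) (f : (ℤ → E) → ℝ) (i : ℤ) (r : ℕ) (e : ℤ → E) : ℝ :=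
  condOn ν (Icc (i - r) i) f e - condOn ν (Ioc (i - r) i) f e

theorem insert_Ioc_eq (i : ℤ) (r : ℕ) : insert (i - r : ℤ) (Ioc (i - r) i) = Icc (i - r) i := by
  ext k; simp only [mem_insert_iff, mem_Ioc, mem_Icc]; omega

theorem lagDiff_eq (ν : Measure E) (f : (ℤ → E) → ℝ) (i : ℤ) (r : ℕ) :
    lagDiff ν f i r = fun e => condOn ν (insert (i - r : ℤ) (Ioc (i - r) i)) f e
      - condOn ν (Ioc (i - r) i) f e := by
  rw [insert_Ioc_eq]; rfl

theorem lagDiff_bddMeas {f : (ℤ → E) → ℝ} (hf : BddMeas f) (i : ℤ) (r : ℕ) :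
    BddMeas (lagDiff ν f i r) := (condOn_bddMeas _ hf).sub (condOn_bddMeas _ hf)

theorem dependsOn_lagDiff (f : (ℤ → E) → ℝ) (i : ℤ) (r : ℕ) :
    DependsOn (lagDiff ν f i r) (Icc (i - r) i) := by
  intro e e' h
  unfold lagDiff
  rw [dependsOn_condOn _ f h, dependsOn_condOn _ f fun k hk => h k (Ioc_subset_Icc_self hk)]

theorem integral_lagDiff {f : (ℤ → E) → ℝ} (hf : BddMeas f) (i : ℤ) (r : ℕ) :
    ∫ e, lagDiff ν f i r e ∂(iid ℤ ν) = 0 := by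
  unfold lagDiff
  rw [integral_sub ((condOn_bddMeas _ hf).integrable _) ((condOn_bddMeas _ hf).integrable _),
    integral_condOn hf, integral_condOn hf, sub_self]

theorem integral_mul_lagDiff {f g : (ℤ → E) → ℝ} (hf : BddMeas f) (hg : BddMeas g) {i : ℤ} {r : ℕ}
    (hgi : DependsOn g {(i - r : ℤ)}ᶜ) : ∫ e, g e * lagDiff ν f i r e ∂(iid ℤ ν) = 0 := by
  rw [lagDiff_eq]
  exact integral_mul_condOn_sub hf hg hgi

theorem sum_lagDiff (f : (ℤ → E) → ℝ) (i : ℤ) (R : ℕ) (e : ℤ → E) :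
    ∑ r ∈ Finset.range R, lagDiff ν f i r e
      = condOn ν (Ioc (i - R) i) f e - ∫ x, f x ∂(iid ℤ ν) := by
  induction R with
  | zero =>
    have : Ioc (i - ((0 : ℕ) : ℤ)) i = ∅ := by simp
    rw [Finset.sum_range_zero, this]
    simp [condOn]
  | succ R ih =>
    rw [Finset.sum_range_succ, ih]
    have : Ioc (i - ((R + 1 : ℕ) : ℤ)) i = Icc (i - R) i := by
      ext k; simp only [mem_Ioc, mem_Icc]; push_cast; omega
    rw [this]
    unfold lagDiff
    ring

/-- The sum over lags telescopes to the conditional expectation given `(i - R, i]`. These windows do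
not exhaust `ℤ`, but a causal function ignores the future, so `(i - R, ∞)` gives the same value, and
these sets do. -/
theorem tendsto_eLpNorm_causal {f : (ℤ → E) → ℝ} (hf : BddMeas f) {i : ℤ}
    (hfi : DependsOn f (Iic i)) :
    Tendsto (fun R : ℕ => eLpNorm (fun e => ∑ r ∈ Finset.range R, lagDiff ν f i r e
      - (f e - ∫ x, f x ∂(iid ℤ ν))) 1 (iid ℤ ν)) atTop (𝓝 0) := by
  classical
  have h := tendsto_eLpNorm_condOn_sub (ν := ν) hf (S := fun R : ℕ => Ioi (i - (R : ℤ)))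
    (fun a b hab => Ioi_subset_Ioi (by omega))
    (by
      ext k
      simp only [mem_iUnion, mem_Ioi, mem_univ, iff_true]
      exact ⟨(i - k).toNat + 1, by push_cast; omega⟩)
  refine h.congr fun R => ?_
  congr 1
  ext e
  rw [sum_lagDiff]
  have : condOn ν (Ioi (i - (R : ℤ))) f e = condOn ν (Ioc (i - (R : ℤ)) i) f e := by
    unfold condOn
    congr with e'
    refine hfi fun k hk => ?_
    have hk' : k ≤ i := hk
    by_cases h1 : i - (R : ℤ) < k
    · simp [Set.piecewise, h1, hk']
    · simp [Set.piecewise, h1]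
  rw [this]
  ring

end Causal

/-! ### A Nagaev type inequality for causal processes -/

section

variable {E : Type*} [mE : MeasurableSpace E] {ν : Measure E} [IsProbabilityMeasure ν]
  {f : ℤ → (ℤ → E) → ℝ}

/-- The lag `r` effect at time `i` averages to zero over the innovation `i - r`, and effects at
later times do not see that innovation. Hence the effects are martingale differences when time runs
backwards, and `D` lists them in that order. -/
theorem eLpNorm_lag_sum_le_of_pos (hf : ∀ i, BddMeas (f i)) {Q β : ℝ} (hQ : 2 ≤ Q) (hβ : 0 < β)
    {r : ℕ} (hm : ∀ i, eLpNorm (lagDiff ν (f i) i r) (ENNReal.ofReal Q) (iid ℤ ν)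
      ≤ ENNReal.ofReal β) (s : ℤ) (n : ℕ) :
    eLpNorm (fun e => ∑ i ∈ Finset.range n, lagDiff ν (f (s + i)) (s + i) r e)
      (ENNReal.ofReal Q) (iid ℤ ν)
      ≤ ENNReal.ofReal (Real.sqrt (3 * taylorConst Q) * Real.sqrt n * β) := by
  let D : ℕ → (ℤ → E) → ℝ := fun j => lagDiff ν (f (s + n - 1 - j)) (s + n - 1 - j) r
  have h := eLpNorm_sum_le_of_orth (μ := iid ℤ ν) hQ hβ (D := D)
    (fun k => lagDiff_bddMeas (hf _) _ _) ?_ (fun k => hm _) n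
  · refine le_trans (le_of_eq ?_) h
    congr 1
    ext e
    rw [← Finset.sum_range_reflect]
    refine Finset.sum_congr rfl fun j hj => ?_
    have hj' := Finset.mem_range.1 hj
    have : (s + ((n - 1 - j : ℕ) : ℤ)) = s + n - 1 - j := by
      push_cast [Nat.sub_sub, Nat.cast_sub (show 1 + j ≤ n by omega)]
      ring
    rw [this]
  · intro k φ hφ
    refine integral_mul_lagDiff (hf _) ((BddMeas.sum _ fun i _ =>
      lagDiff_bddMeas (hf _) _ _).continuous_comp hφ) ?_
    intro e e' hee
    have : ∀ i ∈ Finset.range k, D i e = D i e' := by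
      intro i hi
      have hi' := Finset.mem_range.1 hi
      refine dependsOn_lagDiff _ _ _ fun c hc => hee c ?_
      simp only [mem_Icc, mem_compl_iff, mem_singleton_iff] at hc ⊢
      omega
    show φ (∑ i ∈ Finset.range k, D i e) = φ (∑ i ∈ Finset.range k, D i e')
    rw [Finset.sum_congr rfl this]

/-- The case `β = 0` is included by letting a positive bound decrease to `β`. -/
theorem eLpNorm_lag_sum_le (hf : ∀ i, BddMeas (f i)) {Q β : ℝ} (hQ : 2 ≤ Q) (hβ : 0 ≤ β)
    {r : ℕ} (hm : ∀ i, eLpNorm (lagDiff ν (f i) i r) (ENNReal.ofReal Q) (iid ℤ ν)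
      ≤ ENNReal.ofReal β) (s : ℤ) (n : ℕ) :
    eLpNorm (fun e => ∑ i ∈ Finset.range n, lagDiff ν (f (s + i)) (s + i) r e)
      (ENNReal.ofReal Q) (iid ℤ ν)
      ≤ ENNReal.ofReal (Real.sqrt (3 * taylorConst Q) * Real.sqrt n * β) := by
  have hc : Continuous fun t : ℝ =>
      ENNReal.ofReal (Real.sqrt (3 * taylorConst Q) * Real.sqrt n * t) :=
    ENNReal.continuous_ofReal.comp (by fun_prop)
  have ht := (hc.tendsto β).mono_left (nhdsWithin_le_nhds (s := Ioi β))
  refine ge_of_tendsto ht ?_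
  filter_upwards [self_mem_nhdsWithin] with t ht
  have ht' : β < t := ht
  exact eLpNorm_lag_sum_le_of_pos hf hQ (hβ.trans_lt ht')
    (fun i => (hm i).trans (ENNReal.ofReal_le_ofReal ht'.le)) s n

/-- The part of `f i - E f i` due to the lags in `T`. -/
def lagSum (ν : Measure E) (f : ℤ → (ℤ → E) → ℝ) (T : Finset ℕ) (i : ℤ) (e : ℤ → E) : ℝ :=
  ∑ r ∈ T, lagDiff ν (f i) i r e

theorem lagSum_bddMeas (hf : ∀ i, BddMeas (f i)) (T : Finset ℕ) (i : ℤ) :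
    BddMeas (lagSum ν f T i) := BddMeas.sum _ fun r _ => lagDiff_bddMeas (hf i) i r

theorem integral_lagSum (hf : ∀ i, BddMeas (f i)) (T : Finset ℕ) (i : ℤ) :
    ∫ e, lagSum ν f T i e ∂(iid ℤ ν) = 0 := by
  unfold lagSum
  rw [integral_finsetSum _ fun r _ => (lagDiff_bddMeas (hf i) i r).integrable _]
  exact Finset.sum_eq_zero fun r _ => integral_lagDiff (hf i) i r

theorem dependsOn_lagSum {m : ℕ} (i : ℤ) {T : Finset ℕ} (hT : ∀ r ∈ T, r < m) :
    DependsOn (lagSum ν f T i) (Ioc (i - m) i) := by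
  intro e e' h
  refine Finset.sum_congr rfl fun r hr => dependsOn_lagDiff _ _ _ fun k hk => h k ?_
  have := hT r hr
  simp only [mem_Icc, mem_Ioc] at hk ⊢
  omega

/-- Burkholder is applied lag by lag and the lags are added by the triangle inequality, so only the
sum of the lag norms enters. -/
theorem eLpNorm_lagSum_sum_le (hf : ∀ i, BddMeas (f i)) {Q : ℝ} (hQ : 2 ≤ Q) {β : ℕ → ℝ}
    (hβ : ∀ r, 0 ≤ β r)
    (hm : ∀ i r, eLpNorm (lagDiff ν (f i) i r) (ENNReal.ofReal Q) (iid ℤ ν)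
      ≤ ENNReal.ofReal (β r)) (T : Finset ℕ) {b : ℝ} (hb : ∑ r ∈ T, β r ≤ b) (s : ℤ) (n : ℕ) :
    eLpNorm (fun e => ∑ i ∈ Finset.range n, lagSum ν f T (s + i) e) (ENNReal.ofReal Q) (iid ℤ ν)
      ≤ ENNReal.ofReal (Real.sqrt n * (Real.sqrt (3 * taylorConst Q) * b)) := by
  have heq : (fun e => ∑ i ∈ Finset.range n, lagSum ν f T (s + i) e)
      = ∑ r ∈ T, fun e => ∑ i ∈ Finset.range n, lagDiff ν (f (s + i)) (s + i) r e := by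
    ext e
    simp only [lagSum, Finset.sum_apply]
    exact Finset.sum_comm
  rw [heq]
  refine (eLpNorm_sum_le (fun r _ =>
    (BddMeas.sum _ fun i _ => lagDiff_bddMeas (hf _) _ _).meas.aestronglyMeasurable)
    (by rw [← ENNReal.ofReal_one]; exact ENNReal.ofReal_le_ofReal (by linarith))).trans ?_
  refine (Finset.sum_le_sum fun r _ => eLpNorm_lag_sum_le hf hQ (hβ r) (fun i => hm i r) s n).trans
    ?_
  rw [← ENNReal.ofReal_sum_of_nonneg fun r _ => mul_nonneg (by positivity) (hβ r),
    ← Finset.mul_sum]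
  refine ENNReal.ofReal_le_ofReal ?_
  calc _ ≤ Real.sqrt (3 * taylorConst Q) * Real.sqrt n * b := by gcongr
    _ = _ := by ring

/-- The constant of the moment bounds for block sums. -/
def blockConst (Q : ℝ) : ℝ := chainConst Q * Real.sqrt (3 * taylorConst Q)

theorem sqrt_le_blockConst {Q : ℝ} (hQ : 2 < Q) : Real.sqrt (3 * taylorConst Q) ≤ blockConst Q :=
  le_mul_of_one_le_left (Real.sqrt_nonneg _) (one_le_chainConst hQ)

theorem sqrt_two_pow (l : ℕ) : Real.sqrt ((2 ^ l : ℕ) : ℝ) = Real.sqrt 2 ^ l := by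
  rw [Nat.cast_pow, Nat.cast_ofNat, Real.sqrt_eq_rpow, Real.sqrt_eq_rpow, ← Real.rpow_natCast,
    ← Real.rpow_natCast, ← Real.rpow_mul (by norm_num), ← Real.rpow_mul (by norm_num), mul_comm]

theorem sum_range_mul_eq {M : Type*} [AddCommMonoid M] (g : ℕ → M) (a m : ℕ) :
    ∑ i ∈ Finset.range (a * m), g i
      = ∑ u ∈ Finset.range a, ∑ i ∈ Finset.range m, g (u * m + i) := by
  induction a with
  | zero => simp
  | succ a ih => rw [Nat.succ_mul, Finset.sum_range_add, ih, Finset.sum_range_succ]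

/-- Tail bound for the sum of the blocks of a given parity. -/
theorem measure_blocks_le (hf : ∀ i, BddMeas (f i)) {Q : ℝ} (hQ : 2 < Q) {T : Finset ℕ} {l : ℕ}
    (hT : ∀ r ∈ T, r < 2 ^ l) {b g : ℝ} (hb : 0 < b) (hg : 0 < g)
    (hbm : ∀ (s : ℤ) (n : ℕ), eLpNorm (fun e => ∑ i ∈ Finset.range n, lagSum ν f T (s + i) e)
      (ENNReal.ofReal Q) (iid ℤ ν) ≤ ENNReal.ofReal (Real.sqrt n * b))
    (hgm : ∀ (s : ℤ) (n : ℕ), eLpNorm (fun e => ∑ i ∈ Finset.range n, lagSum ν f T (s + i) e)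
      (ENNReal.ofReal 2) (iid ℤ ν) ≤ ENNReal.ofReal (Real.sqrt n * g))
    {x : ℝ} (hx : 0 < x) (s : ℤ) (N : ℕ) (hN : 0 < N) (par : ℕ) {σ : ℝ} (hσ : |σ| = 1) :
    iid ℤ ν {e | ∃ k ≤ N, x ≤ ∑ u ∈ Finset.range k, if u % 2 = par then
        σ * ∑ i ∈ Finset.range (2 ^ l), lagSum ν f T (s + (u * 2 ^ l : ℕ) + i) e else 0}
      ≤ ENNReal.ofReal (4 * (2 ^ Q * (N * (Real.sqrt 2 ^ l * b) ^ Q) / x ^ Q)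
        + 3 * Real.exp (-(x ^ 2 / (4 * Real.exp Q * (N * (2 ^ l * g ^ 2)))))) := by
  let ξ : ℕ → (ℤ → E) → ℝ := fun u e => if u % 2 = par then
    σ * ∑ i ∈ Finset.range (2 ^ l), lagSum ν f T (s + (u * 2 ^ l : ℕ) + i) e else 0
  -- A block reaches back less than its own length. Blocks of the same parity start at least two
  -- lengths apart, so they use disjoint innovations; the others are zero and use none.
  let S : ℕ → Set ℤ := fun u => if u % 2 = par then
    Ioo (s + (u * 2 ^ l : ℕ) - 2 ^ l) (s + (u * 2 ^ l : ℕ) + 2 ^ l) else ∅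
  have hblock : ∀ u : ℕ, BddMeas fun e => ∑ i ∈ Finset.range (2 ^ l),
      lagSum ν f T (s + (u * 2 ^ l : ℕ) + i) e :=
    fun u => BddMeas.sum _ fun i _ => lagSum_bddMeas hf _ _
  have hξ : ∀ u, BddMeas (ξ u) := by
    intro u
    by_cases hu : u % 2 = par
    · simp only [ξ, hu, if_true]; exact (BddMeas.const σ).mul (hblock u)
    · simp only [ξ, hu, if_false]; exact BddMeas.const 0
  have hS : ∀ u, DependsOn (ξ u) (S u) := by
    intro u e e' hee
    by_cases hu : u % 2 = par
    · simp only [ξ, hu, if_true]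
      congr 1
      refine Finset.sum_congr rfl fun i hi => dependsOn_lagSum _ hT fun c hc => hee c ?_
      have hi' : (i : ℤ) < 2 ^ l := by exact_mod_cast Finset.mem_range.1 hi
      have hi0 : (0 : ℤ) ≤ i := by positivity
      simp only [S, hu, if_true, mem_Ioo, mem_Ioc] at hc ⊢
      push_cast at hc ⊢
      constructor <;> linarith
    · simp only [ξ, hu, if_false]
  have hdisj : Pairwise (Function.onFun Disjoint S) := by
    intro u v huv
    simp only [Function.onFun, S]
    by_cases hu : u % 2 = par
    · by_cases hv : v % 2 = par
      · simp only [hu, hv, if_true]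
        have key : ∀ u v : ℕ, u + 2 ≤ v →
            Disjoint (Ioo (s + (u * 2 ^ l : ℕ) - 2 ^ l) (s + (u * 2 ^ l : ℕ) + 2 ^ l))
              (Ioo (s + (v * 2 ^ l : ℕ) - 2 ^ l) (s + (v * 2 ^ l : ℕ) + 2 ^ l)) := by
          intro u v h
          rw [Set.disjoint_left]
          intro c hc hc'
          simp only [mem_Ioo] at hc hc'
          have h2 : ((u : ℤ) + 2) * 2 ^ l ≤ v * 2 ^ l :=
            mul_le_mul_of_nonneg_right (by exact_mod_cast h) (by positivity)
          push_cast at hc hc'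
          linarith [hc.2, hc'.1]
        rcases Nat.lt_or_gt_of_ne huv with h | h
        · exact key u v (by omega)
        · exact (key v u (by omega)).symm
      · simp [hv]
    · simp [hu]
  have hmean : ∀ u, ∫ e, ξ u e ∂(iid ℤ ν) = 0 := by
    intro u
    by_cases hu : u % 2 = par
    · simp only [ξ, hu, if_true]
      rw [integral_const_mul, integral_finsetSum _ fun i _ => (lagSum_bddMeas hf _ _).integrable _,
        Finset.sum_eq_zero fun i _ => integral_lagSum hf _ _, mul_zero]
    · simp [ξ, hu]
  have hξabs : ∀ u e, |ξ u e| ≤ |∑ i ∈ Finset.range (2 ^ l),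
      lagSum ν f T (s + (u * 2 ^ l : ℕ) + i) e| := by
    intro u e
    by_cases hu : u % 2 = par
    · simp only [ξ, hu, if_true, abs_mul, hσ, one_mul, le_refl]
    · simp only [ξ, hu, if_false, abs_zero, abs_nonneg]
  have hNpos : (0 : ℝ) < N := by exact_mod_cast hN
  have hmom : ∑ u ∈ Finset.range N, ∫ e, |ξ u e| ^ Q ∂(iid ℤ ν)
      ≤ N * (Real.sqrt 2 ^ l * b) ^ Q := by
    have h1 : ∀ u ∈ Finset.range N, ∫ e, |ξ u e| ^ Q ∂(iid ℤ ν) ≤ (Real.sqrt 2 ^ l * b) ^ Q := by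
      intro u _
      have h2 := hbm (s + (u * 2 ^ l : ℕ)) (2 ^ l)
      rw [eLpNorm_le_ofReal_iff (hblock u) (by linarith) (by positivity), sqrt_two_pow] at h2
      refine le_trans (integral_mono (((hξ u).rpow_abs (by linarith)).integrable _)
        (((hblock u).rpow_abs (by linarith)).integrable _) fun e => ?_) h2
      exact Real.rpow_le_rpow (abs_nonneg _) (hξabs u e) (by linarith)
    refine (Finset.sum_le_sum h1).trans ?_
    simp
  have hvar : ∑ u ∈ Finset.range N, ∫ e, ξ u e ^ 2 ∂(iid ℤ ν) ≤ N * (2 ^ l * g ^ 2) := by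
    have h1 : ∀ u ∈ Finset.range N, ∫ e, ξ u e ^ 2 ∂(iid ℤ ν) ≤ 2 ^ l * g ^ 2 := by
      intro u _
      have h2 := hgm (s + (u * 2 ^ l : ℕ)) (2 ^ l)
      rw [eLpNorm_le_ofReal_iff (hblock u) (by norm_num) (by positivity)] at h2
      have h3 : (Real.sqrt ((2 ^ l : ℕ) : ℝ) * g) ^ (2 : ℝ) = 2 ^ l * g ^ 2 := by
        rw [Real.rpow_two, mul_pow, Real.sq_sqrt (by positivity)]; push_cast; ring
      rw [h3] at h2
      refine le_trans (integral_mono (((hξ u).continuous_comp (continuous_pow 2)).integrable _)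
        (((hblock u).rpow_abs (by norm_num)).integrable _) fun e => ?_) h2
      simp only [Real.rpow_two, sq_abs]
      exact sq_le_sq.2 (hξabs u e)
    refine (Finset.sum_le_sum h1).trans ?_
    simp
  exact fuk_nagaev hξ hS hdisj hmean hQ.le hx (by positivity) (by positivity) N hvar hmom

/-- Tail bound for the partial sums of the contribution of the lags below `2 ^ l`. -/
theorem measure_level_le (hf : ∀ i, BddMeas (f i)) {Q : ℝ} (hQ : 2 < Q) {T : Finset ℕ} {l L : ℕ}
    (hlL : l ≤ L) (hT : ∀ r ∈ T, r < 2 ^ l) {β γ : ℕ → ℝ} (hβ : ∀ r, 0 ≤ β r) (hγ : ∀ r, 0 ≤ γ r)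
    (hβm : ∀ i r, eLpNorm (lagDiff ν (f i) i r) (ENNReal.ofReal Q) (iid ℤ ν)
      ≤ ENNReal.ofReal (β r))
    (hγm : ∀ i r, eLpNorm (lagDiff ν (f i) i r) (ENNReal.ofReal 2) (iid ℤ ν)
      ≤ ENNReal.ofReal (γ r))
    {b g : ℝ} (hb : 0 < b) (hg : 0 < g) (hbT : ∑ r ∈ T, β r ≤ b) (hgT : ∑ r ∈ T, γ r ≤ g)
    {x : ℝ} (hx : 0 < x) (s : ℤ) :
    iid ℤ ν {e | ∃ k ≤ 2 ^ L, 3 * x ≤ |∑ i ∈ Finset.range k, lagSum ν f T (s + i) e|}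
      ≤ ENNReal.ofReal ((16 * 2 ^ Q + 1) * (2 ^ (L - l) * (Real.sqrt 2 ^ l * (blockConst Q * b)) ^ Q
          / x ^ Q)
        + 12 * Real.exp (-(x ^ 2 / (12 * Real.exp Q * taylorConst 2 * (2 ^ L * g ^ 2))))) := by
  have hC := one_le_taylorConst hQ.le
  have hC2 := one_le_taylorConst (le_refl (2 : ℝ))
  have hsq := sqrt_le_blockConst hQ
  have hsq0 : 0 < Real.sqrt (3 * taylorConst Q) := Real.sqrt_pos.2 (by positivity)
  have hbc : 0 < blockConst Q := hsq0.trans_le hsq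
  set N := 2 ^ (L - l) with hN
  have hN0 : 0 < N := by positivity
  have hNl : N * 2 ^ l = 2 ^ L := by rw [hN, ← pow_add, Nat.sub_add_cancel hlL]
  have hbm : ∀ (s : ℤ) (n : ℕ), eLpNorm (fun e => ∑ i ∈ Finset.range n, lagSum ν f T (s + i) e)
      (ENNReal.ofReal Q) (iid ℤ ν)
      ≤ ENNReal.ofReal (Real.sqrt n * (Real.sqrt (3 * taylorConst Q) * b)) :=
    eLpNorm_lagSum_sum_le hf hQ.le hβ hβm T hbT
  have hbm' : ∀ (s : ℤ) (n : ℕ), eLpNorm (fun e => ∑ i ∈ Finset.range n, lagSum ν f T (s + i) e)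
      (ENNReal.ofReal Q) (iid ℤ ν) ≤ ENNReal.ofReal (Real.sqrt n * (blockConst Q * b)) :=
    fun s n => (hbm s n).trans (ENNReal.ofReal_le_ofReal (by gcongr))
  have hgm : ∀ (s : ℤ) (n : ℕ), eLpNorm (fun e => ∑ i ∈ Finset.range n, lagSum ν f T (s + i) e)
      (ENNReal.ofReal 2) (iid ℤ ν)
      ≤ ENNReal.ofReal (Real.sqrt n * (Real.sqrt (3 * taylorConst 2) * g)) :=
    eLpNorm_lagSum_sum_le hf le_rfl hγ hγm T hgT
  have hblk := fun (par : ℕ) (σ : ℝ) (hσ : |σ| = 1) =>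
    measure_blocks_le hf hQ hT (by positivity : 0 < blockConst Q * b)
      (by positivity : 0 < Real.sqrt (3 * taylorConst 2) * g) hbm' hgm hx s N hN0 par hσ
  have hchain : ∀ u : ℕ, iid ℤ ν {e | x ≤ |chainMax (lagSum ν f T) l (s + (u * 2 ^ l : ℕ)) e|}
      ≤ ENNReal.ofReal ((Real.sqrt 2 ^ l * (blockConst Q * b)) ^ Q / x ^ Q) := by
    intro u
    have h1 := eLpNorm_chainMax_le (μ := iid ℤ ν) hQ (by positivity)
      (fun i => lagSum_bddMeas hf T i) hbm l (s + (u * 2 ^ l : ℕ))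
    have h2 : chainConst Q * (Real.sqrt 2 ^ l * (Real.sqrt (3 * taylorConst Q) * b))
        = Real.sqrt 2 ^ l * (blockConst Q * b) := by unfold blockConst; ring
    rw [h2] at h1
    exact measure_lt_chain_le (by linarith) (by positivity) hx
      (chainMax_bddMeas (fun i => lagSum_bddMeas hf T i) l _) h1
  set Bl : ℕ → ℝ → Set (ℤ → E) := fun par σ => {e | ∃ k ≤ N, x ≤ ∑ u ∈ Finset.range k,
    if u % 2 = par then σ * ∑ i ∈ Finset.range (2 ^ l),
      lagSum ν f T (s + (u * 2 ^ l : ℕ) + i) e else 0} with hBl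
  -- A prefix is split into complete even blocks, complete odd blocks and one incomplete block, each
  -- allowed `x`. Two parities and two signs make four uses of Fuk–Nagaev, hence `16 = 4 · 4` and
  -- `12 = 4 · 3`; the incomplete block adds the `1`.
  have hsub : {e | ∃ k ≤ 2 ^ L, 3 * x ≤ |∑ i ∈ Finset.range k, lagSum ν f T (s + i) e|}
      ⊆ ((Bl 0 1 ∪ Bl 0 (-1)) ∪ (Bl 1 1 ∪ Bl 1 (-1)))
        ∪ ⋃ u ∈ Finset.range N, {e | x ≤ |chainMax (lagSum ν f T) l (s + (u * 2 ^ l : ℕ)) e|} := by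
    intro e he
    by_contra hcon
    simp only [mem_union, not_or, mem_iUnion, not_exists] at hcon
    obtain ⟨⟨⟨h01, h02⟩, h11, h12⟩, hch⟩ := hcon
    obtain ⟨k, hk, hkx⟩ := he
    have hlt : ∀ par, e ∉ Bl par 1 → e ∉ Bl par (-1) → ∀ k ≤ N,
        |∑ u ∈ Finset.range k, if u % 2 = par then ∑ i ∈ Finset.range (2 ^ l),
          lagSum ν f T (s + (u * 2 ^ l : ℕ) + i) e else 0| < x := by
      intro par h1 h2 k hk
      simp only [hBl, mem_ofPred_eq, not_exists, not_and, not_le] at h1 h2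
      have h1' := h1 k hk
      have h2' := h2 k hk
      have hneg : ∑ u ∈ Finset.range k, (if u % 2 = par then (-1 : ℝ) *
          ∑ i ∈ Finset.range (2 ^ l), lagSum ν f T (s + (u * 2 ^ l : ℕ) + i) e else 0)
          = -∑ u ∈ Finset.range k, if u % 2 = par then ∑ i ∈ Finset.range (2 ^ l),
          lagSum ν f T (s + (u * 2 ^ l : ℕ) + i) e else 0 := by
        rw [← Finset.sum_neg_distrib]
        refine Finset.sum_congr rfl fun u _ => ?_
        split_ifs <;> simp
      rw [hneg] at h2'
      simp only [one_mul] at h1'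
      exact abs_lt.2 ⟨by linarith, h1'⟩
    have e0 := hlt 0 h01 h02
    have e1 := hlt 1 h11 h12
    have hpos : 0 < 2 ^ l := by positivity
    have hdm := Nat.div_add_mod' k (2 ^ l)
    set a := k / 2 ^ l
    set c := k % 2 ^ l
    have hc : c < 2 ^ l := Nat.mod_lt _ hpos
    have haN : a ≤ N := by
      by_contra hcon
      have : (N + 1) * 2 ^ l ≤ a * 2 ^ l := Nat.mul_le_mul_right _ (by omega)
      rw [add_mul, hNl] at this
      omega
    have hfull : ∑ i ∈ Finset.range (a * 2 ^ l), lagSum ν f T (s + i) e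
        = (∑ u ∈ Finset.range a, if u % 2 = 0 then ∑ i ∈ Finset.range (2 ^ l),
          lagSum ν f T (s + (u * 2 ^ l : ℕ) + i) e else 0)
        + ∑ u ∈ Finset.range a, if u % 2 = 1 then ∑ i ∈ Finset.range (2 ^ l),
          lagSum ν f T (s + (u * 2 ^ l : ℕ) + i) e else 0 := by
      rw [sum_range_mul_eq, ← Finset.sum_add_distrib]
      refine Finset.sum_congr rfl fun u _ => ?_
      rcases Nat.mod_two_eq_zero_or_one u with h | h <;> simp [h, add_assoc]
    rw [← hdm, Finset.sum_range_add, hfull] at hkx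
    have t1 := e0 a haN
    have t2 := e1 a haN
    rcases Nat.lt_or_ge a N with haN' | haN'
    · have h3 := hch a (Finset.mem_range.2 haN')
      simp only [mem_ofPred_eq, not_le] at h3
      rw [abs_of_nonneg (chainMax_nonneg _ _ _ _)] at h3
      have h4 := abs_sum_le_chainMax (lagSum ν f T) l (s + (a * 2 ^ l : ℕ)) e hc.le
      have h5 : ∑ i ∈ Finset.range c, lagSum ν f T (s + ((a * 2 ^ l + i : ℕ) : ℤ)) e
          = ∑ i ∈ Finset.range c, lagSum ν f T (s + (a * 2 ^ l : ℕ) + i) e := by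
        refine Finset.sum_congr rfl fun i _ => ?_
        push_cast
        rw [add_assoc]
      rw [h5] at hkx
      have := (abs_add_three _ _ _).trans_lt (add_lt_add (add_lt_add t1 t2) (h4.trans_lt h3))
      linarith
    -- The prefix is the whole window, so there is no incomplete block.
    · have hc0 : c = 0 := by
        have : N * 2 ^ l ≤ a * 2 ^ l := Nat.mul_le_mul_right _ haN'
        omega
      rw [hc0, Finset.sum_range_zero, add_zero] at hkx
      have := (abs_add_le _ _).trans_lt (add_lt_add t1 t2)
      linarith
  refine (measure_mono hsub).trans ((measure_union_le _ _).trans ?_)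
  have hsum : iid ℤ ν (⋃ u ∈ Finset.range N,
      {e | x ≤ |chainMax (lagSum ν f T) l (s + (u * 2 ^ l : ℕ)) e|})
      ≤ ENNReal.ofReal (N * ((Real.sqrt 2 ^ l * (blockConst Q * b)) ^ Q / x ^ Q)) := by
    refine (measure_biUnion_finset_le _ _).trans
      ((Finset.sum_le_sum fun u _ => hchain u).trans (le_of_eq ?_))
    rw [Finset.sum_const, Finset.card_range, nsmul_eq_mul, ENNReal.ofReal_mul (by positivity),
      ENNReal.ofReal_natCast]
  have habs1 : |(-1 : ℝ)| = 1 := by norm_num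
  have h4 : iid ℤ ν ((Bl 0 1 ∪ Bl 0 (-1)) ∪ (Bl 1 1 ∪ Bl 1 (-1))) ≤ _ :=
    (measure_union_le _ _).trans (add_le_add
      ((measure_union_le _ _).trans (add_le_add (hblk 0 1 abs_one) (hblk 0 (-1) habs1)))
      ((measure_union_le _ _).trans (add_le_add (hblk 1 1 abs_one) (hblk 1 (-1) habs1))))
  refine (add_le_add h4 hsum).trans ?_
  rw [← ENNReal.ofReal_add (by positivity) (by positivity),
    ← ENNReal.ofReal_add (by positivity) (by positivity),
    ← ENNReal.ofReal_add (by positivity) (by positivity)]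
  refine ENNReal.ofReal_le_ofReal (le_of_eq ?_)
  have hV : 4 * Real.exp Q * ((N : ℝ) * (2 ^ l * (Real.sqrt (3 * taylorConst 2) * g) ^ 2))
      = 12 * Real.exp Q * taylorConst 2 * (2 ^ L * g ^ 2) := by
    have : (N : ℝ) * 2 ^ l = 2 ^ L := by exact_mod_cast hNl
    rw [mul_pow, Real.sq_sqrt (by positivity), ← this]
    ring
  rw [hV, hN]
  push_cast
  ring

/-- Nagaev type inequality for the partial sums of `2 ^ L` consecutive terms. -/
theorem measure_window_le (hf : ∀ i, BddMeas (f i)) (hfi : ∀ i, DependsOn (f i) (Iic i))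
    {Q : ℝ} (hQ : 2 < Q) {β γ : ℕ → ℝ} (hβ : ∀ r, 0 ≤ β r) (hγ : ∀ r, 0 ≤ γ r)
    (hβm : ∀ i r, eLpNorm (lagDiff ν (f i) i r) (ENNReal.ofReal Q) (iid ℤ ν)
      ≤ ENNReal.ofReal (β r))
    (hγm : ∀ i r, eLpNorm (lagDiff ν (f i) i r) (ENNReal.ofReal 2) (iid ℤ ν)
      ≤ ENNReal.ofReal (γ r))
    {b g lam : ℕ → ℝ} (hb : ∀ l, 0 < b l) (hg : ∀ l, 0 < g l) (hlam : ∀ l, 0 < lam l)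
    (hbT : ∀ l, ∑ r ∈ Finset.Ico (2 ^ l / 2) (2 ^ l), β r ≤ b l)
    (hgT : ∀ l, ∑ r ∈ Finset.Ico (2 ^ l / 2) (2 ^ l), γ r ≤ g l)
    {L : ℕ} {ρ : ℝ} (hρ : ∀ R, ∑ r ∈ Finset.Ico (2 ^ L) R, β r ≤ ρ)
    (hsum : ∑ l ∈ Finset.range (L + 1), lam l ≤ 1) {x : ℝ} (hx : 0 < x) (s : ℤ) :
    iid ℤ ν {e | ∃ k ≤ 2 ^ L, 4 * x ≤ |∑ i ∈ Finset.range k,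
        (f (s + i) e - ∫ u, f (s + i) u ∂(iid ℤ ν))|}
      ≤ ENNReal.ofReal ((∑ l ∈ Finset.range (L + 1),
        ((16 * 2 ^ Q + 1) * (2 ^ (L - l) * (Real.sqrt 2 ^ l * (blockConst Q * b l)) ^ Q
          / (lam l * x) ^ Q)
        + 12 * Real.exp (-((lam l * x) ^ 2
            / (12 * Real.exp Q * taylorConst 2 * (2 ^ L * (g l) ^ 2))))))
        + (Real.sqrt 2 ^ L * (blockConst Q * ρ)) ^ Q / (x / 2) ^ Q) := by
  have hρ0 : 0 ≤ ρ := by simpa using hρ 0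
  have hC := one_le_taylorConst hQ.le
  have hC2 := one_le_taylorConst (le_refl (2 : ℝ))
  have hbc : 0 < blockConst Q :=
    (Real.sqrt_pos.2 (by positivity)).trans_le (sqrt_le_blockConst hQ)
  -- Only finitely many lags are treated. The neglected part tends to zero in `L¹`, and `R → ∞` is
  -- taken at the very end.
  let err : ℕ → ℤ → (ℤ → E) → ℝ := fun R i e =>
    ∑ r ∈ Finset.range R, lagDiff ν (f i) i r e - (f i e - ∫ u, f i u ∂(iid ℤ ν))
  have herrb : ∀ R i, BddMeas (err R i) := fun R i =>
    (BddMeas.sum _ fun r _ => lagDiff_bddMeas (hf i) i r).sub ((hf i).sub (BddMeas.const _))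
  let errTot : ℕ → ℝ≥0∞ := fun R =>
    (∑ i ∈ Finset.range (2 ^ L), eLpNorm (err R (s + i)) 1 (iid ℤ ν)) / ENNReal.ofReal (x / 2)
  have hx2 : ENNReal.ofReal (x / 2) ≠ 0 := by simpa using hx
  have herrT : Tendsto errTot atTop (𝓝 0) := by
    have h1 : Tendsto (fun R => ∑ i ∈ Finset.range (2 ^ L), eLpNorm (err R (s + i)) 1 (iid ℤ ν))
        atTop (𝓝 (∑ i ∈ Finset.range (2 ^ L), 0)) :=
      tendsto_finsetSum _ fun i _ => tendsto_eLpNorm_causal (hf _) (hfi _)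
    have h2 := ENNReal.Tendsto.div_const h1 (b := ENNReal.ofReal (x / 2)) (Or.inr hx2)
    simpa using h2
  set bound : ℝ := (∑ l ∈ Finset.range (L + 1),
        ((16 * 2 ^ Q + 1) * (2 ^ (L - l) * (Real.sqrt 2 ^ l * (blockConst Q * b l)) ^ Q
          / (lam l * x) ^ Q)
        + 12 * Real.exp (-((lam l * x) ^ 2
            / (12 * Real.exp Q * taylorConst 2 * (2 ^ L * (g l) ^ 2))))))
        + (Real.sqrt 2 ^ L * (blockConst Q * ρ)) ^ Q / (x / 2) ^ Q with hbound
  have key : ∀ R, 2 ^ L ≤ R → iid ℤ ν {e | ∃ k ≤ 2 ^ L, 4 * x ≤ |∑ i ∈ Finset.range k,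
        (f (s + i) e - ∫ u, f (s + i) u ∂(iid ℤ ν))|} ≤ ENNReal.ofReal bound + errTot R := by
    intro R hR
    set Lv : ℕ → Set (ℤ → E) := fun l => {e | ∃ k ≤ 2 ^ L, 3 * (lam l * x) ≤
      |∑ i ∈ Finset.range k, lagSum ν f (Finset.Ico (2 ^ l / 2) (2 ^ l)) (s + i) e|} with hLv
    set Rm : Set (ℤ → E) := {e | x / 2 ≤ |chainMax (lagSum ν f (Finset.Ico (2 ^ L) R)) L s e|}
      with hRm
    set Er : Set (ℤ → E) := {e | ENNReal.ofReal (x / 2)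
      ≤ ∑ i ∈ Finset.range (2 ^ L), ‖err R (s + i) e‖ₑ} with hEr
    -- Dyadic levels of lags; at `l = 0` the integer division makes the range `[0, 1)`. The levels
    -- are allowed `3 x` in total, lags beyond the window length `x / 2`, and the neglected part `x
    -- / 2`.
    have hdecomp : ∀ i e, f i e - ∫ u, f i u ∂(iid ℤ ν)
        = (∑ l ∈ Finset.range (L + 1), lagSum ν f (Finset.Ico (2 ^ l / 2) (2 ^ l)) i e)
          + lagSum ν f (Finset.Ico (2 ^ L) R) i e - err R i e := by
      intro i e
      have h1 : ∀ M, ∑ l ∈ Finset.range (M + 1), lagSum ν f (Finset.Ico (2 ^ l / 2) (2 ^ l)) i e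
          = ∑ r ∈ Finset.range (2 ^ M), lagDiff ν (f i) i r e := by
        intro M
        induction M with
        | zero => simp [lagSum]
        | succ M ih =>
          rw [Finset.sum_range_succ, ih]
          have : 2 ^ (M + 1) / 2 = 2 ^ M := by rw [pow_succ]; omega
          rw [this]
          unfold lagSum
          exact Finset.sum_range_add_sum_Ico _ (Nat.pow_le_pow_right (by norm_num) (by omega))
      rw [h1]
      have h2 : ∑ r ∈ Finset.range (2 ^ L), lagDiff ν (f i) i r e
          + lagSum ν f (Finset.Ico (2 ^ L) R) i e = ∑ r ∈ Finset.range R, lagDiff ν (f i) i r e :=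
        Finset.sum_range_add_sum_Ico _ hR
      rw [h2]
      simp only [err]
      ring
    have hsub : {e | ∃ k ≤ 2 ^ L, 4 * x ≤ |∑ i ∈ Finset.range k,
        (f (s + i) e - ∫ u, f (s + i) u ∂(iid ℤ ν))|}
        ⊆ ((⋃ l ∈ Finset.range (L + 1), Lv l) ∪ Rm) ∪ Er := by
      intro e he
      by_contra hcon
      simp only [mem_union, not_or, mem_iUnion, not_exists] at hcon
      obtain ⟨⟨hl, hr⟩, her⟩ := hcon
      obtain ⟨k, hk, hkx⟩ := he
      simp only [hdecomp, Finset.sum_sub_distrib, Finset.sum_add_distrib] at hkx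
      rw [Finset.sum_comm] at hkx
      have h1 : |∑ l ∈ Finset.range (L + 1), ∑ i ∈ Finset.range k,
          lagSum ν f (Finset.Ico (2 ^ l / 2) (2 ^ l)) (s + i) e| ≤ 3 * x := by
        refine (Finset.abs_sum_le_sum_abs _ _).trans ?_
        calc _ ≤ ∑ l ∈ Finset.range (L + 1), 3 * (lam l * x) := by
              refine Finset.sum_le_sum fun l hlr => ?_
              have := hl l hlr
              simp only [hLv, mem_ofPred_eq, not_exists, not_and, not_le] at this
              exact (this k hk).le
          _ = 3 * ((∑ l ∈ Finset.range (L + 1), lam l) * x) := by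
              rw [Finset.sum_mul, Finset.mul_sum]
          _ ≤ 3 * x := by nlinarith
      have h2 : |∑ i ∈ Finset.range k, lagSum ν f (Finset.Ico (2 ^ L) R) (s + i) e| < x / 2 := by
        simp only [hRm, mem_ofPred_eq, not_le] at hr
        rw [abs_of_nonneg (chainMax_nonneg _ _ _ _)] at hr
        exact (abs_sum_le_chainMax _ L s e hk).trans_lt hr
      have h3 : |∑ i ∈ Finset.range k, err R (s + i) e| < x / 2 := by
        simp only [hEr, mem_ofPred_eq, not_le] at her
        simp only [Real.enorm_eq_ofReal_abs] at her
        rw [← ENNReal.ofReal_sum_of_nonneg fun i _ => abs_nonneg _,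
          ENNReal.ofReal_lt_ofReal_iff (by positivity)] at her
        refine ((Finset.abs_sum_le_sum_abs _ _).trans ?_).trans_lt her
        exact Finset.sum_le_sum_of_subset_of_nonneg (Finset.range_subset_range.2 hk)
          fun i _ _ => abs_nonneg _
      have h4 := abs_sub (∑ l ∈ Finset.range (L + 1), ∑ i ∈ Finset.range k,
          lagSum ν f (Finset.Ico (2 ^ l / 2) (2 ^ l)) (s + i) e
          + ∑ i ∈ Finset.range k, lagSum ν f (Finset.Ico (2 ^ L) R) (s + i) e)
          (∑ i ∈ Finset.range k, err R (s + i) e)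
      have h5 := abs_add_le (∑ l ∈ Finset.range (L + 1), ∑ i ∈ Finset.range k,
          lagSum ν f (Finset.Ico (2 ^ l / 2) (2 ^ l)) (s + i) e)
          (∑ i ∈ Finset.range k, lagSum ν f (Finset.Ico (2 ^ L) R) (s + i) e)
      linarith
    have hLvle : iid ℤ ν (⋃ l ∈ Finset.range (L + 1), Lv l) ≤ ENNReal.ofReal
        (∑ l ∈ Finset.range (L + 1),
        ((16 * 2 ^ Q + 1) * (2 ^ (L - l) * (Real.sqrt 2 ^ l * (blockConst Q * b l)) ^ Q
          / (lam l * x) ^ Q)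
        + 12 * Real.exp (-((lam l * x) ^ 2
            / (12 * Real.exp Q * taylorConst 2 * (2 ^ L * (g l) ^ 2)))))) := by
      refine (measure_biUnion_finset_le _ _).trans ?_
      rw [ENNReal.ofReal_sum_of_nonneg fun l _ => by
        have := hb l; have := hlam l; positivity]
      refine Finset.sum_le_sum fun l hl => ?_
      exact measure_level_le hf hQ (by have := Finset.mem_range.1 hl; omega)
        (fun r hr => (Finset.mem_Ico.1 hr).2) hβ hγ hβm hγm (hb l) (hg l) (hbT l) (hgT l)
        (mul_pos (hlam l) hx) s
    have hRmle : iid ℤ ν Rm ≤ ENNReal.ofReal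
        ((Real.sqrt 2 ^ L * (blockConst Q * ρ)) ^ Q / (x / 2) ^ Q) := by
      have h1 := eLpNorm_chainMax_le (μ := iid ℤ ν) hQ (by positivity)
        (fun i => lagSum_bddMeas hf (Finset.Ico (2 ^ L) R) i)
        (eLpNorm_lagSum_sum_le hf hQ.le hβ hβm (Finset.Ico (2 ^ L) R) (hρ R)) L s
      have h2 : chainConst Q * (Real.sqrt 2 ^ L * (Real.sqrt (3 * taylorConst Q) * ρ))
          = Real.sqrt 2 ^ L * (blockConst Q * ρ) := by unfold blockConst; ring
      rw [h2] at h1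
      exact measure_lt_chain_le (by linarith) (by positivity) (by positivity)
        (chainMax_bddMeas (fun i => lagSum_bddMeas hf _ i) L _) h1
    have hErle : iid ℤ ν Er ≤ errTot R := by
      have h1 := meas_ge_le_lintegral_div (μ := iid ℤ ν)
        (f := fun e => ∑ i ∈ Finset.range (2 ^ L), ‖err R (s + i) e‖ₑ)
        (Finset.measurable_sum _ fun (i : ℕ) _ => (herrb R (s + i)).meas.enorm).aemeasurable
        hx2 ENNReal.ofReal_ne_top
      rw [lintegral_finsetSum _ fun (i : ℕ) _ => (herrb R (s + i)).meas.enorm] at h1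
      simpa only [errTot, eLpNorm_one_eq_lintegral_enorm] using h1
    refine (measure_mono hsub).trans ((measure_union_le _ _).trans (add_le_add
      ((measure_union_le _ _).trans ((add_le_add hLvle hRmle).trans (le_of_eq ?_))) hErle))
    rw [← ENNReal.ofReal_add (Finset.sum_nonneg fun l _ => by
      have := hb l; have := hlam l; positivity) (by positivity)]
  have hlim : Tendsto (fun R => ENNReal.ofReal bound + errTot R) atTop
      (𝓝 (ENNReal.ofReal bound + 0)) := tendsto_const_nhds.add herrT
  rw [add_zero] at hlim
  refine ge_of_tendsto hlim ?_
  filter_upwards [eventually_ge_atTop (2 ^ L)] with R hR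
  exact key R hR

end

/-! ### Causal processes as functions of an i.i.d. sequence -/

/-- Truncation at the levels `±T`. -/
def clip (T x : ℝ) : ℝ := max (-T) (min x T)

theorem continuous_clip (T : ℝ) : Continuous (clip T) := by unfold clip; fun_prop

theorem abs_clip_le {T : ℝ} (hT : 0 ≤ T) (x : ℝ) : |clip T x| ≤ T := by
  unfold clip
  rw [abs_le]
  exact ⟨le_max_left _ _, max_le (by linarith) (min_le_right _ _)⟩

theorem clip_eq_self {T x : ℝ} (hx : |x| ≤ T) : clip T x = x := by
  have := abs_le.1 hx
  unfold clip
  rw [min_eq_left this.2, max_eq_right this.1]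

theorem abs_clip_sub_clip_le (T x y : ℝ) : |clip T x - clip T y| ≤ |x - y| := by
  unfold clip
  refine (abs_max_sub_max_le_max _ _ _ _).trans ?_
  rw [sub_self, abs_zero]
  refine max_le (abs_nonneg _) ((abs_min_sub_min_le_max _ _ _ _).trans ?_)
  simp

theorem clip_zero {T : ℝ} (hT : 0 ≤ T) : clip T 0 = 0 := clip_eq_self (by simpa using hT)

theorem abs_clip_le_abs {T : ℝ} (hT : 0 ≤ T) (x : ℝ) : |clip T x| ≤ |x| := by
  simpa [clip_zero hT] using abs_clip_sub_clip_le T x 0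

namespace CausalProcess

variable {Ω : Type*} [MeasurableSpace Ω] {μ : Measure Ω} [IsProbabilityMeasure μ] {p : ℕ}
  (P : CausalProcess μ p)

/-- The law of the innovations. -/
def law : Measure (Fin p → ℝ) := μ.map (P.ε 0)

instance isProbabilityMeasure_law : IsProbabilityMeasure P.law :=
  Measure.isProbabilityMeasure_map (P.measurable_ε 0).aemeasurable

/-- The sequence of innovations. -/
def innov (ω : Ω) (i : ℤ) : Fin p → ℝ := P.ε i ω

/-- `X°_i(t)` as a function of the innovation sequence. -/
def seqX (i : ℤ) (t : ℝ) (e : ℤ → Fin p → ℝ) : Fin p → ℝ := P.H (fun k : ℕ => e (i - k)) t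

theorem X_eq_seqX (i : ℤ) (t : ℝ) (ω : Ω) : P.X i t ω = P.seqX i t (P.innov ω) := rfl

theorem measurable_seqX (i : ℤ) (t : ℝ) : Measurable (P.seqX i t) :=
  P.measurable_H.comp ((by fun_prop : Measurable fun e : ℤ → Fin p → ℝ =>
    ((fun k : ℕ => e (i - k)), t)))

theorem dependsOn_seqX (i : ℤ) (t : ℝ) : DependsOn (P.seqX i t) (Iic i) := by
  intro e e' h
  unfold seqX
  congr 1
  ext k : 1
  exact h _ (by simp)

/-- This moves all questions to the canonical i.i.d. space, where conditional expectations are plain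
integrals and shifts preserve the measure. -/
theorem measurePreserving_innov_pair :
    MeasurePreserving (fun ω => (P.innov ω, fun i => P.ε' i ω)) μ
      ((iid ℤ P.law).prod (iid ℤ P.law)) := by
  have hm : ∀ s : ℤ ⊕ ℤ, Measurable (Sum.elim P.ε P.ε' s) := by
    rintro (i | i)
    · exact P.measurable_ε i
    · exact P.measurable_ε' i
  have h1 := P.indep.map_fun_eq_infinitePi_map hm
  have h2 : (fun s => μ.map (Sum.elim P.ε P.ε' s)) = fun _ => P.law := by
    ext1 s
    rcases s with i | i
    · exact (P.identDistrib_ε i).map_eq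
    · exact (P.identDistrib_ε' i).map_eq
  rw [h2] at h1
  have h3 : MeasurePreserving (fun ω s => Sum.elim P.ε P.ε' s ω) μ (iid (ℤ ⊕ ℤ) P.law) :=
    ⟨measurable_pi_iff.2 hm, h1⟩
  exact (measurePreserving_sumSplit (ι := ℤ) (κ := ℤ) P.law).comp h3

theorem measurePreserving_innov : MeasurePreserving P.innov μ (iid ℤ P.law) :=
  measurePreserving_fst.comp P.measurePreserving_innov_pair

theorem XCoupled_eq (m : ℕ) (t : ℝ) (ω : Ω) :
    P.XCoupled 0 m t ω
      = P.seqX 0 t (Function.update (P.innov ω) (0 - m : ℤ) (P.ε' (0 - m) ω)) := by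
  unfold XCoupled seqX pastCoupled
  congr 1
  ext k : 1
  by_cases h : k = m
  · subst h; simp
  · have : (0 - k : ℤ) ≠ 0 - m := by omega
    rw [Function.update_of_ne h, Function.update_of_ne this]
    rfl

theorem measurePreserving_shift (i : ℤ) :
    MeasurePreserving (fun (e : ℤ → Fin p → ℝ) j => e (j + i)) (iid ℤ P.law) (iid ℤ P.law) :=
  measurePreserving_reindex P.law (add_left_injective i)

theorem seqX_shift (i : ℤ) (t : ℝ) (e : ℤ → Fin p → ℝ) :
    P.seqX 0 t (fun j => e (j + i)) = P.seqX i t e := by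
  have : (fun k : ℕ => e (0 - (k : ℤ) + i)) = fun k : ℕ => e (i - k) :=
    funext fun k => congrArg e (by ring)
  unfold seqX
  exact congrArg (fun x => P.H x t) this

theorem measurable_update (k : ℤ) : Measurable fun e : (ℤ → Fin p → ℝ) × (ℤ → Fin p → ℝ) =>
    Function.update e.1 k (e.2 k) := by
  refine measurable_pi_iff.2 fun i => ?_
  by_cases h : i = k
  · subst h; simp only [Function.update_self]; fun_prop
  · simp only [Function.update_of_ne h]; fun_prop

theorem measurePreserving_update (k : ℤ) :
    MeasurePreserving (fun e : (ℤ → Fin p → ℝ) × (ℤ → Fin p → ℝ) =>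
      Function.update e.1 k (e.2 k)) ((iid ℤ P.law).prod (iid ℤ P.law)) (iid ℤ P.law) := by
  classical
  convert measurePreserving_piecewise P.law ({k}ᶜ : Set ℤ) using 1
  funext e
  ext i
  by_cases h : i = k
  · subst h; simp
  · simp [h]

/-- The dependence measure is defined at time zero; shift invariance of the i.i.d. law carries it to
every time. -/
theorem eLpNorm_seqX_sub_update_le {a : ℝ} (j : Fin p) (r : ℕ) (i : ℤ) {t : ℝ}
    (ht : t ∈ Icc (0 : ℝ) 1) :
    eLpNorm (fun e : (ℤ → Fin p → ℝ) × (ℤ → Fin p → ℝ) =>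
      P.seqX i t e.1 j - P.seqX i t (Function.update e.1 (i - r : ℤ) (e.2 (i - r))) j)
      (ENNReal.ofReal a) ((iid ℤ P.law).prod (iid ℤ P.law)) ≤ P.theta a j r := by
  set G : (ℤ → Fin p → ℝ) × (ℤ → Fin p → ℝ) → ℝ := fun e =>
    P.seqX 0 t e.1 j - P.seqX 0 t (Function.update e.1 (0 - r : ℤ) (e.2 (0 - r))) j with hG
  have hGm : Measurable G :=
    ((measurable_pi_apply j).comp ((P.measurable_seqX 0 t).comp measurable_fst)).sub
      ((measurable_pi_apply j).comp ((P.measurable_seqX 0 t).comp (measurable_update _)))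
  have h1 : eLpNorm G (ENNReal.ofReal a) ((iid ℤ P.law).prod (iid ℤ P.law)) ≤ P.theta a j r := by
    rw [← eLpNorm_comp_measurePreserving hGm.aestronglyMeasurable P.measurePreserving_innov_pair]
    refine le_trans (le_of_eq ?_) (le_iSup₂ (f := fun t (_ : t ∈ Icc (0 : ℝ) 1) =>
      eLpNorm (fun ω => P.X 0 t ω j - P.XCoupled 0 r t ω j) (ENNReal.ofReal a) μ) t ht)
    congr 1
    ext ω
    simp only [XCoupled_eq, X_eq_seqX, hG, Function.comp]
  have hs := (P.measurePreserving_shift i).prod (P.measurePreserving_shift i)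
  rw [← eLpNorm_comp_measurePreserving hGm.aestronglyMeasurable hs] at h1
  refine le_trans (le_of_eq ?_) h1
  congr 1
  ext e
  have hup : (Function.update (fun l => e.1 (l + i)) (0 - r : ℤ) (e.2 (0 - r + i)))
      = fun l => Function.update e.1 (i - r : ℤ) (e.2 (i - r)) (l + i) := by
    ext k : 1
    have h0 : (0 - (r : ℤ) + i) = i - r := by ring
    by_cases h : k = 0 - (r : ℤ)
    · subst h
      rw [h0, Function.update_self, Function.update_self]
    · have : k + i ≠ i - r := by omega
      rw [Function.update_of_ne h, Function.update_of_ne this]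
  simp only [hG, Function.comp, Prod.map, hup, seqX_shift]

theorem eLpNorm_seqX (a : ℝ≥0∞) (j : Fin p) (i : ℤ) (t : ℝ) :
    eLpNorm (fun e => P.seqX i t e j) a (iid ℤ P.law) = eLpNorm (fun ω => P.X 0 t ω j) a μ := by
  have hm : Measurable fun e => P.seqX 0 t e j :=
    (measurable_pi_apply j).comp (P.measurable_seqX 0 t)
  have h1 := eLpNorm_comp_measurePreserving (p := a) hm.aestronglyMeasurable
    (P.measurePreserving_shift i)
  have h2 := eLpNorm_comp_measurePreserving (p := a) hm.aestronglyMeasurable P.measurePreserving_innov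
  rw [← h1] at h2
  rw [show (fun ω => P.X 0 t ω j) = (fun e => P.seqX 0 t e j) ∘ P.innov from rfl, h2]
  congr 1
  ext e
  simp only [Function.comp, seqX_shift]

theorem measurable_X (i : ℤ) (t : ℝ) (j : Fin p) : Measurable fun ω => P.X i t ω j :=
  ((measurable_pi_apply j).comp (P.measurable_seqX i t)).comp P.measurePreserving_innov.measurable

variable {P}

theorem Dependence.lintegral_le {q A ν : ℝ} (h : P.Dependence q A ν) {t : ℝ}
    (ht : t ∈ Icc (0 : ℝ) 1) (j : Fin p) :
    ∫⁻ ω, ‖P.X 0 t ω j‖ₑ ^ (2 * q) ∂μ ≤ ENNReal.ofReal ν :=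
  (le_iSup (fun j => ∫⁻ ω, ‖P.X 0 t ω j‖ₑ ^ (2 * q) ∂μ) j).trans
    ((le_iSup₂ (f := fun t (_ : t ∈ Icc (0 : ℝ) 1) =>
      ⨆ j : Fin p, ∫⁻ ω, ‖P.X 0 t ω j‖ₑ ^ (2 * q) ∂μ) t ht).trans h.moment_le)

/-- The bound `max ν 1` is crude but avoids the root: a number that is at least one dominates its
powers with exponent at most one. -/
theorem Dependence.eLpNorm_le {q A ν : ℝ} (hq : 2 < q) (h : P.Dependence q A ν) {t : ℝ}
    (ht : t ∈ Icc (0 : ℝ) 1) (j : Fin p) {a : ℝ} (ha : a ≤ 2 * q) :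
    eLpNorm (fun ω => P.X 0 t ω j) (ENNReal.ofReal a) μ ≤ ENNReal.ofReal (max ν 1) := by
  refine (eLpNorm_le_eLpNorm_of_exponent_le (ENNReal.ofReal_le_ofReal ha)
    (P.measurable_X 0 t j).aestronglyMeasurable).trans ?_
  have hne : ENNReal.ofReal (2 * q) ≠ 0 := by
    simp only [ne_eq, ENNReal.ofReal_eq_zero, not_le]; linarith
  rw [eLpNorm_eq_lintegral_rpow_enorm_toReal hne ENNReal.ofReal_ne_top,
    ENNReal.toReal_ofReal (by linarith)]
  have h1 : ∫⁻ ω, ‖P.X 0 t ω j‖ₑ ^ (2 * q) ∂μ ≤ ENNReal.ofReal (max ν 1) :=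
    (h.lintegral_le ht j).trans (ENNReal.ofReal_le_ofReal (le_max_left _ _))
  refine (ENNReal.rpow_le_rpow h1 (by positivity)).trans ?_
  have h2 : (1 : ℝ≥0∞) ≤ ENNReal.ofReal (max ν 1) := by
    rw [← ENNReal.ofReal_one]; exact ENNReal.ofReal_le_ofReal (le_max_right _ _)
  calc _ ≤ ENNReal.ofReal (max ν 1) ^ (1 : ℝ) := by
        apply ENNReal.rpow_le_rpow_of_exponent_le h2
        rw [div_le_one (by linarith)]
        linarith
    _ = _ := ENNReal.rpow_one _

variable (P)

/-- The truncated product `X_{ij}(t) X_{ik}(t)`. -/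
def clipProd (T : ℝ) (t : ℝ) (j k : Fin p) (i : ℤ) (e : ℤ → Fin p → ℝ) : ℝ :=
  clip T (P.seqX i t e j) * clip T (P.seqX i t e k)

theorem bddMeas_clip {T : ℝ} (hT : 0 ≤ T) (i : ℤ) (t : ℝ) (j : Fin p) :
    BddMeas fun e => clip T (P.seqX i t e j) :=
  ⟨(continuous_clip T).measurable.comp ((measurable_pi_apply j).comp (P.measurable_seqX i t)),
    T, fun _ => abs_clip_le hT _⟩

theorem bddMeas_clipProd {T : ℝ} (hT : 0 ≤ T) (t : ℝ) (j k : Fin p) (i : ℤ) :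
    BddMeas (P.clipProd T t j k i) := (P.bddMeas_clip hT i t j).mul (P.bddMeas_clip hT i t k)

theorem abs_clipProd_le {T : ℝ} (hT : 0 ≤ T) (t : ℝ) (j k : Fin p) (i : ℤ)
    (e : ℤ → Fin p → ℝ) : |P.clipProd T t j k i e| ≤ T ^ 2 := by
  unfold clipProd
  rw [abs_mul, sq]
  exact mul_le_mul (abs_clip_le hT _) (abs_clip_le hT _) (abs_nonneg _) hT

theorem dependsOn_clipProd (T t : ℝ) (j k : Fin p) (i : ℤ) :
    DependsOn (P.clipProd T t j k i) (Iic i) := fun e e' h => by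
  unfold clipProd
  rw [P.dependsOn_seqX i t h]

/-- Lag bounds for the truncated components. -/
theorem eLpNorm_lagDiff_clip_le {T : ℝ} (hT : 0 ≤ T) {a : ℝ} (ha : 1 ≤ a) (j : Fin p) (r : ℕ)
    (i : ℤ) {t : ℝ} (ht : t ∈ Icc (0 : ℝ) 1) :
    eLpNorm (lagDiff P.law (fun e => clip T (P.seqX i t e j)) i r) (ENNReal.ofReal a)
      (iid ℤ P.law) ≤ P.theta a j r := by
  rw [lagDiff_eq]
  refine (eLpNorm_condOn_sub_le (P.bddMeas_clip hT i t j) (by simp) ha).trans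
    (le_trans (eLpNorm_mono fun e => ?_) (P.eLpNorm_seqX_sub_update_le j r i ht))
  simp only [Real.norm_eq_abs]
  convert abs_clip_sub_clip_le T (P.seqX i t e.1 j) _

/-- Effect of the replacement of one innovation on a truncated product. -/
theorem eLpNorm_clipProd_sub_update_le {T : ℝ} (hT : 0 ≤ T) {a κ : ℝ} (ha : 1 ≤ a)
    (j k : Fin p) (r : ℕ) (i : ℤ) {t : ℝ} (ht : t ∈ Icc (0 : ℝ) 1)
    (hj : eLpNorm (fun ω => P.X 0 t ω j) (ENNReal.ofReal (2 * a)) μ ≤ ENNReal.ofReal κ)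
    (hk : eLpNorm (fun ω => P.X 0 t ω k) (ENNReal.ofReal (2 * a)) μ ≤ ENNReal.ofReal κ) :
    eLpNorm (fun e : (ℤ → Fin p → ℝ) × (ℤ → Fin p → ℝ) => P.clipProd T t j k i e.1
        - P.clipProd T t j k i (Function.update e.1 (i - r : ℤ) (e.2 (i - r))))
      (ENNReal.ofReal a) ((iid ℤ P.law).prod (iid ℤ P.law))
      ≤ ENNReal.ofReal κ * (P.theta (2 * a) j r + P.theta (2 * a) k r) := by
  set M2 := (iid ℤ P.law).prod (iid ℤ P.law) with hM2
  have : ENNReal.HolderTriple (ENNReal.ofReal (2 * a)) (ENNReal.ofReal (2 * a))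
      (ENNReal.ofReal a) := by
    constructor
    rw [← ENNReal.ofReal_inv_of_pos (by linarith), ← ENNReal.ofReal_inv_of_pos (by linarith),
      ← ENNReal.ofReal_add (by positivity) (by positivity)]
    congr 1
    field_simp
    norm_num
  let U : (ℤ → Fin p → ℝ) × (ℤ → Fin p → ℝ) → ℤ → Fin p → ℝ := fun e =>
    Function.update e.1 (i - r : ℤ) (e.2 (i - r))
  have hU : MeasurePreserving U M2 (iid ℤ P.law) := P.measurePreserving_update (i - r)
  have hc1 : ∀ j, BddMeas fun e : (ℤ → Fin p → ℝ) × (ℤ → Fin p → ℝ) =>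
      clip T (P.seqX i t e.1 j) := fun j => (P.bddMeas_clip hT i t j).comp measurable_fst
  have hc2 : ∀ j, BddMeas fun e => clip T (P.seqX i t (U e) j) := fun j =>
    (P.bddMeas_clip hT i t j).comp hU.measurable
  have hdiff : ∀ j, eLpNorm (fun e => clip T (P.seqX i t e.1 j) - clip T (P.seqX i t (U e) j))
      (ENNReal.ofReal (2 * a)) M2 ≤ P.theta (2 * a) j r := fun j =>
    (eLpNorm_mono fun e => by
      simp only [Real.norm_eq_abs]
      exact abs_clip_sub_clip_le T (P.seqX i t e.1 j) (P.seqX i t (U e) j)).trans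
      (P.eLpNorm_seqX_sub_update_le j r i ht)
  have hn1 : eLpNorm (fun e : (ℤ → Fin p → ℝ) × (ℤ → Fin p → ℝ) => clip T (P.seqX i t e.1 j))
      (ENNReal.ofReal (2 * a)) M2 ≤ ENNReal.ofReal κ := by
    have h1 := eLpNorm_comp_measurePreserving (p := ENNReal.ofReal (2 * a))
      (P.bddMeas_clip hT i t j).meas.aestronglyMeasurable
      (measurePreserving_fst (μ := iid ℤ P.law) (ν := iid ℤ P.law))
    refine (le_of_eq h1).trans ((eLpNorm_mono fun e => ?_).trans
      ((le_of_eq (P.eLpNorm_seqX _ j i t)).trans hj))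
    exact abs_clip_le_abs hT _
  have hn2 : eLpNorm (fun e => clip T (P.seqX i t (U e) k))
      (ENNReal.ofReal (2 * a)) M2 ≤ ENNReal.ofReal κ := by
    have h1 := eLpNorm_comp_measurePreserving (p := ENNReal.ofReal (2 * a))
      (P.bddMeas_clip hT i t k).meas.aestronglyMeasurable hU
    refine (le_of_eq h1).trans ((eLpNorm_mono fun e => ?_).trans
      ((le_of_eq (P.eLpNorm_seqX _ k i t)).trans hk))
    exact abs_clip_le_abs hT _
  -- The product rule `x y - x' y' = x (y - y') + (x - x') y'`. Hölder's inequality then doubles the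
  -- exponent, which is why products at exponent `a` need the process at `2 a`.
  have hsplit : (fun e : (ℤ → Fin p → ℝ) × (ℤ → Fin p → ℝ) => P.clipProd T t j k i e.1
        - P.clipProd T t j k i (U e))
      = (fun e => clip T (P.seqX i t e.1 j)
          * (clip T (P.seqX i t e.1 k) - clip T (P.seqX i t (U e) k)))
        + fun e => (clip T (P.seqX i t e.1 j) - clip T (P.seqX i t (U e) j))
          * clip T (P.seqX i t (U e) k) := by
    ext e
    simp only [clipProd, Pi.add_apply]
    ring
  rw [hsplit]
  refine (eLpNorm_add_le ((hc1 j).mul ((hc1 k).sub (hc2 k))).meas.aestronglyMeasurable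
    (((hc1 j).sub (hc2 j)).mul (hc2 k)).meas.aestronglyMeasurable
    (by rw [← ENNReal.ofReal_one]; exact ENNReal.ofReal_le_ofReal ha)).trans ?_
  rw [mul_add, add_comm]
  have hmul : ∀ x y : ℝ, ‖x * y‖ ≤ ((1 : ℝ≥0) : ℝ) * ‖x‖ * ‖y‖ := fun x y => by simp
  refine add_le_add ?_ ?_
  · refine (eLpNorm_le_eLpNorm_mul_eLpNorm'_of_norm (p := ENNReal.ofReal (2 * a))
      (q := ENNReal.ofReal (2 * a)) ((hc1 j).sub (hc2 j)).meas.aestronglyMeasurable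
      (hc2 k).meas.aestronglyMeasurable (fun x y => x * y) 1
      (ae_of_all _ fun e => hmul _ _)).trans ?_
    rw [ENNReal.coe_one, one_mul, mul_comm]
    exact mul_le_mul' hn2 (hdiff j)
  · refine (eLpNorm_le_eLpNorm_mul_eLpNorm'_of_norm (p := ENNReal.ofReal (2 * a))
      (q := ENNReal.ofReal (2 * a)) (hc1 j).meas.aestronglyMeasurable
      ((hc1 k).sub (hc2 k)).meas.aestronglyMeasurable (fun x y => x * y) 1
      (ae_of_all _ fun e => hmul _ _)).trans ?_
    rw [ENNReal.coe_one, one_mul]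
    exact mul_le_mul' hn1 (hdiff k)

/-- A centred component is bounded in norm by its cumulative dependence measure. -/
theorem eLpNorm_X_le_Theta {a : ℝ} (ha : 1 ≤ a) (j : Fin p) {t : ℝ} (ht : t ∈ Icc (0 : ℝ) 1)
    (hint : Integrable (fun ω => P.X 0 t ω j) μ) (hmean : ∫ ω, P.X 0 t ω j ∂μ = 0) :
    eLpNorm (fun ω => P.X 0 t ω j) (ENNReal.ofReal a) μ ≤ P.Theta a j 0 := by
  have ha1 : (1 : ℝ≥0∞) ≤ ENNReal.ofReal a := by
    rw [← ENNReal.ofReal_one]; exact ENNReal.ofReal_le_ofReal ha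
  have hm : Measurable fun e => P.seqX 0 t e j :=
    (measurable_pi_apply j).comp (P.measurable_seqX 0 t)
  have hint' : Integrable (fun e => P.seqX 0 t e j) (iid ℤ P.law) := by
    rw [← P.measurePreserving_innov.map_eq, integrable_map_measure hm.aestronglyMeasurable
      P.measurePreserving_innov.measurable.aemeasurable]
    exact hint
  have hmean' : ∫ e, P.seqX 0 t e j ∂(iid ℤ P.law) = 0 := by
    rw [← P.measurePreserving_innov.map_eq, integral_map
      P.measurePreserving_innov.measurable.aemeasurable hm.aestronglyMeasurable]
    exact hmean
  -- The centred truncated component is the `L¹` limit of its sums over lags, whose norms are at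
  -- most the cumulative dependence measure. Lower semicontinuity of the norm is used along the lags
  -- here, and along `N → ∞` below.
  have hclip : ∀ N : ℕ, eLpNorm (fun e => clip N (P.seqX 0 t e j)
      - ∫ u, clip N (P.seqX 0 t u j) ∂(iid ℤ P.law)) (ENNReal.ofReal a) (iid ℤ P.law)
      ≤ P.Theta a j 0 := by
    intro N
    have hb := P.bddMeas_clip (Nat.cast_nonneg N) 0 t j
    have hdep : DependsOn (fun e => clip N (P.seqX 0 t e j)) (Iic 0) := fun e e' h => by
      show clip N (P.seqX 0 t e j) = clip N (P.seqX 0 t e' j)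
      rw [P.dependsOn_seqX 0 t h]
    have hL := fun R => (BddMeas.sum (Finset.range R) fun r _ =>
      lagDiff_bddMeas (ν := P.law) hb 0 r).meas.aestronglyMeasurable (μ := iid ℤ P.law)
    have htend := tendsto_eLpNorm_causal (ν := P.law) hb hdep
    have hmeasure := tendstoInMeasure_of_tendsto_eLpNorm (μ := iid ℤ P.law) one_ne_zero
      hL (hb.sub (BddMeas.const _)).meas.aestronglyMeasurable htend
    refine eLpNorm_le_of_tendstoInMeasure (u := atTop) (.of_forall fun R => ?_) hmeasure hL
    have heq : (fun e => ∑ r ∈ Finset.range R,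
        lagDiff P.law (fun e => clip N (P.seqX 0 t e j)) 0 r e)
        = ∑ r ∈ Finset.range R, lagDiff P.law (fun e => clip N (P.seqX 0 t e j)) 0 r := by
      ext e; simp
    rw [heq]
    refine (eLpNorm_sum_le (fun r _ => (lagDiff_bddMeas hb 0 r).meas.aestronglyMeasurable)
      ha1).trans ((Finset.sum_le_sum fun r _ =>
        P.eLpNorm_lagDiff_clip_le (Nat.cast_nonneg N) ha j r 0 ht).trans ?_)
    unfold Theta
    simp only [zero_add]
    exact ENNReal.sum_le_tsum _
  rw [← P.eLpNorm_seqX _ j 0 t]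
  have hpt : ∀ e, Tendsto (fun N : ℕ => clip N (P.seqX 0 t e j)) atTop (𝓝 (P.seqX 0 t e j)) := by
    intro e
    refine tendsto_const_nhds.congr' ?_
    filter_upwards [eventually_ge_atTop ⌈|P.seqX 0 t e j|⌉₊] with N hN
    exact (clip_eq_self (Nat.ceil_le.1 hN)).symm
  have hI : Tendsto (fun N : ℕ => ∫ u, clip N (P.seqX 0 t u j) ∂(iid ℤ P.law)) atTop
      (𝓝 (∫ u, P.seqX 0 t u j ∂(iid ℤ P.law))) :=
    tendsto_integral_of_dominated_convergence (fun e => ‖P.seqX 0 t e j‖)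
      (fun N => (P.bddMeas_clip (Nat.cast_nonneg N) 0 t j).meas.aestronglyMeasurable) hint'.norm
      (fun N => ae_of_all _ fun e => abs_clip_le_abs (Nat.cast_nonneg N) _)
      (ae_of_all _ hpt)
  rw [hmean'] at hI
  have hmeasN : ∀ N : ℕ, AEStronglyMeasurable (fun e => clip N (P.seqX 0 t e j)
      - ∫ u, clip N (P.seqX 0 t u j) ∂(iid ℤ P.law)) (iid ℤ P.law) := fun N =>
    ((P.bddMeas_clip (Nat.cast_nonneg N) 0 t j).sub (BddMeas.const _)).meas.aestronglyMeasurable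
  refine eLpNorm_le_of_tendstoInMeasure (u := atTop) (.of_forall hclip)
    (tendstoInMeasure_of_tendsto_ae hmeasN (ae_of_all _ fun e => ?_)) hmeasN
  simpa using (hpt e).sub hI

end CausalProcess

/-! ### Weights of the dyadic levels -/

/-- Order of `∑_{l ≤ L} z^l` up to powers of `L` at `z = 1`. -/
def levelFactor (z Q : ℝ) (L : ℕ) : ℝ :=
  if z < 1 then 1 else if z = 1 then ((L : ℝ) + 1) ^ (Q + 1) else z ^ L

theorem exists_ratio {v y Q : ℝ} (hv : 0 < v) (hv1 : v < 1) (hy : 0 < y) (hy1 : y < 1)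
    (hQ : 0 < Q) : ∃ ρ : ℝ, 0 < ρ ∧ ρ < 1 ∧ v ≤ ρ ^ 2 ∧ y ≤ ρ ^ Q := by
  refine ⟨max (Real.sqrt v) (y ^ (1 / Q)), lt_max_of_lt_left (Real.sqrt_pos.2 hv),
    max_lt ?_ (Real.rpow_lt_one hy.le hy1 (by positivity)), ?_, ?_⟩
  · rw [Real.sqrt_lt' one_pos]; simpa using hv1
  · calc v = Real.sqrt v ^ 2 := (Real.sq_sqrt hv.le).symm
      _ ≤ _ := by gcongr; exact le_max_left _ _
  · calc y = (y ^ (1 / Q)) ^ Q := by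
          rw [← Real.rpow_mul hy.le, one_div_mul_cancel hQ.ne', Real.rpow_one]
      _ ≤ _ := by gcongr; exact le_max_right _ _

theorem sum_pow_le {ρ : ℝ} (h0 : 0 ≤ ρ) (h1 : ρ < 1) (n : ℕ) :
    ∑ l ∈ Finset.range n, ρ ^ l ≤ (1 - ρ)⁻¹ :=
  (Summable.sum_le_tsum _ (fun _ _ => by positivity)
    (summable_geometric_of_lt_one h0 h1)).trans_eq (tsum_geometric_of_lt_one h0 h1)

theorem sum_pow_sub_le {ρ : ℝ} (h0 : 0 ≤ ρ) (h1 : ρ < 1) (L : ℕ) :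
    ∑ l ∈ Finset.range (L + 1), ρ ^ (L - l) ≤ (1 - ρ)⁻¹ := by
  have := Finset.sum_range_reflect (fun l => ρ ^ l) (L + 1)
  simp only [Nat.add_sub_cancel] at this
  rw [this]
  exact sum_pow_le h0 h1 _

/-- The weights superpose a profile decaying from the left (for `z < 1`), one decaying towards the
left (for `z > 1`) and a uniform one (for `z = 1`). The auxiliary `y`, the root of `z` or its
inverse, is the ratio of the series that remains after division by `lam l ^ Q`. The left profile is
present in all cases and secures `c v^l ≤ lam l²` for the Gaussian terms. -/
theorem exists_level_weights {z v Q : ℝ} (hz : 0 < z) (hv : 0 < v) (hv1 : v < 1) (hQ : 0 < Q) :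
    ∃ C c : ℝ, 0 < C ∧ 0 < c ∧ ∀ L : ℕ, ∃ lam : ℕ → ℝ, (∀ l, 0 < lam l) ∧
      ∑ l ∈ Finset.range (L + 1), lam l ≤ 1 ∧ (∀ l, c * v ^ l ≤ lam l ^ 2) ∧
      ∑ l ∈ Finset.range (L + 1), z ^ l / lam l ^ Q ≤ C * levelFactor z Q L := by
  obtain ⟨y, hy, hy1, hyz, hyz'⟩ : ∃ y : ℝ, 0 < y ∧ y < 1 ∧ (z < 1 → y = Real.sqrt z) ∧
      (1 < z → y = (Real.sqrt z)⁻¹) := by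
    rcases lt_trichotomy z 1 with h | h | h
    · refine ⟨Real.sqrt z, Real.sqrt_pos.2 hz, ?_, fun _ => rfl, fun h' => absurd h h'.not_gt⟩
      rw [Real.sqrt_lt' one_pos]; simpa using h
    · exact ⟨1 / 2, by norm_num, by norm_num, fun h' => absurd h h'.ne, fun h' => absurd h h'.ne'⟩
    · refine ⟨(Real.sqrt z)⁻¹, inv_pos.2 (Real.sqrt_pos.2 hz), ?_,
        fun h' => absurd h h'.not_gt, fun _ => rfl⟩
      exact inv_lt_one_of_one_lt₀ (Real.lt_sqrt_of_sq_lt (by simpa using h))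
  obtain ⟨ρ, hρ, hρ1, hρv, hρy⟩ := exists_ratio hv hv1 hy hy1 hQ
  set c : ℝ := (2 * (1 - ρ)⁻¹ + 1)⁻¹ with hc
  have h1ρ : 0 < (1 - ρ)⁻¹ := inv_pos.2 (by linarith)
  have hcpos : 0 < c := by positivity
  have hcQ : 0 < c ^ Q := by positivity
  refine ⟨(c ^ Q)⁻¹ * (1 + (1 - y)⁻¹), c ^ 2, by have : 0 < 1 - y := by linarith
                                                 positivity, by positivity, fun L =>
    ⟨fun l => c * (ρ ^ l + ρ ^ (L - l) + 1 / ((L : ℝ) + 1)), fun l => by positivity, ?_, ?_, ?_⟩⟩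
  · rw [← Finset.mul_sum, Finset.sum_add_distrib, Finset.sum_add_distrib, hc]
    rw [inv_mul_le_iff₀ (by positivity), mul_one]
    have h1 := sum_pow_le hρ.le hρ1 (L + 1)
    have h2 := sum_pow_sub_le hρ.le hρ1 L
    have h3 : ∑ _l ∈ Finset.range (L + 1), 1 / ((L : ℝ) + 1) = 1 := by
      rw [Finset.sum_const, Finset.card_range, nsmul_eq_mul]
      push_cast
      field_simp
    linarith
  · intro l
    calc c ^ 2 * v ^ l ≤ c ^ 2 * (ρ ^ 2) ^ l := by gcongr
      _ = (c * ρ ^ l) ^ 2 := by ring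
      _ ≤ _ := by
        have : 0 ≤ ρ ^ (L - l) := by positivity
        have : 0 ≤ 1 / ((L : ℝ) + 1) := by positivity
        refine pow_le_pow_left₀ (by positivity) ?_ 2
        show c * ρ ^ l ≤ c * (ρ ^ l + ρ ^ (L - l) + 1 / ((L : ℝ) + 1))
        gcongr
        linarith
  · have hkey : ∀ l, ∀ a : ℝ, 0 < a → a ≤ ρ ^ l + ρ ^ (L - l) + 1 / ((L : ℝ) + 1) →
        z ^ l / (c * (ρ ^ l + ρ ^ (L - l) + 1 / ((L : ℝ) + 1))) ^ Q
          ≤ (c ^ Q)⁻¹ * (z ^ l / a ^ Q) := by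
      intro l a ha hle
      rw [Real.mul_rpow hcpos.le (by positivity), ← div_div, div_eq_inv_mul (z ^ l) (c ^ Q), mul_div_assoc]
      gcongr
    have hpl : ∀ l, 0 < ρ ^ l := fun l => by positivity
    have hpL : 0 < 1 / ((L : ℝ) + 1) := by positivity
    have hy' : 0 < (1 - y)⁻¹ := inv_pos.2 (by linarith)
    unfold levelFactor
    rcases lt_trichotomy z 1 with h | h | h
    · rw [if_pos h, mul_one]
      calc _ ≤ ∑ l ∈ Finset.range (L + 1), (c ^ Q)⁻¹ * (z ^ l / (ρ ^ l) ^ Q) :=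
            Finset.sum_le_sum fun l _ => hkey l _ (hpl l) (by linarith [hpl (L - l)])
        _ ≤ ∑ l ∈ Finset.range (L + 1), (c ^ Q)⁻¹ * y ^ l := by
            refine Finset.sum_le_sum fun l _ => ?_
            gcongr
            rw [← Real.rpow_natCast ρ l, ← Real.rpow_mul hρ.le, mul_comm, Real.rpow_mul hρ.le,
              Real.rpow_natCast, ← div_pow]
            refine pow_le_pow_left₀ (by positivity) ?_ l
            rw [div_le_iff₀ (by positivity)]
            calc z = y * y := by rw [hyz h, Real.mul_self_sqrt hz.le]
              _ ≤ _ := by gcongr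
        _ ≤ _ := by
            rw [← Finset.mul_sum]
            gcongr
            linarith [sum_pow_le hy.le hy1 (L + 1)]
    · rw [if_neg (by rw [h]; exact lt_irrefl _), if_pos h]
      calc _ ≤ ∑ l ∈ Finset.range (L + 1), (c ^ Q)⁻¹ * (z ^ l / (1 / ((L : ℝ) + 1)) ^ Q) :=
            Finset.sum_le_sum fun l _ => hkey l _ hpL (by linarith [hpl (L - l), hpl l])
        _ = (c ^ Q)⁻¹ * ((L : ℝ) + 1) ^ (Q + 1) := by
            subst h
            simp only [one_pow, Finset.sum_const, Finset.card_range, nsmul_eq_mul]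
            rw [Real.div_rpow (by positivity) (by positivity), Real.one_rpow, one_div_one_div,
              Real.rpow_add (by positivity), Real.rpow_one]
            push_cast
            ring
        _ ≤ _ := by
            gcongr
            have : 0 ≤ (c ^ Q)⁻¹ * (1 - y)⁻¹ := by positivity
            linarith
    · rw [if_neg h.not_gt, if_neg h.ne']
      calc _ ≤ ∑ l ∈ Finset.range (L + 1), (c ^ Q)⁻¹ * (z ^ l / (ρ ^ (L - l)) ^ Q) :=
            Finset.sum_le_sum fun l _ => hkey l _ (hpl (L - l)) (by linarith [hpl l])
        _ ≤ ∑ l ∈ Finset.range (L + 1), (c ^ Q)⁻¹ * (z ^ L * y ^ (L - l)) := by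
            refine Finset.sum_le_sum fun l hl => ?_
            have hl' : l ≤ L := Nat.lt_succ_iff.1 (Finset.mem_range.1 hl)
            gcongr
            rw [← Real.rpow_natCast ρ (L - l), ← Real.rpow_mul hρ.le, mul_comm, Real.rpow_mul hρ.le,
              Real.rpow_natCast]
            rw [div_le_iff₀ (by positivity)]
            have hz2 : z * (y * y) = 1 := by
              rw [hyz' h, ← mul_inv, Real.mul_self_sqrt hz.le, mul_inv_cancel₀ hz.ne']
            calc z ^ l = z ^ l * (z * (y * y)) ^ (L - l) := by rw [hz2, one_pow, mul_one]
              _ = z ^ (l + (L - l)) * y ^ (L - l) * y ^ (L - l) := by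
                  rw [mul_pow, mul_pow, pow_add]; ring
              _ = z ^ L * y ^ (L - l) * y ^ (L - l) := by rw [Nat.add_sub_cancel' hl']
              _ ≤ _ := by gcongr
        _ ≤ _ := by
            rw [← Finset.mul_sum, ← Finset.mul_sum, mul_assoc]
            refine mul_le_mul_of_nonneg_left ?_ (by positivity)
            rw [mul_comm]
            refine mul_le_mul_of_nonneg_right ?_ (by positivity)
            linarith [sum_pow_sub_le hy.le hy1 L]

/-- Bernoulli gives `v⁻¹ ^ l ≥ 1 + l (v⁻¹ - 1)`; with `G ≥ 1` the series is dominated by a geometric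
one times `exp (-G)`. -/
theorem sum_exp_le {v G : ℝ} (hv : 0 < v) (hv1 : v < 1) (hG : 1 ≤ G) (n : ℕ) :
    ∑ l ∈ Finset.range n, Real.exp (-(G * (v⁻¹) ^ l))
      ≤ (1 - Real.exp (-(v⁻¹ - 1)))⁻¹ * Real.exp (-G) := by
  have h1 : 0 < v⁻¹ - 1 := by
    have := (one_lt_inv₀ hv).2 hv1
    linarith
  have he : Real.exp (-(v⁻¹ - 1)) < 1 := by rw [Real.exp_lt_one_iff]; linarith
  rw [mul_comm]
  calc _ ≤ ∑ l ∈ Finset.range n, Real.exp (-G) * Real.exp (-(v⁻¹ - 1)) ^ l := by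
        refine Finset.sum_le_sum fun l _ => ?_
        rw [← Real.exp_nat_mul, ← Real.exp_add]
        refine Real.exp_le_exp.2 ?_
        have h2 := one_add_mul_le_pow (a := v⁻¹ - 1) (by linarith) l
        rw [add_sub_cancel] at h2
        have h3 : 0 ≤ (l : ℝ) * (v⁻¹ - 1) := by positivity
        nlinarith
    _ ≤ _ := by
        rw [← Finset.mul_sum]
        gcongr
        exact sum_pow_le (Real.exp_pos _).le he n

/-! ### Window bounds under polynomial decay of the dependence -/

/-- `|f|^Q ≤ S^(Q-q) |f|^q`. Truncation thus allows an exponent `Q` above the available `q`, at the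
price of a power of the truncation level. -/
theorem eLpNorm_interpolate {α : Type*} [MeasurableSpace α] {μ : Measure α}
    [IsProbabilityMeasure μ] {f : α → ℝ} (hf : BddMeas f) {q Q S u : ℝ} (hq : 0 < q) (hqQ : q ≤ Q)
    (hS : ∀ x, |f x| ≤ S) (hS0 : 0 ≤ S) (hu : 0 ≤ u)
    (h : eLpNorm f (ENNReal.ofReal q) μ ≤ ENNReal.ofReal u) :
    eLpNorm f (ENNReal.ofReal Q) μ ≤ ENNReal.ofReal (S ^ (1 - q / Q) * u ^ (q / Q)) := by
  have hQ : 0 < Q := hq.trans_le hqQ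
  rw [eLpNorm_le_ofReal_iff hf hq hu] at h
  rw [eLpNorm_le_ofReal_iff hf hQ (by positivity), Real.mul_rpow (by positivity) (by positivity),
    ← Real.rpow_mul hS0, ← Real.rpow_mul hu, div_mul_cancel₀ _ hQ.ne', sub_mul, one_mul,
    div_mul_cancel₀ _ hQ.ne']
  calc ∫ x, |f x| ^ Q ∂μ ≤ ∫ x, S ^ (Q - q) * |f x| ^ q ∂μ := by
        refine integral_mono ((hf.rpow_abs hQ.le).integrable μ)
          (((BddMeas.const _).mul (hf.rpow_abs hq.le)).integrable μ) fun x => ?_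
        show |f x| ^ Q ≤ S ^ (Q - q) * |f x| ^ q
        calc |f x| ^ Q = |f x| ^ (Q - q) * |f x| ^ q := by
              rw [← Real.rpow_add_of_nonneg (abs_nonneg _) (by linarith) hq.le, sub_add_cancel]
          _ ≤ _ := by gcongr; exact hS x
    _ = S ^ (Q - q) * ∫ x, |f x| ^ q ∂μ := integral_const_mul _ _
    _ ≤ _ := by gcongr

/-- The power mean inequality for the concave power `θ`. -/
theorem sum_rpow_le_card_mul {ι : Type*} (s : Finset ι) {u : ι → ℝ} (hu : ∀ i, 0 ≤ u i) {θ N B : ℝ}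
    (hθ : 0 < θ) (hθ1 : θ ≤ 1) (hN : (s.card : ℝ) ≤ N) (hB : ∑ i ∈ s, u i ≤ B) :
    ∑ i ∈ s, u i ^ θ ≤ N ^ (1 - θ) * B ^ θ := by
  have hs : 0 ≤ ∑ i ∈ s, u i := Finset.sum_nonneg fun i _ => hu i
  have h := Real.rpow_sum_le_const_mul_sum_rpow s (fun i => u i ^ θ) (one_le_one_div hθ hθ1)
  have habs : ∀ i, |u i ^ θ| = u i ^ θ := fun i => abs_of_nonneg (Real.rpow_nonneg (hu i) _)
  simp only [habs] at h
  have hback : ∀ i, (u i ^ θ) ^ (1 / θ) = u i := fun i => by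
    rw [← Real.rpow_mul (hu i), mul_one_div_cancel hθ.ne', Real.rpow_one]
  simp only [hback] at h
  have hs' : 0 ≤ ∑ i ∈ s, u i ^ θ := Finset.sum_nonneg fun i _ => Real.rpow_nonneg (hu i) _
  have hN0 : 0 ≤ N := (Nat.cast_nonneg _).trans hN
  calc ∑ i ∈ s, u i ^ θ = ((∑ i ∈ s, u i ^ θ) ^ (1 / θ)) ^ θ := by
        rw [← Real.rpow_mul hs', one_div_mul_cancel hθ.ne', Real.rpow_one]
    _ ≤ ((s.card : ℝ) ^ (1 / θ - 1) * ∑ i ∈ s, u i) ^ θ := by gcongr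
    _ = (s.card : ℝ) ^ (1 - θ) * (∑ i ∈ s, u i) ^ θ := by
        rw [Real.mul_rpow (by positivity) hs, ← Real.rpow_mul (Nat.cast_nonneg _), sub_mul,
          one_div_mul_cancel hθ.ne', one_mul]
    _ ≤ _ := by
        have : 0 ≤ 1 - θ := by linarith
        gcongr

theorem abs_lagDiff_le {E : Type*} [MeasurableSpace E] {ν : Measure E} [IsProbabilityMeasure ν]
    {f : (ℤ → E) → ℝ} {S : ℝ} (hS : ∀ e, |f e| ≤ S) (i : ℤ) (r : ℕ) (e : ℤ → E) :
    |lagDiff ν f i r e| ≤ 2 * S := by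
  have h : ∀ T : Set ℤ, |condOn ν T f e| ≤ S := fun T => by
    have := norm_integral_le_of_norm_le_const (μ := iid ℤ ν) (C := S)
      (f := fun e' => f (by classical exact T.piecewise e e')) (ae_of_all _ fun e' => hS _)
    simpa [condOn] using this
  refine (abs_sub _ _).trans ?_
  linarith [h (Icc (i - r) i), h (Ioc (i - r) i)]

theorem two_rpow_pow (s : ℝ) (l : ℕ) : ((2 : ℝ) ^ s) ^ l = ((2 : ℝ) ^ l) ^ s := by
  rw [← Real.rpow_natCast, ← Real.rpow_mul (by norm_num), ← Real.rpow_natCast 2 l,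
    ← Real.rpow_mul (by norm_num), mul_comm]

theorem half_add_one_rpow_le {A : ℝ} (hA : 0 < A) (l : ℕ) :
    (((2 ^ l / 2 : ℕ) : ℝ) + 1) ^ (-A) ≤ 2 ^ A * ((2 : ℝ) ^ (-A)) ^ l := by
  have h : (2 : ℝ) ^ l / 2 ≤ ((2 ^ l / 2 : ℕ) : ℝ) + 1 := by
    have : (2 ^ l : ℕ) ≤ 2 * (2 ^ l / 2) + 1 := by omega
    have : ((2 ^ l : ℕ) : ℝ) ≤ 2 * ((2 ^ l / 2 : ℕ) : ℝ) + 1 := by exact_mod_cast this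
    push_cast at this ⊢
    linarith
  calc (((2 ^ l / 2 : ℕ) : ℝ) + 1) ^ (-A) ≤ ((2 : ℝ) ^ l / 2) ^ (-A) :=
        Real.rpow_le_rpow_of_nonpos (by positivity) h (by linarith)
    _ = _ := by
        rw [Real.div_rpow (by positivity) (by positivity), two_rpow_pow, Real.rpow_neg (by norm_num : (0:ℝ) ≤ 2) A,
          div_inv_eq_mul, mul_comm]

/-- The ratio of consecutive levels in the polynomial part of the window bound. -/
def levelRatio (q Q A : ℝ) : ℝ := 2 ^ (Q / 2 - 1 + (Q - q) - A * q)

theorem sum_Ico_two_pow_le {β b : ℕ → ℝ}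
    (hbT : ∀ l, ∑ r ∈ Finset.Ico (2 ^ l / 2) (2 ^ l), β r ≤ b l) (L n : ℕ) :
    ∑ r ∈ Finset.Ico (2 ^ L) (2 ^ (L + n)), β r ≤ ∑ m ∈ Finset.range n, b (L + m + 1) := by
  induction n with
  | zero => simp
  | succ n ih =>
    rw [Finset.sum_range_succ, ← Finset.sum_Ico_consecutive β
      (Nat.pow_le_pow_right (by norm_num) (Nat.le_add_right L n))
      (Nat.pow_le_pow_right (by norm_num) (by omega : L + n ≤ L + (n + 1)))]
    refine add_le_add ih ?_
    have := hbT (L + n + 1)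
    rwa [show 2 ^ (L + n + 1) / 2 = 2 ^ (L + n) by rw [pow_succ]; simp] at this

/-- Interpolation turns lag norms `u r` at exponent `q` into `S^(1-θ) (u r)^θ` at exponent `Q`,
where `θ = q / Q`. Over the level `l` these sum to a multiple of `w^l`, and the polynomial term of
that level is a multiple of `z^l / lam l ^ Q` with `z = levelRatio q Q A`. -/
theorem exists_measure_window_le {q Q A : ℝ} (hq : 2 < q) (hqQ : q ≤ Q) (hA : 0 < A)
    (hQA : Q - q < A * q) : ∃ C c : ℝ, 0 < C ∧ 0 < c ∧
    ∀ {E : Type} [MeasurableSpace E] {ν : Measure E} [IsProbabilityMeasure ν]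
      {f : ℤ → (ℤ → E) → ℝ}, (∀ i, BddMeas (f i)) → (∀ i, DependsOn (f i) (Iic i)) →
      ∀ {S u₀ g₀ x : ℝ} {u γ : ℕ → ℝ}, 0 < S → (∀ i e, 2 * |f i e| ≤ S) → 0 < u₀ → 0 < g₀ → 0 < x →
      (∀ r, 0 ≤ u r) → (∀ r, 0 ≤ γ r) →
      (∀ i r, eLpNorm (lagDiff ν (f i) i r) (ENNReal.ofReal q) (iid ℤ ν) ≤ ENNReal.ofReal (u r)) →
      (∀ i r, eLpNorm (lagDiff ν (f i) i r) (ENNReal.ofReal 2) (iid ℤ ν) ≤ ENNReal.ofReal (γ r)) →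
      (∀ m R, ∑ r ∈ Finset.Ico m R, u r ≤ u₀ * ((m : ℝ) + 1) ^ (-A)) →
      (∀ m R, ∑ r ∈ Finset.Ico m R, γ r ≤ g₀ * ((m : ℝ) + 1) ^ (-A)) →
      ∀ (L : ℕ) (s : ℤ), 1 ≤ c * x ^ 2 / (2 ^ L * g₀ ^ 2) →
      iid ℤ ν {e | ∃ k ≤ 2 ^ L, 4 * x ≤ |∑ i ∈ Finset.range k,
          (f (s + i) e - ∫ v, f (s + i) v ∂(iid ℤ ν))|}
        ≤ ENNReal.ofReal (C * (2 ^ L * S ^ (Q - q) * u₀ ^ q / x ^ Q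
            * levelFactor (levelRatio q Q A) Q L
          + Real.exp (-(c * x ^ 2 / (2 ^ L * g₀ ^ 2))))) := by
  have hQ : 2 < Q := hq.trans_le hqQ
  have hQ0 : 0 < Q := by linarith
  have hq0 : 0 < q := by linarith
  set θ : ℝ := q / Q with hθd
  have hθ : 0 < θ := by positivity
  have hθ1 : θ ≤ 1 := (div_le_one hQ0).2 hqQ
  have hθQ : θ * Q = q := div_mul_cancel₀ _ hQ0.ne'
  -- Multiplied by `Q`, the exponent is `Q - q - A q`, which is negative by `hQA`.
  set w : ℝ := 2 ^ (1 - θ - A * θ) with hwd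
  have hw : 0 < w := by positivity
  have hw1 : w < 1 := by
    refine Real.rpow_lt_one_of_one_lt_of_neg (by norm_num) ?_
    by_contra hcon
    push Not at hcon
    have := mul_nonneg hcon hQ0.le
    have h2 : (1 - θ - A * θ) * Q = Q - q - A * q := by rw [sub_mul, sub_mul, mul_assoc, hθQ]; ring
    linarith
  set v : ℝ := 2 ^ (-A) with hvd
  have hv : 0 < v := by positivity
  have hv1 : v < 1 := Real.rpow_lt_one_of_one_lt_of_neg (by norm_num) (by linarith)
  set z := levelRatio q Q A with hzd
  have hz : 0 < z := by rw [hzd]; unfold levelRatio; positivity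
  have hzw : z = 2⁻¹ * (Real.sqrt 2 * w) ^ Q := by
    rw [hzd, hwd, levelRatio, Real.sqrt_eq_rpow, ← Real.rpow_add (by norm_num),
      ← Real.rpow_mul (by norm_num), ← Real.rpow_neg_one, ← Real.rpow_add (by norm_num)]
    congr 1
    have : A * q = A * (θ * Q) := by rw [hθQ]
    rw [this, ← hθQ]; ring
  obtain ⟨C₁, c₁, hC₁, hc₁, hlev⟩ := exists_level_weights (Q := Q) hz hv hv1 hQ0
  set KQ : ℝ := 16 * 2 ^ Q + 1 with hKQ
  have hKQ0 : 0 < KQ := by positivity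
  set B := blockConst Q with hBd
  have hB : 0 < B := lt_of_lt_of_le (Real.sqrt_pos.2 (by
    have := one_le_taylorConst hQ.le; linarith)) (sqrt_le_blockConst hQ)
  set D : ℝ := 12 * Real.exp Q * taylorConst 2 with hDd
  have hD : 0 < D := by have := one_le_taylorConst (le_refl (2 : ℝ)); positivity
  have hEx : 0 < (1 - Real.exp (-(v⁻¹ - 1)))⁻¹ := by
    have : 1 < v⁻¹ := (one_lt_inv₀ hv).2 hv1
    have : Real.exp (-(v⁻¹ - 1)) < 1 := by rw [Real.exp_lt_one_iff]; linarith
    exact inv_pos.2 (by linarith)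
  have hw1' : 0 < (1 - w)⁻¹ := inv_pos.2 (by linarith)
  set C₂ : ℝ := (KQ + (2 * (1 - w)⁻¹) ^ Q) * ((B * ((2 ^ A) ^ θ)) ^ Q * C₁) with hC₂
  set C₃ : ℝ := 12 * (1 - Real.exp (-(v⁻¹ - 1)))⁻¹ with hC₃
  have hC₂0 : 0 < C₂ := by positivity
  have hC₃0 : 0 < C₃ := by positivity
  refine ⟨C₂ + C₃, c₁ / (D * (2 ^ A) ^ 2), by positivity, by positivity, ?_⟩
  intro E _ ν _ f hf hfi S u₀ g₀ x u γ hS hfS hu₀ hg₀ hx hu hγ hum hγm husum hγsum L s hG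
  obtain ⟨lam, hlam, hlam1, hlamv, hlamz⟩ := hlev L
  set G : ℝ := c₁ / (D * (2 ^ A) ^ 2) * x ^ 2 / (2 ^ L * g₀ ^ 2) with hGd
  set b₀ : ℝ := S ^ (1 - θ) * (u₀ * 2 ^ A) ^ θ with hb₀d
  have hb₀ : 0 < b₀ := by positivity
  set β : ℕ → ℝ := fun r => S ^ (1 - θ) * u r ^ θ with hβd
  have hβ0 : ∀ r, 0 ≤ β r := fun r => mul_nonneg (by positivity) (Real.rpow_nonneg (hu r) _)
  have hβm : ∀ i r, eLpNorm (lagDiff ν (f i) i r) (ENNReal.ofReal Q) (iid ℤ ν)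
      ≤ ENNReal.ofReal (β r) := fun i r =>
    eLpNorm_interpolate (lagDiff_bddMeas (hf i) i r) hq0 hqQ (fun e => by
      have := abs_lagDiff_le (ν := ν) (f := f i) (S := S / 2) (fun e => by linarith [hfS i e]) i r e
      linarith) hS.le (hu r) (hum i r)
  have hbT : ∀ l, ∑ r ∈ Finset.Ico (2 ^ l / 2) (2 ^ l), β r ≤ b₀ * w ^ l := by
    intro l
    have h1 := sum_rpow_le_card_mul (Finset.Ico (2 ^ l / 2) (2 ^ l)) hu hθ hθ1 (N := 2 ^ l)
      (by rw [Nat.card_Ico]; exact_mod_cast Nat.sub_le _ _) (B := u₀ * 2 ^ A * v ^ l)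
      ((husum _ _).trans (by
        rw [mul_assoc]; gcongr; exact half_add_one_rpow_le hA l))
    rw [hβd, ← Finset.mul_sum, hb₀d, mul_assoc]
    gcongr
    refine h1.trans (le_of_eq ?_)
    rw [Real.mul_rpow (by positivity) (by positivity), hwd, hvd, two_rpow_pow, two_rpow_pow,
      sub_eq_add_neg (1 - θ), Real.rpow_add (by positivity), ← Real.rpow_mul (by positivity), neg_mul]
    ring
  have hgT : ∀ l, ∑ r ∈ Finset.Ico (2 ^ l / 2) (2 ^ l), γ r ≤ g₀ * 2 ^ A * v ^ l := fun l =>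
    (hγsum _ _).trans (by rw [mul_assoc]; gcongr; exact half_add_one_rpow_le hA l)
  have hρ : ∀ R, ∑ r ∈ Finset.Ico (2 ^ L) R, β r ≤ b₀ * w ^ L * (1 - w)⁻¹ := by
    intro R
    calc ∑ r ∈ Finset.Ico (2 ^ L) R, β r ≤ ∑ r ∈ Finset.Ico (2 ^ L) (2 ^ (L + R)), β r := by
          refine Finset.sum_le_sum_of_subset_of_nonneg (Finset.Ico_subset_Ico le_rfl ?_)
            fun r _ _ => hβ0 r
          exact (Nat.lt_two_pow_self).le.trans (Nat.pow_le_pow_right (by norm_num) (by omega))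
      _ ≤ ∑ m ∈ Finset.range R, b₀ * w ^ (L + m + 1) :=
          sum_Ico_two_pow_le (b := fun l => b₀ * w ^ l) hbT L R
      _ ≤ ∑ m ∈ Finset.range R, b₀ * w ^ L * w ^ m := by
          refine Finset.sum_le_sum fun m _ => ?_
          rw [mul_assoc b₀, ← pow_add]
          exact mul_le_mul_of_nonneg_left (pow_le_pow_of_le_one hw.le hw1.le (by omega)) hb₀.le
      _ ≤ _ := by
          rw [← Finset.mul_sum]
          gcongr
          exact sum_pow_le hw.le hw1 R
  refine (measure_window_le hf hfi hQ hβ0 hγ hβm hγm (b := fun l => b₀ * w ^ l)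
    (g := fun l => g₀ * 2 ^ A * v ^ l) (fun l => by positivity) (fun l => by positivity) hlam hbT hgT
    hρ hlam1 hx s).trans (ENNReal.ofReal_le_ofReal ?_)
  set F : ℝ := 2 ^ L * S ^ (Q - q) * u₀ ^ q / x ^ Q with hFd
  have hF : 0 < F := by positivity
  have hb₀Q : b₀ ^ Q = S ^ (Q - q) * u₀ ^ q * ((2 ^ A) ^ θ) ^ Q := by
    rw [hb₀d, Real.mul_rpow (by positivity) (by positivity), ← Real.rpow_mul hS.le, sub_mul, hθQ,
      one_mul, Real.mul_rpow hu₀.le (by positivity), Real.mul_rpow (by positivity) (by positivity),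
      ← Real.rpow_mul hu₀.le, hθQ]
    ring
  have hs2 : ∀ l, l ≤ L → 2 ^ (L - l) * (Real.sqrt 2 ^ l * (B * (b₀ * w ^ l))) ^ Q
      = 2 ^ L * (B * b₀) ^ Q * z ^ l := by
    intro l hl
    have h2 : (2 : ℝ) ^ L = 2 ^ (L - l) * 2 ^ l := by rw [← pow_add, Nat.sub_add_cancel hl]
    have h3 : ((Real.sqrt 2 * w) ^ Q) ^ l = ((Real.sqrt 2 * w) ^ l) ^ Q :=
      Real.rpow_pow_comm (by positivity) _ _
    rw [hzw, mul_pow, h3, h2,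
      show Real.sqrt 2 ^ l * (B * (b₀ * w ^ l)) = (B * b₀) * (Real.sqrt 2 * w) ^ l by ring,
      Real.mul_rpow (by positivity) (by positivity)]
    have : (2 : ℝ) ^ l * 2⁻¹ ^ l = 1 := by rw [← mul_pow]; norm_num
    linear_combination (-(2 ^ (L - l) * (B * b₀) ^ Q * ((Real.sqrt 2 * w) ^ l) ^ Q)) * this
  have hW : 2 ^ L * (B * b₀) ^ Q / x ^ Q = F * (B * ((2 ^ A) ^ θ)) ^ Q := by
    rw [Real.mul_rpow hB.le hb₀.le, hb₀Q, Real.mul_rpow hB.le (by positivity), hFd]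
    ring
  have hlamle : ∀ l ≤ L, lam l ≤ 1 := fun l hl =>
    (Finset.single_le_sum (fun i _ => (hlam i).le)
      (Finset.mem_range.2 (Nat.lt_succ_of_le hl))).trans hlam1
  have hterm : ∀ l ≤ L, 2 ^ (L - l) * (Real.sqrt 2 ^ l * (B * (b₀ * w ^ l))) ^ Q
      / (lam l * x) ^ Q = F * (B * ((2 ^ A) ^ θ)) ^ Q * (z ^ l / lam l ^ Q) := fun l hl => by
    rw [hs2 l hl, Real.mul_rpow (hlam l).le hx.le, ← hW]
    have : 0 < lam l ^ Q := Real.rpow_pos_of_pos (hlam l) _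
    have : 0 < x ^ Q := by positivity
    field_simp
  set Ψ := levelFactor z Q L with hΨ
  -- Lags beyond the window cost as much as the last level up to a constant. The last term of the
  -- weighted sum bounds this, since `lam L ≤ 1`.
  have hzL : z ^ L ≤ C₁ * Ψ := by
    refine le_trans ?_ ((Finset.single_le_sum (f := fun l => z ^ l / lam l ^ Q) (fun l _ =>
      div_nonneg (by positivity) (Real.rpow_nonneg (hlam l).le _))
      (Finset.self_mem_range_succ L)).trans hlamz)
    rw [le_div_iff₀ (Real.rpow_pos_of_pos (hlam L) _)]
    exact mul_le_of_le_one_right (by positivity)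
      (Real.rpow_le_one (hlam L).le (hlamle L le_rfl) hQ0.le)
  have hΨ0 : 0 ≤ Ψ := by
    by_contra hcon
    push Not at hcon
    have : 0 < z ^ L := by positivity
    nlinarith
  have hrem : (Real.sqrt 2 ^ L * (B * (b₀ * w ^ L * (1 - w)⁻¹))) ^ Q / (x / 2) ^ Q
      = (2 * (1 - w)⁻¹) ^ Q * (F * (B * ((2 ^ A) ^ θ)) ^ Q * z ^ L) := by
    have h := hs2 L le_rfl
    rw [Nat.sub_self, pow_zero, one_mul] at h
    rw [show Real.sqrt 2 ^ L * (B * (b₀ * w ^ L * (1 - w)⁻¹))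
        = (Real.sqrt 2 ^ L * (B * (b₀ * w ^ L))) * (1 - w)⁻¹ by ring,
      Real.mul_rpow (by positivity) hw1'.le, h, Real.div_rpow hx.le (by norm_num), ← hW,
      Real.mul_rpow (by norm_num) hw1'.le]
    have : (0:ℝ) < 2 ^ Q := by positivity
    have : 0 < x ^ Q := by positivity
    field_simp
  -- The second order norm of level `l` is of order `v^l`, so its square is `v^(2l)`, while `lam l²`
  -- is at least `c₁ v^l`. The quotient leaves the growing factor `v⁻¹ ^ l` in the exponent.
  have hgauss : ∀ l, Real.exp (-((lam l * x) ^ 2 / (D * (2 ^ L * (g₀ * 2 ^ A * v ^ l) ^ 2))))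
      ≤ Real.exp (-(G * (v⁻¹) ^ l)) := by
    intro l
    refine Real.exp_le_exp.2 (neg_le_neg ?_)
    rw [le_div_iff₀ (by positivity)]
    have : G * v⁻¹ ^ l * (D * (2 ^ L * (g₀ * 2 ^ A * v ^ l) ^ 2)) = c₁ * v ^ l * x ^ 2 := by
      rw [hGd, inv_pow]
      field_simp
    rw [this, mul_pow]
    gcongr
    exact hlamv l
  rw [Finset.sum_add_distrib, ← Finset.mul_sum, ← Finset.mul_sum, hrem,
    Finset.sum_congr rfl fun l hl => hterm l (Nat.lt_succ_iff.1 (Finset.mem_range.1 hl)),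
    ← Finset.mul_sum]
  have hE := (Finset.sum_le_sum fun l (_ : l ∈ Finset.range (L + 1)) => hgauss l).trans
    (sum_exp_le hv hv1 hG (L + 1))
  set FB := F * (B * ((2 ^ A) ^ θ)) ^ Q with hFB
  have hFB0 : 0 < FB := by positivity
  calc _ ≤ KQ * (FB * (C₁ * Ψ)) + 12 * ((1 - Real.exp (-(v⁻¹ - 1)))⁻¹ * Real.exp (-G))
        + (2 * (1 - w)⁻¹) ^ Q * (FB * (C₁ * Ψ)) := by gcongr
    _ = C₂ * (F * Ψ) + C₃ * Real.exp (-G) := by rw [hC₂, hC₃, hFB]; ring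
    _ ≤ _ := by
      have h1 : 0 ≤ C₃ * (F * Ψ) := by positivity
      have h2 : 0 ≤ C₂ * Real.exp (-G) := by positivity
      linarith

/-! ### Uniform deviation bound for sums over intervals -/

/-- Sums over short intervals are controlled by prefix sums over a partition into windows. -/
theorem abs_sum_Ico_lt_of_windows {g : ℕ → ℝ} {W n : ℕ} {y : ℝ} (hW : 0 < W)
    (h : ∀ w ≤ n / W, ∀ k ≤ W, |∑ i ∈ Finset.range k, g (1 + w * W + i)| < y) {a b : ℕ}
    (ha : 1 ≤ a) (hab : a ≤ b) (hb : b ≤ n + 1) (hl : b - a ≤ W) :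
    |∑ i ∈ Finset.Ico a b, g i| < 3 * y := by
  have hpre : ∀ s k, ∑ i ∈ Finset.range k, g (s + i) = ∑ i ∈ Finset.Ico s (s + k), g i :=
    fun s k => by rw [Finset.sum_Ico_eq_sum_range, Nat.add_sub_cancel_left]
  have hy : 0 < y := (abs_nonneg _).trans_lt (h 0 (Nat.zero_le _) 0 (Nat.zero_le _))
  simp only [hpre] at h
  set w := (a - 1) / W
  set r := (a - 1) % W
  have hdm : w * W + r = a - 1 := by rw [mul_comm]; exact Nat.div_add_mod _ _
  have hr : r < W := Nat.mod_lt _ hW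
  have haw : a = 1 + w * W + r := by omega
  have hwn : w ≤ n / W := Nat.div_le_div_right (by omega)
  have h1 := abs_lt.1 (h w hwn r hr.le)
  by_cases hc : r + (b - a) ≤ W
  · have h2 := abs_lt.1 (h w hwn _ hc)
    have h3 := Finset.sum_Ico_consecutive g (m := 1 + w * W) (n := a) (k := b) (by omega) hab
    rw [show 1 + w * W + (r + (b - a)) = b by omega] at h2
    rw [← haw] at h1
    rw [abs_lt]
    constructor <;> linarith [h1.1, h1.2, h2.1, h2.2]
  · push Not at hc
    have h2 := abs_lt.1 (h w hwn W le_rfl)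
    have hw1 : w + 1 ≤ n / W := by
      rw [Nat.le_div_iff_mul_le hW, add_mul]
      omega
    have h4 := abs_lt.1 (h (w + 1) hw1 (r + (b - a) - W) (by omega))
    have he : 1 + (w + 1) * W = 1 + w * W + W := by ring
    rw [he, show 1 + w * W + W + (r + (b - a) - W) = b by omega] at h4
    have h3 := Finset.sum_Ico_consecutive g (m := 1 + w * W) (n := a) (k := 1 + w * W + W)
      (by omega) (by omega)
    have h5 := Finset.sum_Ico_consecutive g (m := a) (n := 1 + w * W + W) (k := b)
      (by omega) (by omega)
    rw [← haw] at h1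
    rw [abs_lt]
    constructor <;> linarith [h1.1, h1.2, h2.1, h2.2, h4.1, h4.2]

/-- Truncation scales each factor by a number in `[0, 1]`, so the difference is at most `|x y|`. It
vanishes unless `m = max |x| |y| > T`, in which case `m² = m^(2q) m^(2-2q) ≤ m^(2q) T^(2-2q)`. -/
theorem abs_mul_sub_clip_mul_clip_le {T x y q : ℝ} (hT : 0 < T) (hq : 1 < q) :
    |x * y - clip T x * clip T y| ≤ (|x| ^ (2 * q) + |y| ^ (2 * q)) * T ^ (2 - 2 * q) := by
  by_cases h : |x| ≤ T ∧ |y| ≤ T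
  · rw [clip_eq_self h.1, clip_eq_self h.2, sub_self, abs_zero]
    positivity
  · have hm : T < max |x| |y| := by
      by_contra hcon
      push Not at hcon
      exact h ⟨(le_max_left _ _).trans hcon, (le_max_right _ _).trans hcon⟩
    set m := max |x| |y| with hmd
    have hm0 : 0 < m := hT.trans hm
    have hxy : |x * y - clip T x * clip T y| ≤ |x * y| := by
      have key : ∀ x : ℝ, ∃ s : ℝ, 0 ≤ s ∧ s ≤ 1 ∧ clip T x = s * x := by
        intro x
        by_cases hx : x = 0
        · exact ⟨1, zero_le_one, le_rfl, by rw [hx, clip_zero hT.le]; simp⟩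
        · refine ⟨clip T x / x, ?_, ?_, by field_simp⟩
          · unfold clip
            rcases lt_or_gt_of_ne hx with hx | hx
            · exact div_nonneg_of_nonpos (max_le (by linarith) ((min_le_left _ _).trans hx.le)) hx.le
            · exact div_nonneg (le_max_of_le_right (le_min hx.le hT.le)) hx.le
          · refine (le_abs_self _).trans ?_
            rw [abs_div]
            exact div_le_one_of_le₀ (abs_clip_le_abs hT.le x) (abs_nonneg _)
      obtain ⟨s, hs0, hs1, hs⟩ := key x
      obtain ⟨t, ht0, ht1, ht⟩ := key y
      rw [hs, ht, show x * y - s * x * (t * y) = (1 - s * t) * (x * y) by ring, abs_mul]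
      refine mul_le_of_le_one_left (abs_nonneg _) ?_
      rw [abs_le]
      constructor <;> nlinarith [mul_nonneg hs0 ht0]
    have hsum : m ^ (2 * q) ≤ |x| ^ (2 * q) + |y| ^ (2 * q) := by
      rcases max_choice |x| |y| with h' | h' <;> rw [hmd, h']
      · linarith [Real.rpow_nonneg (abs_nonneg y) (2 * q)]
      · linarith [Real.rpow_nonneg (abs_nonneg x) (2 * q)]
    calc |x * y - clip T x * clip T y| ≤ |x| * |y| := by rw [← abs_mul]; exact hxy
      _ ≤ m * m := mul_le_mul (le_max_left _ _) (le_max_right _ _) (abs_nonneg _) hm0.le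
      _ = m ^ (2 * q) * m ^ (2 - 2 * q) := by
          rw [← Real.rpow_add hm0]; norm_num; ring
      _ ≤ m ^ (2 * q) * T ^ (2 - 2 * q) := by
          gcongr ?_ * ?_
          exact Real.rpow_le_rpow_of_nonpos hT hm.le (by linarith)
      _ ≤ _ := by gcongr

/-! ### Decay of the dependence measures, tails of the components and truncation bias -/

namespace CausalProcess

variable {Ω : Type*} [MeasurableSpace Ω] {μ : Measure Ω} [IsProbabilityMeasure μ] {p : ℕ}
  {P : CausalProcess μ p}

theorem measurable_XCoupled (m : ℕ) (t : ℝ) (j : Fin p) :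
    Measurable fun ω => P.XCoupled 0 m t ω j := by
  have h : (fun ω => P.XCoupled 0 m t ω j) = (fun e : (ℤ → Fin p → ℝ) × (ℤ → Fin p → ℝ) =>
      P.seqX 0 t (Function.update e.1 (0 - m : ℤ) (e.2 (0 - m))) j)
      ∘ fun ω => (P.innov ω, fun i => P.ε' i ω) := by
    ext ω; simp only [XCoupled_eq, Function.comp]
  rw [h]
  exact ((measurable_pi_apply j).comp ((P.measurable_seqX 0 t).comp (measurable_update _))).comp
    (P.measurePreserving_innov.measurable.prodMk (measurable_pi_iff.2 P.measurable_ε'))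

theorem theta_mono {a a' : ℝ} (h : a ≤ a') (j : Fin p) (m : ℕ) : P.theta a j m ≤ P.theta a' j m :=
  iSup₂_mono fun t _ => eLpNorm_le_eLpNorm_of_exponent_le (ENNReal.ofReal_le_ofReal h)
    ((P.measurable_X 0 t j).sub (measurable_XCoupled m t j)).aestronglyMeasurable

theorem dan_mono {a a' : ℝ} (h : a ≤ a') (A : ℝ) (j : Fin p) : P.dan a A j ≤ P.dan a' A j :=
  iSup_mono fun _ => mul_le_mul_right (ENNReal.tsum_le_tsum fun _ => theta_mono h j _) _

theorem Theta_zero_le_dan (a A : ℝ) (j : Fin p) : P.Theta a j 0 ≤ P.dan a A j := by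
  refine le_trans (le_of_eq ?_) (le_iSup (fun m : ℕ => ((m : ℝ≥0∞) + 1) ^ A * P.Theta a j m) 0)
  simp

theorem theta_ne_top {a A : ℝ} {j : Fin p} (h : P.dan a A j < ∞) (m : ℕ) : P.theta a j m ≠ ∞ := by
  refine ne_top_of_le_ne_top h.ne (le_trans ?_ (Theta_zero_le_dan a A j))
  refine le_trans (le_of_eq ?_) (ENNReal.le_tsum m)
  rw [zero_add]

/-- Polynomial decay of the dependence measures. -/
theorem sum_theta_le {a A : ℝ} {j : Fin p} (h : P.dan a A j < ∞) (m R : ℕ) :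
    ∑ r ∈ Finset.Ico m R, (P.theta a j r).toReal
      ≤ (P.dan a A j).toReal * ((m : ℝ) + 1) ^ (-A) := by
  have h1 : ∑ r ∈ Finset.Ico m R, P.theta a j r ≤ P.Theta a j m := by
    rw [Finset.sum_Ico_eq_sum_range]
    exact ENNReal.sum_le_tsum _
  have h2 : ((m : ℝ≥0∞) + 1) ^ A * P.Theta a j m ≤ P.dan a A j :=
    le_iSup (fun m : ℕ => ((m : ℝ≥0∞) + 1) ^ A * P.Theta a j m) m
  have hm : ((m : ℝ≥0∞) + 1) = ENNReal.ofReal ((m : ℝ) + 1) := by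
    rw [ENNReal.ofReal_add (by positivity) zero_le_one, ENNReal.ofReal_natCast, ENNReal.ofReal_one]
  rw [hm, ENNReal.ofReal_rpow_of_pos (by positivity)] at h2
  rw [← ENNReal.toReal_sum fun r _ => theta_ne_top h r]
  have h3 := ENNReal.toReal_mono h.ne ((mul_le_mul_right h1 _).trans h2)
  rw [ENNReal.toReal_mul, ENNReal.toReal_ofReal (by positivity)] at h3
  rw [Real.rpow_neg (by positivity), ← div_eq_mul_inv, le_div_iff₀ (by positivity), mul_comm]
  exact h3

theorem Dependence.dan_lt {q A ν : ℝ} (h : P.Dependence q A ν) (j : Fin p) :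
    P.dan (2 * q) A j < ∞ := (le_iSup (P.dan (2 * q) A) j).trans_lt h.maxDan_lt

theorem Dependence.dan_four_lt {q A ν : ℝ} (h : P.Dependence q A ν) (hq : 2 < q) (j : Fin p) :
    P.dan 4 A j < ∞ := (dan_mono (by linarith) A j).trans_lt (h.dan_lt j)

theorem Dependence.dan_four_le_NX {q A ν : ℝ} (h : P.Dependence q A ν) (hq : 2 < q) (j : Fin p) :
    (P.dan 4 A j).toReal ≤ P.NX A :=
  ENNReal.toReal_mono (ne_top_of_le_ne_top h.maxDan_lt.ne
    (iSup_mono fun j => dan_mono (by linarith) A j)) (le_iSup (P.dan 4 A) j)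

theorem Dependence.integrable {q A ν : ℝ} (h : P.Dependence q A ν) (hq : 2 < q) {t : ℝ}
    (ht : t ∈ Icc (0 : ℝ) 1) (j : Fin p) : MemLp (fun ω => P.X 0 t ω j) 2 μ :=
  ⟨(P.measurable_X 0 t j).aestronglyMeasurable, by
    have := h.eLpNorm_le hq ht j (a := 2) (by linarith)
    rw [ENNReal.ofReal_ofNat] at this
    exact this.trans_lt ENNReal.ofReal_lt_top⟩

/-- The `2q`-th power of the norm is split into two `q`-th powers, one bounded by the uniform moment
and the other by the dependence adjusted norm of the centred component. The result is linear in the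
summands of `M_X^q`, so a union over the coordinates costs `M_X^q` and no factor `p`. -/
theorem Dependence.lintegral_seqX_le {q A ν : ℝ} (h : P.Dependence q A ν) (hq : 2 < q) {t : ℝ}
    (ht : t ∈ Icc (0 : ℝ) 1) (j : Fin p) (hmean : ∫ ω, P.X 0 t ω j ∂μ = 0) (i : ℤ) :
    ∫⁻ e, ENNReal.ofReal (|P.seqX i t e j| ^ (2 * q)) ∂(iid ℤ P.law)
      ≤ ENNReal.ofReal (max ν 1 ^ q * (P.dan (2 * q) A j).toReal ^ q) := by
  have h0 : 0 < 2 * q := by linarith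
  have h1 := h.eLpNorm_le hq ht j (le_refl (2 * q))
  have h2 := (P.eLpNorm_X_le_Theta (a := 2 * q) (by linarith) j ht
    ((h.integrable hq ht j).integrable (by norm_num)) hmean).trans (Theta_zero_le_dan (2 * q) A j)
  rw [← P.eLpNorm_seqX _ j i t] at h1 h2
  have hne : ENNReal.ofReal (2 * q) ≠ 0 := by
    simp only [ne_eq, ENNReal.ofReal_eq_zero, not_le]; linarith
  have h3 : ∫⁻ e, ENNReal.ofReal (|P.seqX i t e j| ^ (2 * q)) ∂(iid ℤ P.law)
      = eLpNorm (fun e => P.seqX i t e j) (ENNReal.ofReal (2 * q)) (iid ℤ P.law) ^ (2 * q) := by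
    rw [eLpNorm_eq_lintegral_rpow_enorm_toReal hne ENNReal.ofReal_ne_top,
      ENNReal.toReal_ofReal h0.le, ← ENNReal.rpow_mul, one_div_mul_cancel h0.ne', ENNReal.rpow_one]
    refine lintegral_congr fun e => ?_
    rw [← ENNReal.ofReal_rpow_of_nonneg (abs_nonneg _) h0.le, Real.enorm_eq_ofReal_abs]
  have hM : 0 < max ν 1 := lt_max_of_lt_right one_pos
  have hsq : ∀ N : ℝ≥0∞, N ^ (2 * q) = N ^ q * N ^ q := fun N => by
    rw [two_mul, ENNReal.rpow_add_of_nonneg _ _ (by linarith) (by linarith)]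
  rw [h3, hsq,
    ENNReal.ofReal_mul (p := max ν 1 ^ q) (by positivity), ← ENNReal.ofReal_rpow_of_nonneg hM.le (by linarith),
    ← ENNReal.ofReal_rpow_of_nonneg ENNReal.toReal_nonneg (by linarith),
    ENNReal.ofReal_toReal (h.dan_lt j).ne]
  exact mul_le_mul' (ENNReal.rpow_le_rpow h1 (by linarith)) (ENNReal.rpow_le_rpow h2 (by linarith))

theorem Dependence.measure_exceed_le {q A ν : ℝ} (h : P.Dependence q A ν) (hq : 2 < q) {t : ℝ}
    (ht : t ∈ Icc (0 : ℝ) 1) (j : Fin p) (hmean : ∫ ω, P.X 0 t ω j ∂μ = 0) (i : ℤ) {T : ℝ}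
    (hT : 0 < T) : iid ℤ P.law {e | T < |P.seqX i t e j|}
      ≤ ENNReal.ofReal (max ν 1 ^ q * (P.dan (2 * q) A j).toReal ^ q / T ^ (2 * q)) := by
  have hT' : 0 < T ^ (2 * q) := by positivity
  have h1 := (mul_meas_ge_le_lintegral₀ (μ := iid ℤ P.law)
    (f := fun e => ENNReal.ofReal (|P.seqX i t e j| ^ (2 * q))) ?_
    (ENNReal.ofReal (T ^ (2 * q)))).trans (h.lintegral_seqX_le hq ht j hmean i)
  · rw [ENNReal.ofReal_div_of_pos hT', ENNReal.le_div_iff_mul_le (by simp [hT']) (by simp), mul_comm]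
    refine le_trans (mul_le_mul_right (measure_mono fun e he => ?_) _) h1
    exact ENNReal.ofReal_le_ofReal (Real.rpow_le_rpow hT.le (le_of_lt he) (by linarith))
  · exact ((((measurable_pi_apply j).comp (P.measurable_seqX i t)).abs.pow_const _).ennreal_ofReal).aemeasurable

theorem cov_eq_integral_seqX (t : ℝ) (j k : Fin p) (i : ℤ) :
    P.cov t j k = ∫ e, P.seqX i t e j * P.seqX i t e k ∂(iid ℤ P.law) := by
  have hm : ∀ i, Measurable fun e => P.seqX i t e j * P.seqX i t e k := fun i =>
    ((measurable_pi_apply j).comp (P.measurable_seqX i t)).mul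
      ((measurable_pi_apply k).comp (P.measurable_seqX i t))
  have h1 : P.cov t j k = ∫ e, P.seqX 0 t e j * P.seqX 0 t e k ∂(iid ℤ P.law) := by
    rw [← P.measurePreserving_innov.map_eq, integral_map
      P.measurePreserving_innov.measurable.aemeasurable (hm 0).aestronglyMeasurable]
    rfl
  rw [h1]
  have := integral_map (μ := iid ℤ P.law) (P.measurePreserving_shift i).measurable.aemeasurable
    (f := fun e => P.seqX 0 t e j * P.seqX 0 t e k) (hm 0).aestronglyMeasurable
  rw [(P.measurePreserving_shift i).map_eq] at this
  rw [this]
  simp only [seqX_shift]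

/-- The pointwise truncation bound is integrated; stationarity allows the covariance to be computed
at time `i`. -/
theorem Dependence.abs_integral_clipProd_sub_le {q A ν : ℝ} (h : P.Dependence q A ν) (hq : 2 < q)
    {t : ℝ} (ht : t ∈ Icc (0 : ℝ) 1) (j k : Fin p) (hmean : ∀ j, ∫ ω, P.X 0 t ω j ∂μ = 0) (i : ℤ)
    {T : ℝ} (hT : 0 < T) : |∫ e, P.clipProd T t j k i e ∂(iid ℤ P.law) - P.cov t j k|
      ≤ max ν 1 ^ q * ((P.dan (2 * q) A j).toReal ^ q + (P.dan (2 * q) A k).toReal ^ q)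
        * T ^ (2 - 2 * q) := by
  have hmX : ∀ j, Measurable fun e => P.seqX i t e j := fun j =>
    (measurable_pi_apply j).comp (P.measurable_seqX i t)
  have hL2 : ∀ j, MemLp (fun e => P.seqX i t e j) 2 (iid ℤ P.law) := fun j =>
    ⟨(hmX j).aestronglyMeasurable, by rw [P.eLpNorm_seqX]; exact (h.integrable hq ht j).2⟩
  have hprod : Integrable (fun e => P.seqX i t e j * P.seqX i t e k) (iid ℤ P.law) :=
    (hL2 j).integrable_mul (hL2 k)
  have hclip := (P.bddMeas_clipProd hT.le t j k i).integrable (iid ℤ P.law)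
  have hpow : ∀ j, Integrable (fun e => |P.seqX i t e j| ^ (2 * q)) (iid ℤ P.law) ∧
      ∫ e, |P.seqX i t e j| ^ (2 * q) ∂(iid ℤ P.law)
        ≤ max ν 1 ^ q * (P.dan (2 * q) A j).toReal ^ q := by
    intro j
    have h1 := h.lintegral_seqX_le hq ht j (hmean j) i
    have hmeas : AEStronglyMeasurable (fun e => |P.seqX i t e j| ^ (2 * q)) (iid ℤ P.law) :=
      ((hmX j).abs.pow_const _).aestronglyMeasurable
    have hnn : 0 ≤ᵐ[iid ℤ P.law] fun e => |P.seqX i t e j| ^ (2 * q) :=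
      ae_of_all _ fun e => by positivity
    refine ⟨⟨hmeas, ?_⟩, ?_⟩
    · rw [hasFiniteIntegral_iff_ofReal hnn]
      exact h1.trans_lt ENNReal.ofReal_lt_top
    · rw [integral_eq_lintegral_of_nonneg_ae hnn hmeas]
      have hM : 0 < max ν 1 := lt_max_of_lt_right one_pos
      have h0 : 0 ≤ max ν 1 ^ q * (P.dan (2 * q) A j).toReal ^ q := by positivity
      exact (ENNReal.toReal_mono ENNReal.ofReal_ne_top h1).trans_eq (ENNReal.toReal_ofReal h0)
  rw [cov_eq_integral_seqX t j k i, ← integral_sub hclip hprod]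
  refine (abs_integral_le_integral_abs).trans ?_
  calc ∫ e, |P.clipProd T t j k i e - P.seqX i t e j * P.seqX i t e k| ∂(iid ℤ P.law)
      ≤ ∫ e, (|P.seqX i t e j| ^ (2 * q) + |P.seqX i t e k| ^ (2 * q)) * T ^ (2 - 2 * q)
          ∂(iid ℤ P.law) := by
        refine integral_mono (hclip.sub hprod).abs
          (((hpow j).1.add (hpow k).1).mul_const _) fun e => ?_
        show |P.clipProd T t j k i e - P.seqX i t e j * P.seqX i t e k| ≤ _
        rw [abs_sub_comm]
        exact abs_mul_sub_clip_mul_clip_le hT (by linarith)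
    _ = (∫ e, |P.seqX i t e j| ^ (2 * q) ∂(iid ℤ P.law)
          + ∫ e, |P.seqX i t e k| ^ (2 * q) ∂(iid ℤ P.law)) * T ^ (2 - 2 * q) := by
        rw [integral_mul_const, integral_add (hpow j).1 (hpow k).1]
    _ ≤ _ := by
        rw [mul_add]
        gcongr
        · exact (hpow j).2
        · exact (hpow k).2

end CausalProcess

/-! ### Deviation of sums of products over short intervals -/

namespace CausalProcess

variable {Ω : Type*} [MeasurableSpace Ω] {μ : Measure Ω} [IsProbabilityMeasure μ] {p : ℕ}
  {P : CausalProcess μ p}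

/-- The centred products `X_{ij} X_{ik} - σ_{jk}(i/n)` of the observations. -/
def noise (P : CausalProcess μ p) (n : ℕ) (ω : Ω) (j k : Fin p) (i : ℕ) : ℝ :=
  P.X i ((i : ℝ) / n) ω j * P.X i ((i : ℝ) / n) ω k - P.cov ((i : ℝ) / n) j k

/-- `i/n`, projected to the unit interval. -/
def clampTime (n : ℕ) (i : ℤ) : ℝ := max 0 (min 1 ((i : ℝ) / n))

theorem clampTime_mem (n : ℕ) (i : ℤ) : clampTime n i ∈ Icc (0 : ℝ) 1 :=
  ⟨le_max_left _ _, max_le zero_le_one (min_le_left _ _)⟩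

theorem clampTime_natCast {n i : ℕ} (h : i ≤ n) : clampTime n i = (i : ℝ) / n := by
  unfold clampTime
  rw [Int.cast_natCast, min_eq_right (div_le_one_of_le₀ (by exact_mod_cast h) (by positivity)),
    max_eq_right (by positivity)]

/-- The sum of the `q`-th powers of the dependence adjusted norms. -/
def danSum (P : CausalProcess μ p) (q A : ℝ) : ℝ := ∑ j, (P.dan (2 * q) A j).toReal ^ q

theorem dan_rpow_le_danSum {q A : ℝ} (j : Fin p) : (P.dan (2 * q) A j).toReal ^ q ≤ P.danSum q A :=
  Finset.single_le_sum (f := fun j => (P.dan (2 * q) A j).toReal ^ q)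
    (fun _ _ => by positivity) (Finset.mem_univ j)

theorem danSum_nonneg {q A : ℝ} : 0 ≤ P.danSum q A := Finset.sum_nonneg fun _ _ => by positivity

theorem add_rpow_le_two_rpow {x y q : ℝ} (hx : 0 ≤ x) (hy : 0 ≤ y) (hq : 0 ≤ q) :
    (x + y) ^ q ≤ 2 ^ q * (x ^ q + y ^ q) := by
  have h : x + y ≤ 2 * max x y := by linarith [le_max_left x y, le_max_right x y]
  calc (x + y) ^ q ≤ (2 * max x y) ^ q := by gcongr
    _ = 2 ^ q * max x y ^ q := Real.mul_rpow (by norm_num) (le_max_of_le_left hx)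
    _ ≤ _ := by
      gcongr
      rcases max_choice x y with h | h <;> rw [h]
      · linarith [Real.rpow_nonneg hy q]
      · linarith [Real.rpow_nonneg hx q]

/-- Summing over all pairs costs a factor `p` and not `p²`; this is the `p` in `J`. -/
theorem sum_sum_dan_le {q A : ℝ} (hq : 0 ≤ q) :
    ∑ j : Fin p, ∑ k : Fin p, ((P.dan (2 * q) A j).toReal + (P.dan (2 * q) A k).toReal) ^ q
      ≤ 2 ^ q * (2 * (p * P.danSum q A)) := by
  calc _ ≤ ∑ j : Fin p, ∑ k : Fin p, 2 ^ q *
        ((P.dan (2 * q) A j).toReal ^ q + (P.dan (2 * q) A k).toReal ^ q) :=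
        Finset.sum_le_sum fun j _ => Finset.sum_le_sum fun k _ =>
          add_rpow_le_two_rpow ENNReal.toReal_nonneg ENNReal.toReal_nonneg hq
    _ = _ := by
        simp only [← Finset.mul_sum, Finset.sum_add_distrib, Finset.sum_const, Finset.card_univ,
          Fintype.card_fin, nsmul_eq_mul]
        unfold danSum
        ring

/-- The window bound for truncated products: their lag norms at exponents `q` and `2` come from the
process at exponents `2q` and `4`, whence `M_X` and `N_X`. Times are clamped because a dyadic window
may run past `n`, where nothing is assumed. -/
theorem exists_clip_window_le {q Q A ν : ℝ} (hq : 2 < q) (hqQ : q ≤ Q) (hA : 0 < A)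
    (hQA : Q - q < A * q) : ∃ C c : ℝ, 0 < C ∧ 0 < c ∧
    ∀ {Ω : Type*} [MeasurableSpace Ω] {μ : Measure Ω} [IsProbabilityMeasure μ] {p : ℕ}
      (P : CausalProcess μ p), P.Dependence q A ν → 0 < P.NX A →
      (∀ j, 0 < (P.dan (2 * q) A j).toReal) →
      ∀ (n L : ℕ) (T x : ℝ), 0 < T → 0 < x → 1 ≤ c * x ^ 2 / (2 ^ L * P.NX A ^ 2) →
      ∀ (j k : Fin p) (s : ℤ), iid ℤ P.law {e | ∃ m ≤ 2 ^ L, 4 * x ≤ |∑ i ∈ Finset.range m,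
          (P.clipProd T (clampTime n (s + i)) j k (s + i) e
            - ∫ v, P.clipProd T (clampTime n (s + i)) j k (s + i) v ∂(iid ℤ P.law))|}
        ≤ ENNReal.ofReal (C * (2 ^ L * (T ^ 2) ^ (Q - q)
            * ((P.dan (2 * q) A j).toReal + (P.dan (2 * q) A k).toReal) ^ q / x ^ Q
            * levelFactor (levelRatio q Q A) Q L
          + Real.exp (-(c * x ^ 2 / (2 ^ L * P.NX A ^ 2))))) := by
  obtain ⟨C, c, hC, hc, H⟩ := exists_measure_window_le hq hqQ hA hQA
  set κ : ℝ := max ν 1 with hκd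
  have hκ : 0 < κ := lt_max_of_lt_right one_pos
  refine ⟨C * (1 + 2 ^ (Q - q) * κ ^ q), c / (2 * κ) ^ 2, by positivity, by positivity, ?_⟩
  intro Ω _ μ _ p P hP hN hd n L T x hT hx hG j k s
  have hq0 : 0 < q := by linarith
  set dj := (P.dan (2 * q) A j).toReal
  set dk := (P.dan (2 * q) A k).toReal
  have hdj : 0 < dj := hd j
  have hdk : 0 < dk := hd k
  have hGeq : c / (2 * κ) ^ 2 * x ^ 2 / (2 ^ L * P.NX A ^ 2)
      = c * x ^ 2 / (2 ^ L * (2 * κ * P.NX A) ^ 2) := by field_simp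
  rw [hGeq] at hG ⊢
  have hlag : ∀ (a : ℝ), 1 ≤ a → 2 * a ≤ 2 * q → ∀ (i : ℤ) (r : ℕ),
      eLpNorm (lagDiff P.law (P.clipProd T (clampTime n i) j k i) i r) (ENNReal.ofReal a)
        (iid ℤ P.law) ≤ ENNReal.ofReal (κ * ((P.theta (2 * a) j r).toReal
          + (P.theta (2 * a) k r).toReal)) := by
    intro a ha haq i r
    have hfin : ∀ j, P.theta (2 * a) j r ≠ ∞ := fun j =>
      theta_ne_top ((dan_mono haq A j).trans_lt (hP.dan_lt j)) r
    rw [ENNReal.ofReal_mul hκ.le, ENNReal.ofReal_add ENNReal.toReal_nonneg ENNReal.toReal_nonneg,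
      ENNReal.ofReal_toReal (hfin j), ENNReal.ofReal_toReal (hfin k), lagDiff_eq]
    have hsub := P.eLpNorm_clipProd_sub_update_le hT.le ha j k r i (clampTime_mem n i)
      (hP.eLpNorm_le hq (clampTime_mem n i) j haq) (hP.eLpNorm_le hq (clampTime_mem n i) k haq)
    have hnot : (i - r : ℤ) ∉ Ioc (i - r : ℤ) i := by simp
    have hcond := eLpNorm_condOn_sub_le (ν := P.law)
      (P.bddMeas_clipProd hT.le (clampTime n i) j k i) hnot ha
    refine hcond.trans (le_trans (le_of_eq ?_) hsub)
    congr 1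
    funext e
    congr!
  have hsum : ∀ (a D : ℝ), P.dan a A j < ∞ → P.dan a A k < ∞ →
      (P.dan a A j).toReal + (P.dan a A k).toReal ≤ D → ∀ m R : ℕ,
      ∑ r ∈ Finset.Ico m R, κ * ((P.theta a j r).toReal + (P.theta a k r).toReal)
        ≤ κ * D * ((m : ℝ) + 1) ^ (-A) := by
    intro a D h1 h2 hD m R
    rw [← Finset.mul_sum, Finset.sum_add_distrib, mul_assoc]
    gcongr
    calc _ ≤ ((P.dan a A j).toReal + (P.dan a A k).toReal) * ((m : ℝ) + 1) ^ (-A) := by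
          rw [add_mul]; exact add_le_add (sum_theta_le h1 m R) (sum_theta_le h2 m R)
      _ ≤ _ := by gcongr
  have hlag4 : ∀ (i : ℤ) (r : ℕ),
      eLpNorm (lagDiff P.law (P.clipProd T (clampTime n i) j k i) i r) (ENNReal.ofReal 2)
        (iid ℤ P.law) ≤ ENNReal.ofReal (κ * ((P.theta 4 j r).toReal
          + (P.theta 4 k r).toReal)) := by
    intro i r
    have := hlag 2 (by norm_num) (by linarith) i r
    rwa [show (2 : ℝ) * 2 = 4 by norm_num] at this
  have hsum4 := hsum 4 (2 * P.NX A) (hP.dan_four_lt hq j) (hP.dan_four_lt hq k)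
    (by linarith [hP.dan_four_le_NX hq j, hP.dan_four_le_NX hq k])
  rw [show κ * (2 * P.NX A) = 2 * κ * P.NX A by ring] at hsum4
  have hS0 : 0 < 2 * T ^ 2 := by positivity
  have hS : ∀ (i : ℤ) (e : ℤ → Fin p → ℝ), 2 * |P.clipProd T (clampTime n i) j k i e| ≤ 2 * T ^ 2 :=
    fun i e => mul_le_mul_of_nonneg_left (P.abs_clipProd_le hT.le (clampTime n i) j k i e) (by norm_num)
  have hu0 : 0 < κ * (dj + dk) := by positivity
  have hg0 : 0 < 2 * κ * P.NX A := by positivity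
  have hunn : ∀ r, 0 ≤ κ * ((P.theta (2 * q) j r).toReal + (P.theta (2 * q) k r).toReal) :=
    fun r => mul_nonneg hκ.le (add_nonneg ENNReal.toReal_nonneg ENNReal.toReal_nonneg)
  have hγnn : ∀ r, 0 ≤ κ * ((P.theta 4 j r).toReal + (P.theta 4 k r).toReal) :=
    fun r => mul_nonneg hκ.le (add_nonneg ENNReal.toReal_nonneg ENNReal.toReal_nonneg)
  have key := H (ν := P.law) (f := fun i => P.clipProd T (clampTime n i) j k i)
    (fun i => P.bddMeas_clipProd hT.le _ j k i) (fun i => P.dependsOn_clipProd T _ j k i)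
    (S := 2 * T ^ 2) (u₀ := κ * (dj + dk)) (g₀ := 2 * κ * P.NX A) (x := x)
    (u := fun r => κ * ((P.theta (2 * q) j r).toReal + (P.theta (2 * q) k r).toReal))
    (γ := fun r => κ * ((P.theta 4 j r).toReal + (P.theta 4 k r).toReal))
    hS0 hS hu0 hg0 hx hunn hγnn (hlag q (by linarith) le_rfl) hlag4 (fun m R => hsum (2 * q) _ (hP.dan_lt j) (hP.dan_lt k) le_rfl m R) hsum4 L s hG
  refine key.trans (ENNReal.ofReal_le_ofReal ?_)
  rw [Real.mul_rpow (by norm_num) (by positivity), Real.mul_rpow hκ.le (by positivity)]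
  have hΨ : 0 ≤ levelFactor (levelRatio q Q A) Q L := by
    have : 0 < levelRatio q Q A := by unfold levelRatio; positivity
    unfold levelFactor
    split_ifs <;> positivity
  set Ψ := levelFactor (levelRatio q Q A) Q L
  set G := Real.exp (-(c * x ^ 2 / (2 ^ L * (2 * κ * P.NX A) ^ 2)))
  have hG0 : 0 < G := Real.exp_pos _
  have h1 : 0 ≤ C * (2 ^ L * (T ^ 2) ^ (Q - q) * (dj + dk) ^ q / x ^ Q * Ψ) := by positivity
  have h2 : 0 ≤ C * (2 ^ (Q - q) * κ ^ q) * G := by positivity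
  calc _ = C * (2 ^ L * (T ^ 2) ^ (Q - q) * (dj + dk) ^ q / x ^ Q * Ψ) * (2 ^ (Q - q) * κ ^ q)
        + C * G := by ring
    _ ≤ C * (2 ^ L * (T ^ 2) ^ (Q - q) * (dj + dk) ^ q / x ^ Q * Ψ) * (1 + 2 ^ (Q - q) * κ ^ q)
        + C * G + C * (2 ^ (Q - q) * κ ^ q) * G := by linarith
    _ = _ := by ring

/-- Uniform deviation of sums of products over intervals of bounded length. -/
theorem exists_deviation_le {q Q A ν : ℝ} (hq : 2 < q) (hqQ : q ≤ Q) (hA : 0 < A)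
    (hQA : Q - q < A * q) : ∃ C c : ℝ, 0 < C ∧ 0 < c ∧
    ∀ {Ω : Type*} [MeasurableSpace Ω] {μ : Measure Ω} [IsProbabilityMeasure μ] {p : ℕ}
      (P : CausalProcess μ p), P.Dependence q A ν → 0 < P.NX A →
      (∀ j, 0 < (P.dan (2 * q) A j).toReal) →
      (∀ t ∈ Icc (0 : ℝ) 1, ∀ j, ∫ ω, P.X 0 t ω j ∂μ = 0) →
      ∀ (n L : ℕ) (T x y : ℝ), 0 < T → 0 < x → 2 ^ L ≤ n →
      1 ≤ c * x ^ 2 / (2 ^ L * P.NX A ^ 2) →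
      4 * x + 2 ^ L * (C * P.danSum q A * T ^ (2 - 2 * q)) ≤ y →
      μ {ω | ∃ j k, ∃ a b : ℕ, 1 ≤ a ∧ a ≤ b ∧ b ≤ n + 1 ∧ b - a ≤ 2 ^ L ∧
          3 * y ≤ |∑ i ∈ Finset.Ico a b, P.noise n ω j k i|}
        ≤ ENNReal.ofReal (C * (n * P.danSum q A / T ^ (2 * q)
          + n * p * P.danSum q A * (T ^ 2) ^ (Q - q) / x ^ Q
            * levelFactor (levelRatio q Q A) Q L
          + p ^ 2 * (n / 2 ^ L) * Real.exp (-(c * x ^ 2 / (2 ^ L * P.NX A ^ 2))))) := by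
  obtain ⟨C, c, hC, hc, H⟩ := exists_clip_window_le (ν := ν) hq hqQ hA hQA
  set κ : ℝ := max ν 1 with hκd
  have hκ : 0 < κ := lt_max_of_lt_right one_pos
  refine ⟨2 * κ ^ q + 4 * C * 2 ^ q + 2 * C, c, by positivity, hc, ?_⟩
  intro Ω _ μ _ p P hP hN hd hmean n L T x y hT hx hLn hG hy
  have hq0 : 0 < q := by linarith
  set D := P.danSum q A
  have hD : 0 ≤ D := danSum_nonneg
  have hdD : ∀ j, (P.dan (2 * q) A j).toReal ^ q ≤ D := dan_rpow_le_danSum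
  set C' := 2 * κ ^ q + 4 * C * 2 ^ q + 2 * C
  set G := Real.exp (-(c * x ^ 2 / (2 ^ L * P.NX A ^ 2))) with hGd
  have hG0 : 0 < G := Real.exp_pos _
  have hΨ : 0 ≤ levelFactor (levelRatio q Q A) Q L := by
    have : 0 < levelRatio q Q A := by unfold levelRatio; positivity
    unfold levelFactor
    split_ifs <;> positivity
  set Ψ := levelFactor (levelRatio q Q A) Q L
  let win : ℕ → ℤ := fun w => ((1 + w * 2 ^ L : ℕ) : ℤ)
  let Bad : Fin p → Fin p → ℕ → Set (ℤ → Fin p → ℝ) := fun j k w =>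
    {e | ∃ m ≤ 2 ^ L, 4 * x ≤ |∑ i ∈ Finset.range m,
      (P.clipProd T (clampTime n (win w + i)) j k (win w + i) e
        - ∫ v, P.clipProd T (clampTime n (win w + i)) j k (win w + i) v ∂(iid ℤ P.law))|}
  -- Outside these events truncation changes no observation.
  let Ex : ℕ → Fin p → Set (ℤ → Fin p → ℝ) := fun i j =>
    {e | T < |P.seqX i (clampTime n i) e j|}
  let I := Finset.Icc 1 n
  let J := Finset.range (n / 2 ^ L + 1)
  have hsub : {ω | ∃ j k, ∃ a b : ℕ, 1 ≤ a ∧ a ≤ b ∧ b ≤ n + 1 ∧ b - a ≤ 2 ^ L ∧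
      3 * y ≤ |∑ i ∈ Finset.Ico a b, P.noise n ω j k i|}
      ⊆ P.innov ⁻¹' ((⋃ i ∈ I, ⋃ j, Ex i j) ∪ ⋃ w ∈ J, ⋃ j, ⋃ k, Bad j k w) := by
    rintro ω ⟨j, k, a, b, ha, hab, hb, hl, hbig⟩
    by_contra hcon
    simp only [mem_preimage, mem_union, mem_iUnion, not_or, not_exists] at hcon
    obtain ⟨hEx, hBad⟩ := hcon
    refine absurd hbig (not_le.2 ?_)
    set m : ℕ → ℝ := fun i => ∫ v, P.clipProd T (clampTime n i) j k i v ∂(iid ℤ P.law)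
    set z : ℝ := C' * D * T ^ (2 - 2 * q) with hzd
    have hz : 0 ≤ z := by positivity
    -- Inside the sample this is the noise. Beyond it the truncated summand itself is used, so that
    -- the comparison with the windows holds there trivially.
    let g : ℕ → ℝ := fun i => if i ∈ I then P.noise n ω j k i else
      P.clipProd T (clampTime n i) j k i (P.innov ω) - m i
    have hgI : ∑ i ∈ Finset.Ico a b, P.noise n ω j k i = ∑ i ∈ Finset.Ico a b, g i := by
      refine Finset.sum_congr rfl fun i hi => ?_
      rw [Finset.mem_Ico] at hi
      simp only [g]
      rw [if_pos (Finset.mem_Icc.2 ⟨by omega, by omega⟩)]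
    have hgm : ∀ i : ℕ, |g i - (P.clipProd T (clampTime n i) j k i (P.innov ω) - m i)| ≤ z := by
      intro i
      simp only [g]
      split_ifs with hi
      · have hi' := Finset.mem_Icc.1 hi
        have hclip : ∀ j, clip T (P.seqX i (clampTime n i) (P.innov ω) j)
            = P.X i ((i : ℝ) / n) ω j := fun j => by
          rw [clip_eq_self (not_lt.1 (hEx i hi j)), ← X_eq_seqX, clampTime_natCast hi'.2]
        have h1 := hP.abs_integral_clipProd_sub_le hq (clampTime_mem n i) j k
          (hmean _ (clampTime_mem n i)) i hT
        rw [noise, clipProd, hclip, hclip, ← clampTime_natCast hi'.2,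
          show ∀ u v w : ℝ, u - v - (u - w) = w - v by intros; ring]
        refine h1.trans ?_
        rw [hzd]
        refine mul_le_mul_of_nonneg_right ?_ (by positivity)
        calc κ ^ q * ((P.dan (2 * q) A j).toReal ^ q + (P.dan (2 * q) A k).toReal ^ q)
            ≤ κ ^ q * (D + D) := by gcongr <;> exact hdD _
          _ = 2 * κ ^ q * D := by ring
          _ ≤ C' * D := by
            refine mul_le_mul_of_nonneg_right ?_ hD
            have : 0 ≤ 4 * C * 2 ^ q + 2 * C := by positivity
            simp only [C']; linarith
      · rw [sub_self, abs_zero]; exact hz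
    rw [hgI]
    refine abs_sum_Ico_lt_of_windows (W := 2 ^ L) (n := n) (by positivity) ?_ ha hab hb hl
    intro w hw mm hmm
    have hB : |∑ i ∈ Finset.range mm, (P.clipProd T (clampTime n (win w + i)) j k (win w + i)
        (P.innov ω) - ∫ v, P.clipProd T (clampTime n (win w + i)) j k (win w + i) v
          ∂(iid ℤ P.law))| < 4 * x := by
      by_contra hcon
      exact hBad w (Finset.mem_range.2 (Nat.lt_succ_of_le hw)) j k ⟨mm, hmm, not_lt.1 hcon⟩
    have hcast : ∀ i : ℕ, win w + (i : ℤ) = ((1 + w * 2 ^ L + i : ℕ) : ℤ) := fun i => by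
      simp only [win]; push_cast; ring
    simp only [hcast] at hB
    have hdiff : |∑ i ∈ Finset.range mm, g (1 + w * 2 ^ L + i)
        - ∑ i ∈ Finset.range mm, (P.clipProd T (clampTime n (1 + w * 2 ^ L + i : ℕ)) j k
          (1 + w * 2 ^ L + i : ℕ) (P.innov ω) - m (1 + w * 2 ^ L + i))| ≤ 2 ^ L * z := by
      rw [← Finset.sum_sub_distrib]
      refine (Finset.abs_sum_le_sum_abs _ _).trans ((Finset.sum_le_sum fun i _ => hgm _).trans ?_)
      rw [Finset.sum_const, Finset.card_range, nsmul_eq_mul]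
      gcongr
      exact_mod_cast hmm
    rw [abs_sub_le_iff] at hdiff
    have hB' := abs_lt.1 hB
    rw [abs_lt]
    constructor <;> linarith [hdiff.1, hdiff.2, hB'.1, hB'.2]
  have hEx : ∀ i j, iid ℤ P.law (Ex i j)
      ≤ ENNReal.ofReal (κ ^ q * (P.dan (2 * q) A j).toReal ^ q / T ^ (2 * q)) := fun i j =>
    hP.measure_exceed_le hq (clampTime_mem n i) j (hmean _ (clampTime_mem n i) j) i hT
  have hBad : ∀ j k w, iid ℤ P.law (Bad j k w) ≤ ENNReal.ofReal (C * (2 ^ L * (T ^ 2) ^ (Q - q)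
      * ((P.dan (2 * q) A j).toReal + (P.dan (2 * q) A k).toReal) ^ q / x ^ Q * Ψ + G)) :=
    fun j k w => H P hP hN hd n L T x hT hx hG j k (win w)
  -- This inequality between a measure and its image needs no measurability of the set.
  refine (measure_mono hsub).trans ((Measure.le_map_apply
    P.measurePreserving_innov.measurable.aemeasurable _).trans ?_)
  rw [P.measurePreserving_innov.map_eq]
  have h1 : iid ℤ P.law (⋃ i ∈ I, ⋃ j, Ex i j)
      ≤ ENNReal.ofReal (κ ^ q * (n * D / T ^ (2 * q))) := by
    refine (measure_biUnion_finset_le I _).trans ?_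
    calc ∑ i ∈ I, iid ℤ P.law (⋃ j, Ex i j)
        ≤ ∑ i ∈ I, ∑ j, ENNReal.ofReal (κ ^ q * (P.dan (2 * q) A j).toReal ^ q / T ^ (2 * q)) :=
          Finset.sum_le_sum fun i _ => (measure_iUnion_fintype_le _ _).trans
            (Finset.sum_le_sum fun j _ => hEx i j)
      _ = _ := by
          rw [Finset.sum_const, Nat.card_Icc, Nat.add_sub_cancel, nsmul_eq_mul,
            ← ENNReal.ofReal_sum_of_nonneg fun j _ => by positivity, ← ENNReal.ofReal_natCast,
            ← ENNReal.ofReal_mul (by positivity), ← Finset.sum_div, ← Finset.mul_sum]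
          congr 1
          simp only [D, danSum]
          ring
  have h2 : iid ℤ P.law (⋃ w ∈ J, ⋃ j, ⋃ k, Bad j k w)
      ≤ ENNReal.ofReal ((n / 2 ^ L + 1 : ℝ) * (C * (2 ^ L * (T ^ 2) ^ (Q - q)
        * (2 ^ q * (2 * (p * D))) / x ^ Q * Ψ + p ^ 2 * G))) := by
    refine (measure_biUnion_finset_le J _).trans ?_
    calc ∑ w ∈ J, iid ℤ P.law (⋃ j, ⋃ k, Bad j k w)
        ≤ ∑ w ∈ J, ∑ j, ∑ k, ENNReal.ofReal (C * (2 ^ L * (T ^ 2) ^ (Q - q)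
            * ((P.dan (2 * q) A j).toReal + (P.dan (2 * q) A k).toReal) ^ q / x ^ Q * Ψ + G)) :=
          Finset.sum_le_sum fun w _ => (measure_iUnion_fintype_le _ _).trans
            (Finset.sum_le_sum fun j _ => (measure_iUnion_fintype_le _ _).trans
              (Finset.sum_le_sum fun k _ => hBad j k w))
      _ = ENNReal.ofReal ((n / 2 ^ L + 1 : ℕ) * ∑ j : Fin p, ∑ k : Fin p,
          (C * (2 ^ L * (T ^ 2) ^ (Q - q)
            * ((P.dan (2 * q) A j).toReal + (P.dan (2 * q) A k).toReal) ^ q / x ^ Q * Ψ + G))) := by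
          rw [Finset.sum_const, Finset.card_range, nsmul_eq_mul, ENNReal.ofReal_mul (by positivity),
            ENNReal.ofReal_natCast, ENNReal.ofReal_sum_of_nonneg
              fun j _ => Finset.sum_nonneg fun k _ => by positivity]
          congr 1
          refine Finset.sum_congr rfl fun j _ => ?_
          rw [ENNReal.ofReal_sum_of_nonneg fun k _ => by positivity]
      _ ≤ _ := by
          refine ENNReal.ofReal_le_ofReal ?_
          have hcast : ((n / 2 ^ L + 1 : ℕ) : ℝ) ≤ n / 2 ^ L + 1 := by
            push_cast
            have : ((n / 2 ^ L : ℕ) : ℝ) ≤ (n : ℝ) / ((2 ^ L : ℕ) : ℝ) := Nat.cast_div_le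
            push_cast at this
            linarith
          have hss := sum_sum_dan_le (P := P) (A := A) hq0.le
          have heq : ∑ j : Fin p, ∑ k : Fin p, (C * (2 ^ L * (T ^ 2) ^ (Q - q)
              * ((P.dan (2 * q) A j).toReal + (P.dan (2 * q) A k).toReal) ^ q / x ^ Q * Ψ + G))
              = C * (2 ^ L * (T ^ 2) ^ (Q - q) * (∑ j : Fin p, ∑ k : Fin p,
                ((P.dan (2 * q) A j).toReal + (P.dan (2 * q) A k).toReal) ^ q) / x ^ Q * Ψ
                + p ^ 2 * G) := by
            simp only [← Finset.mul_sum, Finset.sum_add_distrib, Finset.sum_const, Finset.card_univ,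
              Fintype.card_fin, nsmul_eq_mul, ← Finset.sum_mul, ← Finset.sum_div]
            ring
          rw [heq]
          gcongr
  refine (measure_union_le _ _).trans ((add_le_add h1 h2).trans ?_)
  rw [← ENNReal.ofReal_add (by positivity) (by positivity)]
  refine ENNReal.ofReal_le_ofReal ?_
  have hn2 : (n / 2 ^ L + 1 : ℝ) ≤ 2 * (n / 2 ^ L) := by
    have : (1 : ℝ) ≤ n / 2 ^ L := by
      rw [one_le_div (by positivity)]; exact_mod_cast hLn
    linarith
  set Y := n * p * D * (T ^ 2) ^ (Q - q) / x ^ Q * Ψ with hY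
  set Z := n * D / T ^ (2 * q) with hZ
  have hY0 : 0 ≤ Y := by positivity
  have hZ0 : 0 ≤ Z := by positivity
  set V := (p : ℝ) ^ 2 * (n / 2 ^ L) * G with hV
  have hV0 : 0 ≤ V := by positivity
  calc κ ^ q * Z + (n / 2 ^ L + 1 : ℝ) * (C * (2 ^ L * (T ^ 2) ^ (Q - q)
        * (2 ^ q * (2 * (p * D))) / x ^ Q * Ψ + p ^ 2 * G))
      ≤ κ ^ q * Z + 2 * (n / 2 ^ L) * (C * (2 ^ L * (T ^ 2) ^ (Q - q)
        * (2 ^ q * (2 * (p * D))) / x ^ Q * Ψ + p ^ 2 * G)) := by gcongr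
    _ = κ ^ q * Z + 4 * C * 2 ^ q * Y + 2 * C * V := by
        rw [hY, hV]
        have : (2 : ℝ) ^ L ≠ 0 := by positivity
        field_simp
        ring
    _ ≤ C' * Z + C' * Y + C' * V := by
        have e1 : 0 ≤ κ ^ q := by positivity
        have e2 : 0 ≤ 4 * C * 2 ^ q := by positivity
        gcongr <;> simp only [C'] <;> linarith
    _ = _ := by ring

end CausalProcess

/-! ### Asymptotics of the deviation bound -/

theorem two_pow_log_le {x : ℝ} (hx : 1 ≤ x) : (2 : ℝ) ^ Nat.log 2 ⌊x⌋₊ ≤ x := by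
  have h1 : ⌊x⌋₊ ≠ 0 := (Nat.floor_pos.2 hx).ne'
  have h2 : 2 ^ Nat.log 2 ⌊x⌋₊ ≤ ⌊x⌋₊ := Nat.pow_log_le_self 2 h1
  calc (2 : ℝ) ^ Nat.log 2 ⌊x⌋₊ ≤ (⌊x⌋₊ : ℝ) := by exact_mod_cast h2
    _ ≤ x := Nat.floor_le (by linarith)

theorem lt_two_mul_two_pow_log (x : ℝ) : x < 2 * 2 ^ Nat.log 2 ⌊x⌋₊ := by
  have h2 : ⌊x⌋₊ < 2 ^ (Nat.log 2 ⌊x⌋₊ + 1) := Nat.lt_pow_succ_log_self (by norm_num) _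
  calc x < ⌊x⌋₊ + 1 := Nat.lt_floor_add_one x
    _ ≤ 2 ^ (Nat.log 2 ⌊x⌋₊ + 1) := by exact_mod_cast h2
    _ = _ := by rw [pow_succ]; ring

/-- From `n ≥ 3` one has `log n ≥ 1`, and in the last case the exponent `q / 2 - A q` is at least
one. -/
theorem le_varpi {q A : ℝ} {n : ℕ} (hq : 0 < q) (hn : 3 ≤ n) : (n : ℝ) ≤ varpi q A n := by
  have hn' : (3 : ℝ) ≤ n := by exact_mod_cast hn
  have h1 : (1 : ℝ) ≤ n := by linarith
  unfold varpi
  split_ifs with h h'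
  · exact le_rfl
  · have hlog : 1 ≤ Real.log n := by
      rw [Real.le_log_iff_exp_le (by linarith)]
      linarith [Real.exp_one_lt_d9]
    exact le_mul_of_one_le_right (by linarith) (Real.one_le_rpow hlog (by positivity))
  · calc (n : ℝ) = (n : ℝ) ^ (1 : ℝ) := (Real.rpow_one _).symm
      _ ≤ _ := by
        refine Real.rpow_le_rpow_of_exponent_le h1 ?_
        push Not at h
        have hlt := mul_le_mul_of_nonneg_right h hq.le
        rw [sub_mul, one_div_mul_cancel hq.ne'] at hlt
        linarith

/-- Fast decay: with `Q` slightly above `q` the level ratio is still below one, and the truncation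
gains a negative power of `p`. Boundary case: `Q = q`, the ratio is one, and `(L + 1)^(q+1)` is of
order at most `(log n)^(q+1)`, which against `(log n)^(1+2q)` leaves `(log n)^(-q)`. Slow decay: `Q
= q`, and with `a = q/2 - 1 - A q > 0` the factor is at most `(n b)^a` while `ϖ = n^(1+a)`, which
leaves `b^a`. -/
theorem exists_polynomial_term_tendsto {q A : ℝ} (hq : 2 < q) (hA : 0 < A) :
    ∃ Q : ℝ, q ≤ Q ∧ Q - q < A * q ∧ ∀ (p L : ℕ → ℕ) (b : ℕ → ℝ), Tendsto p atTop atTop →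
      Tendsto b atTop (𝓝 0) → (∀ᶠ n : ℕ in atTop, (2 : ℝ) ^ L n ≤ n * b n) →
      Tendsto (fun n : ℕ => n / varpi q A n * (p n : ℝ) ^ (-((Q - q) / (2 * q)))
        * levelFactor (levelRatio q Q A) Q (L n)) atTop (𝓝 0) := by
  have hq0 : 0 < q := by linarith
  have hvar0 : ∀ᶠ n : ℕ in atTop, (0 : ℝ) < n ∧ (n : ℝ) ≤ varpi q A n := by
    filter_upwards [eventually_ge_atTop 3] with n hn
    exact ⟨by exact_mod_cast (by omega : 0 < n), le_varpi hq0 hn⟩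
  have hmulq : (1 / 2 - 1 / q) * q = q / 2 - 1 := by field_simp
  rcases lt_trichotomy (1 / 2 - 1 / q) A with h | h | h
  · have hgap : 0 < A * q + 1 - q / 2 := by
      have := mul_lt_mul_of_pos_right h hq0
      linarith
    -- The exponent of the level ratio is `3 η / 2 - (A q + 1 - q / 2)`, negative for this `η`; the
    -- other half of the minimum gives `Q - q < A q`.
    set η : ℝ := min (A * q + 1 - q / 2) (A * q) / 2 with hη
    have hAq : 0 < A * q := by positivity
    have hη0 : 0 < η := by positivity
    have hη1 : 2 * η ≤ A * q + 1 - q / 2 := by rw [hη]; linarith [min_le_left (A * q + 1 - q / 2) (A * q)]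
    have hη2 : 2 * η ≤ A * q := by rw [hη]; linarith [min_le_right (A * q + 1 - q / 2) (A * q)]
    refine ⟨q + η, by linarith, by linarith, fun p L b hp hb hL => ?_⟩
    have hratio : levelRatio q (q + η) A < 1 := by
      unfold levelRatio
      exact Real.rpow_lt_one_of_one_lt_of_neg (by norm_num) (by linarith)
    unfold levelFactor
    simp only [if_pos hratio, mul_one, add_sub_cancel_left]
    have hp' : Tendsto (fun n => (p n : ℝ) ^ (-(η / (2 * q)))) atTop (𝓝 0) :=
      (tendsto_rpow_neg_atTop (by positivity)).comp (tendsto_natCast_atTop_atTop.comp hp)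
    refine squeeze_zero' ?_ ?_ hp'
    · filter_upwards [hvar0] with n hn
      have : 0 < varpi q A n := hn.1.trans_le hn.2
      positivity
    · filter_upwards [hvar0] with n hn
      refine mul_le_of_le_one_left (by positivity) ?_
      rw [div_le_one (hn.1.trans_le hn.2)]
      exact hn.2
  · refine ⟨q, le_rfl, by rw [sub_self]; positivity, fun p L b hp hb hL => ?_⟩
    have hratio : levelRatio q q A = 1 := by
      unfold levelRatio
      rw [← h, hmulq]; norm_num
    have hlim : Tendsto (fun n : ℕ => 3 ^ (q + 1) * Real.log n ^ (-q)) atTop (𝓝 0) := by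
      rw [← mul_zero ((3 : ℝ) ^ (q + 1))]
      exact ((tendsto_rpow_neg_atTop hq0).comp (Real.tendsto_log_atTop.comp
        tendsto_natCast_atTop_atTop)).const_mul _
    have hb1 : ∀ᶠ n in atTop, b n ≤ 1 := hb.eventually (eventually_le_nhds one_pos)
    have hv : ∀ n : ℕ, varpi q A n = n * Real.log n ^ (1 + 2 * q) := fun n => by
      unfold varpi; rw [if_neg (by rw [h]; exact lt_irrefl _), if_pos h.symm]
    unfold levelFactor
    simp only [hratio, lt_irrefl, if_false, if_true, sub_self, zero_div, neg_zero, Real.rpow_zero,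
      mul_one, hv]
    refine squeeze_zero' (Eventually.of_forall fun n => ?_) ?_ hlim
    · have : 0 ≤ Real.log n := Real.log_natCast_nonneg n
      positivity
    · filter_upwards [hb1, hL, eventually_ge_atTop 3] with n hbn hLn hn
      have hn' : (3 : ℝ) ≤ n := by exact_mod_cast hn
      have hlog : 1 ≤ Real.log n := by
        rw [Real.le_log_iff_exp_le (by linarith)]
        linarith [Real.exp_one_lt_d9]
      have hlog0 : 0 < Real.log n := by linarith
      have hLlog : (L n : ℝ) + 1 ≤ 3 * Real.log n := by
        have h1 : (2 : ℝ) ^ L n ≤ n := hLn.trans (mul_le_of_le_one_right (by linarith) hbn)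
        have h2 := Real.log_le_log (by positivity) h1
        rw [Real.log_pow] at h2
        have h3 := Real.log_two_gt_d9
        have h4 : (0 : ℝ) ≤ L n := Nat.cast_nonneg _
        nlinarith
      calc (n : ℝ) / (n * Real.log n ^ (1 + 2 * q)) * ((L n : ℝ) + 1) ^ (q + 1)
          ≤ (n : ℝ) / (n * Real.log n ^ (1 + 2 * q)) * (3 * Real.log n) ^ (q + 1) := by gcongr
        _ = 3 ^ (q + 1) * (Real.log n ^ (q + 1) / Real.log n ^ (1 + 2 * q)) := by
            rw [Real.mul_rpow (by norm_num) hlog0.le]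
            have : (n : ℝ) ≠ 0 := by linarith
            field_simp
        _ = _ := by
            rw [← Real.rpow_sub hlog0]
            congr 2; ring
  · refine ⟨q, le_rfl, by rw [sub_self]; positivity, fun p L b hp hb hL => ?_⟩
    set a : ℝ := q / 2 - 1 - A * q with ha
    have ha0 : 0 < a := by
      have := mul_lt_mul_of_pos_right h hq0
      linarith
    have hr : levelRatio q q A = 2 ^ a := by
      unfold levelRatio; congr 1; rw [ha]; ring
    have hr1 : (1 : ℝ) < 2 ^ a := Real.one_lt_rpow (by norm_num) ha0
    have hv : ∀ n : ℕ, varpi q A n = (n : ℝ) ^ (q / 2 - A * q) := fun n => by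
      unfold varpi; rw [if_neg h.not_gt, if_neg h.ne]
    unfold levelFactor
    simp only [hr, if_neg hr1.not_gt, if_neg hr1.ne', sub_self, zero_div, neg_zero, Real.rpow_zero,
      mul_one, hv, two_rpow_pow]
    have hlim : Tendsto (fun n => |b n| ^ a) atTop (𝓝 0) := by
      have := (hb.abs).rpow_const (p := a) (Or.inr ha0.le)
      rwa [abs_zero, Real.zero_rpow ha0.ne'] at this
    refine squeeze_zero' (Eventually.of_forall fun n => by positivity) ?_ hlim
    filter_upwards [hL, eventually_ge_atTop 1] with n hLn hn
    have hn0 : (0 : ℝ) < n := by exact_mod_cast hn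
    calc (n : ℝ) / (n : ℝ) ^ (q / 2 - A * q) * (2 ^ L n) ^ a
        ≤ (n : ℝ) / (n : ℝ) ^ (q / 2 - A * q) * (n * |b n|) ^ a := by
          gcongr
          exact hLn.trans (by gcongr; exact le_abs_self _)
      _ = (n : ℝ) ^ (1 - (q / 2 - A * q) + a) * |b n| ^ a := by
          rw [Real.mul_rpow hn0.le (abs_nonneg _), Real.rpow_add hn0, Real.rpow_sub hn0 1 (q / 2 - A * q),
            Real.rpow_one]
          ring
      _ = |b n| ^ a := by
          rw [show 1 - (q / 2 - A * q) + a = 0 by rw [ha]; ring, Real.rpow_zero, one_mul]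

/-- The exponent is `c log p / b` with `b → 0`. Half of it absorbs `p²` as soon as `b ≤ c / 4`, and
the other half absorbs `2 / b ≤ 2 log p / b`. -/
theorem gaussian_term_tendsto {c : ℝ} (hc : 0 < c) {p : ℕ → ℕ} {b : ℕ → ℝ}
    (hp : Tendsto p atTop atTop) (hb : Tendsto b atTop (𝓝 0)) (hb0 : ∀ᶠ n in atTop, 0 < b n) :
    Tendsto (fun n => Real.log (p n) / b n) atTop atTop ∧
    Tendsto (fun n => (p n : ℝ) ^ 2 * (2 / b n) * Real.exp (-(c * (Real.log (p n) / b n)))) atTop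
      (𝓝 0) := by
  have hlog : Tendsto (fun n => Real.log (p n)) atTop atTop :=
    Real.tendsto_log_atTop.comp (tendsto_natCast_atTop_atTop.comp hp)
  have hy : Tendsto (fun n => Real.log (p n) / b n) atTop atTop := by
    have hinv : Tendsto (fun n => (b n)⁻¹) atTop atTop :=
      (tendsto_nhdsWithin_iff.2 ⟨hb, hb0⟩).inv_tendsto_nhdsGT_zero
    simpa [div_eq_mul_inv] using hlog.atTop_mul_atTop₀ hinv
  refine ⟨hy, ?_⟩
  have hlim : Tendsto (fun n => 2 * ((2 / c) * ((c / 2 * (Real.log (p n) / b n)) ^ 1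
      * Real.exp (-(c / 2 * (Real.log (p n) / b n)))))) atTop (𝓝 0) := by
    have h := (Real.tendsto_pow_mul_exp_neg_atTop_nhds_zero 1).comp
      (hy.const_mul_atTop (by positivity : 0 < c / 2))
    have := (h.const_mul (2 / c)).const_mul 2
    simpa using this
  refine squeeze_zero' ?_ ?_ hlim
  · filter_upwards [hb0] with n hn
    positivity
  · filter_upwards [hb0, hb.eventually (eventually_le_nhds (by positivity : 0 < c / 4)),
      hlog.eventually_ge_atTop 1, hp.eventually_ge_atTop 1] with n hb0 hbc hl hp1
    have hp0 : (0 : ℝ) < p n := by exact_mod_cast hp1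
    set y := Real.log (p n) / b n with hyd
    have hyl : Real.log (p n) = y * b n := by rw [hyd]; field_simp
    have hy0 : 0 < y := by positivity
    have h1 : (p n : ℝ) ^ 2 ≤ Real.exp (c / 2 * y) := by
      rw [← Real.exp_log hp0, ← Real.exp_nat_mul]
      refine Real.exp_le_exp.2 ?_
      rw [hyl]
      push_cast
      nlinarith
    have h2 : 2 / b n ≤ 2 * y := by
      rw [hyd, mul_div_assoc']
      gcongr
      linarith
    calc (p n : ℝ) ^ 2 * (2 / b n) * Real.exp (-(c * y))
        ≤ Real.exp (c / 2 * y) * (2 * y) * Real.exp (-(c * y)) := by gcongr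
      _ = 2 * y * Real.exp (-(c / 2 * y)) := by
          rw [show -(c / 2 * y) = c / 2 * y + -(c * y) by ring, Real.exp_add]; ring
      _ = _ := by field_simp

/-! ### The rates in terms of the dependence adjusted norms -/

namespace CausalProcess

variable {Ω : Type*} [MeasurableSpace Ω] {μ : Measure Ω} [IsProbabilityMeasure μ] {p : ℕ}
  {P : CausalProcess μ p}

theorem Dependence.MX_rpow {q A ν : ℝ} (h : P.Dependence q A ν) (hq : 2 < q) :
    P.MX q A ^ q = P.danSum q A := by
  have hq0 : 0 < q := by linarith
  unfold MX danSum
  rw [ENNReal.toReal_rpow, ← ENNReal.rpow_mul, one_div_mul_cancel hq0.ne', ENNReal.rpow_one,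
    ENNReal.toReal_sum fun j _ => ENNReal.rpow_ne_top_of_nonneg hq0.le (h.dan_lt j).ne]
  exact Finset.sum_congr rfl fun j _ => (ENNReal.toReal_rpow _ _).symm

theorem NX_nonneg {A : ℝ} : 0 ≤ P.NX A := ENNReal.toReal_nonneg

theorem J_nonneg {q A : ℝ} {n : ℕ} : 0 ≤ P.J q A n := by
  have : 0 ≤ varpi q A n := by
    have := Real.log_natCast_nonneg n
    unfold varpi
    split_ifs <;> positivity
  have : 0 ≤ P.MX q A := ENNReal.toReal_nonneg
  unfold J
  positivity

theorem Dependence.J_rpow {q A ν : ℝ} (h : P.Dependence q A ν) (hq : 2 < q) {n : ℕ} (hn : 3 ≤ n) :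
    P.J q A n ^ q = P.danSum q A * (p * varpi q A n) := by
  have hq0 : 0 < q := by linarith
  have hv : 0 ≤ varpi q A n := (Nat.cast_nonneg n).trans (le_varpi hq0 hn)
  have : 0 ≤ P.MX q A := ENNReal.toReal_nonneg
  unfold J
  rw [Real.mul_rpow this (by positivity), h.MX_rpow hq, ← Real.rpow_mul (by positivity),
    one_div_mul_cancel hq0.ne', Real.rpow_one]

/-- Each of the two summands of the bandwidth alone is a lower bound; the first controls the
polynomial term and the second the Gaussian term. -/
theorem cubeRootRate_ge {q A C₁ C₂ : ℝ} (hC₁ : 0 ≤ C₁) (hC₂ : 0 ≤ C₂) {n : ℕ} :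
    C₁ ^ 3 * (P.J q A n / n) ≤ P.cubeRootRate q A C₁ C₂ n ^ 3 ∧
    C₂ ^ 6 * (P.NX A ^ 2 * Real.log p / n) ≤ P.cubeRootRate q A C₁ C₂ n ^ 6 := by
  have hJ : 0 ≤ P.J q A n / n := div_nonneg J_nonneg (Nat.cast_nonneg n)
  have hN : 0 ≤ P.NX A := NX_nonneg
  have hl : 0 ≤ Real.log p := Real.log_natCast_nonneg p
  have hn : (0 : ℝ) ≤ n := Nat.cast_nonneg n
  have h1 : 0 ≤ C₁ * (P.J q A n / n) ^ (1 / 3 : ℝ) := by positivity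
  have h2 : 0 ≤ C₂ * P.NX A ^ (1 / 3 : ℝ) * (n : ℝ) ^ (-(1 / 6) : ℝ) * Real.log p ^ (1 / 6 : ℝ) := by
    positivity
  unfold cubeRootRate
  constructor
  · calc _ = (C₁ * (P.J q A n / n) ^ (1 / 3 : ℝ)) ^ 3 := by
          rw [mul_pow, ← Real.rpow_natCast (_ ^ (1 / 3 : ℝ)), ← Real.rpow_mul hJ]
          norm_num
      _ ≤ _ := by gcongr; linarith
  · calc _ = (C₂ * P.NX A ^ (1 / 3 : ℝ) * (n : ℝ) ^ (-(1 / 6) : ℝ) * Real.log p ^ (1 / 6 : ℝ)) ^ 6 := by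
          simp only [mul_pow, ← Real.rpow_mul_natCast hN, ← Real.rpow_mul_natCast hn,
            ← Real.rpow_mul_natCast hl]
          norm_num
          rw [Real.rpow_neg_one]
          ring
      _ ≤ _ := by gcongr; linarith

end CausalProcess

/-! ### Uniform smallness of the noise -/

namespace CausalProcess

/-- Uniformly over intervals of length `O(nb)`, the sums of centred products are `O(nb³)`. -/
theorem tendsto_measure_noise {q A ν B₁ B₂ : ℝ} (hq : 2 < q) (hA : 0 < A) (hB₁ : 0 < B₁)
    (hB₂ : 0 < B₂) {p : ℕ → ℕ} {Ω : ℕ → Type*} [∀ n, MeasurableSpace (Ω n)]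
    {μ : ∀ n, Measure (Ω n)} [∀ n, IsProbabilityMeasure (μ n)]
    (P : ∀ n, CausalProcess (μ n) (p n)) (hp : Tendsto p atTop atTop)
    (hdep : ∀ n, (P n).Dependence q A ν)
    (hmean : ∀ n, ∀ t ∈ Icc (0 : ℝ) 1, ∀ j, ∫ ω, (P n).X 0 t ω j ∂(μ n) = 0)
    (hN : ∀ᶠ n in atTop, 0 < (P n).NX A)
    (hd : ∀ᶠ n in atTop, ∀ j, 0 < ((P n).dan (2 * q) A j).toReal)
    {b : ℕ → ℝ} (hb : ∀ n, b n = (P n).cubeRootRate q A B₁ B₂ n)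
    (hb0 : Tendsto b atTop (𝓝 0)) (hnb : Tendsto (fun n : ℕ => n * b n) atTop atTop) :
    Tendsto (fun n => μ n {ω | ∃ j k, ∃ a a' : ℕ, 1 ≤ a ∧ a ≤ a' ∧ a' ≤ n + 1 ∧
      ((a' - a : ℕ) : ℝ) ≤ n * b n / 2 ∧
      15 * (n * b n ^ 3) ≤ |∑ i ∈ Finset.Ico a a', (P n).noise n ω j k i|}) atTop (𝓝 0) := by
  have hq0 : 0 < q := by linarith
  obtain ⟨Q, hqQ, hQA, hpoly⟩ := exists_polynomial_term_tendsto hq hA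
  obtain ⟨C, c, hC, hc, H⟩ := exists_deviation_le (ν := ν) hq hqQ hA hQA
  -- The largest power of two below `n b`; it exceeds `n b / 2`, the admitted length of the
  -- intervals.
  set L : ℕ → ℕ := fun n => Nat.log 2 ⌊(n : ℝ) * b n⌋₊ with hLd
  have hbpos : ∀ᶠ n in atTop, 0 < b n := by
    filter_upwards [hnb.eventually_gt_atTop 0] with n hn
    exact pos_of_mul_pos_right hn (Nat.cast_nonneg n)
  have hL1 : ∀ᶠ n : ℕ in atTop, (2 : ℝ) ^ L n ≤ n * b n := by
    filter_upwards [hnb.eventually_ge_atTop 1] with n hn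
    exact two_pow_log_le hn
  set s : ℝ := (Q - q) / (2 * q) with hs
  set c' : ℝ := c * B₂ ^ 6 with hc'
  have hc'0 : 0 < c' := by positivity
  set K₀ : ℝ := (B₁ ^ (3 * q))⁻¹ with hK₀
  have hK₀0 : 0 < K₀ := by positivity
  obtain ⟨hlogb, hgauss⟩ := gaussian_term_tendsto hc'0 hp hb0 hbpos
  have hpr : Tendsto (fun n => (p n : ℝ) ^ (-(1 / 2) : ℝ)) atTop (𝓝 0) :=
    (tendsto_rpow_neg_atTop (by norm_num)).comp (tendsto_natCast_atTop_atTop.comp hp)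
  have hbound : Tendsto (fun n : ℕ => ENNReal.ofReal (C * (K₀ * (p n : ℝ) ^ (-(1 / 2) : ℝ)
      + K₀ * (n / varpi q A n * (p n : ℝ) ^ (-s) * levelFactor (levelRatio q Q A) Q (L n))
      + (p n : ℝ) ^ 2 * (2 / b n) * Real.exp (-(c' * (Real.log (p n) / b n)))))) atTop (𝓝 0) := by
    rw [← ENNReal.ofReal_zero]
    refine (ENNReal.continuous_ofReal.tendsto 0).comp ?_
    have := (((hpr.const_mul K₀).add ((hpoly p L b hp hb0 hL1).const_mul K₀)).add hgauss).const_mul C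
    simpa using this
  have hshift : Tendsto (fun n => C * K₀ * b n * (p n : ℝ) ^ (-(1 / 2) : ℝ)) atTop (𝓝 0) := by
    have := (hb0.const_mul (C * K₀)).mul hpr
    simpa using this
  refine tendsto_of_tendsto_of_tendsto_of_le_of_le' tendsto_const_nhds hbound
    (Eventually.of_forall fun n => zero_le) ?_
  filter_upwards [hN, hd, hbpos, hL1, hb0.eventually (eventually_le_nhds one_pos),
    hlogb.eventually_ge_atTop (c'⁻¹), hshift.eventually (eventually_le_nhds one_pos),
    eventually_ge_atTop 3, hp.eventually_ge_atTop 2] with n hNn hdn hbn hLn hb1 hlb hsh hn hpn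
  have hn0 : (0 : ℝ) < n := by exact_mod_cast (by omega : 0 < n)
  have hp0 : (0 : ℝ) < p n := by exact_mod_cast (by omega : 0 < p n)
  have hp1 : (1 : ℝ) ≤ p n := by exact_mod_cast (by omega : 1 ≤ p n)
  have hv := le_varpi (A := A) hq0 hn
  have hv0 : 0 < varpi q A n := hn0.trans_le hv
  set D := (P n).danSum q A with hD
  have hD0 : 0 ≤ D := danSum_nonneg
  set x : ℝ := n * b n ^ 3 with hx
  have hx0 : 0 < x := by positivity
  obtain ⟨hb3, hb6⟩ := cubeRootRate_ge (P := P n) (q := q) (A := A) (n := n) hB₁.le hB₂.le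
  rw [← hb n] at hb3 hb6
  have hDx : D * (p n * varpi q A n) ≤ K₀ * x ^ q := by
    rw [← (hdep n).J_rpow hq hn]
    have h1 : B₁ ^ 3 * (P n).J q A n ≤ x := by
      rw [hx]
      calc B₁ ^ 3 * (P n).J q A n = n * (B₁ ^ 3 * ((P n).J q A n / n)) := by field_simp
        _ ≤ _ := by gcongr
    have h2 : (B₁ ^ 3 * (P n).J q A n) ^ q ≤ x ^ q :=
      Real.rpow_le_rpow (mul_nonneg (by positivity) J_nonneg) h1 hq0.le
    rw [Real.mul_rpow (by positivity) J_nonneg, ← Real.rpow_natCast, ← Real.rpow_mul hB₁.le] at h2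
    rw [hK₀, ← div_eq_inv_mul, le_div_iff₀ (by positivity), mul_comm]
    exact_mod_cast h2
  have hDx' : D / x ^ q ≤ K₀ / (p n * varpi q A n) := by
    rw [div_le_div_iff₀ (by positivity) (by positivity)]
    exact hDx
  -- The square of the truncation level. `J^q` contains a factor `p` that the union over coordinates
  -- does not use. Half of it is spent on lowering the level below `x = n b³`, and the other half
  -- makes the probability of an exceedance of order `p^(-1/2)`.
  set T2 : ℝ := (p n : ℝ) ^ (-(1 / (2 * q))) * x with hT2
  have hT20 : 0 < T2 := by positivity
  set T : ℝ := Real.sqrt T2 with hT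
  have hT0 : 0 < T := Real.sqrt_pos.2 hT20
  have hTsq : T ^ 2 = T2 := Real.sq_sqrt hT20.le
  have hTq : T ^ (2 * q) = (p n : ℝ) ^ (-(1 / 2) : ℝ) * x ^ q := by
    rw [Real.rpow_mul hT0.le, Real.rpow_two, hTsq, hT2, Real.mul_rpow (by positivity) hx0.le,
      ← Real.rpow_mul hp0.le]
    congr 2
    field_simp
  have hTQ : (T ^ 2) ^ (Q - q) / x ^ Q = (p n : ℝ) ^ (-s) / x ^ q := by
    rw [hTsq, hT2, Real.mul_rpow (by positivity) hx0.le, ← Real.rpow_mul hp0.le,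
      Real.rpow_sub hx0, show -(1 / (2 * q)) * (Q - q) = -s by rw [hs]; ring]
    have : x ^ Q ≠ 0 := by positivity
    field_simp
  have hhalf : (p n : ℝ) ^ (-(1 / 2) : ℝ) * (p n : ℝ) ^ (-(1 / 2) : ℝ) = (p n : ℝ)⁻¹ := by
    rw [← Real.rpow_add hp0, ← Real.rpow_neg_one]; norm_num
  set r := (p n : ℝ) ^ (-(1 / 2) : ℝ) with hr
  have hr0 : 0 < r := by positivity
  have hDT : D / T ^ (2 * q) ≤ K₀ * r / varpi q A n := by
    rw [hTq]
    calc D / (r * x ^ q) = D / x ^ q / r := by field_simp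
      _ ≤ K₀ / (p n * varpi q A n) / r := by gcongr
      _ = K₀ / varpi q A n * ((p n : ℝ)⁻¹ / r) := by field_simp
      _ = K₀ * r / varpi q A n := by rw [← hhalf]; field_simp
  -- With `x = n b³` and at most `n b` terms, the exponent is at least a multiple of `n b⁵ / N_X²`,
  -- and `b⁶ ≥ B₂⁶ N_X² log p / n` turns this into `log p / b`.
  have hG : c' * (Real.log (p n) / b n) ≤ c * x ^ 2 / (2 ^ L n * (P n).NX A ^ 2) := by
    rw [le_div_iff₀ (by positivity)]
    calc c' * (Real.log (p n) / b n) * (2 ^ L n * (P n).NX A ^ 2)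
        ≤ c' * (Real.log (p n) / b n) * (n * b n * (P n).NX A ^ 2) := by
          have := Real.log_natCast_nonneg (p n)
          gcongr
      _ = c * n ^ 2 * (B₂ ^ 6 * ((P n).NX A ^ 2 * Real.log (p n) / n)) := by
          rw [hc']; field_simp
      _ ≤ c * n ^ 2 * b n ^ 6 := by gcongr
      _ = _ := by rw [hx]; ring
  have hG1 : 1 ≤ c * x ^ 2 / (2 ^ L n * (P n).NX A ^ 2) := by
    refine le_trans ?_ hG
    rwa [← inv_le_iff_one_le_mul₀' hc'0]
  have hTshift : 4 * x + 2 ^ L n * (C * D * T ^ (2 - 2 * q)) ≤ 5 * x := by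
    have h1 : C * D * T ^ (2 - 2 * q) = C * T2 * (D / T ^ (2 * q)) := by
      rw [Real.rpow_sub hT0, Real.rpow_two, hTsq]; ring
    have hT2x : T2 ≤ x := by
      refine mul_le_of_le_one_left hx0.le ?_
      exact Real.rpow_le_one_of_one_le_of_nonpos hp1 (by
        rw [neg_nonpos]; positivity)
    have : 2 ^ L n * (C * D * T ^ (2 - 2 * q)) ≤ x := by
      rw [h1]
      calc 2 ^ L n * (C * T2 * (D / T ^ (2 * q)))
          ≤ n * b n * (C * x * (K₀ * r / varpi q A n)) := by gcongr
        _ = (C * K₀ * b n * r) * x * (n / varpi q A n) := by field_simp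
        _ ≤ 1 * x * 1 := by
            gcongr
            exact (div_le_one hv0).2 hv
        _ = x := by ring
    linarith
  have hLnat : 2 ^ L n ≤ n := by
    have : (2 : ℝ) ^ L n ≤ n := hLn.trans (mul_le_of_le_one_right hn0.le hb1)
    exact_mod_cast this
  -- `4 x` for the deviation and `x` for the truncation bias make `5 x`; the passage from windows to
  -- intervals triples it to `15 x`.
  have hmain := H (P n) (hdep n) hNn hdn (hmean n) n (L n) T x (5 * x) hT0 hx0 hLnat hG1 hTshift
  refine (measure_mono ?_).trans (hmain.trans (ENNReal.ofReal_le_ofReal ?_))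
  · rintro ω ⟨j, k, a, a', h1, h2, h3, h4, h5⟩
    refine ⟨j, k, a, a', h1, h2, h3, ?_, by linarith⟩
    have hlt := lt_two_mul_two_pow_log ((n : ℝ) * b n)
    have : ((a' - a : ℕ) : ℝ) ≤ 2 ^ L n := by
      have hLn' : L n = Nat.log 2 ⌊(n : ℝ) * b n⌋₊ := rfl
      rw [hLn']
      linarith
    exact_mod_cast this
  · have hΨ : 0 ≤ levelFactor (levelRatio q Q A) Q (L n) := by
      have : 0 < levelRatio q Q A := by unfold levelRatio; positivity
      unfold levelFactor
      split_ifs <;> positivity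
    set Ψ := levelFactor (levelRatio q Q A) Q (L n)
    gcongr C * (?_ + ?_ + ?_)
    · calc n * D / T ^ (2 * q) = n * (D / T ^ (2 * q)) := by ring
        _ ≤ n * (K₀ * r / varpi q A n) := by gcongr
        _ = K₀ * r * (n / varpi q A n) := by ring
        _ ≤ K₀ * r * 1 := by gcongr; exact (div_le_one hv0).2 hv
        _ = K₀ * r := mul_one _
    · calc n * p n * D * (T ^ 2) ^ (Q - q) / x ^ Q * Ψ
          = n * p n * D * ((T ^ 2) ^ (Q - q) / x ^ Q) * Ψ := by ring
        _ = n * p n * (D / x ^ q) * (p n : ℝ) ^ (-s) * Ψ := by rw [hTQ]; ring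
        _ ≤ n * p n * (K₀ / (p n * varpi q A n)) * (p n : ℝ) ^ (-s) * Ψ := by gcongr
        _ = _ := by field_simp
    · have h2 : (n : ℝ) / 2 ^ L n ≤ 2 / b n := by
        rw [div_le_div_iff₀ (by positivity) hbn]
        exact (lt_two_mul_two_pow_log ((n : ℝ) * b n)).le
      gcongr

end CausalProcess

/-! ### Kernel sums -/

namespace IsKernel

variable {K : ℝ → ℝ}

theorem exists_bounds (hK : IsKernel K) : ∃ B : ℝ, 0 < B ∧ (∀ u, K u ≤ B) ∧
    ∀ u v, |u| ≤ 1 → |v| ≤ 1 → |K u - K v| ≤ B * |u - v| := by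
  obtain ⟨C, hC⟩ := hK.lipschitz
  have hlip : ∀ u v, |u| ≤ 1 → |v| ≤ 1 → |K u - K v| ≤ C * |u - v| := fun u v hu hv => by
    have := hC.dist_le_mul u (abs_le.1 hu) v (abs_le.1 hv)
    simpa [Real.dist_eq] using this
  refine ⟨K 0 + C + 1, by have := hK.nonneg 0; positivity, fun u => ?_, fun u v hu hv => ?_⟩
  · have h0 := hK.nonneg 0
    by_cases hu : |u| ≤ 1
    · have h1 := (abs_le.1 (hlip u 0 hu (by simp))).2
      rw [sub_zero] at h1
      have : (C : ℝ) * |u| ≤ C := mul_le_of_le_one_right C.2 hu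
      linarith
    · rw [hK.support u (not_le.1 hu)]
      positivity
  · refine (hlip u v hu hv).trans ?_
    gcongr
    linarith [hK.nonneg 0]

theorem abs_eq (hK : IsKernel K) (u : ℝ) : K |u| = K u := by
  rcases abs_choice u with h | h <;> rw [h]
  exact hK.symm u

/-- The mean of `K` over `[-1, 1]` is `1 / 2`, so by symmetry `K ≥ 1 / 2` somewhere in `[0, 1]`, and
the Lipschitz condition keeps `K ≥ 1 / 4` on an interval next to it inside `[0, 1]`. -/
theorem exists_lower (hK : IsKernel K) : ∃ α β : ℝ, 0 ≤ α ∧ α < β ∧ β ≤ 1 ∧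
    ∀ u ∈ Icc α β, 1 / 4 ≤ K u := by
  obtain ⟨B, hB, hKB, hlip⟩ := hK.exists_bounds
  obtain ⟨v, hv, hKv⟩ : ∃ v ∈ Icc (0 : ℝ) 1, 1 / 2 ≤ K v := by
    by_contra hcon
    push Not at hcon
    obtain ⟨C, hC⟩ := hK.lipschitz
    have hcont : ContinuousOn K (Icc (-1) 1) := hC.continuousOn
    have hcont' : ContinuousOn K (uIcc (-1) 1) := by rwa [uIcc_of_le (by norm_num)]
    have hlt : ∀ u ∈ Icc (-1 : ℝ) 1, K u < 1 / 2 := fun u hu => by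
      rw [← hK.abs_eq]
      exact hcon _ ⟨abs_nonneg u, abs_le.2 hu⟩
    have h1 : ∫ u in (-1 : ℝ)..1, K u < ∫ _u in (-1 : ℝ)..1, (1 / 2 : ℝ) := by
      refine intervalIntegral.integral_lt_integral_of_continuousOn_of_le_of_exists_lt (by norm_num)
        hcont continuousOn_const (fun u hu => (hlt u ⟨hu.1.le, hu.2⟩).le)
        ⟨0, by constructor <;> norm_num, hlt 0 (by constructor <;> norm_num)⟩
    rw [hK.integral, intervalIntegral.integral_const] at h1
    norm_num at h1
  set η : ℝ := min (1 / (4 * B)) (1 / 2) with hη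
  have hη0 : 0 < η := by positivity
  have hη1 : η ≤ 1 / 2 := min_le_right _ _
  have hη2 : B * η ≤ 1 / 4 := by
    calc B * η ≤ B * (1 / (4 * B)) := by gcongr; exact min_le_left _ _
      _ = 1 / 4 := by field_simp
  have key : ∀ u ∈ Icc (0 : ℝ) 1, |u - v| ≤ η → 1 / 4 ≤ K u := fun u hu huv => by
    have h1 := (abs_le.1 (hlip u v (abs_le.2 ⟨by linarith [hu.1], hu.2⟩)
      (abs_le.2 ⟨by linarith [hv.1], hv.2⟩))).1
    have : B * |u - v| ≤ B * η := by gcongr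
    linarith
  by_cases hv2 : v ≤ 1 / 2
  · exact ⟨v, v + η, hv.1, by linarith, by linarith, fun u hu =>
      key u ⟨by linarith [hu.1, hv.1], by linarith [hu.2]⟩ (abs_le.2 ⟨by linarith [hu.1], by linarith [hu.2]⟩)⟩
  · push Not at hv2
    exact ⟨v - η, v, by linarith, by linarith, hv.2, fun u hu =>
      key u ⟨by linarith [hu.1], by linarith [hu.2, hv.2]⟩ (abs_le.2 ⟨by linarith [hu.1], by linarith [hu.2]⟩)⟩

/-- Near an end point half of the window is missing, so only one side is counted: the right side for
`t ≤ 1 / 2`, the left side otherwise. The condition `b ≤ 1 / 2` keeps it in the sample, and `n b ℓ ≥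
2` makes the rounding loss at most half of the count. -/
theorem exists_sum_ge (hK : IsKernel K) : ∃ c N₀ : ℝ, 0 < c ∧ 1 ≤ N₀ ∧ ∀ (n : ℕ) (b t : ℝ),
    0 < b → b ≤ 1 / 2 → t ∈ Icc (0 : ℝ) 1 → N₀ ≤ n * b →
    c * (n * b) ≤ ∑ i ∈ Finset.Icc 1 n, K (|(i : ℝ) / n - t| / b) := by
  obtain ⟨α, β, hα, hαβ, hβ, hKl⟩ := hK.exists_lower
  set ℓ := β - α with hℓ
  have hℓ0 : 0 < ℓ := by simp only [hℓ]; linarith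
  refine ⟨ℓ / 8, max 1 (2 / ℓ), by positivity, le_max_left _ _, ?_⟩
  intro n b t hb hb2 ht hnb
  have hnb1 : 1 ≤ n * b := (le_max_left _ _).trans hnb
  have hnb2 : 2 ≤ n * b * ℓ := by
    have := (le_max_right _ _).trans hnb
    rwa [div_le_iff₀ hℓ0] at this
  have hn : (0 : ℝ) < n := pos_of_mul_pos_left (by linarith : 0 < (n : ℝ) * b) hb.le
  have hmain : ∀ s : Finset ℕ, s ⊆ Finset.Icc 1 n →
      (∀ i ∈ s, |(i : ℝ) / n - t| / b ∈ Icc α β) → n * b * ℓ - 1 ≤ (s.card : ℝ) →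
      ℓ / 8 * (n * b) ≤ ∑ i ∈ Finset.Icc 1 n, K (|(i : ℝ) / n - t| / b) := by
    intro s hs hmem hcard
    calc ℓ / 8 * (n * b) ≤ (s.card : ℝ) * (1 / 4) := by nlinarith
      _ = ∑ _i ∈ s, (1 / 4 : ℝ) := by rw [Finset.sum_const, nsmul_eq_mul]
      _ ≤ ∑ i ∈ s, K (|(i : ℝ) / n - t| / b) := Finset.sum_le_sum fun i hi => hKl _ (hmem i hi)
      _ ≤ _ := Finset.sum_le_sum_of_subset_of_nonneg hs fun _ _ _ => hK.nonneg _
  by_cases ht2 : t ≤ 1 / 2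
  · refine hmain (Finset.Ioc ⌊n * t + n * b * α⌋₊ ⌊n * t + n * b * β⌋₊) ?_ ?_ ?_
    · intro i hi
      rw [Finset.mem_Ioc] at hi
      rw [Finset.mem_Icc]
      refine ⟨by omega, hi.2.trans ?_⟩
      refine Nat.floor_le_of_le ?_
      have : n * b * β ≤ n * (1 / 2) := by
        calc n * b * β ≤ n * b * 1 := by gcongr
          _ ≤ n * (1 / 2) := by rw [mul_one]; gcongr
      nlinarith
    · intro i hi
      rw [Finset.mem_Ioc] at hi
      have h1 : n * t + n * b * α < i := (Nat.floor_lt (by have := ht.1; positivity)).1 hi.1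
      have hβ0 : 0 ≤ β := by linarith
      have h2 : (i : ℝ) ≤ n * t + n * b * β :=
        (Nat.le_floor_iff (by have := ht.1; positivity)).1 hi.2
      have h3 : (i : ℝ) / n - t = (i - n * t) / n := by field_simp
      have h0 : 0 ≤ n * b * α := by positivity
      rw [h3, abs_of_nonneg (div_nonneg (by linarith) hn.le), div_div]
      constructor
      · rw [le_div_iff₀ (by positivity)]; linarith
      · rw [div_le_iff₀ (by positivity)]; linarith
    · have hle : ⌊n * t + n * b * α⌋₊ ≤ ⌊n * t + n * b * β⌋₊ := Nat.floor_le_floor (by gcongr)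
      rw [Nat.card_Ioc, Nat.cast_sub hle]
      have h1 := Nat.floor_le (show 0 ≤ n * t + n * b * α by have := ht.1; positivity)
      have h2 := Nat.lt_floor_add_one (n * t + n * b * β)
      have : n * b * ℓ = n * b * β - n * b * α := by rw [hℓ]; ring
      linarith
  · push Not at ht2
    have hpos : 0 < n * t - n * b * β := by
      have : n * b * β ≤ n * (1 / 2) := by
        calc n * b * β ≤ n * b * 1 := by gcongr
          _ ≤ n * (1 / 2) := by rw [mul_one]; gcongr
      nlinarith
    have hle0 : n * t - n * b * β ≤ n * t - n * b * α := by gcongr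
    refine hmain (Finset.Ico ⌈n * t - n * b * β⌉₊ ⌈n * t - n * b * α⌉₊) ?_ ?_ ?_
    · intro i hi
      rw [Finset.mem_Ico] at hi
      rw [Finset.mem_Icc]
      have h1 : 0 < ⌈n * t - n * b * β⌉₊ := Nat.ceil_pos.2 hpos
      refine ⟨by omega, hi.2.le.trans (Nat.ceil_le.2 ?_)⟩
      have h0 : 0 ≤ n * b * α := by positivity
      nlinarith [ht.2]
    · intro i hi
      rw [Finset.mem_Ico] at hi
      have h1 : n * t - n * b * β ≤ i := Nat.ceil_le.1 hi.1
      have h2 : (i : ℝ) < n * t - n * b * α := Nat.lt_ceil.1 hi.2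
      have h3 : (i : ℝ) / n - t = -((n * t - i) / n) := by field_simp; ring
      have h0 : 0 ≤ n * b * α := by positivity
      rw [h3, abs_neg, abs_of_nonneg (div_nonneg (by linarith) hn.le), div_div]
      constructor
      · rw [le_div_iff₀ (by positivity)]; linarith
      · rw [div_le_iff₀ (by positivity)]; linarith
    · rw [Nat.card_Ico, Nat.cast_sub (Nat.ceil_le_ceil hle0)]
      have h1 := Nat.le_ceil (n * t - n * b * α)
      have h2 := Nat.ceil_lt_add_one hpos.le
      have : n * b * ℓ = n * b * β - n * b * α := by rw [hℓ]; ring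
      linarith

end IsKernel

/-- Summation by parts. -/
theorem abs_sum_mul_le_of_prefix {f g : ℕ → ℝ} {m : ℕ} {B V y : ℝ} (hB : ∀ i ≤ m, |f i| ≤ B)
    (hV : ∀ i < m, |f i - f (i + 1)| ≤ V) (hy : ∀ i ≤ m, |∑ l ∈ Finset.range i, g l| ≤ y) :
    |∑ i ∈ Finset.range m, f i * g i| ≤ (B + m * V) * y := by
  have key : ∀ m, ∑ i ∈ Finset.range m, f i * g i = f m * ∑ l ∈ Finset.range m, g l
      + ∑ i ∈ Finset.range m, (f i - f (i + 1)) * ∑ l ∈ Finset.range (i + 1), g l := by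
    intro m
    induction m with
    | zero => simp
    | succ m ih =>
      rw [Finset.sum_range_succ, ih, Finset.sum_range_succ (fun i => (f i - f (i + 1)) * _),
        Finset.sum_range_succ g m]
      ring
  have hy0 : 0 ≤ y := (abs_nonneg _).trans (hy 0 (Nat.zero_le _))
  have hB0 : 0 ≤ B := (abs_nonneg _).trans (hB 0 (Nat.zero_le _))
  rw [key, add_mul]
  refine (abs_add_le _ _).trans (add_le_add ?_ ?_)
  · rw [abs_mul]
    exact mul_le_mul (hB m le_rfl) (hy m le_rfl) (abs_nonneg _) hB0
  · refine (Finset.abs_sum_le_sum_abs _ _).trans ?_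
    calc _ ≤ ∑ _i ∈ Finset.range m, V * y := Finset.sum_le_sum fun i hi => by
          have hi' := Finset.mem_range.1 hi
          rw [abs_mul]
          exact mul_le_mul (hV i hi') (hy _ hi') (abs_nonneg _) ((abs_nonneg _).trans (hV i hi'))
      _ = _ := by rw [Finset.sum_const, Finset.card_range, nsmul_eq_mul]; ring

namespace IsKernel

variable {K : ℝ → ℝ}

/-- Kernel sums of a sequence are controlled by its sums over intervals. -/
theorem exists_abs_sum_le (hK : IsKernel K) : ∃ C : ℝ, 0 < C ∧ ∀ (n : ℕ) (b t y : ℝ) (g : ℕ → ℝ),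
    0 < b → 1 ≤ n * b → 0 ≤ y →
    (∀ a a' : ℕ, 1 ≤ a → a ≤ a' → a' ≤ n + 1 → (∀ i ∈ Finset.Ico a a', |(i : ℝ) / n - t| ≤ b) →
      |∑ i ∈ Finset.Ico a a', g i| ≤ y) →
    |∑ i ∈ Finset.Icc 1 n, K (|(i : ℝ) / n - t| / b) * g i| ≤ C * y := by
  obtain ⟨B, hB, hKB, hlip⟩ := hK.exists_bounds
  refine ⟨4 * B, by positivity, fun n b t y g hb hnb hy hg => ?_⟩
  have hn : (0 : ℝ) < n := pos_of_mul_pos_left (by linarith : 0 < (n : ℝ) * b) hb.le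
  -- `K` may jump at `±1`, so the variation of the weights is estimated strictly inside the window,
  -- which is an interval of at most `2 n b + 1` indices.
  set s := (Finset.Icc 1 n).filter fun i : ℕ => |(i : ℝ) / n - t| ≤ b with hs
  have hsum : ∑ i ∈ Finset.Icc 1 n, K (|(i : ℝ) / n - t| / b) * g i
      = ∑ i ∈ s, K (|(i : ℝ) / n - t| / b) * g i := by
    rw [hs, Finset.sum_filter]
    refine Finset.sum_congr rfl fun i _ => ?_
    split_ifs with h
    · rfl
    · rw [hK.support _ (by
        rw [abs_of_nonneg (by positivity), lt_div_iff₀ hb, one_mul]; exact not_le.1 h), zero_mul]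
  rw [hsum]
  rcases s.eq_empty_or_nonempty with h0 | hne
  · rw [h0, Finset.sum_empty, abs_zero]; positivity
  set a := s.min' hne
  set z := s.max' hne
  have ha : (1 ≤ a ∧ a ≤ n) ∧ |(a : ℝ) / n - t| ≤ b :=
    have h := Finset.mem_filter.1 (s.min'_mem hne)
    ⟨Finset.mem_Icc.1 h.1, h.2⟩
  have hz : (1 ≤ z ∧ z ≤ n) ∧ |(z : ℝ) / n - t| ≤ b :=
    have h := Finset.mem_filter.1 (s.max'_mem hne)
    ⟨Finset.mem_Icc.1 h.1, h.2⟩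
  have haz : a ≤ z := Finset.min'_le_max' s hne
  have hmem : ∀ i ∈ Finset.Ico a (z + 1), |(i : ℝ) / n - t| ≤ b := by
    intro i hi
    rw [Finset.mem_Ico] at hi
    have h1 : (a : ℝ) ≤ i := by exact_mod_cast hi.1
    have h2 : (i : ℝ) ≤ z := by exact_mod_cast (by omega : i ≤ z)
    have h1' : (a : ℝ) / n ≤ i / n := by gcongr
    have h2' : (i : ℝ) / n ≤ z / n := by gcongr
    have h3 := abs_le.1 ha.2
    have h4 := abs_le.1 hz.2
    exact abs_le.2 ⟨by linarith [h3.1], by linarith [h4.2]⟩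
  have hsI : s = Finset.Ico a (z + 1) := by
    ext i
    constructor
    · intro hi
      exact Finset.mem_Ico.2 ⟨s.min'_le i hi, Nat.lt_succ_of_le (s.le_max' i hi)⟩
    · intro hi
      have hi' := Finset.mem_Ico.1 hi
      exact Finset.mem_filter.2 ⟨Finset.mem_Icc.2 ⟨ha.1.1.trans hi'.1, by
        have := hz.1.2; omega⟩, hmem i hi⟩
  rw [hsI, Finset.sum_Ico_eq_sum_range]
  obtain ⟨m, hm⟩ : ∃ m, z = a + m := Nat.exists_eq_add_of_le haz
  have hlen : ((m : ℕ) : ℝ) ≤ 2 * (n * b) := by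
    have h3 := (abs_le.1 ha.2).1
    have h4 := (abs_le.1 hz.2).2
    have h5 : ((z : ℝ) - a) / n ≤ 2 * b := by rw [sub_div]; linarith
    rw [div_le_iff₀ hn] at h5
    have : (z : ℝ) = a + m := by exact_mod_cast hm
    linarith
  rw [show z + 1 - a = m + 1 by omega]
  have hker : ∀ i ≤ m, |((a + i : ℕ) : ℝ) / n - t| / b ≤ 1 := fun i hi => by
    rw [div_le_one hb]
    exact hmem _ (Finset.mem_Ico.2 ⟨by omega, by omega⟩)
  -- The last term is split off so that summation by parts never evaluates the weights outside the
  -- window. It costs `B y`, the main part `(B + 2 B) y`.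
  rw [Finset.sum_range_succ]
  have hpre : ∀ i ≤ m + 1, |∑ l ∈ Finset.range i, g (a + l)| ≤ y := by
    intro i hi
    have h := hg a (a + i) ha.1.1 (by omega) (by have := hz.1.2; omega) (fun l hl =>
      hmem l (by rw [Finset.mem_Ico] at hl ⊢; omega))
    rwa [Finset.sum_Ico_eq_sum_range, Nat.add_sub_cancel_left] at h
  have h1 := abs_sum_mul_le_of_prefix (f := fun i => K (|((a + i : ℕ) : ℝ) / n - t| / b))
    (g := fun i => g (a + i)) (m := m) (B := B) (V := B / (n * b)) (y := y)
    (fun i _ => by rw [abs_of_nonneg (hK.nonneg _)]; exact hKB _)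
    (fun i hi => by
      have habs : ∀ i ≤ m, |(|((a + i : ℕ) : ℝ) / n - t| / b)| ≤ 1 := fun i hi => by
        rw [abs_of_nonneg (by positivity)]; exact hker i hi
      refine (hlip _ _ (habs i hi.le) (habs (i + 1) hi)).trans ?_
      rw [← sub_div, abs_div, abs_of_pos hb]
      have : abs (|((a + i : ℕ) : ℝ) / n - t| - |((a + (i + 1) : ℕ) : ℝ) / n - t|) ≤ 1 / n := by
        refine (abs_abs_sub_abs_le_abs_sub _ _).trans (le_of_eq ?_)
        rw [show ((a + i : ℕ) : ℝ) / n - t - (((a + (i + 1) : ℕ) : ℝ) / n - t) = -(1 / n) by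
          push_cast; ring, abs_neg, abs_of_pos (by positivity)]
      calc B * (_ / b) ≤ B * (1 / n / b) := by gcongr
        _ = _ := by field_simp)
    (fun i hi => hpre i (by omega))
  have hgm : |g (a + m)| ≤ y := by
    have := hg (a + m) (a + m + 1) (by omega) (by omega) (by have := hz.1.2; omega) (fun l hl =>
      hmem l (by rw [Finset.mem_Ico] at hl ⊢; omega))
    simpa using this
  have h2 : (m : ℝ) * (B / (n * b)) ≤ 2 * B := by
    calc (m : ℝ) * (B / (n * b)) ≤ 2 * (n * b) * (B / (n * b)) := by gcongr
      _ = 2 * B := by field_simp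
  refine (abs_add_le _ _).trans ?_
  rw [abs_mul, abs_of_nonneg (hK.nonneg _)]
  calc _ ≤ (B + 2 * B) * y + B * y := by
        refine add_le_add (h1.trans (by gcongr)) ?_
        exact mul_le_mul (hKB _) hgm (abs_nonneg _) hB.le
    _ = _ := by ring

/-- First moment of the kernel weights at an interior point. -/
theorem exists_abs_moment_le (hK : IsKernel K) : ∃ C : ℝ, 0 < C ∧ ∀ (n : ℕ) (b t : ℝ),
    0 < b → 1 ≤ n * b → t ∈ Icc b (1 - b) →
    |∑ i ∈ Finset.Icc 1 n, K (|(i : ℝ) / n - t| / b) * ((i : ℝ) / n - t)| ≤ C * b := by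
  obtain ⟨B, hB, hKB, hlip⟩ := hK.exists_bounds
  refine ⟨8 * B, by positivity, fun n b t hb hnb ht => ?_⟩
  have hn : (0 : ℝ) < n := pos_of_mul_pos_left (by linarith : 0 < (n : ℝ) * b) hb.le
  set G : ℝ → ℝ := fun v => K (|v| / b) * v with hG
  have hGz : ∀ v, b < |v| → G v = 0 := fun v hv => by
    simp only [hG]
    rw [hK.support _ (by rw [abs_of_nonneg (by positivity), lt_div_iff₀ hb, one_mul]; exact hv),
      zero_mul]
  have hGb : ∀ v, |G v| ≤ B * b := fun v => by
    by_cases hv : b < |v|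
    · rw [hGz v hv, abs_zero]; positivity
    · simp only [hG]
      rw [abs_mul, abs_of_nonneg (hK.nonneg _)]
      exact mul_le_mul (hKB _) (not_lt.1 hv) (abs_nonneg _) hB.le
  have hGodd : ∀ v, G (-v) = -G v := fun v => by simp only [hG, abs_neg]; ring
  have hGlip : ∀ v w, |v| ≤ b → |w| ≤ b → |G v - G w| ≤ 2 * B * |v - w| := by
    intro v w hv hw
    have hab : ∀ v, |v| ≤ b → |(|v| / b)| ≤ 1 := fun v hv => by
      rw [abs_of_nonneg (by positivity), div_le_one hb]; exact hv
    have h1 := hlip (|v| / b) (|w| / b) (hab v hv) (hab w hw)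
    rw [← sub_div, abs_div, abs_of_pos hb] at h1
    have h2 : |K (|v| / b) - K (|w| / b)| ≤ B * (|v - w| / b) := by
      refine h1.trans (mul_le_mul_of_nonneg_left ?_ hB.le)
      exact div_le_div_of_nonneg_right (abs_abs_sub_abs_le_abs_sub v w) hb.le
    calc |G v - G w| = |(K (|v| / b) - K (|w| / b)) * v + K (|w| / b) * (v - w)| := by
          simp only [hG]; congr 1; ring
      _ ≤ B * (|v - w| / b) * b + B * |v - w| := by
          refine (abs_add_le _ _).trans (add_le_add ?_ ?_)
          · rw [abs_mul]
            exact mul_le_mul h2 hv (abs_nonneg _) (by positivity)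
          · rw [abs_mul, abs_of_nonneg (hK.nonneg _)]
            exact mul_le_mul_of_nonneg_right (hKB _) (abs_nonneg _)
      _ = _ := by field_simp; ring
  set F : ℤ → ℝ := fun i => G ((i : ℝ) / n - t) with hF
  -- The reflection `i ↦ N₀ - i` preserves the grid and is the reflection at `t` up to `δ ≤ 1 / n`.
  -- As `G` is odd, paired terms nearly cancel.
  set N₀ : ℤ := ⌊2 * (n * t)⌋ with hN₀
  set R : ℤ := ⌈n * t + n * b⌉ with hR
  have hN1 : (N₀ : ℝ) ≤ 2 * (n * t) := Int.floor_le _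
  have hN2 : 2 * (n * t) < N₀ + 1 := Int.lt_floor_add_one _
  have hR1 : n * t + n * b ≤ R := Int.le_ceil _
  have hR2 : (R : ℝ) < n * t + n * b + 1 := Int.ceil_lt_add_one _
  set I := Finset.Icc (N₀ - R) R with hI
  have hFs : ∀ i : ℤ, F i ≠ 0 → n * t - n * b ≤ i ∧ (i : ℝ) ≤ n * t + n * b := by
    intro i hi
    have h1 : |(i : ℝ) / n - t| ≤ b := by
      by_contra hcon
      exact hi (hGz _ (not_le.1 hcon))
    rw [show (i : ℝ) / n - t = (i - n * t) / n by field_simp, abs_div, abs_of_pos hn,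
      div_le_iff₀ hn] at h1
    have := abs_le.1 h1
    constructor <;> linarith [this.1, this.2]
  have hsupI : Function.support F ⊆ I := fun i hi => by
    have h := hFs i hi
    simp only [hI, Finset.coe_Icc, mem_Icc]
    constructor
    · have : ((N₀ - R : ℤ) : ℝ) ≤ i := by push_cast; linarith
      exact_mod_cast this
    · have : (i : ℝ) ≤ (R : ℤ) := by linarith
      exact_mod_cast this
  -- The interior condition on `t` puts the whole support in `0, …, n`. The index `0` is outside the
  -- sample and is subtracted at the end, at a cost of `B b`.
  have hsup0 : Function.support F ⊆ (Finset.Icc ((0 : ℕ) : ℤ) (n : ℤ) : Finset ℤ) := fun i hi => by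
    have h := hFs i hi
    have hb1 : (n : ℝ) * b ≤ n * t := by gcongr; exact ht.1
    have hb2 : n * t ≤ n * (1 - b) := by gcongr; exact ht.2
    simp only [Finset.coe_Icc, mem_Icc]
    constructor
    · have : ((0 : ℤ) : ℝ) ≤ i := by push_cast; linarith
      exact_mod_cast this
    · have : (i : ℝ) ≤ ((n : ℤ) : ℝ) := by push_cast; linarith
      exact_mod_cast this
  have hnat : ∑ i ∈ Finset.Icc ((0 : ℕ) : ℤ) (n : ℤ), F i = ∑ i ∈ Finset.Icc 0 n, F (i : ℕ) := by
    refine Finset.sum_nbij' Int.toNat (fun i => (i : ℤ)) ?_ ?_ ?_ ?_ ?_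
    · intro i hi; simp only [Finset.mem_Icc] at hi ⊢; omega
    · intro i hi; simp only [Finset.mem_Icc] at hi ⊢; omega
    · intro i hi
      simp only [Finset.mem_Icc] at hi
      exact Int.toNat_of_nonneg (by omega)
    · intro i _; exact Int.toNat_natCast i
    · intro i hi
      simp only [Finset.mem_Icc] at hi
      rw [Int.toNat_of_nonneg (by omega)]
  have hsum : ∑ i ∈ I, F i = F 0 + ∑ i ∈ Finset.Icc 1 n, F (i : ℕ) := by
    rw [← finsum_eq_sum_of_support_subset F hsupI, finsum_eq_sum_of_support_subset F hsup0,
      hnat, show Finset.Icc 0 n = insert 0 (Finset.Icc 1 n) by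
        ext i; simp only [Finset.mem_Icc, Finset.mem_insert]; omega,
      Finset.sum_insert (by simp)]
    rfl
  have hrefl : ∑ i ∈ I, F i = ∑ i ∈ I, F (N₀ - i) := by
    refine Finset.sum_nbij' (fun i => N₀ - i) (fun i => N₀ - i) ?_ ?_ ?_ ?_ ?_
    · intro i hi; simp only [hI, Finset.mem_Icc] at hi ⊢; omega
    · intro i hi; simp only [hI, Finset.mem_Icc] at hi ⊢; omega
    · intro i _; ring
    · intro i _; ring
    · intro i _
      show F i = F (N₀ - (N₀ - i))
      congr 1; ring
  -- The indices for which exactly one of the paired points is in the window, so that the jump of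
  -- `K` at its edge is seen. There is at most one such index at each end.
  set p₁ : ℤ → Prop := fun i => n * t + n * b - 1 < i ∧ (i : ℝ) ≤ n * t + n * b with hp₁
  set p₂ : ℤ → Prop := fun i => n * t - n * b - 1 ≤ i ∧ (i : ℝ) < n * t - n * b with hp₂
  classical
  have hterm : ∀ i ∈ I, |F i + F (N₀ - i)| ≤ 2 * B * (1 / n) + ((if p₁ i then B * b else 0)
      + if p₂ i then B * b else 0) := by
    intro i _
    set v : ℝ := (i : ℝ) / n - t with hv
    set δ : ℝ := 2 * t - N₀ / n with hδ
    have hδ0 : 0 ≤ δ := by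
      rw [hδ, sub_nonneg, div_le_iff₀ hn]; linarith
    have hδ1 : δ ≤ 1 / n := by
      rw [hδ, sub_le_iff_le_add, ← add_div, le_div_iff₀ hn]; linarith
    have hFr : F (N₀ - i) = -G (v + δ) := by
      rw [← hGodd]
      simp only [hF]
      congr 1
      rw [hv, hδ]; push_cast; ring
    rw [hFr, ← sub_eq_add_neg]
    show |G v - G (v + δ)| ≤ _
    have hnv : (i : ℝ) = n * t + n * v := by rw [hv]; field_simp; ring
    have hBb : 0 ≤ B * b := by positivity
    have hBn : 0 ≤ 2 * B * (1 / n) := by positivity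
    have hif : ∀ (q : Prop) [Decidable q], 0 ≤ if q then B * b else 0 := fun q _ => by split_ifs <;> positivity
    by_cases h1 : |v| ≤ b
    · by_cases h2 : |v + δ| ≤ b
      · have h3 := hGlip v (v + δ) h1 h2
        rw [show v - (v + δ) = -δ by ring, abs_neg, abs_of_nonneg hδ0] at h3
        have : 2 * B * δ ≤ 2 * B * (1 / n) := by gcongr
        linarith [hif (p₁ i), hif (p₂ i)]
      · push Not at h2
        have hv1 := abs_le.1 h1
        have hlt : b < v + δ := by
          rcases lt_abs.1 h2 with h | h
          · exact h
          · linarith [hv1.1]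
        have hp : p₁ i := by
          have h5 : n * (b - 1 / n) < n * v := by gcongr; linarith
          have h6 : n * v ≤ n * b := by gcongr; exact hv1.2
          rw [mul_sub, mul_one_div_cancel hn.ne'] at h5
          exact ⟨by rw [hnv]; linarith, by rw [hnv]; linarith⟩
        rw [hGz _ h2, sub_zero, if_pos hp]
        linarith [hif (p₂ i), hGb v]
    · push Not at h1
      rw [hGz v h1, zero_sub, abs_neg]
      by_cases h2 : |v + δ| ≤ b
      · have hv1 := abs_le.1 h2
        have hlt : v < -b := by
          rcases lt_abs.1 h1 with h | h
          · linarith [hv1.2]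
          · linarith
        have hp : p₂ i := by
          have h5 : n * (-b - 1 / n) ≤ n * v := by gcongr; linarith [hv1.1]
          have h6 : n * v < n * (-b) := by gcongr
          rw [mul_sub, mul_one_div_cancel hn.ne'] at h5
          exact ⟨by rw [hnv]; linarith, by rw [hnv]; linarith⟩
        rw [if_pos hp]
        linarith [hif (p₁ i), hGb (v + δ)]
      · rw [hGz _ (not_le.1 h2), abs_zero]
        linarith [hif (p₁ i), hif (p₂ i)]
  have hcount : ∀ (q : ℤ → Prop) [DecidablePred q], (∀ i i' : ℤ, q i → q i' → (i : ℝ) < i' + 1) →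
      ∑ i ∈ I, (if q i then B * b else 0) ≤ B * b := by
    intro q _ hq
    rw [← Finset.sum_filter, Finset.sum_const, nsmul_eq_mul]
    refine mul_le_of_le_one_left (by positivity) ?_
    have : (I.filter q).card ≤ 1 := Finset.card_le_one.2 fun i hi i' hi' => by
      have h1 := hq i i' (Finset.mem_filter.1 hi).2 (Finset.mem_filter.1 hi').2
      have h2 := hq i' i (Finset.mem_filter.1 hi').2 (Finset.mem_filter.1 hi).2
      have h1' : i < i' + 1 := by exact_mod_cast h1
      have h2' : i' < i + 1 := by exact_mod_cast h2
      omega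
    exact_mod_cast this
  have hcard : (I.card : ℝ) ≤ 6 * (n * b) := by
    have h0 : (0 : ℝ) ≤ n * b := by positivity
    have hpos : 0 ≤ R + 1 - (N₀ - R) := by
      have : (-1 : ℝ) < ((R + 1 - (N₀ - R) : ℤ) : ℝ) := by push_cast; linarith
      have : (-1 : ℤ) < R + 1 - (N₀ - R) := by exact_mod_cast this
      omega
    rw [hI, Int.card_Icc]
    have : (((R + 1 - (N₀ - R)).toNat : ℤ) : ℝ) = ((R + 1 - (N₀ - R) : ℤ) : ℝ) := by
      rw [Int.toNat_of_nonneg hpos]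
    rw [Int.cast_natCast] at this
    rw [this]
    push_cast
    linarith
  have htwo : 2 * ∑ i ∈ I, F i = ∑ i ∈ I, (F i + F (N₀ - i)) := by
    rw [Finset.sum_add_distrib, ← hrefl]; ring
  have hbound : |2 * ∑ i ∈ I, F i| ≤ 14 * B * b := by
    rw [htwo]
    refine (Finset.abs_sum_le_sum_abs _ _).trans ((Finset.sum_le_sum hterm).trans ?_)
    rw [Finset.sum_add_distrib, Finset.sum_add_distrib, Finset.sum_const, nsmul_eq_mul]
    have h1 := hcount p₁ fun i i' hi hi' => by linarith [hi.2, hi'.1]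
    have h2 := hcount p₂ fun i i' hi hi' => by linarith [hi.2, hi'.1]
    have h3 : (I.card : ℝ) * (2 * B * (1 / n)) ≤ 12 * B * b := by
      calc (I.card : ℝ) * (2 * B * (1 / n)) ≤ 6 * (n * b) * (2 * B * (1 / n)) := by gcongr
        _ = 12 * B * b := by field_simp; ring
    linarith
  have hgoal : ∑ i ∈ Finset.Icc 1 n, K (|(i : ℝ) / n - t| / b) * ((i : ℝ) / n - t)
      = ∑ i ∈ I, F i - F 0 := by
    rw [hsum, add_sub_cancel_left]
    refine Finset.sum_congr rfl fun i _ => ?_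
    simp only [hF, hG, Int.cast_natCast]
  rw [hgoal]
  rw [abs_mul, abs_two] at hbound
  refine (abs_sub _ _).trans ?_
  have hF0 : |F 0| ≤ B * b := hGb _
  linarith

end IsKernel

/-! ### Matrix norms -/

section Norms

variable {p : ℕ}

theorem abs_le_maxNorm (M : Matrix (Fin p) (Fin p) ℝ) (j k : Fin p) : |M j k| ≤ maxNorm M :=
  le_ciSup (f := fun jk : Fin p × Fin p => |M jk.1 jk.2|) (Set.finite_range _).bddAbove (j, k)

theorem maxNorm_nonneg (M : Matrix (Fin p) (Fin p) ℝ) : 0 ≤ maxNorm M :=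
  Real.iSup_nonneg fun _ => abs_nonneg _

theorem maxNorm_le {M : Matrix (Fin p) (Fin p) ℝ} {c : ℝ} (hc : 0 ≤ c) (h : ∀ j k, |M j k| ≤ c) :
    maxNorm M ≤ c := Real.iSup_le (fun jk => h jk.1 jk.2) hc

end Norms

/-! ### Piecewise smooth covariance functions -/

/-- The interior break points. -/
def brk {ι : ℕ} (τ : Fin (ι + 2) → ℝ) (w : Fin ι) : ℝ := τ w.succ.castSucc

/-- The last piece that starts at or before `s` works: it could end before `t` only at a break in
`(s, t]`. -/
theorem exists_mem_piece {ι : ℕ} {τ : Fin (ι + 2) → ℝ} (h0 : τ 0 = 0)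
    (h1 : τ (Fin.last (ι + 1)) = 1) {s t : ℝ} (hs : 0 ≤ s) (hst : s ≤ t) (ht : t ≤ 1)
    (h : ∀ w : Fin ι, ¬(s < brk τ w ∧ brk τ w ≤ t)) : ∃ l, s ∈ piece τ l ∧ t ∈ piece τ l := by
  classical
  set S := Finset.univ.filter fun l : Fin (ι + 1) => τ l.castSucc ≤ s with hS
  have hne : S.Nonempty := ⟨0, by simp [hS, h0, hs]⟩
  have hl := S.max'_mem hne
  set l := S.max' hne
  have hls : τ l.castSucc ≤ s := (Finset.mem_filter.1 hl).2
  refine ⟨l, ?_⟩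
  unfold piece
  by_cases hlast : l = Fin.last ι
  · rw [if_pos hlast, hlast, Fin.succ_last, h1]
    rw [hlast] at hls
    exact ⟨⟨hls, hst.trans ht⟩, hls.trans hst, ht⟩
  · obtain ⟨w, hw⟩ := Fin.exists_castSucc_eq.2 hlast
    have hsucc : l.succ = w.succ.castSucc := by rw [← hw]; rfl
    have hlt : s < brk τ w := by
      by_contra hcon
      push Not at hcon
      have : w.succ ∈ S := Finset.mem_filter.2 ⟨Finset.mem_univ _, hcon⟩
      have := S.le_max' _ this
      have h2 : w.succ ≤ w.castSucc := by rw [hw]; exact this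
      exact absurd h2 (not_le.2 (Fin.castSucc_lt_succ))
    have hlt' : t < brk τ w := by
      by_contra hcon
      exact h w ⟨hlt, not_lt.1 hcon⟩
    rw [if_neg hlast, hsucc]
    exact ⟨⟨hls, hlt⟩, hls.trans hst, hlt'⟩

namespace CausalProcess

variable {Ω : Type*} [MeasurableSpace Ω] {μ : Measure Ω} {p : ℕ} {P : CausalProcess μ p}
  {ι : ℕ} {τ : Fin (ι + 2) → ℝ} {L M c₁ c₂ : ℝ}

theorem PiecewiseSmooth.abs_cov_sub_le (h : P.PiecewiseSmooth τ L M) {s t : ℝ} (hs : 0 ≤ s)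
    (hst : s ≤ t) (ht : t ≤ 1) (hb : ∀ w : Fin ι, ¬(s < brk τ w ∧ brk τ w ≤ t)) (j k : Fin p) :
    |P.cov t j k - P.cov s j k| ≤ L * (t - s) := by
  obtain ⟨l, h1, h2⟩ := exists_mem_piece h.first h.last hs hst ht hb
  have := (abs_le_maxNorm (P.cov t - P.cov s) j k).trans (h.cov_lipschitz l t h2 s h1)
  rwa [abs_of_nonneg (by linarith : 0 ≤ t - s)] at this

theorem Jumps.separated_brk (h : P.Jumps τ c₁ c₂) (hm : StrictMono τ) {w w' : Fin ι} (hw : w < w') :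
    brk τ w + c₁ ≤ brk τ w' := by
  have h1 := h.separated w.succ
  have h2 : τ w.succ.succ ≤ τ w'.succ.castSucc := hm.monotone (by
    rw [Fin.le_def]
    simp only [Fin.val_succ, Fin.val_castSucc]
    have := Fin.lt_def.1 hw
    omega)
  unfold brk
  linarith

theorem Jumps.le_brk (h : P.Jumps τ c₁ c₂) (hs : P.PiecewiseSmooth τ L M) (w : Fin ι) :
    c₁ ≤ brk τ w := by
  have h1 := h.separated 0
  have h2 : τ (Fin.succ 0) ≤ τ w.succ.castSucc := hs.strictMono.monotone (by
    rw [Fin.le_def]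
    simp only [Fin.val_succ, Fin.val_castSucc, Fin.val_zero]
    omega)
  have h3 : τ (Fin.castSucc 0) = 0 := hs.first
  unfold brk
  linarith

theorem Jumps.brk_le (h : P.Jumps τ c₁ c₂) (hs : P.PiecewiseSmooth τ L M) (w : Fin ι) :
    brk τ w ≤ 1 - c₁ := by
  have h1 := h.separated w.succ
  have h2 : τ w.succ.succ ≤ τ (Fin.last (ι + 1)) := hs.strictMono.monotone (Fin.le_last _)
  rw [hs.last] at h2
  unfold brk
  linarith

/-- To the left of the break the covariance is Lipschitz and extends continuously, so
`Function.leftLim` is a genuine limit there; both one-sided increments are then at most `L` times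
the distance. -/
theorem PiecewiseSmooth.abs_jump_sub_le (h : P.PiecewiseSmooth τ L M) (hL : 0 ≤ L) (w : Fin ι)
    {s t : ℝ} (hs : 0 ≤ s) (hsw : s < brk τ w) (hwt : brk τ w ≤ t) (ht : t ≤ 1)
    (hb : ∀ w' : Fin ι, w' ≠ w → ¬(s < brk τ w' ∧ brk τ w' ≤ t)) (j k : Fin p) :
    |P.jump (brk τ w) j k - (P.cov t j k - P.cov s j k)| ≤ L * (t - s) := by
  set σ : ℝ → ℝ := fun s => P.cov s j k with hσ
  have hlip : ∀ u ∈ Ico s (brk τ w), ∀ v ∈ Ico s (brk τ w), |σ u - σ v| ≤ L * |u - v| := by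
    have key : ∀ u ∈ Ico s (brk τ w), ∀ v ∈ Ico s (brk τ w), u ≤ v → |σ v - σ u| ≤ L * (v - u) := by
      intro u hu v hv huv
      refine h.abs_cov_sub_le (hs.trans hu.1) huv (hv.2.le.trans (hwt.trans ht)) (fun w' hw' => ?_) j k
      by_cases hww : w' = w
      · rw [hww] at hw'; linarith [hv.2, hw'.2]
      · exact hb w' hww ⟨hu.1.trans_lt hw'.1, hw'.2.trans (hv.2.le.trans hwt)⟩
    intro u hu v hv
    rcases le_total u v with huv | huv
    · rw [abs_sub_comm, abs_sub_comm u, abs_of_nonneg (by linarith : 0 ≤ v - u)]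
      exact key u hu v hv huv
    · rw [abs_of_nonneg (by linarith : 0 ≤ u - v)]
      exact key v hv u hu huv
  obtain ⟨g, hg, hgσ⟩ := (LipschitzOnWith.of_dist_le_mul (K := L.toNNReal) (s := Ico s (brk τ w))
    (f := σ) fun u hu v hv => by
      rw [Real.coe_toNNReal L hL, Real.dist_eq, Real.dist_eq]; exact hlip u hu v hv).extend_real
  have htend : Tendsto σ (𝓝[<] brk τ w) (𝓝 (g (brk τ w))) := by
    refine ((hg.continuous.tendsto _).mono_left nhdsWithin_le_nhds).congr' ?_
    filter_upwards [Ico_mem_nhdsLT hsw] with u hu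
    exact (hgσ hu).symm
  have hlim : Function.leftLim σ (brk τ w) = g (brk τ w) :=
    leftLim_eq_of_tendsto htend
  have h1 : |σ s - g (brk τ w)| ≤ L * (brk τ w - s) := by
    have := hg.dist_le_mul s (brk τ w)
    rw [Real.coe_toNNReal L hL, Real.dist_eq, Real.dist_eq, ← hgσ ⟨le_rfl, hsw⟩,
      abs_sub_comm s, abs_of_nonneg (by linarith : 0 ≤ brk τ w - s)] at this
    exact this
  have h2 : |σ t - σ (brk τ w)| ≤ L * (t - brk τ w) := by
    refine h.abs_cov_sub_le (by linarith) hwt ht (fun w' hw' => ?_) j k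
    by_cases hww : w' = w
    · rw [hww] at hw'; exact lt_irrefl _ hw'.1
    · exact hb w' hww ⟨hsw.trans hw'.1, hw'.2⟩
  have hj : P.jump (brk τ w) j k = σ (brk τ w) - g (brk τ w) := by
    rw [← hlim]; rfl
  rw [hj]
  have h1' := abs_le.1 h1
  have h2' := abs_le.1 h2
  show |σ (brk τ w) - g (brk τ w) - (σ t - σ s)| ≤ _
  rw [abs_le]
  constructor <;> linarith [h1'.1, h1'.2, h2'.1, h2'.2]

theorem piece_convex (l : Fin (ι + 1)) : Convex ℝ (piece τ l) := by
  unfold piece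
  split_ifs
  · exact convex_Icc _ _
  · exact convex_Ico _ _

theorem piece_uniqueDiffOn (hm : StrictMono τ) (l : Fin (ι + 1)) : UniqueDiffOn ℝ (piece τ l) := by
  unfold piece
  split_ifs
  · exact uniqueDiffOn_Icc (hm Fin.castSucc_lt_succ)
  · exact uniqueDiffOn_Ico _ _

/-- The mean value inequality is used twice within the piece, with derivatives relative to it; this
gives `M` in place of `M / 2`. -/
theorem PiecewiseSmooth.exists_taylor (h : P.PiecewiseSmooth τ L M) {l : Fin (ι + 1)} {t : ℝ}
    (ht : t ∈ piece τ l) (j k : Fin p) :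
    ∃ a : ℝ, ∀ u ∈ piece τ l, |P.cov u j k - P.cov t j k - a * (u - t)| ≤ M * (u - t) ^ 2 := by
  set s := piece τ l with hs
  set f : ℝ → ℝ := fun t => P.cov t j k with hf
  have hconv : Convex ℝ s := piece_convex l
  have huniq : UniqueDiffOn ℝ s := piece_uniqueDiffOn h.strictMono l
  have hcd : ContDiffOn ℝ 2 f s := h.contDiffOn l j k
  set F := iteratedDerivWithin 1 f s with hF
  have hFd : DifferentiableOn ℝ F s := hcd.differentiableOn_iteratedDerivWithin (by norm_num) huniq
  have hM : 0 ≤ M := (abs_nonneg _).trans (h.deriv2_le l j k t ht)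
  have hFlip : ∀ u ∈ s, |F u - F t| ≤ M * |u - t| := fun u hu => by
    have := hconv.norm_image_sub_le_of_norm_derivWithin_le (C := M) hFd (fun v hv => by
      rw [hF, ← iteratedDerivWithin_succ]
      exact h.deriv2_le l j k v hv) ht hu
    simpa [Real.norm_eq_abs] using this
  have hfd : ∀ u ∈ s, HasDerivWithinAt f (F u) s u := fun u hu => by
    have h1 := ((hcd.differentiableOn (by norm_num)) u hu).hasDerivWithinAt
    rwa [hF, iteratedDerivWithin_one]
  refine ⟨F t, fun u hu => ?_⟩
  have hseg : uIcc t u ⊆ s := by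
    rw [← segment_eq_uIcc]
    exact hconv.segment_subset ht hu
  have := (convex_uIcc t u).norm_image_sub_le_of_norm_hasDerivWithin_le
    (f := fun v => f v - F t * v) (f' := fun v => F v - F t) (C := M * |u - t|)
    (x := t) (y := u) (fun v hv => by
      have h1 := ((hfd v (hseg hv)).mono hseg).sub ((hasDerivWithinAt_id v (uIcc t u)).const_mul (F t))
      simp only [mul_one] at h1
      exact h1) (fun v hv => by
      rw [Real.norm_eq_abs]
      exact (hFlip v (hseg hv)).trans
        (mul_le_mul_of_nonneg_left (abs_sub_left_of_mem_uIcc hv) hM)) left_mem_uIcc right_mem_uIcc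
  rw [Real.norm_eq_abs, Real.norm_eq_abs, mul_assoc, ← sq, sq_abs] at this
  rwa [show f u - F t * u - (f t - F t * t) = f u - f t - F t * (u - t) by ring] at this

end CausalProcess

/-! ### Localization of the change points -/

/-- The sum of `m` terms up to `r` minus the sum of the `m` terms after `r`. -/
def contrast (f : ℤ → ℝ) (m : ℕ) (r : ℤ) : ℝ :=
  ∑ i ∈ Finset.range m, (f (r - i) - f (r + i + 1))

theorem sum_range_odd (m : ℕ) : ∑ i ∈ Finset.range m, (2 * (i : ℝ) + 1) = (m : ℝ) ^ 2 := by
  induction m with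
  | zero => simp
  | succ m ih => rw [Finset.sum_range_succ, ih]; push_cast; ring

theorem abs_contrast_le {f : ℤ → ℝ} {m : ℕ} {r : ℤ} {ℓ : ℝ}
    (h : ∀ i < m, |f (r - i) - f (r + i + 1)| ≤ ℓ * (2 * (i : ℝ) + 1)) :
    |contrast f m r| ≤ ℓ * m ^ 2 := by
  refine (Finset.abs_sum_le_sum_abs _ _).trans ?_
  rw [← sum_range_odd, Finset.mul_sum]
  exact Finset.sum_le_sum fun i hi => h i (Finset.mem_range.1 hi)

theorem abs_contrast_sub_le {f : ℤ → ℝ} {m : ℕ} {r r' : ℤ} {ℓ D : ℝ}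
    (h : ∀ i < m, |f (r - i) - f (r' - i)| ≤ ℓ * D ∧ |f (r + i + 1) - f (r' + i + 1)| ≤ ℓ * D) :
    |contrast f m r - contrast f m r'| ≤ 2 * ℓ * m * D := by
  unfold contrast
  rw [← Finset.sum_sub_distrib]
  refine (Finset.abs_sum_le_sum_abs _ _).trans ?_
  calc _ ≤ ∑ _i ∈ Finset.range m, 2 * (ℓ * D) := Finset.sum_le_sum fun i hi => by
        obtain ⟨h1, h2⟩ := h i (Finset.mem_range.1 hi)
        have h1 := abs_le.1 h1
        have h2 := abs_le.1 h2
        rw [abs_le]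
        constructor <;> linarith [h1.1, h1.2, h2.1, h2.2]
    _ = _ := by rw [Finset.sum_const, Finset.card_range, nsmul_eq_mul]; ring

theorem sum_range_ite_lt {d m : ℕ} (h : d ≤ m) :
    ∑ i ∈ Finset.range m, (if i < d then (1 : ℝ) else 0) = d := by
  rw [← Finset.sum_filter, Finset.sum_const, nsmul_eq_mul, mul_one,
    show (Finset.range m).filter (· < d) = Finset.range d by
      ext i; simp only [Finset.mem_filter, Finset.mem_range]; omega, Finset.card_range]

/-- A unit step produces a tent: each unit of distance from the step cancels one pair. -/
theorem contrast_step {m : ℕ} {r ρ : ℤ} (h : |r - ρ| ≤ m) :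
    contrast (fun i => if ρ < i then 1 else 0) m r = -((m : ℝ) - |((r - ρ : ℤ) : ℝ)|) := by
  unfold contrast
  rcases le_total ρ r with hr | hr
  · obtain ⟨d, hd⟩ := Int.eq_ofNat_of_zero_le (sub_nonneg.2 hr)
    rw [abs_of_nonneg (sub_nonneg.2 hr)] at h
    have hdm : d ≤ m := by omega
    rw [Finset.sum_congr rfl fun i hi => show _ = (if i < d then (1 : ℝ) else 0) - 1 by
      simp only []
      rw [if_pos (show ρ < r + i + 1 by omega)]
      by_cases hid : i < d
      · rw [if_pos hid, if_pos (by omega)]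
      · rw [if_neg hid, if_neg (by omega)],
      Finset.sum_sub_distrib, sum_range_ite_lt hdm, hd]
    simp
  · obtain ⟨d, hd⟩ := Int.eq_ofNat_of_zero_le (sub_nonneg.2 hr)
    rw [abs_sub_comm, abs_of_nonneg (sub_nonneg.2 hr)] at h
    have hdm : d ≤ m := by omega
    rw [Finset.sum_congr rfl fun i hi => show _ = (if i < d then (1 : ℝ) else 0) - 1 by
      simp only []
      rw [if_neg (show ¬ρ < r - i by omega)]
      by_cases hid : i < d
      · rw [if_pos hid, if_neg (by omega)]; norm_num
      · rw [if_neg hid, if_pos (by omega)],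
      Finset.sum_sub_distrib, sum_range_ite_lt hdm, show r - ρ = -(d : ℤ) by omega]
    simp

theorem contrast_add (f g : ℤ → ℝ) (c : ℝ) (m : ℕ) (r : ℤ) :
    contrast (fun i => f i + c * g i) m r = contrast f m r + c * contrast g m r := by
  unfold contrast
  rw [Finset.mul_sum, ← Finset.sum_add_distrib]
  exact Finset.sum_congr rfl fun i _ => by ring

/-- Behaviour of the contrast of a sequence with one jump near the jump. -/
theorem contrast_near_jump {s : ℤ → ℝ} {m : ℕ} {ρ : ℤ} {ℓ : ℝ} (hℓ : 0 ≤ ℓ)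
    (hs : ∀ i i' : ℤ, ρ - 2 * m ≤ i → i ≤ i' → i' ≤ ρ + 2 * m → (i' ≤ ρ ∨ ρ < i) →
      |s i' - s i| ≤ ℓ * (i' - i)) (hm : 0 < m) :
    (m : ℝ) * |s (ρ + 1) - s ρ| - ℓ * m ^ 2 ≤ |contrast s m ρ| ∧
    ∀ r : ℤ, |r - ρ| ≤ m → |contrast s m r| ≤
      (1 - |((r - ρ : ℤ) : ℝ)| / m) * |contrast s m ρ| + 3 * ℓ * m * |((r - ρ : ℤ) : ℝ)| := by
  have hm0 : (0 : ℝ) < m := by exact_mod_cast hm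
  set Δ := s (ρ + 1) - s ρ with hΔ
  set st : ℤ → ℝ := fun i => if ρ < i then 1 else 0 with hst
  -- With the jump removed, `u` takes the same value at `ρ` and `ρ + 1`, so it is Lipschitz across
  -- `ρ`, and the contrast of `s` is a small Lipschitz perturbation of a tent.
  set u : ℤ → ℝ := fun i => s i - Δ * st i with hu
  have hsu : s = fun i => u i + Δ * st i := by ext i; simp only [hu]; ring
  have hlip0 : ∀ i i' : ℤ, ρ - 2 * m ≤ i → i ≤ i' → i' ≤ ρ + 2 * m →
      |u i' - u i| ≤ ℓ * (i' - i) := by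
    intro i i' h1 h2 h3
    by_cases ha : i' ≤ ρ
    · simp only [hu, hst]
      rw [if_neg (not_lt.2 ha), if_neg (not_lt.2 (h2.trans ha)), mul_zero, sub_zero, sub_zero]
      exact hs i i' h1 h2 h3 (Or.inl ha)
    · push Not at ha
      by_cases hb : ρ < i
      · simp only [hu, hst]
        rw [if_pos ha, if_pos hb, sub_sub_sub_cancel_right]
        exact hs i i' h1 h2 h3 (Or.inr hb)
      · push Not at hb
        simp only [hu, hst]
        rw [if_pos ha, if_neg (not_lt.2 hb), mul_one, mul_zero, sub_zero, hΔ]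
        have e1 := abs_le.1 (hs i ρ h1 hb (by omega) (Or.inl le_rfl))
        have e2 := abs_le.1 (hs (ρ + 1) i' (by omega) (by omega) h3 (Or.inr (by omega)))
        push_cast at e2
        rw [abs_le]
        constructor <;> nlinarith [e1.1, e1.2, e2.1, e2.2]
  have hlip : ∀ i i' : ℤ, ρ - 2 * m ≤ i → i ≤ ρ + 2 * m → ρ - 2 * m ≤ i' → i' ≤ ρ + 2 * m →
      |u i - u i'| ≤ ℓ * |((i - i' : ℤ) : ℝ)| := by
    intro i i' h1 h2 h3 h4
    rcases le_total i i' with h | h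
    · have := hlip0 i i' h1 h h4
      have h0 : ((i - i' : ℤ) : ℝ) ≤ 0 := by exact_mod_cast (by omega : i - i' ≤ 0)
      rw [abs_sub_comm, abs_of_nonpos h0]
      push_cast
      linarith
    · have := hlip0 i' i h3 h h2
      have h0 : (0 : ℝ) ≤ ((i - i' : ℤ) : ℝ) := by exact_mod_cast (by omega : 0 ≤ i - i')
      rw [abs_of_nonneg h0]
      push_cast
      linarith
  have hcu : |contrast u m ρ| ≤ ℓ * m ^ 2 := by
    refine abs_contrast_le fun i hi => ?_
    have := hlip0 (ρ - i) (ρ + i + 1) (by omega) (by omega) (by omega)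
    rw [abs_sub_comm]
    push_cast at this
    linarith
  have hcs : ∀ r, |r - ρ| ≤ m → contrast s m r
      = contrast u m r - Δ * (m - |((r - ρ : ℤ) : ℝ)|) := by
    intro r hr
    rw [hsu, contrast_add, contrast_step hr]; ring
  have hcρ : contrast s m ρ = contrast u m ρ - Δ * m := by
    rw [hcs ρ (by simp)]; simp
  refine ⟨?_, fun r hr => ?_⟩
  · have e1 : Δ * m = contrast u m ρ - contrast s m ρ := by rw [hcρ]; ring
    have e2 : (m : ℝ) * |Δ| = |contrast u m ρ - contrast s m ρ| := by
      rw [← e1, abs_mul, abs_of_pos hm0, mul_comm]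
    have := abs_sub (contrast u m ρ) (contrast s m ρ)
    linarith
  · set d : ℝ := |((r - ρ : ℤ) : ℝ)| with hd
    have hd0 : 0 ≤ d := abs_nonneg _
    have hdm : d ≤ m := by rw [hd, ← Int.cast_abs]; exact_mod_cast hr
    have hr' := abs_le.1 hr
    have hdiff : |contrast u m r - contrast u m ρ| ≤ 2 * ℓ * m * d := by
      refine abs_contrast_sub_le fun i hi => ⟨?_, ?_⟩
      · have := hlip (r - i) (ρ - i) (by omega) (by omega) (by omega) (by omega)
        rwa [show r - i - (ρ - i) = r - ρ by ring] at this
      · have := hlip (r + i + 1) (ρ + i + 1) (by omega) (by omega) (by omega) (by omega)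
        rwa [show r + i + 1 - (ρ + i + 1) = r - ρ by ring] at this
    have hid : contrast s m r = (1 - d / m) * contrast s m ρ
        + (contrast u m r - contrast u m ρ) + d / m * contrast u m ρ := by
      rw [hcs r hr, hcρ]
      field_simp
      ring
    have h1 : 0 ≤ 1 - d / m := by rw [sub_nonneg, div_le_one hm0]; exact hdm
    rw [hid]
    refine (abs_add_le _ _).trans ?_
    have h2 := abs_add_le ((1 - d / m) * contrast s m ρ) (contrast u m r - contrast u m ρ)
    rw [abs_mul, abs_of_nonneg h1] at h2
    have h3 : |d / m * contrast u m ρ| ≤ ℓ * m * d := by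
      rw [abs_mul, abs_of_nonneg (by positivity)]
      calc d / m * |contrast u m ρ| ≤ d / m * (ℓ * m ^ 2) := by gcongr
        _ = _ := by field_simp
    linarith

/-- The expectation of the difference statistic. -/
def meanStat {p : ℕ} (s : ℤ → Matrix (Fin p) (Fin p) ℝ) (n m : ℕ) (r : ℤ) :
    Matrix (Fin p) (Fin p) ℝ :=
  Matrix.of fun j k => (n : ℝ)⁻¹ * contrast (fun i => s i j k) m r

/-- Farther than the window from every jump the statistic is below `θ`, and at a jump it is at least
`θ`. Near a jump it falls linearly, so a point that does at least as well as the jump is within `4 ε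
n / c`. Inductively, every earlier estimate is close to some jump. Hence a new estimate is near a
jump not found before, which is still in the grid and does not beat the estimate. A jump never found
would still be in the final grid and contradict the stopping rule. -/
theorem localization {p ι n m : ℕ} {x : ℤ → Fin p → ℝ} {s : ℤ → Matrix (Fin p) (Fin p) ℝ}
    {ρ : Fin ι → ℤ} {ℓ c ε θ : ℝ} {k : ℕ} {r : ℕ → ℤ} (hn : 0 < n) (hm : 0 < m) (hℓ : 0 ≤ ℓ)
    (hc : 0 < c) (hε0 : 0 ≤ ε) (hout : IsChangePointOutput x n m θ k r)
    (hlip : ∀ i i' : ℤ, 1 ≤ i → i ≤ i' → i' ≤ n → (∀ w, ¬(i ≤ ρ w ∧ ρ w < i')) →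
      ∀ j k, |s i' j k - s i j k| ≤ ℓ * (i' - i))
    (hjump : ∀ w, c ≤ maxNorm (s (ρ w + 1) - s (ρ w)))
    (hsep : ∀ w w', w ≠ w' → 4 * (m : ℤ) < |ρ w - ρ w'|)
    (hleft : ∀ w, 2 * (m : ℤ) < ρ w) (hright : ∀ w, ρ w + 2 * m < n)
    (hnoise : ∀ r : ℤ, (m : ℤ) ≤ r → r ≤ n - m → ∀ j k,
      |diffStat x n m r j k - meanStat s n m r j k| ≤ ε)
    (hθ : ℓ * m ^ 2 / n + ε < θ) (hθ' : θ + ε + ℓ * m ^ 2 / n ≤ c * m / n)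
    (hℓm : 8 * ℓ * m ≤ c) (hε : 8 * ε * n ≤ c * m) :
    (∀ l < k, ∃ w, |((r l - ρ w : ℤ) : ℝ)| ≤ 4 * ε * n / c) ∧
    (∀ w, ∃ l < k, |((r l - ρ w : ℤ) : ℝ)| ≤ 4 * ε * n / c) := by
  have hn0 : (0 : ℝ) < n := by exact_mod_cast hn
  have hm0 : (0 : ℝ) < m := by exact_mod_cast hm
  set δ : ℝ := 4 * ε * n / c with hδ
  have hδm : δ ≤ m / 2 := by
    rw [hδ, div_le_iff₀ hc]; linarith
  set D : ℤ → Matrix (Fin p) (Fin p) ℝ := diffStat x n m with hD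
  have hms : ∀ r j k, meanStat s n m r j k = (n : ℝ)⁻¹ * contrast (fun i => s i j k) m r :=
    fun _ _ _ => rfl
  have hA : ∀ r : ℤ, (m : ℤ) ≤ r → r ≤ n - m → (∀ w, ¬(|r - ρ w| < m)) →
      maxNorm (D r) < θ := by
    intro r h1 h2 hw
    refine lt_of_le_of_lt (maxNorm_le (by positivity) fun j k => ?_) hθ
    have e1 : |contrast (fun i => s i j k) m r| ≤ ℓ * m ^ 2 := by
      refine abs_contrast_le fun i hi => ?_
      have := hlip (r - i) (r + i + 1) (by omega) (by omega) (by omega) (fun w hw' => hw w (by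
        rw [abs_lt]; omega)) j k
      rw [abs_sub_comm]
      push_cast at this
      linarith
    have e2 : |meanStat s n m r j k| ≤ ℓ * m ^ 2 / n := by
      rw [hms, abs_mul, abs_of_pos (by positivity), div_eq_inv_mul]
      gcongr
    have e3 := abs_le.1 (hnoise r h1 h2 j k)
    have e4 := abs_le.1 e2
    rw [abs_le]
    constructor <;> linarith [e3.1, e3.2, e4.1, e4.2]
  have hnear : ∀ w j k, (m : ℝ) * |s (ρ w + 1) j k - s (ρ w) j k| - ℓ * m ^ 2
      ≤ |contrast (fun i => s i j k) m (ρ w)| ∧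
      ∀ r : ℤ, |r - ρ w| ≤ m → |contrast (fun i => s i j k) m r| ≤
      (1 - |((r - ρ w : ℤ) : ℝ)| / m) * |contrast (fun i => s i j k) m (ρ w)|
        + 3 * ℓ * m * |((r - ρ w : ℤ) : ℝ)| := by
    intro w j k
    refine contrast_near_jump (s := fun i => s i j k) (ρ := ρ w) (m := m) hℓ
      (fun i i' h1 h2 h3 h4 => ?_) hm
    have h5 := hleft w
    have h6 := hright w
    refine hlip i i' (by omega) h2 (by omega) (fun w' hw' => ?_) j k
    by_cases hww : w' = w
    · subst hww; omega
    · have h7 := hsep w' w hww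
      rw [lt_abs] at h7
      omega
  have hH : ∀ w, c * m / n - ℓ * m ^ 2 / n ≤ maxNorm (meanStat s n m (ρ w)) := by
    intro w
    set H := maxNorm (meanStat s n m (ρ w))
    have hH0 : 0 ≤ H := maxNorm_nonneg _
    have h1 : maxNorm (s (ρ w + 1) - s (ρ w)) ≤ (n * H + ℓ * m ^ 2) / m := by
      refine maxNorm_le (by positivity) fun j k => ?_
      rw [le_div_iff₀ hm0]
      have h2 := (hnear w j k).1
      have h3 := abs_le_maxNorm (meanStat s n m (ρ w)) j k
      rw [hms, abs_mul, abs_of_pos (by positivity), inv_mul_le_iff₀ hn0] at h3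
      rw [Matrix.sub_apply]
      linarith
    have h2 := (hjump w).trans h1
    rw [le_div_iff₀ hm0] at h2
    rw [← sub_div, div_le_iff₀ hn0]
    linarith
  have hρmem : ∀ w, (m : ℤ) ≤ ρ w ∧ ρ w ≤ n - m := fun w => by
    have := hleft w; have := hright w; omega
  have hHD : ∀ w, maxNorm (meanStat s n m (ρ w)) ≤ maxNorm (D (ρ w)) + ε := fun w => by
    refine maxNorm_le (add_nonneg (maxNorm_nonneg _) hε0) fun j k => ?_
    have h1 := abs_le.1 (hnoise (ρ w) (hρmem w).1 (hρmem w).2 j k)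
    have h2 := abs_le.1 (abs_le_maxNorm (D (ρ w)) j k)
    rw [abs_le]
    constructor <;> linarith [h1.1, h1.2, h2.1, h2.2]
  have hC : ∀ w, θ ≤ maxNorm (D (ρ w)) := fun w => by linarith [hH w, hHD w]
  -- Comparing with the value at the jump gives `d (c - 4 ℓ m) ≤ 2 ε n`, and `8 ℓ m ≤ c` makes the
  -- bracket at least `c / 2`.
  have hB : ∀ (w : Fin ι) (r : ℤ), (m : ℤ) ≤ r → r ≤ n - m → |r - ρ w| ≤ m →
      maxNorm (D (ρ w)) ≤ maxNorm (D r) → |((r - ρ w : ℤ) : ℝ)| ≤ δ := by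
    intro w r h1 h2 h3 h4
    set d := |((r - ρ w : ℤ) : ℝ)| with hd
    have hd0 : 0 ≤ d := abs_nonneg _
    have hdm : d ≤ m := by rw [hd, ← Int.cast_abs]; exact_mod_cast h3
    have hdm1 : 0 ≤ 1 - d / m := by rw [sub_nonneg, div_le_one hm0]; exact hdm
    set H := maxNorm (meanStat s n m (ρ w))
    have hH0 : 0 ≤ H := maxNorm_nonneg _
    have h5 : maxNorm (D r) ≤ (1 - d / m) * H + 3 * ℓ * m * d / n + ε := by
      refine maxNorm_le (by positivity) fun j k => ?_
      have e1 := (hnear w j k).2 r h3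
      have e2 : |meanStat s n m r j k| ≤ (1 - d / m) * H + 3 * ℓ * m * d / n := by
        have e3 := abs_le_maxNorm (meanStat s n m (ρ w)) j k
        rw [hms, abs_mul, abs_of_pos (by positivity)] at e3 ⊢
        calc (n : ℝ)⁻¹ * |contrast (fun i => s i j k) m r|
            ≤ (n : ℝ)⁻¹ * ((1 - d / m) * |contrast (fun i => s i j k) m (ρ w)| + 3 * ℓ * m * d) := by
              gcongr
          _ = (1 - d / m) * ((n : ℝ)⁻¹ * |contrast (fun i => s i j k) m (ρ w)|)
              + 3 * ℓ * m * d / n := by field_simp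
          _ ≤ _ := by gcongr
      have e3 := abs_le.1 (hnoise r h1 h2 j k)
      have e4 := abs_le.1 e2
      rw [abs_le]
      constructor <;> linarith [e3.1, e3.2, e4.1, e4.2]
    have h6 : d / m * H ≤ 3 * ℓ * m * d / n + 2 * ε := by linarith [hHD w]
    have h7 : d / m * (c * m / n - ℓ * m ^ 2 / n) ≤ 3 * ℓ * m * d / n + 2 * ε :=
      (mul_le_mul_of_nonneg_left (hH w) (by positivity)).trans h6
    have h8 : d / m * (c * m / n - ℓ * m ^ 2 / n) = (d * c - d * ℓ * m) / n := by field_simp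
    have h9 : 3 * ℓ * m * d / n + 2 * ε = (3 * ℓ * m * d + 2 * ε * n) / n := by field_simp
    rw [h8, h9, div_le_div_iff_of_pos_right hn0] at h7
    rw [hδ, le_div_iff₀ hc]
    nlinarith
  have habs : ∀ z : ℤ, |(z : ℝ)| ≤ δ → 2 * |z| ≤ m := fun z hz => by
    rw [← Int.cast_abs] at hz
    have : 2 * ((|z| : ℤ) : ℝ) ≤ ((m : ℤ) : ℝ) := by push_cast at hz ⊢; linarith
    exact_mod_cast this
  have hfar : ∀ w w' : Fin ι, w' ≠ w → ∀ z : ℤ, |((z - ρ w' : ℤ) : ℝ)| ≤ δ →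
      2 * (m : ℤ) < |ρ w - z| := by
    intro w w' hww z hz
    have h1 := habs _ hz
    have h2 := hsep w' w hww
    have h3 : |ρ w' - ρ w| ≤ |z - ρ w'| + |ρ w - z| := by
      have := abs_add_le (ρ w' - z) (z - ρ w)
      rw [abs_sub_comm (ρ w') z, abs_sub_comm z (ρ w)] at this
      rwa [sub_add_sub_cancel] at this
    omega
  -- If an earlier estimate were near the same jump, both would be within `3 m / 2` of each other,
  -- against the exclusion radius `2 m`; so the jump itself is still admissible.
  have hfirst : ∀ l, l < k → ∃ w, |((r l - ρ w : ℤ) : ℝ)| ≤ δ := by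
    intro l
    induction l using Nat.strong_induction_on with
    | _ l ih =>
      intro hl
      obtain ⟨g1, g2, g3⟩ := hout.mem l hl
      obtain ⟨w, hw⟩ : ∃ w, |r l - ρ w| < m := by
        by_contra hcon
        push Not at hcon
        exact absurd (hout.continue_le l hl) (not_le.2 (hA _ g1 g2 fun w => not_lt.2 (hcon w)))
      refine ⟨w, hB w (r l) g1 g2 hw.le (hout.argmax l hl _ ⟨(hρmem w).1, (hρmem w).2, fun i hi => ?_⟩)⟩
      obtain ⟨w', hw'⟩ := ih i hi (hi.trans hl)
      by_cases hww : w' = w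
      · subst hww
        have h1 := habs _ hw'
        have h2 := g3 i hi
        have h3 : |r l - r i| ≤ |r l - ρ w'| + |r i - ρ w'| := by
          have := abs_sub (r l - ρ w') (r i - ρ w')
          rwa [sub_sub_sub_cancel_right] at this
        omega
      · exact hfar w w' hww _ hw'
  refine ⟨hfirst, fun w => ?_⟩
  by_contra hcon
  push Not at hcon
  refine absurd (hout.stop_lt (ρ w) ⟨(hρmem w).1, (hρmem w).2, fun i hi => ?_⟩) (not_lt.2 (hC w))
  obtain ⟨w', hw'⟩ := hfirst i hi
  by_cases hww : w' = w
  · subst hww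
    exact absurd hw' (not_le.2 (hcon i hi))
  · exact hfar w w' hww _ hw'

/-! ### Consistency of the change point procedure for the model -/

namespace CausalProcess

variable {Ω : Type*} [MeasurableSpace Ω] {μ : Measure Ω} {p : ℕ} {P : CausalProcess μ p}
  {ι : ℕ} {τ : Fin (ι + 2) → ℝ} {L M c₁ c₂ : ℝ}

/-- The last grid index before a break point. -/
def brkIndex (n : ℕ) (τ : Fin (ι + 2) → ℝ) (w : Fin ι) : ℤ := ⌈n * brk τ w⌉ - 1

theorem le_brkIndex {n : ℕ} (hn : 0 < n) (w : Fin ι) (i : ℤ) :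
    i ≤ brkIndex n τ w ↔ (i : ℝ) / n < brk τ w := by
  have hn0 : (0 : ℝ) < n := by exact_mod_cast hn
  rw [brkIndex, Int.le_sub_one_iff, Int.lt_ceil, div_lt_iff₀ hn0, mul_comm]

theorem brkIndex_lt {n : ℕ} (hn : 0 < n) (w : Fin ι) (i : ℤ) :
    brkIndex n τ w < i ↔ brk τ w ≤ (i : ℝ) / n := by
  rw [← not_le, le_brkIndex hn, not_lt]

theorem obs_mul_obs {n : ℕ} (ω : Ω) {i : ℕ} (h1 : 1 ≤ i) (h2 : i ≤ n) (j k : Fin p) :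
    P.obs n ω i j * P.obs n ω i k = P.noise n ω j k i + P.cov ((i : ℝ) / n) j k := by
  unfold obs noise
  rw [if_pos ⟨by exact_mod_cast h1, by exact_mod_cast h2⟩]
  simp

theorem obs_mul_obs_int {n : ℕ} (ω : Ω) {i : ℤ} (h1 : 1 ≤ i) (h2 : i ≤ n) (j k : Fin p) :
    P.obs n ω i j * P.obs n ω i k = P.noise n ω j k i.toNat + P.cov ((i : ℝ) / n) j k := by
  obtain ⟨i, rfl⟩ := Int.eq_ofNat_of_zero_le (by omega : 0 ≤ i)
  have := obs_mul_obs (P := P) (n := n) ω (i := i) (by omega) (by omega) j k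
  simpa using this

/-- After reindexing, the error is the difference of two interval sums of the noise, each over `m`
indices. -/
theorem abs_diffStat_sub_meanStat_le {n m : ℕ} (hn : 0 < n) (hm : 0 < m) {ω : Ω} {y : ℝ}
    {j k : Fin p}
    (hy : ∀ a : ℕ, 1 ≤ a → a + m ≤ n + 1 → |∑ i ∈ Finset.Ico a (a + m), P.noise n ω j k i| ≤ y)
    {r : ℤ} (h1 : (m : ℤ) ≤ r) (h2 : r ≤ n - m) :
    |diffStat (P.obs n ω) n m r j k - meanStat (fun i => P.cov ((i : ℝ) / n)) n m r j k|
      ≤ 2 * y / n := by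
  have hn0 : (0 : ℝ) < n := by exact_mod_cast hn
  obtain ⟨R, rfl⟩ := Int.eq_ofNat_of_zero_le (by omega : 0 ≤ r)
  have e1 : ∑ i ∈ Finset.range m, P.obs n ω ((R : ℤ) - i) j * P.obs n ω ((R : ℤ) - i) k
      = ∑ i ∈ Finset.Ico (R + 1 - m) (R + 1 - m + m), P.noise n ω j k i
        + ∑ i ∈ Finset.range m, P.cov ((((R : ℤ) - i : ℤ) : ℝ) / n) j k := by
    rw [Finset.sum_congr rfl fun i hi => obs_mul_obs_int (P := P) ω
      (by have := Finset.mem_range.1 hi; omega) (by have := Finset.mem_range.1 hi; omega) j k,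
      Finset.sum_add_distrib]
    congr 1
    refine Finset.sum_nbij' (fun i => R - i) (fun i => R - i) ?_ ?_ ?_ ?_ ?_
    · intro i hi; have := Finset.mem_range.1 hi; rw [Finset.mem_Ico]; omega
    · intro i hi; rw [Finset.mem_Ico] at hi; rw [Finset.mem_range]; omega
    · intro i hi; have := Finset.mem_range.1 hi; omega
    · intro i hi; rw [Finset.mem_Ico] at hi; omega
    · intro i hi; have := Finset.mem_range.1 hi; congr 1; omega
  have e2 : ∑ i ∈ Finset.Icc 1 m, P.obs n ω ((R : ℤ) + i) j * P.obs n ω ((R : ℤ) + i) k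
      = ∑ i ∈ Finset.Ico (R + 1) (R + 1 + m), P.noise n ω j k i
        + ∑ i ∈ Finset.range m, P.cov ((((R : ℤ) + i + 1 : ℤ) : ℝ) / n) j k := by
    rw [Finset.sum_congr rfl fun i hi => obs_mul_obs_int (P := P) ω
      (by have := Finset.mem_Icc.1 hi; omega) (by have := Finset.mem_Icc.1 hi; omega) j k,
      Finset.sum_add_distrib]
    congr 1
    · refine Finset.sum_nbij' (fun i => R + i) (fun i => i - R) ?_ ?_ ?_ ?_ ?_
      · intro i hi; have := Finset.mem_Icc.1 hi; rw [Finset.mem_Ico]; omega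
      · intro i hi; rw [Finset.mem_Ico] at hi; rw [Finset.mem_Icc]; omega
      · intro i hi; omega
      · intro i hi; rw [Finset.mem_Ico] at hi; omega
      · intro i hi; congr 1
    · refine Finset.sum_nbij' (fun i => i - 1) (fun i => i + 1) ?_ ?_ ?_ ?_ ?_
      · intro i hi; have := Finset.mem_Icc.1 hi; rw [Finset.mem_range]; omega
      · intro i hi; rw [Finset.mem_range] at hi; rw [Finset.mem_Icc]; omega
      · intro i hi; have := Finset.mem_Icc.1 hi; omega
      · intro i hi; omega
      · intro i hi
        have := Finset.mem_Icc.1 hi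
        rw [show ((R : ℤ) + i) = (R : ℤ) + ((i - 1 : ℕ) : ℤ) + 1 by omega]
  have e3 : diffStat (P.obs n ω) n m R j k - meanStat (fun i => P.cov ((i : ℝ) / n)) n m R j k
      = (n : ℝ)⁻¹ * (∑ i ∈ Finset.Ico (R + 1 - m) (R + 1 - m + m), P.noise n ω j k i
        - ∑ i ∈ Finset.Ico (R + 1) (R + 1 + m), P.noise n ω j k i) := by
    simp only [diffStat, meanStat, contrast, Matrix.smul_apply, Matrix.sub_apply, Matrix.sum_apply,
      Matrix.vecMulVec_apply, Matrix.of_apply, smul_eq_mul]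
    rw [e1, e2, Finset.sum_sub_distrib]
    ring
  rw [e3, abs_mul, abs_of_pos (by positivity), div_eq_inv_mul]
  have h3 := hy (R + 1 - m) (by omega) (by omega)
  have h4 := hy (R + 1) (by omega) (by omega)
  have h5 := abs_sub (∑ i ∈ Finset.Ico (R + 1 - m) (R + 1 - m + m), P.noise n ω j k i)
    (∑ i ∈ Finset.Ico (R + 1) (R + 1 + m), P.noise n ω j k i)
  gcongr
  linarith

/-- If the partial sums of the noise are small, the estimated change points are close to the true
ones, and all of them are found. -/
theorem abs_changePoint_sub_le (hs : P.PiecewiseSmooth τ L M) (hj : P.Jumps τ c₁ c₂) (hL : 0 < L)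
    (hc₂ : 0 < c₂) {n : ℕ} (hn : 0 < n) {h ε : ℝ} (hnh : 2 ≤ n * h) (hh1 : 32 * (1 + L) * h ≤ c₂)
    (hh2 : 8 * h ≤ c₁) (hε0 : 0 ≤ ε) (hε : ε < h ^ 2) {ω : Ω} {k : ℕ} {r : ℕ → ℤ}
    (hout : IsChangePointOutput (P.obs n ω) n ⌊n * h⌋₊ ((1 + L) * h ^ 2) k r)
    (hy : ∀ j k, ∀ a a' : ℕ, 1 ≤ a → a ≤ a' → a' ≤ n + 1 → ((a' - a : ℕ) : ℝ) ≤ n * h →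
      |∑ i ∈ Finset.Ico a a', P.noise n ω j k i| ≤ n * ε / 2) :
    (∀ l < k, ∃ w, |(r l : ℝ) / n - brk τ w| ≤ 8 * ε / c₂ + 1 / n) ∧
    (∀ w, ∃ l < k, |(r l : ℝ) / n - brk τ w| ≤ 8 * ε / c₂ + 1 / n) := by
  have hn0 : (0 : ℝ) < n := by exact_mod_cast hn
  have hh0 : 0 < h := pos_of_mul_pos_right (by linarith : 0 < (n : ℝ) * h) hn0.le
  have hinv : 1 / (n : ℝ) ≤ h / 2 := by rw [div_le_div_iff₀ hn0 two_pos]; linarith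
  set m := ⌊(n : ℝ) * h⌋₊ with hm
  have hm_le : (m : ℝ) ≤ n * h := Nat.floor_le (by positivity)
  have hm_gt : (n : ℝ) * h < m + 1 := Nat.lt_floor_add_one _
  have hm1 : 0 < m := Nat.floor_pos.2 (by linarith)
  have hmh : (n : ℝ) * h / 2 ≤ m := by linarith
  have hmn : (m : ℝ) / n ≤ h := by rw [div_le_iff₀ hn0]; linarith
  have hmn' : h / 2 ≤ (m : ℝ) / n := by rw [le_div_iff₀ hn0]; linarith
  have hLh : L * h ≤ c₂ / 32 := by nlinarith
  have hh32 : h ≤ c₂ / 32 := by nlinarith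
  have hρ1 : ∀ w, (n : ℝ) * brk τ w - 1 ≤ brkIndex n τ w := fun w => by
    unfold brkIndex; push_cast; linarith [Int.le_ceil ((n : ℝ) * brk τ w)]
  have hρ2 : ∀ w, (brkIndex n τ w : ℝ) < n * brk τ w := fun w => by
    unfold brkIndex; push_cast; linarith [Int.ceil_lt_add_one ((n : ℝ) * brk τ w)]
  have hnc : 8 * (n * h) ≤ n * c₁ := by nlinarith
  have hleft : ∀ w, 2 * (m : ℤ) < brkIndex n τ w := fun w => by
    have h1 := hρ1 w
    have h2 := mul_le_mul_of_nonneg_left (hj.le_brk hs w) hn0.le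
    have : 2 * (m : ℝ) < brkIndex n τ w := by linarith
    exact_mod_cast this
  have hright : ∀ w, brkIndex n τ w + 2 * m < n := fun w => by
    have h1 := hρ2 w
    have h2 := mul_le_mul_of_nonneg_left (hj.brk_le hs w) hn0.le
    have : (brkIndex n τ w : ℝ) + 2 * m < n := by linarith
    exact_mod_cast this
  have hsep0 : ∀ w w', w < w' → 4 * (m : ℤ) < brkIndex n τ w' - brkIndex n τ w := fun w w' hw => by
    have h1 := hρ1 w'
    have h2 := hρ2 w
    have h3 := mul_le_mul_of_nonneg_left (hj.separated_brk hs.strictMono hw) hn0.le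
    have : 4 * (m : ℝ) < brkIndex n τ w' - brkIndex n τ w := by linarith
    exact_mod_cast this
  have hsep : ∀ w w', w ≠ w' → 4 * (m : ℤ) < |brkIndex n τ w - brkIndex n τ w'| := by
    intro w w' hw
    rcases lt_or_gt_of_ne hw with hlt | hlt
    · rw [abs_sub_comm]; exact (hsep0 w w' hlt).trans_le (le_abs_self _)
    · exact (hsep0 w' w hlt).trans_le (le_abs_self _)
  -- On the grid the Lipschitz constant is `L / n`, and the increment across a break keeps at least
  -- half of `c₂`. The threshold is above the level `L h² + ε` away from jumps because `ε < h²`, and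
  -- below the signal because `h` is small against `c₂ / (1 + L)`.
  have hloc := localization (p := p) (x := P.obs n ω) (s := fun i => P.cov ((i : ℝ) / n))
    (ρ := brkIndex n τ) (ℓ := L / n) (c := c₂ / 2) (ε := ε) (θ := (1 + L) * h ^ 2) hn hm1
    (by positivity) (by positivity) hε0 hout
    (fun i i' h1 h2 h3 hb j k => by
      have h1' : (1 : ℝ) ≤ i := by exact_mod_cast h1
      have h2' : (i : ℝ) ≤ i' := by exact_mod_cast h2
      have h3' : (i' : ℝ) ≤ n := by exact_mod_cast h3
      have := hs.abs_cov_sub_le (s := (i : ℝ) / n) (t := (i' : ℝ) / n) (by positivity)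
        (by gcongr) (by rwa [div_le_one hn0]) (fun w hw => hb w
          ⟨(le_brkIndex hn w i).2 hw.1, (brkIndex_lt hn w i').2 hw.2⟩) j k
      calc _ ≤ _ := this
        _ = _ := by ring)
    (fun w => by
      have h1 := hleft w
      have h2 := hright w
      have h1' : (0 : ℝ) ≤ brkIndex n τ w := by exact_mod_cast (by omega : 0 ≤ brkIndex n τ w)
      have h2' : ((brkIndex n τ w + 1 : ℤ) : ℝ) ≤ n := by
        exact_mod_cast (by omega : brkIndex n τ w + 1 ≤ n)
      have key : ∀ j k, |P.jump (brk τ w) j k| ≤ maxNorm (P.cov (((brkIndex n τ w + 1 : ℤ) : ℝ) / n)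
          - P.cov ((brkIndex n τ w : ℝ) / n)) + L / n := by
        intro j k
        have e1 := abs_le.1 (hs.abs_jump_sub_le hL.le w (s := (brkIndex n τ w : ℝ) / n)
          (t := ((brkIndex n τ w + 1 : ℤ) : ℝ) / n) (by positivity) ((le_brkIndex hn w _).1 le_rfl)
          ((brkIndex_lt hn w _).1 (by omega)) (by rwa [div_le_one hn0]) (fun w' hw' hb => by
            have e2 := (le_brkIndex hn w' _).2 hb.1
            have e3 := (brkIndex_lt hn w' _).2 hb.2
            have e4 := hsep w' w hw'
            rw [lt_abs] at e4
            omega) j k)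
        have e2 := abs_le.1 (abs_le_maxNorm (P.cov (((brkIndex n τ w + 1 : ℤ) : ℝ) / n)
          - P.cov ((brkIndex n τ w : ℝ) / n)) j k)
        rw [Matrix.sub_apply] at e2
        have e3 : L * (((brkIndex n τ w + 1 : ℤ) : ℝ) / n - (brkIndex n τ w : ℝ) / n) = L / n := by
          push_cast; ring
        rw [e3] at e1
        rw [abs_le]
        constructor <;> linarith [e1.1, e1.2, e2.1, e2.2]
      have h3 := (hj.sizeable w).trans (maxNorm_le (add_nonneg (maxNorm_nonneg _) (by positivity)) key)
      have h4 : L / n ≤ c₂ / 2 := by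
        calc L / n = L * (1 / n) := by ring
          _ ≤ L * (h / 2) := by gcongr
          _ ≤ _ := by linarith
      linarith)
    hsep hleft hright
    (fun r h1 h2 j k => by
      refine (abs_diffStat_sub_meanStat_le (y := n * ε / 2) hn hm1 (fun a ha1 ha2 =>
        hy j k a (a + m) ha1 (by omega) ha2 (by simpa using hm_le)) h1 h2).trans (le_of_eq ?_)
      field_simp)
    (by
      have : L / n * (m : ℝ) ^ 2 / n = L * ((m : ℝ) / n) ^ 2 := by field_simp
      rw [this]
      have : L * ((m : ℝ) / n) ^ 2 ≤ L * h ^ 2 := by gcongr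
      linarith)
    (by
      have e1 : L / n * (m : ℝ) ^ 2 / n = L * ((m : ℝ) / n) ^ 2 := by field_simp
      rw [e1, mul_div_assoc]
      have e2 : L * ((m : ℝ) / n) ^ 2 ≤ L * h ^ 2 := by gcongr
      have e3 : c₂ / 2 * (h / 2) ≤ c₂ / 2 * ((m : ℝ) / n) := by gcongr
      have e4 : L * h ^ 2 ≤ c₂ / 32 * h := by rw [sq, ← mul_assoc]; gcongr
      have e5 : h ^ 2 ≤ c₂ / 32 * h := by rw [sq]; gcongr
      have e6 : 0 < c₂ * h := by positivity
      linarith)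
    (by
      calc 8 * (L / n) * m = 8 * L * (m / n) := by ring
        _ ≤ 8 * L * h := by gcongr
        _ ≤ _ := by linarith)
    (by
      have e5 : h ^ 2 ≤ c₂ / 32 * h := by rw [sq]; gcongr
      have e6 : 8 * ε ≤ c₂ / 2 * (h / 2) := by linarith [mul_pos hc₂ hh0]
      have e7 : 8 * ε ≤ c₂ / 2 * (m / n) := e6.trans (by gcongr)
      calc 8 * ε * n ≤ c₂ / 2 * (m / n) * n := by gcongr
        _ = _ := by field_simp)
  have hfin : ∀ (z : ℤ) (w : Fin ι), |((z - brkIndex n τ w : ℤ) : ℝ)| ≤ 4 * ε * n / (c₂ / 2) →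
      |(z : ℝ) / n - brk τ w| ≤ 8 * ε / c₂ + 1 / n := by
    intro z w hz
    have h1 := hρ1 w
    have h2 := hρ2 w
    have e0 : 4 * ε * n / (c₂ / 2) = n * (8 * ε / c₂) := by field_simp; ring
    rw [e0] at hz
    push_cast at hz
    obtain ⟨h3, h4⟩ := abs_le.1 hz
    have e1 : (z : ℝ) / n - brk τ w = (z - n * brk τ w) / n := by field_simp
    have e2 : 8 * ε / c₂ + 1 / (n : ℝ) = (n * (8 * ε / c₂) + 1) / n := by field_simp
    rw [e1, e2, abs_div, abs_of_pos hn0]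
    gcongr
    rw [abs_le]
    constructor <;> linarith
  exact ⟨fun l hl => (hloc.1 l hl).imp fun w hw => hfin _ _ hw,
    fun w => (hloc.2 w).imp fun l hl => ⟨hl.1, hfin _ _ hl.2⟩⟩

end CausalProcess

/-! ### Deterministic bounds for the reflected kernel estimator -/

/-- The count is at most `2 n b + 1`, and the `1` is absorbed by `1 ≤ n b`. -/
theorem window_length {n a a' : ℕ} {b t : ℝ} (hnb : 1 ≤ n * b) (ha : a ≤ a')
    (h : ∀ i ∈ Finset.Ico a a', |(i : ℝ) / n - t| ≤ b) : ((a' - a : ℕ) : ℝ) ≤ 3 * (n * b) := by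
  rcases Nat.eq_zero_or_pos n with rfl | hn
  · norm_num at hnb
  have hn0 : (0 : ℝ) < n := by exact_mod_cast hn
  rcases ha.eq_or_lt with rfl | hlt
  · simp; linarith
  have h1 := abs_le.1 (h a (Finset.mem_Ico.2 ⟨le_rfl, hlt⟩))
  have h2 := abs_le.1 (h (a' - 1) (Finset.mem_Ico.2 ⟨by omega, by omega⟩))
  rw [Nat.cast_sub (by omega), Nat.cast_one] at h2
  have h3 : ((a' : ℝ) - 1) / n - a / n ≤ 2 * b := by linarith [h1.1, h2.2]
  rw [← sub_div, div_le_iff₀ hn0] at h3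
  rw [Nat.cast_sub ha]
  linarith

theorem card_near_le {n : ℕ} {R : ℤ} {v : ℝ} (hv : 0 ≤ v) :
    (((Finset.Icc 1 n).filter fun i : ℕ => |(i : ℝ) - R| ≤ v).card : ℝ) ≤ 2 * v + 1 := by
  have h1 : ((Finset.Icc 1 n).filter fun i : ℕ => |(i : ℝ) - R| ≤ v).card
      ≤ (Finset.Icc (R - ⌊v⌋) (R + ⌊v⌋)).card := by
    refine Finset.card_le_card_of_injOn (fun i : ℕ => (i : ℤ)) (fun i hi => ?_)
      (fun i _ j _ h => by simpa using h)
    have h2 := (Finset.mem_filter.1 hi).2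
    have h3 : |(i : ℤ) - R| ≤ ⌊v⌋ := by
      rw [Int.le_floor]; push_cast; exact h2
    rw [abs_le] at h3
    simp only [Finset.coe_Icc, Set.mem_Icc]
    omega
  have h4 : 0 ≤ ⌊v⌋ := Int.floor_nonneg.2 hv
  rw [Int.card_Icc] at h1
  have h5 : (((Finset.Icc 1 n).filter fun i : ℕ => |(i : ℝ) - R| ≤ v).card : ℤ) ≤ 2 * ⌊v⌋ + 1 := by
    omega
  have h6 : (((Finset.Icc 1 n).filter fun i : ℕ => |(i : ℝ) - R| ≤ v).card : ℝ) ≤ 2 * ⌊v⌋ + 1 := by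
    exact_mod_cast h5
  linarith [Int.floor_le v]

/-- The index `i`, reflected at `R` unless `i - R` has the sign of `T`. -/
def reflectAt (R : ℤ) (T : ℝ) (i : ℤ) : ℤ := if 0 ≤ ((i : ℝ) - R) * T then i else 2 * R - i

theorem reflectAt_of_pos {R i : ℤ} {T : ℝ} (hT : 0 < T) :
    reflectAt R T i = if R ≤ i then i else 2 * R - i := by
  unfold reflectAt
  refine if_congr ?_ rfl rfl
  rw [mul_nonneg_iff_of_pos_right hT, sub_nonneg, Int.cast_le]

theorem reflectAt_of_neg {R i : ℤ} {T : ℝ} (hT : T < 0) :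
    reflectAt R T i = if i ≤ R then i else 2 * R - i := by
  unfold reflectAt
  refine if_congr ?_ rfl rfl
  rw [← neg_mul_neg, mul_nonneg_iff_of_pos_right (neg_pos.2 hT), neg_nonneg, sub_nonpos, Int.cast_le]

theorem abs_sum_reflected_le {n a a' : ℕ} {G : ℕ → ℝ} {R : ℤ} {y ℓ : ℝ} (hy : 0 ≤ y)
    (ha : a ≤ a')
    (hG : ∀ u u' : ℕ, 1 ≤ u → u ≤ u' → u' ≤ n + 1 → ((u' - u : ℕ) : ℝ) ≤ ℓ →
      |∑ i ∈ Finset.Ico u u', G i| ≤ y)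
    (hmem : ∀ i ∈ Finset.Ico a a', 1 ≤ 2 * R - (i : ℤ) ∧ 2 * R - (i : ℤ) ≤ n)
    (hℓ : ((a' - a : ℕ) : ℝ) ≤ ℓ) :
    |∑ i ∈ Finset.Ico a a', G (2 * R - (i : ℤ)).toNat| ≤ y := by
  rcases ha.eq_or_lt with rfl | hlt
  · simpa using hy
  have h1 := hmem a (Finset.mem_Ico.2 ⟨le_rfl, hlt⟩)
  have h2 := hmem (a' - 1) (Finset.mem_Ico.2 ⟨by omega, by omega⟩)
  have h3 := hG (2 * R - a' + 1).toNat (2 * R - a + 1).toNat (by omega) (by omega) (by omega)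
    (by rwa [show (2 * R - a + 1).toNat - (2 * R - a' + 1).toNat = a' - a by omega])
  convert h3 using 2
  refine Finset.sum_nbij' (fun i => (2 * R - (i : ℤ)).toNat) (fun i => (2 * R - (i : ℤ)).toNat)
    ?_ ?_ ?_ ?_ ?_
  · intro i hi
    have := hmem i hi
    rw [Finset.mem_Ico] at hi ⊢; omega
  · intro i hi; rw [Finset.mem_Ico] at hi ⊢; omega
  · intro i hi
    have := hmem i hi
    rw [Finset.mem_Ico] at hi; omega
  · intro i hi; rw [Finset.mem_Ico] at hi; omega
  · intro i hi; rfl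

/-- The point `R` cuts the interval in two. One part is kept, the other is reflected onto another
interval of the sample, so two interval sums suffice. -/
theorem abs_sum_reflectAt_le {n a a' : ℕ} {G : ℕ → ℝ} {R : ℤ} {T y ℓ : ℝ} (hT : T ≠ 0) (hy : 0 ≤ y)
    (ha1 : 1 ≤ a) (ha : a ≤ a') (ha' : a' ≤ n + 1)
    (hG : ∀ u u' : ℕ, 1 ≤ u → u ≤ u' → u' ≤ n + 1 → ((u' - u : ℕ) : ℝ) ≤ ℓ →
      |∑ i ∈ Finset.Ico u u', G i| ≤ y)
    (hmem : ∀ i ∈ Finset.Ico a a', 1 ≤ reflectAt R T i ∧ reflectAt R T i ≤ n)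
    (hℓ : ((a' - a : ℕ) : ℝ) ≤ ℓ) :
    |∑ i ∈ Finset.Ico a a', G (reflectAt R T i).toNat| ≤ 2 * y := by
  have hkeep : ∀ u u' : ℕ, a ≤ u → u ≤ u' → u' ≤ a' →
      (∀ i ∈ Finset.Ico u u', reflectAt R T i = i) →
      |∑ i ∈ Finset.Ico u u', G (reflectAt R T i).toNat| ≤ y := by
    intro u u' h1 h2 h3 h4
    rw [Finset.sum_congr rfl fun i hi => show _ = G i by rw [h4 i hi, Int.toNat_natCast]]
    exact hG u u' (by omega) h2 (by omega) (le_trans (by exact_mod_cast (by omega)) hℓ)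
  have hrefl : ∀ u u' : ℕ, a ≤ u → u ≤ u' → u' ≤ a' →
      (∀ i ∈ Finset.Ico u u', reflectAt R T i = 2 * R - i) →
      |∑ i ∈ Finset.Ico u u', G (reflectAt R T i).toNat| ≤ y := by
    intro u u' h1 h2 h3 h4
    rw [Finset.sum_congr rfl fun (i : ℕ) hi => show _ = G (2 * R - (i : ℤ)).toNat by rw [h4 i hi]]
    refine abs_sum_reflected_le hy h2 hG (fun i hi => ?_)
      (le_trans (by exact_mod_cast (by omega)) hℓ)
    rw [← h4 i hi]
    exact hmem i (Finset.Ico_subset_Ico h1 h3 hi)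
  rcases lt_or_gt_of_ne hT with hneg | hpos
  · set e := max a (min a' (R + 1).toNat) with he
    rw [← Finset.sum_Ico_consecutive _ (show a ≤ e by omega) (show e ≤ a' by omega)]
    refine (abs_add_le _ _).trans ?_
    have h1 := hkeep a e le_rfl (by omega) (by omega) fun i hi => by
      rw [Finset.mem_Ico] at hi
      rw [reflectAt_of_neg hneg, if_pos (by omega)]
    have h2 := hrefl e a' (by omega) (by omega) le_rfl fun i hi => by
      rw [Finset.mem_Ico] at hi
      rw [reflectAt_of_neg hneg, if_neg (by omega)]
    linarith
  · set e := max a (min a' R.toNat) with he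
    rw [← Finset.sum_Ico_consecutive _ (show a ≤ e by omega) (show e ≤ a' by omega)]
    refine (abs_add_le _ _).trans ?_
    have h1 := hrefl a e le_rfl (by omega) (by omega) fun i hi => by
      rw [Finset.mem_Ico] at hi
      rw [reflectAt_of_pos hpos, if_neg (by omega)]
    have h2 := hkeep e a' (by omega) (by omega) le_rfl fun i hi => by
      rw [Finset.mem_Ico] at hi
      rw [reflectAt_of_pos hpos, if_pos (by omega)]
    linarith

theorem reflIndex_eq_self {n k : ℕ} {r : ℕ → ℤ} {d t : ℝ} (h : ∀ j < k, t ∉ nbhd n r d j) (i : ℤ) :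
    reflIndex n k r d t i = i := by
  unfold reflIndex
  rw [dif_neg (fun ⟨j, hj⟩ => h j hj.1 hj.2)]

theorem exists_reflIndex_eq {n k : ℕ} {r : ℕ → ℤ} {d t : ℝ} (h : ∃ j, j < k ∧ t ∈ nbhd n r d j) :
    ∃ j < k, t ∈ nbhd n r d j ∧
      ∀ i, reflIndex n k r d t i = reflectAt (r j) (t * n - r j) i := by
  classical
  refine ⟨Nat.find h, (Nat.find_spec h).1, ?_, fun i => ?_⟩
  · exact (Nat.find_spec h).2
  · unfold reflIndex reflectAt
    rw [dif_pos h]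

namespace CausalProcess

variable {Ω : Type*} [MeasurableSpace Ω] {μ : Measure Ω} {p : ℕ} {P : CausalProcess μ p}
  {ι : ℕ} {τ : Fin (ι + 2) → ℝ} {L M c₁ c₂ : ℝ} {K : ℝ → ℝ}

theorem PiecewiseSmooth.nonneg (h : P.PiecewiseSmooth τ L M) (j : Fin p) : 0 ≤ M := by
  have h0 : τ (Fin.castSucc 0) ∈ piece τ 0 := by
    unfold piece
    have := h.strictMono (Fin.castSucc_lt_succ (i := (0 : Fin (ι + 1))))
    split_ifs
    · exact ⟨le_rfl, this.le⟩
    · exact ⟨le_rfl, this⟩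
  exact (abs_nonneg _).trans (h.deriv2_le 0 j j _ h0)

theorem PiecewiseSmooth.abs_cov_sub_le' (h : P.PiecewiseSmooth τ L M) {s t : ℝ}
    (hs : s ∈ Icc (0 : ℝ) 1) (ht : t ∈ Icc (0 : ℝ) 1)
    (hb : ∀ w : Fin ι, ¬(min s t < brk τ w ∧ brk τ w ≤ max s t)) (j k : Fin p) :
    |P.cov s j k - P.cov t j k| ≤ L * |s - t| := by
  rcases le_total s t with hst | hst
  · rw [min_eq_left hst, max_eq_right hst] at hb
    rw [abs_sub_comm, abs_sub_comm s, abs_of_nonneg (sub_nonneg.2 hst)]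
    exact h.abs_cov_sub_le hs.1 hst ht.2 hb j k
  · rw [min_eq_right hst, max_eq_left hst] at hb
    rw [abs_of_nonneg (sub_nonneg.2 hst)]
    exact h.abs_cov_sub_le ht.1 hst hs.2 hb j k

/-- The weights sum to one, so `Σ(t)` can be put inside the sum, and the products split into noise
and covariance. The split needs the reflected indices to stay in the sample, since observations
outside it are zero. -/
theorem covHat_sub_apply (hK : IsKernel K) {n k : ℕ} {r : ℕ → ℤ} {b h t : ℝ} {ω : Ω} (hb : 0 < b)
    (hS : ∑ i ∈ Finset.Icc 1 n, K (|(i : ℝ) / n - t| / b) ≠ 0)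
    (hρ : ∀ i : ℕ, 1 ≤ i → i ≤ n → |(i : ℝ) / n - t| ≤ b →
      1 ≤ reflIndex n k r (b + h ^ 2) t i ∧ reflIndex n k r (b + h ^ 2) t i ≤ n) (j l : Fin p) :
    covHat K (P.obs n ω) n k r b h t j l - P.cov t j l =
      (∑ i ∈ Finset.Icc 1 n, K (|(i : ℝ) / n - t| / b))⁻¹ *
      (∑ i ∈ Finset.Icc 1 n, K (|(i : ℝ) / n - t| / b) *
          P.noise n ω j l (reflIndex n k r (b + h ^ 2) t i).toNat
        + ∑ i ∈ Finset.Icc 1 n, K (|(i : ℝ) / n - t| / b) *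
          (P.cov ((reflIndex n k r (b + h ^ 2) t i : ℝ) / n) j l - P.cov t j l)) := by
  set S := ∑ i ∈ Finset.Icc 1 n, K (|(i : ℝ) / n - t| / b) with hSd
  have hw : ∀ i, weight K n b t i = S⁻¹ * K (|(i : ℝ) / n - t| / b) := by
    intro i
    unfold weight kernelAt
    rw [← Finset.sum_div, ← hSd]
    field_simp
  have h1 : covHat K (P.obs n ω) n k r b h t j l = S⁻¹ * ∑ i ∈ Finset.Icc 1 n,
      K (|(i : ℝ) / n - t| / b) * (P.obs n ω (reflIndex n k r (b + h ^ 2) t i) j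
        * P.obs n ω (reflIndex n k r (b + h ^ 2) t i) l) := by
    unfold covHat
    rw [Matrix.sum_apply, Finset.mul_sum]
    refine Finset.sum_congr rfl fun i _ => ?_
    rw [Matrix.smul_apply, Matrix.vecMulVec_apply, smul_eq_mul, hw]
    ring
  have h2 : P.cov t j l = S⁻¹ * ∑ i ∈ Finset.Icc 1 n, K (|(i : ℝ) / n - t| / b) * P.cov t j l := by
    rw [← Finset.sum_mul, ← hSd, ← mul_assoc, inv_mul_cancel₀ hS, one_mul]
  rw [h1, ← Finset.sum_add_distrib]
  nth_rewrite 1 [h2]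
  rw [← mul_sub, ← Finset.sum_sub_distrib]
  congr 1
  refine Finset.sum_congr rfl fun i hi => ?_
  rw [Finset.mem_Icc] at hi
  by_cases hwin : |(i : ℝ) / n - t| ≤ b
  · obtain ⟨h3, h4⟩ := hρ i hi.1 hi.2 hwin
    rw [obs_mul_obs_int ω h3 h4]
    ring
  · rw [hK.support _ (by
      rw [abs_of_nonneg (div_nonneg (abs_nonneg _) hb.le), one_lt_div hb]; exact not_le.1 hwin)]
    ring

/-- Away from the break points, the estimator has error `O(y/(nb) + 1/n + b²)`, where `y` is the
size of the partial sums of the noise. -/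
theorem abs_covHat_sub_le_of_far (hK : IsKernel K) (hs : P.PiecewiseSmooth τ L M) (hL : 0 < L)
    {n k : ℕ} {r : ℕ → ℤ} {b h t c C D y : ℝ} {ω : Ω} (hb : 0 < b) (hnb : 1 ≤ n * b)
    (hc : 0 < c) (hC : 0 < C) (hy0 : 0 ≤ y)
    (hS : c * (n * b) ≤ ∑ i ∈ Finset.Icc 1 n, K (|(i : ℝ) / n - t| / b))
    (hA : ∀ (y : ℝ) (g : ℕ → ℝ), 0 ≤ y →
      (∀ a a' : ℕ, 1 ≤ a → a ≤ a' → a' ≤ n + 1 → (∀ i ∈ Finset.Ico a a', |(i : ℝ) / n - t| ≤ b) →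
        |∑ i ∈ Finset.Ico a a', g i| ≤ y) →
      |∑ i ∈ Finset.Icc 1 n, K (|(i : ℝ) / n - t| / b) * g i| ≤ C * y)
    (hMom : |∑ i ∈ Finset.Icc 1 n, K (|(i : ℝ) / n - t| / b) * ((i : ℝ) / n - t)| ≤ D * b)
    (hy : ∀ j l, ∀ a a' : ℕ, 1 ≤ a → a ≤ a' → a' ≤ n + 1 → ((a' - a : ℕ) : ℝ) ≤ 3 * (n * b) →
      |∑ i ∈ Finset.Ico a a', P.noise n ω j l i| ≤ y)
    (ht : t ∈ Icc b (1 - b)) (hout : ∀ j < k, t ∉ nbhd n r (b + h ^ 2) j)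
    (hbrk : ∀ w, b < |brk τ w - t|) (j l : Fin p) :
    |covHat K (P.obs n ω) n k r b h t j l - P.cov t j l| ≤
      (C * y + (L + M * b) * (D * b)) / (c * (n * b)) + M * b ^ 2 := by
  have hM := hs.nonneg j
  set S := ∑ i ∈ Finset.Icc 1 n, K (|(i : ℝ) / n - t| / b) with hSd
  have hcnb : 0 < c * (n * b) := by positivity
  have hS0 : 0 < S := hcnb.trans_le hS
  have hρ := fun i : ℤ => reflIndex_eq_self hout i
  rw [covHat_sub_apply hK hb hS0.ne' (fun i h1 h2 _ => by
    rw [hρ]; exact ⟨by exact_mod_cast h1, by exact_mod_cast h2⟩)]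
  simp only [hρ, Int.toNat_natCast, Int.cast_natCast]
  rw [← hSd, abs_mul, abs_of_pos (inv_pos.2 hS0)]
  have h1 := hA y (P.noise n ω j l) hy0 fun a a' h1 h2 h3 h4 =>
    hy j l a a' h1 h2 h3 (window_length hnb h2 h4)
  have hnb' : ∀ w : Fin ι, ¬(t - b < brk τ w ∧ brk τ w ≤ t + b) := fun w hw => by
    have := hbrk w
    rw [lt_abs] at this
    rcases this with h | h <;> linarith [hw.1, hw.2]
  obtain ⟨l', hl1, hl2⟩ := exists_mem_piece hs.first hs.last (s := t - b) (t := t + b)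
    (by linarith [ht.1]) (by linarith) (by linarith [ht.2]) hnb'
  have hpiece : ∀ u, |u - t| ≤ b → u ∈ piece τ l' := fun u hu => by
    have := abs_le.1 hu
    exact (piece_convex l').ordConnected.out hl1 hl2 ⟨by linarith [this.1], by linarith [this.2]⟩
  have htp : t ∈ piece τ l' := hpiece t (by simpa using hb.le)
  obtain ⟨a, ha⟩ := hs.exists_taylor htp j l
  -- The slope at `t` is read off from the increment over one bandwidth, which is at most `L b`.
  have haL : |a| ≤ L + M * b := by
    have e1 := ha (t + b) hl2
    have e2 := (abs_le_maxNorm (P.cov (t + b) - P.cov t) j l).trans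
      (hs.cov_lipschitz l' (t + b) hl2 t htp)
    rw [Matrix.sub_apply] at e2
    rw [add_sub_cancel_left] at e1 e2
    rw [abs_of_pos hb] at e2
    have e3 : |a * b| ≤ (L + M * b) * b := by
      have e1' := abs_le.1 e1
      have e2' := abs_le.1 e2
      rw [abs_le]
      constructor <;> nlinarith [e1'.1, e1'.2, e2'.1, e2'.2]
    rw [abs_mul, abs_of_pos hb] at e3
    exact le_of_mul_le_mul_right e3 hb
  -- The linear part only sees the first moment of the kernel weights, which nearly vanishes in the
  -- interior. The quadratic remainder costs `M b²` per unit of weight.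
  have h2 : |∑ i ∈ Finset.Icc 1 n, K (|(i : ℝ) / n - t| / b) *
      (P.cov ((i : ℝ) / n) j l - P.cov t j l)| ≤ (L + M * b) * (D * b) + M * b ^ 2 * S := by
    have e1 : ∑ i ∈ Finset.Icc 1 n, K (|(i : ℝ) / n - t| / b) *
        (P.cov ((i : ℝ) / n) j l - P.cov t j l)
        = a * ∑ i ∈ Finset.Icc 1 n, K (|(i : ℝ) / n - t| / b) * ((i : ℝ) / n - t)
          + ∑ i ∈ Finset.Icc 1 n, K (|(i : ℝ) / n - t| / b) *
            (P.cov ((i : ℝ) / n) j l - P.cov t j l - a * ((i : ℝ) / n - t)) := by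
      rw [Finset.mul_sum, ← Finset.sum_add_distrib]
      exact Finset.sum_congr rfl fun i _ => by ring
    rw [e1]
    refine (abs_add_le _ _).trans (add_le_add ?_ ?_)
    · rw [abs_mul]
      exact mul_le_mul haL hMom (abs_nonneg _) (by positivity)
    · refine (Finset.abs_sum_le_sum_abs _ _).trans ?_
      rw [hSd, Finset.mul_sum]
      refine Finset.sum_le_sum fun i _ => ?_
      rw [abs_mul, abs_of_nonneg (hK.nonneg _), mul_comm]
      by_cases hwin : |(i : ℝ) / n - t| ≤ b
      · refine mul_le_mul_of_nonneg_right ((ha _ (hpiece _ hwin)).trans ?_) (hK.nonneg _)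
        rw [← sq_abs]
        gcongr
      · rw [hK.support _ (by
          rw [abs_of_nonneg (div_nonneg (abs_nonneg _) hb.le), one_lt_div hb]
          exact not_le.1 hwin)]
        simp
  refine (mul_le_mul_of_nonneg_left ((abs_add_le _ _).trans (add_le_add h1 h2))
    (inv_pos.2 hS0).le).trans ?_
  have hD : 0 ≤ D * b := (abs_nonneg _).trans hMom
  calc S⁻¹ * (C * y + ((L + M * b) * (D * b) + M * b ^ 2 * S))
      = (C * y + (L + M * b) * (D * b)) / S + M * b ^ 2 := by field_simp; ring
    _ ≤ _ := by
      gcongr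

/-- Outside the immediate neighbourhoods of the change points, the reflected estimator has error
`O(y/(nb) + b + δ/b)`, where `y` is the size of the partial sums of the noise and `δ` the precision
of the change point estimates. -/
theorem abs_covHat_sub_le_of_reflected (hK : IsKernel K) (hs : P.PiecewiseSmooth τ L M)
    (hj : P.Jumps τ c₁ c₂) (hL : 0 < L)
    {n k : ℕ} {r : ℕ → ℤ} {b h t c C B V δ y : ℝ} {ω : Ω} (hb : 0 < b) (hnb : 1 ≤ n * b)
    (hc : 0 < c) (hC : 0 < C) (hy0 : 0 ≤ y) (hKB : ∀ u, K u ≤ B) (hB : 0 < B) (hh : 0 < h)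
    (hV : ∀ t ∈ Icc (0 : ℝ) 1, ∀ j l, |P.cov t j l| ≤ V)
    (hS : c * (n * b) ≤ ∑ i ∈ Finset.Icc 1 n, K (|(i : ℝ) / n - t| / b))
    (hA : ∀ (y : ℝ) (g : ℕ → ℝ), 0 ≤ y →
      (∀ a a' : ℕ, 1 ≤ a → a ≤ a' → a' ≤ n + 1 → (∀ i ∈ Finset.Ico a a', |(i : ℝ) / n - t| ≤ b) →
        |∑ i ∈ Finset.Ico a a', g i| ≤ y) →
      |∑ i ∈ Finset.Icc 1 n, K (|(i : ℝ) / n - t| / b) * g i| ≤ C * y)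
    (hy : ∀ j l, ∀ a a' : ℕ, 1 ≤ a → a ≤ a' → a' ≤ n + 1 → ((a' - a : ℕ) : ℝ) ≤ 3 * (n * b) →
      |∑ i ∈ Finset.Ico a a', P.noise n ω j l i| ≤ y)
    (ht : t ∈ Icc (0 : ℝ) 1) (hout : ∀ j < k, t ∉ nbhd n r (h ^ 2) j)
    (hδ0 : 0 ≤ δ) (hδ : δ < h ^ 2) (hbc : 4 * (b + h ^ 2) ≤ c₁)
    (hloc₁ : ∀ l < k, ∃ w, |(r l : ℝ) / n - brk τ w| ≤ δ)
    (hloc₂ : ∀ w, ∃ l < k, |(r l : ℝ) / n - brk τ w| ≤ δ) (j l : Fin p) :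
    |covHat K (P.obs n ω) n k r b h t j l - P.cov t j l| ≤
      (C * (2 * y) + B * (2 * V) * (2 * (δ * n) + 1)) / (c * (n * b)) + L * b := by
  have hn0 : (0 : ℝ) < n := pos_of_mul_pos_left (by linarith : 0 < (n : ℝ) * b) hb.le
  have hn1 : 1 ≤ n := by exact_mod_cast hn0
  have hV0 : 0 ≤ V := (abs_nonneg _).trans (hV t ht j j)
  set S := ∑ i ∈ Finset.Icc 1 n, K (|(i : ℝ) / n - t| / b) with hSd
  have hcnb : 0 < c * (n * b) := by positivity
  have hS0 : 0 < S := hcnb.trans_le hS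
  have hfinish : ∀ x z : ℝ, |x| ≤ C * (2 * y) → |z| ≤ B * (2 * V) * (2 * (δ * n) + 1) + L * b * S →
      |S⁻¹ * (x + z)| ≤ (C * (2 * y) + B * (2 * V) * (2 * (δ * n) + 1)) / (c * (n * b)) + L * b := by
    intro x z hx hz
    rw [abs_mul, abs_of_pos (inv_pos.2 hS0)]
    refine (mul_le_mul_of_nonneg_left ((abs_add_le _ _).trans (add_le_add hx hz))
      (inv_pos.2 hS0).le).trans ?_
    calc S⁻¹ * (C * (2 * y) + (B * (2 * V) * (2 * (δ * n) + 1) + L * b * S))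
        = (C * (2 * y) + B * (2 * V) * (2 * (δ * n) + 1)) / S + L * b := by field_simp; ring
      _ ≤ _ := by gcongr
  have hunit : ∀ z : ℤ, 1 ≤ z → z ≤ n → (z : ℝ) / n ∈ Icc (0 : ℝ) 1 := fun z h1 h2 => by
    have h1' : (1 : ℝ) ≤ z := by exact_mod_cast h1
    have h2' : (z : ℝ) ≤ n := by exact_mod_cast h2
    exact ⟨by positivity, (div_le_one hn0).2 h2'⟩
  have houtwin : ∀ i : ℕ, ¬|(i : ℝ) / n - t| ≤ b → K (|(i : ℝ) / n - t| / b) = 0 := fun i hwin =>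
    hK.support _ (by
      rw [abs_of_nonneg (div_nonneg (abs_nonneg _) hb.le), one_lt_div hb]
      exact not_le.1 hwin)
  by_cases hex : ∃ j, j < k ∧ t ∈ nbhd n r (b + h ^ 2) j
  · obtain ⟨J, hJk, hJt, hρ⟩ := exists_reflIndex_eq hex
    set R := r J with hR
    obtain ⟨w, hw⟩ := hloc₁ J hJk
    rw [← hR] at hw
    have hw' := abs_le.1 hw
    have hRn : (R : ℝ) / n * n = R := by field_simp
    have hc1 := hj.le_brk hs w
    have hc2 := hj.brk_le hs w
    obtain ⟨hJ1, hJ2⟩ := hJt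
    rw [← hR] at hJ1 hJ2
    -- Since `δ < h²`, the true break lies on the same side of `t` as the estimate.
    have hside : (R : ℝ) / n + h ^ 2 ≤ t ∨ t < (R : ℝ) / n - h ^ 2 := by
      by_contra hcon
      push Not at hcon
      exact hout J hJk ⟨hcon.2, hcon.1⟩
    have hT : t * n - R ≠ 0 := by
      have h2 : 0 < h ^ 2 := by positivity
      rcases hside with h1 | h1
      · have : (R : ℝ) / n < t := by linarith
        rw [div_lt_iff₀ hn0] at this
        linarith
      · have : t < (R : ℝ) / n := by linarith
        rw [lt_div_iff₀ hn0] at this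
        linarith
    -- the reflected index is on the side of `t`, and not farther from `t`
    have hgeom : ∀ i : ℕ, |(i : ℝ) / n - t| ≤ b →
        |(reflectAt R (t * n - R) i : ℝ) / n - t| ≤ b ∧
        |(reflectAt R (t * n - R) i : ℝ) - R| = |(i : ℝ) - R| ∧
        (((R : ℝ) / n + h ^ 2 ≤ t ∧ (R : ℝ) / n ≤ (reflectAt R (t * n - R) i : ℝ) / n) ∨
          (t < (R : ℝ) / n - h ^ 2 ∧ (reflectAt R (t * n - R) i : ℝ) / n ≤ (R : ℝ) / n)) := by
      intro i hi
      have hi' := abs_le.1 hi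
      have h2 : 0 < h ^ 2 := by positivity
      rcases hside with h1 | h1
      · have hlt : (R : ℝ) / n < t := by linarith
        have hTpos : 0 < t * n - R := by rw [div_lt_iff₀ hn0] at hlt; linarith
        rw [reflectAt_of_pos hTpos]
        split_ifs with hc
        · have hc' : (R : ℝ) ≤ ((i : ℤ) : ℝ) := by exact_mod_cast hc
          refine ⟨by simpa using hi, by simp, Or.inl ⟨h1, by gcongr⟩⟩
        · have hc' : ((i : ℤ) : ℝ) ≤ R := by exact_mod_cast (not_le.1 hc).le
          have hc'' : ((i : ℝ)) / n ≤ (R : ℝ) / n := by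
            rw [Int.cast_natCast] at hc'; gcongr
          push_cast
          rw [sub_div, mul_div_assoc]
          refine ⟨?_, ?_, Or.inl ⟨h1, ?_⟩⟩
          · rw [abs_le]; constructor <;> linarith [hi'.1, hi'.2]
          · rw [show 2 * (R : ℝ) - i - R = -(i - R) by ring, abs_neg]
          · linarith
      · have hlt : t < (R : ℝ) / n := by linarith
        have hTneg : t * n - R < 0 := by rw [lt_div_iff₀ hn0] at hlt; linarith
        rw [reflectAt_of_neg hTneg]
        split_ifs with hc
        · have hc' : ((i : ℤ) : ℝ) ≤ R := by exact_mod_cast hc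
          refine ⟨by simpa using hi, by simp, Or.inr ⟨h1, by gcongr⟩⟩
        · have hc' : (R : ℝ) ≤ ((i : ℤ) : ℝ) := by exact_mod_cast (not_le.1 hc).le
          have hc'' : (R : ℝ) / n ≤ ((i : ℝ)) / n := by
            rw [Int.cast_natCast] at hc'; gcongr
          push_cast
          rw [sub_div, mul_div_assoc]
          refine ⟨?_, ?_, Or.inr ⟨h1, ?_⟩⟩
          · rw [abs_le]; constructor <;> linarith [hi'.1, hi'.2]
          · rw [show 2 * (R : ℝ) - i - R = -(i - R) by ring, abs_neg]
          · linarith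
    have hmem : ∀ i : ℕ, |(i : ℝ) / n - t| ≤ b →
        1 ≤ reflectAt R (t * n - R) i ∧ reflectAt R (t * n - R) i ≤ n := by
      intro i hi
      have h1 := abs_le.1 (hgeom i hi).1
      have h2 : 0 < (reflectAt R (t * n - R) i : ℝ) / n := by linarith [h1.1]
      have h3 : (reflectAt R (t * n - R) i : ℝ) / n < 1 := by linarith [h1.2]
      rw [div_pos_iff_of_pos_right hn0] at h2
      rw [div_lt_one hn0] at h3
      have h2' : 0 < reflectAt R (t * n - R) i := by exact_mod_cast h2
      have h3' : reflectAt R (t * n - R) i < n := by exact_mod_cast h3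
      omega
    rw [covHat_sub_apply hK hb hS0.ne' (fun i _ _ h3 => by rw [hρ]; exact hmem i h3)]
    rw [← hSd]
    refine hfinish _ _ ?_ ?_
    · refine hA (2 * y) _ (by positivity) fun a a' h1 h2 h3 h4 => ?_
      simp only [hρ]
      exact abs_sum_reflectAt_le hT hy0 h1 h2 h3 (hy j l) (fun i hi => hmem i (h4 i hi))
        (window_length hnb h2 h4)
    · refine (Finset.abs_sum_le_sum_abs _ _).trans ?_
      -- A reflected index within `δ n` of `R` may lie beyond the true break and is charged the full
      -- `B · 2V`. All others are on the side of `t` with no break in between, since the other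
      -- breaks are at distance `c₁`.
      have hterm : ∀ i ∈ Finset.Icc 1 n, |K (|(i : ℝ) / n - t| / b) *
          (P.cov ((reflIndex n k r (b + h ^ 2) t i : ℝ) / n) j l - P.cov t j l)| ≤
          (if |(i : ℝ) - R| ≤ δ * n then B * (2 * V) else 0) + L * b * K (|(i : ℝ) / n - t| / b) := by
        intro i hi
        have hK0 := hK.nonneg (|(i : ℝ) / n - t| / b)
        rw [hρ, abs_mul, abs_of_nonneg hK0]
        by_cases hwin : |(i : ℝ) / n - t| ≤ b
        · obtain ⟨g1, g2, g3⟩ := hgeom i hwin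
          obtain ⟨m1, m2⟩ := hmem i hwin
          set z := reflectAt R (t * n - R) i
          have hz := hunit z m1 m2
          split_ifs with hnear
          · have e1 : |P.cov ((z : ℝ) / n) j l - P.cov t j l| ≤ 2 * V := by
              have := abs_sub (P.cov ((z : ℝ) / n) j l) (P.cov t j l)
              linarith [hV _ hz j l, hV t ht j l]
            have e2 : 0 ≤ L * b * K (|(i : ℝ) / n - t| / b) := by positivity
            have e3 := mul_le_mul (hKB (|(i : ℝ) / n - t| / b)) e1 (abs_nonneg _) hB.le
            linarith
          · rw [zero_add, mul_comm]
            refine mul_le_mul_of_nonneg_right ?_ hK0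
            refine (hs.abs_cov_sub_le' hz ht (fun w' hw'' => ?_) j l).trans
              (mul_le_mul_of_nonneg_left g1 hL.le)
            rw [← g2, not_le] at hnear
            have g1' := abs_le.1 g1
            have hfar : δ < |(z : ℝ) / n - (R : ℝ) / n| := by
              rw [← sub_div, abs_div, abs_of_pos hn0, lt_div_iff₀ hn0]; exact hnear
            by_cases hww : w' = w
            · subst hww
              rcases g3 with ⟨g3, g4⟩ | ⟨g3, g4⟩
              · rw [abs_of_nonneg (sub_nonneg.2 g4)] at hfar
                have : brk τ w' < min ((z : ℝ) / n) t := lt_min (by linarith [hw'.1]) (by linarith [hw'.1])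
                linarith [hw''.1]
              · rw [abs_sub_comm, abs_of_nonneg (sub_nonneg.2 g4)] at hfar
                have : max ((z : ℝ) / n) t < brk τ w' := max_lt (by linarith [hw'.2]) (by linarith [hw'.2])
                linarith [hw''.2]
            · have hsep : c₁ ≤ |brk τ w' - brk τ w| := by
                rcases lt_or_gt_of_ne hww with hlt | hlt
                · have := hj.separated_brk hs.strictMono hlt
                  rw [abs_sub_comm]
                  exact le_trans (by linarith) (le_abs_self _)
                · have := hj.separated_brk hs.strictMono hlt
                  exact le_trans (by linarith) (le_abs_self _)
              have e1 : t - b ≤ min ((z : ℝ) / n) t := le_min (by linarith [g1'.1]) (by linarith)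
              have e2 : max ((z : ℝ) / n) t ≤ t + b := max_le (by linarith [g1'.2]) (by linarith)
              rw [le_abs] at hsep
              rcases hsep with h5 | h5 <;> linarith [hw''.1, hw''.2, hw'.1, hw'.2]
        · rw [houtwin i hwin, zero_mul, mul_zero, add_zero]
          split_ifs <;> positivity
      refine (Finset.sum_le_sum hterm).trans ?_
      rw [Finset.sum_add_distrib, ← Finset.mul_sum, ← hSd, ← Finset.sum_filter, Finset.sum_const,
        nsmul_eq_mul, mul_comm (Nat.cast _)]
      have := card_near_le (n := n) (R := R) (v := δ * n) (by positivity)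
      gcongr
  · push Not at hex
    have hρ := fun i : ℤ => reflIndex_eq_self (i := i) hex
    rw [covHat_sub_apply hK hb hS0.ne' (fun i h1 h2 _ => by
      rw [hρ]; exact ⟨by exact_mod_cast h1, by exact_mod_cast h2⟩)]
    simp only [hρ, Int.toNat_natCast, Int.cast_natCast]
    rw [← hSd]
    -- Every break has an estimate within `δ < h²`, so a break within `b` of `t` would have put `t`
    -- in a reflection zone.
    have hbrk : ∀ w : Fin ι, b < |brk τ w - t| := by
      intro w
      by_contra hcon
      obtain ⟨l, hl, hlw⟩ := hloc₂ w
      have h1 := abs_le.1 (not_lt.1 hcon)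
      have h2 := abs_le.1 hlw
      exact hex l hl ⟨by linarith [h1.1, h2.2], by linarith [h1.2, h2.1]⟩
    refine hfinish _ _ ?_ ?_
    · refine hA (2 * y) _ (by positivity) fun a a' h1 h2 h3 h4 => ?_
      have := hy j l a a' h1 h2 h3 (window_length hnb h2 h4)
      linarith
    · refine (Finset.abs_sum_le_sum_abs _ _).trans ?_
      have h0 : 0 ≤ B * (2 * V) * (2 * (δ * n) + 1) := by positivity
      refine le_trans ?_ (le_add_of_nonneg_left h0)
      rw [hSd, Finset.mul_sum]
      refine Finset.sum_le_sum fun i hi => ?_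
      rw [Finset.mem_Icc] at hi
      have hK0 := hK.nonneg (|(i : ℝ) / n - t| / b)
      rw [abs_mul, abs_of_nonneg hK0, mul_comm]
      by_cases hwin : |(i : ℝ) / n - t| ≤ b
      · refine mul_le_mul_of_nonneg_right ?_ hK0
        have hz : (i : ℝ) / n ∈ Icc (0 : ℝ) 1 := by
          simpa using hunit i (by exact_mod_cast hi.1) (by exact_mod_cast hi.2)
        have g1' := abs_le.1 hwin
        refine (hs.abs_cov_sub_le' hz ht (fun w hw => ?_) j l).trans
          (mul_le_mul_of_nonneg_left hwin hL.le)
        have e1 : t - b ≤ min ((i : ℝ) / n) t := le_min (by linarith [g1'.1]) (by linarith)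
        have e2 : max ((i : ℝ) / n) t ≤ t + b := max_le (by linarith [g1'.2]) (by linarith)
        have := hbrk w
        rw [lt_abs] at this
        rcases this with h5 | h5 <;> linarith [hw.1, hw.2]
      · rw [houtwin i hwin, mul_zero, mul_zero]

end CausalProcess

/-! ### The CLIME estimator -/

section Clime

variable {p : ℕ} {S Γ W : Matrix (Fin p) (Fin p) ℝ} {κ ε lam : ℝ}

theorem sum_abs_le_colL1 (M : Matrix (Fin p) (Fin p) ℝ) (k : Fin p) : ∑ j, |M j k| ≤ colL1 M :=
  le_ciSup (f := fun k => ∑ j, |M j k|) (Set.finite_range _).bddAbove k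

theorem abs_mul_apply_le {M N : Matrix (Fin p) (Fin p) ℝ} {j k : Fin p} {a c : ℝ}
    (hM : ∀ l, |M j l| ≤ a) (hN : ∑ l, |N l k| ≤ c) (ha : 0 ≤ a) : |(M * N) j k| ≤ a * c := by
  rw [Matrix.mul_apply]
  calc |∑ l, M j l * N l k| ≤ ∑ l, |M j l * N l k| := Finset.abs_sum_le_sum_abs _ _
    _ ≤ ∑ l, a * |N l k| := Finset.sum_le_sum fun l _ => by
        rw [abs_mul]; exact mul_le_mul_of_nonneg_right (hM l) (abs_nonneg _)
    _ = a * ∑ l, |N l k| := by rw [Finset.mul_sum]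
    _ ≤ a * c := mul_le_mul_of_nonneg_left hN ha

/-- Error bound for CLIME in terms of the error of the covariance estimate. -/
theorem IsClime.maxNorm_sub_le (hW : IsClime S lam W) (hu : IsUnit Γ.det) (hsymm : Γ.transpose = Γ)
    (hκ : colL1 Γ⁻¹ ≤ κ) (hS : maxNorm (S - Γ) ≤ ε) (hlam : κ * ε ≤ lam) (hκ0 : 0 ≤ κ) :
    maxNorm (W - Γ⁻¹) ≤ 2 * κ * lam := by
  have hε : 0 ≤ ε := (maxNorm_nonneg _).trans hS
  have hlam0 : 0 ≤ lam := (mul_nonneg hκ0 hε).trans hlam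
  have hcol : ∀ k, ∑ j, |Γ⁻¹ j k| ≤ κ := fun k => (sum_abs_le_colL1 _ k).trans hκ
  have hSe : ∀ j l, |(S - Γ) j l| ≤ ε := fun j l => (abs_le_maxNorm _ j l).trans hS
  have hinv : Γ * Γ⁻¹ = 1 := Matrix.mul_nonsing_inv _ hu
  have hinv' : Γ⁻¹ * Γ = 1 := Matrix.nonsing_inv_mul _ hu
  -- `S Γ⁻¹ - 1 = (S - Γ) Γ⁻¹`, so the true precision matrix is feasible.
  have hfeas : ∀ j k, |(S * Γ⁻¹ - 1) j k| ≤ lam := fun j k => by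
    rw [show S * Γ⁻¹ - 1 = (S - Γ) * Γ⁻¹ by rw [Matrix.sub_mul, hinv]]
    refine (abs_mul_apply_le (hSe j) (hcol k) hε).trans ?_
    rwa [mul_comm]
  obtain ⟨hWf, hWmin⟩ := hW ⟨Γ⁻¹, maxNorm_le hlam0 hfeas⟩
  have hWe : ∀ j k, |(S * W - 1) j k| ≤ lam := fun j k => (abs_le_maxNorm _ j k).trans hWf
  -- Constraint and objective both split over columns. Exchanging one column of `W` for that of
  -- `Γ⁻¹` keeps feasibility, so minimality holds column by column.
  have hWcol : ∀ k, ∑ j, |W j k| ≤ κ := by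
    intro k
    have h1 := hWmin (W.updateCol k fun j => Γ⁻¹ j k) (maxNorm_le hlam0 fun j l => by
      by_cases hl : l = k
      · subst hl
        have := hfeas j l
        simpa [Matrix.mul_apply, Matrix.sub_apply] using this
      · have := hWe j l
        simpa [Matrix.mul_apply, Matrix.sub_apply, Matrix.updateCol_ne hl] using this)
    unfold entryL1 at h1
    rw [Finset.sum_comm, Finset.sum_comm (s := Finset.univ) (t := Finset.univ)
      (f := fun j l => |W.updateCol k (fun j => Γ⁻¹ j k) j l|),
      ← Finset.add_sum_erase _ _ (Finset.mem_univ k),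
      ← Finset.add_sum_erase (f := fun l => ∑ j, |W.updateCol k (fun j => Γ⁻¹ j k) j l|) _
        (Finset.mem_univ k),
      Finset.sum_congr (s₁ := Finset.univ.erase k) rfl fun l hl => show
        ∑ j, |W.updateCol k (fun j => Γ⁻¹ j k) j l| = ∑ j, |W j l| by
          simp [Matrix.updateCol_ne (Finset.ne_of_mem_erase hl)]] at h1
    have h2 := le_of_add_le_add_right h1
    simp only [Matrix.updateCol_self] at h2
    exact h2.trans (hcol k)
  have hGW : ∀ j k, |(Γ * W - 1) j k| ≤ 2 * lam := fun j k => by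
    rw [show Γ * W - 1 = (S * W - 1) - (S - Γ) * W by rw [Matrix.sub_mul]; abel, Matrix.sub_apply]
    have h1 := abs_mul_apply_le (hSe j) (hWcol k) hε
    have h2 := abs_sub ((S * W - 1) j k) (((S - Γ) * W) j k)
    linarith [hWe j k, mul_comm ε κ]
  refine maxNorm_le (by positivity) fun j k => ?_
  have hsymm' : ∀ a b, Γ⁻¹ a b = Γ⁻¹ b a := fun a b => by
    have : Γ⁻¹.transpose = Γ⁻¹ := by rw [Matrix.transpose_nonsing_inv, hsymm]
    exact congrFun (congrFun this b) a
  -- The row sums of `Γ⁻¹` are needed here; after transposition its symmetry lets the column sums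
  -- serve.
  rw [show W - Γ⁻¹ = Γ⁻¹ * (Γ * W - 1) by rw [Matrix.mul_sub, ← Matrix.mul_assoc, hinv']; simp,
    ← Matrix.transpose_apply (Γ⁻¹ * (Γ * W - 1)), Matrix.transpose_mul]
  have h1 := abs_mul_apply_le (M := (Γ * W - 1).transpose) (N := Γ⁻¹.transpose) (j := k) (k := j)
    (a := 2 * lam) (c := κ) (fun l => hGW l k) (by
      refine le_trans (le_of_eq (Finset.sum_congr rfl fun l _ => ?_)) (hcol j)
      rw [Matrix.transpose_apply, hsymm']) (by positivity)
  linarith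

/-- Both entries entering the minimum estimate the same number, since `Θ` is symmetric; it does not
matter which one is chosen. -/
theorem estEdges_subset {Θ : Matrix (Fin p) (Fin p) ℝ} {u : ℝ} (hsymm : Θ.transpose = Θ)
    (h : maxNorm (W - Θ) < u) : estEdges W u ⊆ edges Θ := by
  rintro ⟨j, k⟩ hjk h0
  have hjk' : u ≤ |min (W j k) (W k j)| := hjk
  have h0' : Θ j k = 0 := h0
  have h1 : Θ k j = 0 := (congrFun (congrFun hsymm j) k).trans h0'
  have h2 := (abs_le_maxNorm (W - Θ) j k).trans_lt h
  have h3 := (abs_le_maxNorm (W - Θ) k j).trans_lt h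
  rw [Matrix.sub_apply, h0', sub_zero] at h2
  rw [Matrix.sub_apply, h1, sub_zero] at h3
  rcases min_choice (W j k) (W k j) with h4 | h4 <;> rw [h4] at hjk' <;> linarith

theorem sigEdges_subset {Θ : Matrix (Fin p) (Fin p) ℝ} {u : ℝ} (hsymm : Θ.transpose = Θ)
    (h : maxNorm (W - Θ) < u) : sigEdges Θ (2 * u) ⊆ estEdges W u := by
  rintro ⟨j, k⟩ hjk
  have hjk' : 2 * u < |Θ j k| := hjk
  have h1 : Θ k j = Θ j k := congrFun (congrFun hsymm j) k
  have h2 := (abs_le_maxNorm (W - Θ) j k).trans_lt h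
  have h3 := (abs_le_maxNorm (W - Θ) k j).trans_lt h
  rw [Matrix.sub_apply] at h2 h3
  rw [h1] at h3
  show u ≤ |min (W j k) (W k j)|
  have h4 : ∀ x : ℝ, |x - Θ j k| < u → u ≤ |x| := fun x hx => by
    have := abs_sub_abs_le_abs_sub (Θ j k) x
    rw [abs_sub_comm] at this
    linarith
  rcases min_choice (W j k) (W k j) with h5 | h5 <;> rw [h5]
  · exact h4 _ h2
  · exact h4 _ h3

end Clime

/-! ### Bounds on the covariance and lower bounds implied by sparsity -/

namespace CausalProcess

variable {Ω : Type*} [MeasurableSpace Ω] {μ : Measure Ω} [IsProbabilityMeasure μ] {p : ℕ}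
  {P : CausalProcess μ p} {ι : ℕ} {τ : Fin (ι + 2) → ℝ} {L M c₁ c₂ q A ν κ : ℝ}

theorem cov_transpose (t : ℝ) : (P.cov t).transpose = P.cov t := by
  ext j k
  simp only [cov, Matrix.transpose_apply, Matrix.of_apply, mul_comm]

theorem prec_transpose (t : ℝ) : (P.prec t).transpose = P.prec t := by
  unfold prec
  rw [Matrix.transpose_nonsing_inv, cov_transpose]

theorem Dependence.abs_cov_le_mul (h : P.Dependence q A ν) (hq : 2 < q) {t : ℝ}
    (ht : t ∈ Icc (0 : ℝ) 1) (j k : Fin p) :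
    |P.cov t j k| ≤ (eLpNorm (fun ω => P.X 0 t ω j) 2 μ).toReal
      * (eLpNorm (fun ω => P.X 0 t ω k) 2 μ).toReal := by
  have hj := h.integrable hq ht j
  have hk := h.integrable hq ht k
  set f := fun ω => P.X 0 t ω j
  set g := fun ω => P.X 0 t ω k
  have h1 : eLpNorm (f • g) 1 μ ≤ eLpNorm f 2 μ * eLpNorm g 2 μ :=
    eLpNorm_smul_le_mul_eLpNorm hk.1 hj.1
  have h2 : ‖∫ ω, (f • g) ω ∂μ‖ₑ ≤ eLpNorm (f • g) 1 μ := by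
    rw [eLpNorm_one_eq_lintegral_enorm]
    exact enorm_integral_le_lintegral_enorm _
  have h3 := ENNReal.toReal_mono (ENNReal.mul_ne_top hj.2.ne hk.2.ne) (h2.trans h1)
  rw [ENNReal.toReal_mul, toReal_enorm, Real.norm_eq_abs] at h3
  exact h3

theorem Dependence.eLpNorm_two_le (h : P.Dependence q A ν) (hq : 2 < q) {t : ℝ}
    (ht : t ∈ Icc (0 : ℝ) 1) (j : Fin p) :
    (eLpNorm (fun ω => P.X 0 t ω j) 2 μ).toReal ≤ max ν 1 := by
  have := h.eLpNorm_le hq ht j (a := 2) (by linarith)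
  rw [ENNReal.ofReal_ofNat] at this
  exact ENNReal.toReal_le_of_le_ofReal (by positivity) this

theorem Dependence.abs_cov_le (h : P.Dependence q A ν) (hq : 2 < q) {t : ℝ}
    (ht : t ∈ Icc (0 : ℝ) 1) (j k : Fin p) : |P.cov t j k| ≤ max ν 1 ^ 2 := by
  refine (h.abs_cov_le_mul hq ht j k).trans ?_
  rw [sq]
  exact mul_le_mul (h.eLpNorm_two_le hq ht j) (h.eLpNorm_two_le hq ht k) ENNReal.toReal_nonneg
    (by positivity)

theorem Sparse.nonneg (h : P.Sparse κ) (j : Fin p) : 0 ≤ κ :=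
  (Finset.sum_nonneg fun _ _ => abs_nonneg _).trans
    ((sum_abs_le_colL1 (P.prec 0) j).trans (h.colL1_le 0 ⟨le_rfl, zero_le_one⟩))

/-- Sparsity of the precision matrix bounds the standard deviations from below. -/
theorem Sparse.one_le (h : P.Sparse κ) (hdep : P.Dependence q A ν) (hq : 2 < q) (j : Fin p) :
    1 ≤ (eLpNorm (fun ω => P.X 0 0 ω j) 2 μ).toReal * max ν 1 * κ := by
  have h0 : (0 : ℝ) ∈ Icc (0 : ℝ) 1 := ⟨le_rfl, zero_le_one⟩
  have h1 : (P.cov 0 * P.prec 0) j j = 1 := by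
    unfold prec
    rw [Matrix.mul_nonsing_inv _ (h.invertible 0 h0), Matrix.one_apply_eq]
  have h2 := abs_mul_apply_le (M := P.cov 0) (N := P.prec 0) (j := j) (k := j)
    (a := (eLpNorm (fun ω => P.X 0 0 ω j) 2 μ).toReal * max ν 1) (c := κ)
    (fun l => (hdep.abs_cov_le_mul hq h0 j l).trans
      (mul_le_mul_of_nonneg_left (hdep.eLpNorm_two_le hq h0 l) ENNReal.toReal_nonneg))
    ((sum_abs_le_colL1 _ j).trans (h.colL1_le 0 h0)) (by positivity)
  rwa [h1, abs_one] at h2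

theorem PiecewiseSmooth.eLpNorm_two_le_dan (hs : P.PiecewiseSmooth τ L M)
    (hdep : P.Dependence q A ν) (hq : 2 < q) (j : Fin p) {a : ℝ} (ha : 2 ≤ a) :
    eLpNorm (fun ω => P.X 0 0 ω j) 2 μ ≤ P.dan a A j := by
  have h0 : (0 : ℝ) ∈ Icc (0 : ℝ) 1 := ⟨le_rfl, zero_le_one⟩
  have h1 := eLpNorm_X_le_Theta (P := P) (a := 2) (by norm_num) j h0
    ((hdep.integrable hq h0 j).integrable (by norm_num)) (hs.centred 0 h0 j)
  rw [ENNReal.ofReal_ofNat] at h1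
  exact (h1.trans (Theta_zero_le_dan 2 A j)).trans (dan_mono ha A j)

/-- A component with tiny variance would force large entries of the precision matrix. Thus `N_X` is
bounded below by a multiple of `1 / κ`, which later keeps the bandwidth from being too small. -/
theorem Sparse.one_le_NX (h : P.Sparse κ) (hs : P.PiecewiseSmooth τ L M)
    (hdep : P.Dependence q A ν) (hq : 2 < q) (j : Fin p) : 1 ≤ P.NX A * max ν 1 * κ := by
  refine (h.one_le hdep hq j).trans ?_
  have hκ := h.nonneg j
  have : (eLpNorm (fun ω => P.X 0 0 ω j) 2 μ).toReal ≤ P.NX A :=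
    (ENNReal.toReal_mono (hdep.dan_four_lt hq j).ne
      (hs.eLpNorm_two_le_dan hdep hq j (by norm_num))).trans (hdep.dan_four_le_NX hq j)
  gcongr

theorem Sparse.dan_pos (h : P.Sparse κ) (hs : P.PiecewiseSmooth τ L M)
    (hdep : P.Dependence q A ν) (hq : 2 < q) (j : Fin p) : 0 < (P.dan (2 * q) A j).toReal := by
  have h1 := h.one_le hdep hq j
  have h2 := ENNReal.toReal_mono (hdep.dan_lt j).ne
    (hs.eLpNorm_two_le_dan hdep hq j (a := 2 * q) (by linarith))
  refine lt_of_lt_of_le ?_ h2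
  by_contra hcon
  rw [le_antisymm (not_lt.1 hcon) ENNReal.toReal_nonneg] at h1
  norm_num at h1

end CausalProcess

/-! ### Comparison of the rates -/

/-- A bound for sums over short intervals gives one for sums over longer intervals. -/
theorem abs_sum_Ico_le_of_short {g : ℕ → ℝ} {N : ℕ} {w y R : ℝ} (hw : 1 ≤ w) (hR : 0 ≤ R)
    (hg : ∀ a a' : ℕ, 1 ≤ a → a ≤ a' → a' ≤ N → ((a' - a : ℕ) : ℝ) ≤ w →
      |∑ i ∈ Finset.Ico a a', g i| ≤ y)
    {a a' : ℕ} (h1 : 1 ≤ a) (h2 : a ≤ a') (h3 : a' ≤ N) (h4 : ((a' - a : ℕ) : ℝ) ≤ R * w) :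
    |∑ i ∈ Finset.Ico a a', g i| ≤ (2 * R + 1) * y := by
  have hy : 0 ≤ y := (abs_nonneg _).trans
    (hg a a h1 le_rfl (h2.trans h3) (by rw [Nat.sub_self, Nat.cast_zero]; linarith))
  set v := ⌊w⌋₊ with hv
  have hv1 : 1 ≤ v := Nat.le_floor (by exact_mod_cast hw)
  have hvw : (v : ℝ) ≤ w := Nat.floor_le (by linarith)
  have hwv : w ≤ 2 * v := by
    have := Nat.lt_floor_add_one w
    have h' : (1 : ℝ) ≤ v := by exact_mod_cast hv1
    linarith
  have key : ∀ T : ℕ, ∀ a a' : ℕ, 1 ≤ a → a ≤ a' → a' ≤ N → a' - a ≤ T * v →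
      |∑ i ∈ Finset.Ico a a', g i| ≤ T * y := by
    intro T
    induction T with
    | zero =>
      intro a a' _ h2 _ h4
      have : a = a' := by omega
      subst this
      simp
    | succ T ih =>
      intro a a' h1 h2 h3 h4
      rw [add_one_mul] at h4
      have h5 := ih a (max a (a' - v)) h1 (le_max_left _ _) (by omega) (by omega)
      have h6 := hg (max a (a' - v)) a' (by omega) (by omega) h3
        (le_trans (by exact_mod_cast (by omega)) hvw)
      rw [← Finset.sum_Ico_consecutive _ (le_max_left a (a' - v)) (by omega)]
      refine (abs_add_le _ _).trans ?_
      push_cast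
      linarith
  have h5 := key ⌈2 * R⌉₊ a a' h1 h2 h3 (by
    have h6 : ((a' - a : ℕ) : ℝ) ≤ (⌈2 * R⌉₊ : ℝ) * v :=
      calc ((a' - a : ℕ) : ℝ) ≤ R * (2 * v) := h4.trans (mul_le_mul_of_nonneg_left hwv hR)
        _ = 2 * R * v := by ring
        _ ≤ _ := by gcongr; exact Nat.le_ceil _
    exact_mod_cast h6)
  refine h5.trans (mul_le_mul_of_nonneg_right ?_ hy)
  exact (Nat.ceil_lt_add_one (by positivity)).le

theorem le_of_cube_le {x y c : ℝ} (hy : 0 ≤ y) (h : x ^ 3 ≤ c * y ^ 3) :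
    x ≤ max 1 c * y := by
  have h1 : (1 : ℝ) ≤ max 1 c := le_max_left _ _
  refine le_of_pow_le_pow_left₀ (n := 3) (by norm_num) (by positivity) (h.trans ?_)
  rw [mul_pow]
  gcongr
  calc c ≤ max 1 c := le_max_right _ _
    _ = max 1 c ^ 1 := (pow_one _).symm
    _ ≤ max 1 c ^ 3 := pow_le_pow_right₀ h1 (by norm_num)

namespace CausalProcess

section Rates

variable {Ω : Type*} [MeasurableSpace Ω] {μ : Measure Ω} [IsProbabilityMeasure μ] {p : ℕ}
  {P : CausalProcess μ p} {q A C₁ C₂ : ℝ} {n : ℕ}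

/-- The common order of `b_♯³`, `h_⋄³` and `b_⋆²`. -/
def rateSum (P : CausalProcess μ p) (q A : ℝ) (n : ℕ) : ℝ :=
  P.J q A n / n + P.NX A * (n : ℝ) ^ (-(1 / 2) : ℝ) * Real.log p ^ (1 / 2 : ℝ)

theorem gaussian_rate_rpow (a : ℝ) :
    (P.NX A * (n : ℝ) ^ (-(1 / 2) : ℝ) * Real.log p ^ (1 / 2 : ℝ)) ^ a =
      P.NX A ^ a * (n : ℝ) ^ (-(1 / 2) * a) * Real.log p ^ (1 / 2 * a) := by
  have hN : 0 ≤ P.NX A := NX_nonneg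
  have hl : 0 ≤ Real.log p := Real.log_natCast_nonneg p
  have hn : (0 : ℝ) ≤ n := Nat.cast_nonneg n
  rw [Real.mul_rpow (by positivity) (by positivity), Real.mul_rpow hN (by positivity),
    ← Real.rpow_mul hn, ← Real.rpow_mul hl]

/-- With `x` and `y` the cube roots of the two summands of `rateSum`, this is `x³ + y³ ≤ (x + y)³ ≤
4 (x³ + y³)`. All bandwidths are compared through `rateSum`. -/
theorem cubeRootRate_bounds (hC₁ : 0 < C₁) (hC₂ : 0 < C₂) :
    0 ≤ P.cubeRootRate q A C₁ C₂ n ∧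
    min C₁ C₂ ^ 3 * P.rateSum q A n ≤ P.cubeRootRate q A C₁ C₂ n ^ 3 ∧
    P.cubeRootRate q A C₁ C₂ n ^ 3 ≤ 4 * max C₁ C₂ ^ 3 * P.rateSum q A n := by
  have hJ : 0 ≤ P.J q A n / n := div_nonneg J_nonneg (Nat.cast_nonneg n)
  have hl : 0 ≤ Real.log p := Real.log_natCast_nonneg p
  have hG : 0 ≤ P.NX A * (n : ℝ) ^ (-(1 / 2) : ℝ) * Real.log p ^ (1 / 2 : ℝ) := by
    have := NX_nonneg (P := P) (A := A)
    positivity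
  obtain ⟨x, hx0, hx⟩ : ∃ x : ℝ, 0 ≤ x ∧ x = (P.J q A n / n) ^ (1 / 3 : ℝ) := ⟨_, by positivity, rfl⟩
  obtain ⟨y, hy0, hy⟩ : ∃ y : ℝ, 0 ≤ y ∧
      y = (P.NX A * (n : ℝ) ^ (-(1 / 2) : ℝ) * Real.log p ^ (1 / 2 : ℝ)) ^ (1 / 3 : ℝ) :=
    ⟨_, by positivity, rfl⟩
  have hr : P.cubeRootRate q A C₁ C₂ n = C₁ * x + C₂ * y := by
    rw [hx, hy, gaussian_rate_rpow, cubeRootRate]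
    norm_num
    ring
  have hs : P.rateSum q A n = x ^ 3 + y ^ 3 := by
    rw [hx, hy, ← Real.rpow_natCast, ← Real.rpow_natCast, ← Real.rpow_mul hJ, ← Real.rpow_mul hG,
      rateSum]
    norm_num
  have hm1 : 0 < min C₁ C₂ := lt_min hC₁ hC₂
  have hm2 : 0 < max C₁ C₂ := hm1.trans_le min_le_max
  rw [hr, hs]
  refine ⟨by positivity, ?_, ?_⟩
  · calc min C₁ C₂ ^ 3 * (x ^ 3 + y ^ 3) ≤ (min C₁ C₂ * (x + y)) ^ 3 := by
          rw [mul_pow]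
          gcongr
          nlinarith [mul_nonneg hx0 hy0, mul_nonneg (mul_nonneg hx0 hy0) (add_nonneg hx0 hy0)]
      _ ≤ _ := by
          gcongr
          have := mul_le_mul_of_nonneg_right (min_le_left C₁ C₂) hx0
          have := mul_le_mul_of_nonneg_right (min_le_right C₁ C₂) hy0
          linarith
  · calc (C₁ * x + C₂ * y) ^ 3 ≤ (max C₁ C₂ * (x + y)) ^ 3 := by
          gcongr
          have := mul_le_mul_of_nonneg_right (le_max_left C₁ C₂) hx0
          have := mul_le_mul_of_nonneg_right (le_max_right C₁ C₂) hy0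
          linarith
      _ ≤ max C₁ C₂ ^ 3 * (4 * (x ^ 3 + y ^ 3)) := by
          rw [mul_pow]
          gcongr
          nlinarith [mul_nonneg (add_nonneg hx0 hy0) (sq_nonneg (x - y))]
      _ = _ := by ring

theorem sqrtRate_bounds (hC₁ : 0 < C₁) (hC₂ : 0 < C₂) :
    0 ≤ P.sqrtRate q A C₁ C₂ n ∧
    min C₁ C₂ ^ 2 * P.rateSum q A n ≤ P.sqrtRate q A C₁ C₂ n ^ 2 ∧
    P.sqrtRate q A C₁ C₂ n ^ 2 ≤ 2 * max C₁ C₂ ^ 2 * P.rateSum q A n := by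
  have hJ : 0 ≤ P.J q A n / n := div_nonneg J_nonneg (Nat.cast_nonneg n)
  have hl : 0 ≤ Real.log p := Real.log_natCast_nonneg p
  have hG : 0 ≤ P.NX A * (n : ℝ) ^ (-(1 / 2) : ℝ) * Real.log p ^ (1 / 2 : ℝ) := by
    have := NX_nonneg (P := P) (A := A)
    positivity
  obtain ⟨x, hx0, hx⟩ : ∃ x : ℝ, 0 ≤ x ∧ x = (P.J q A n / n) ^ (1 / 2 : ℝ) := ⟨_, by positivity, rfl⟩
  obtain ⟨y, hy0, hy⟩ : ∃ y : ℝ, 0 ≤ y ∧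
      y = (P.NX A * (n : ℝ) ^ (-(1 / 2) : ℝ) * Real.log p ^ (1 / 2 : ℝ)) ^ (1 / 2 : ℝ) :=
    ⟨_, by positivity, rfl⟩
  have hr : P.sqrtRate q A C₁ C₂ n = C₁ * x + C₂ * y := by
    rw [hx, hy, gaussian_rate_rpow, sqrtRate]
    norm_num
    ring
  have hs : P.rateSum q A n = x ^ 2 + y ^ 2 := by
    rw [hx, hy, ← Real.rpow_natCast, ← Real.rpow_natCast, ← Real.rpow_mul hJ, ← Real.rpow_mul hG,
      rateSum]
    norm_num
  have hm1 : 0 < min C₁ C₂ := lt_min hC₁ hC₂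
  have hm2 : 0 < max C₁ C₂ := hm1.trans_le min_le_max
  rw [hr, hs]
  refine ⟨by positivity, ?_, ?_⟩
  · calc min C₁ C₂ ^ 2 * (x ^ 2 + y ^ 2) ≤ (min C₁ C₂ * (x + y)) ^ 2 := by
          rw [mul_pow]
          gcongr
          nlinarith [mul_nonneg hx0 hy0]
      _ ≤ _ := by
          gcongr
          have := mul_le_mul_of_nonneg_right (min_le_left C₁ C₂) hx0
          have := mul_le_mul_of_nonneg_right (min_le_right C₁ C₂) hy0
          linarith
  · calc (C₁ * x + C₂ * y) ^ 2 ≤ (max C₁ C₂ * (x + y)) ^ 2 := by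
          gcongr
          have := mul_le_mul_of_nonneg_right (le_max_left C₁ C₂) hx0
          have := mul_le_mul_of_nonneg_right (le_max_right C₁ C₂) hy0
          linarith
      _ ≤ max C₁ C₂ ^ 2 * (2 * (x ^ 2 + y ^ 2)) := by
          rw [mul_pow]
          gcongr
          nlinarith [sq_nonneg (x - y)]
      _ = _ := by ring

theorem cubeRootRate_le_mul {D₁ D₂ : ℝ} (hC₁ : 0 < C₁) (hC₂ : 0 < C₂) (hD₁ : 0 < D₁) (hD₂ : 0 < D₂) :
    P.cubeRootRate q A C₁ C₂ n ≤
      max 1 (4 * max C₁ C₂ ^ 3 / min D₁ D₂ ^ 3) * P.cubeRootRate q A D₁ D₂ n := by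
  obtain ⟨h1, -, h2⟩ := cubeRootRate_bounds (P := P) (q := q) (A := A) (n := n) hC₁ hC₂
  obtain ⟨h3, h4, -⟩ := cubeRootRate_bounds (P := P) (q := q) (A := A) (n := n) hD₁ hD₂
  have hm1 : 0 < min D₁ D₂ := lt_min hD₁ hD₂
  have hm2 : 0 < max C₁ C₂ := hC₁.trans_le (le_max_left _ _)
  refine le_of_cube_le h3 (h2.trans ?_)
  rw [div_mul_eq_mul_div, le_div_iff₀ (by positivity), mul_assoc]
  gcongr
  rwa [mul_comm]

theorem sqrtRate_sq_le_mul {D₁ D₂ : ℝ} (hC₁ : 0 < C₁) (hC₂ : 0 < C₂) (hD₁ : 0 < D₁) (hD₂ : 0 < D₂) :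
    P.sqrtRate q A C₁ C₂ n ^ 2 ≤
      2 * max C₁ C₂ ^ 2 / min D₁ D₂ ^ 3 * P.cubeRootRate q A D₁ D₂ n ^ 3 := by
  obtain ⟨h1, -, h2⟩ := sqrtRate_bounds (P := P) (q := q) (A := A) (n := n) hC₁ hC₂
  obtain ⟨h3, h4, -⟩ := cubeRootRate_bounds (P := P) (q := q) (A := A) (n := n) hD₁ hD₂
  have hm1 : 0 < min D₁ D₂ := lt_min hD₁ hD₂
  have hm2 : 0 < max C₁ C₂ := hC₁.trans_le (le_max_left _ _)
  refine h2.trans ?_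
  rw [div_mul_eq_mul_div, le_div_iff₀ (by positivity), mul_assoc]
  gcongr
  rwa [mul_comm]

theorem cubeRootRate_cube_le_mul {D₁ D₂ : ℝ} (hC₁ : 0 < C₁) (hC₂ : 0 < C₂) (hD₁ : 0 < D₁)
    (hD₂ : 0 < D₂) : P.cubeRootRate q A C₁ C₂ n ^ 3 ≤
      4 * max C₁ C₂ ^ 3 / min D₁ D₂ ^ 2 * P.sqrtRate q A D₁ D₂ n ^ 2 := by
  obtain ⟨h1, -, h2⟩ := cubeRootRate_bounds (P := P) (q := q) (A := A) (n := n) hC₁ hC₂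
  obtain ⟨h3, h4, -⟩ := sqrtRate_bounds (P := P) (q := q) (A := A) (n := n) hD₁ hD₂
  have hm1 : 0 < min D₁ D₂ := lt_min hD₁ hD₂
  have hm2 : 0 < max C₁ C₂ := hC₁.trans_le (le_max_left _ _)
  refine h2.trans ?_
  rw [div_mul_eq_mul_div, le_div_iff₀ (by positivity), mul_assoc]
  gcongr
  rwa [mul_comm]

end Rates

end CausalProcess

/-! ### Error of the covariance estimate when the noise is small -/

namespace CausalProcess

section

variable {Ω : Type*} [MeasurableSpace Ω] {μ : Measure Ω} {p : ℕ}
  {P : CausalProcess μ p} {ι : ℕ} {τ : Fin (ι + 2) → ℝ} {L M c₁ c₂ : ℝ}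

theorem Jumps.le_abs_brk_sub (hj : P.Jumps τ c₁ c₂) (hs : P.PiecewiseSmooth τ L M) {w w' : Fin ι}
    (hw : w' ≠ w) : c₁ ≤ |brk τ w' - brk τ w| := by
  rcases lt_or_gt_of_ne hw with hlt | hlt
  · have := hj.separated_brk hs.strictMono hlt
    rw [abs_sub_comm]
    exact le_trans (by linarith) (le_abs_self _)
  · have := hj.separated_brk hs.strictMono hlt
    exact le_trans (by linarith) (le_abs_self _)

/-- Times in `𝒩` are not in the immediate neighbourhood of an estimated change point. -/
theorem not_mem_nbhd_of_mem_around (hs : P.PiecewiseSmooth τ L M) (hj : P.Jumps τ c₁ c₂) {n k : ℕ}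
    {x : ℤ → Fin p → ℝ} {θ : ℝ} {r : ℕ → ℤ} {b h δ t : ℝ} (hn : 0 < n) (hb : 0 < b) (hnh : 2 ≤ n * h)
    (hout : IsChangePointOutput x n ⌊n * h⌋₊ θ k r) (hh : h ≤ 1 / 2)
    (hδ : δ < h ^ 2) (hbc : 4 * (b + h ^ 2) ≤ c₁)
    (hloc : ∀ l < k, ∃ w, |(r l : ℝ) / n - brk τ w| ≤ δ)
    (ht : t ∈ around n k r b h) : ∀ j < k, t ∉ nbhd n r (h ^ 2) j := by
  have hn0 : (0 : ℝ) < n := by exact_mod_cast hn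
  have hh0 : 0 < h := pos_of_mul_pos_right (by linarith : 0 < (n : ℝ) * h) hn0.le
  have hh2 : 0 < h ^ 2 := by positivity
  -- Estimates are more than `2 ⌊n h⌋` grid steps apart, which exceeds `n h` because `n h ≥ 2`. Two
  -- estimates of one break would be within `2 δ < 2 h² ≤ h`, so each break has one estimate only.
  have hfar : ∀ i < k, ∀ j < k, i < j → h < |(r j : ℝ) / n - (r i : ℝ) / n| := by
    intro i _ j hj hij
    have h1 := (hout.mem j hj).2.2 i hij
    have h2 : 2 * ((⌊n * h⌋₊ : ℕ) : ℝ) < |(r j : ℝ) - r i| := by exact_mod_cast h1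
    have h3 := Nat.lt_floor_add_one ((n : ℝ) * h)
    rw [← sub_div, abs_div, abs_of_pos hn0, lt_div_iff₀ hn0]
    linarith
  intro j hjk hjt
  obtain ⟨w, hw⟩ := hloc j hjk
  have hw' := abs_le.1 hw
  have h1 := hj.le_brk hs w
  have h2 := hj.brk_le hs w
  obtain ⟨g1, g2⟩ := hjt
  rcases ht.2 with ht | ht | ⟨i, hik, ⟨hi1, hi2⟩, hi3⟩
  · linarith [hw'.1]
  · linarith [hw'.2]
  · have hij : i ≠ j := by rintro rfl; exact hi3 ⟨g1, g2⟩
    obtain ⟨w', hw2⟩ := hloc i hik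
    have hw2' := abs_le.1 hw2
    by_cases hww : w' = w
    · subst hww
      have h3 : h < |(r j : ℝ) / n - (r i : ℝ) / n| := by
        rcases lt_or_gt_of_ne hij with h4 | h4
        · exact hfar i hik j hjk h4
        · rw [abs_sub_comm]; exact hfar j hjk i hik h4
      have h5 : h < 2 * h ^ 2 := by
        refine h3.trans_le (abs_le.2 ⟨?_, ?_⟩) <;> linarith [hw'.1, hw'.2, hw2'.1, hw2'.2]
      nlinarith
    · have h3 := hj.le_abs_brk_sub hs hww
      rw [le_abs] at h3
      rcases h3 with h3 | h3 <;> linarith [hw'.1, hw'.2, hw2'.1, hw2'.2]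

end

/-- When the partial sums of the noise are small, the covariance estimate has error `O(b²)` between
the change points, and `O(b')` around them, for suitable bandwidths `b` and `b'`. -/
theorem exists_covHat_error_le {q A ν L M c₁ c₂ H G : ℝ} {K : ℝ → ℝ} (hq : 2 < q) (hL : 0 < L)
    (hc₁ : 0 < c₁) (hc₂ : 0 < c₂) (hK : IsKernel K) (hH : 0 < H) (hG : 0 < G) :
    ∃ β N C : ℝ, 0 < β ∧ 1 ≤ N ∧ 0 < C ∧
    ∀ {Ω : Type*} [MeasurableSpace Ω] {μ : Measure Ω} [IsProbabilityMeasure μ] {p : ℕ}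
      {P : CausalProcess μ p} {ι : ℕ} {τ : Fin (ι + 2) → ℝ},
    P.PiecewiseSmooth τ L M → P.Dependence q A ν → P.Jumps τ c₁ c₂ →
    ∀ {n : ℕ} {b h : ℝ} {ω : Ω} {k : ℕ} {r : ℕ → ℤ},
    0 < b → b ≤ β → N ≤ n * b → 1 / n ≤ b ^ 4 → h ≤ H * b → b ≤ H * h →
    IsChangePointOutput (P.obs n ω) n ⌊n * h⌋₊ ((1 + L) * h ^ 2) k r →
    (∀ j k, ∀ a a' : ℕ, 1 ≤ a → a ≤ a' → a' ≤ n + 1 → ((a' - a : ℕ) : ℝ) ≤ n * b / 2 →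
      |∑ i ∈ Finset.Ico a a', P.noise n ω j k i| ≤ 15 * (n * b ^ 3)) →
    (∀ t ∈ between n k r b h,
      maxNorm (covHat K (P.obs n ω) n k r b h t - P.cov t) ≤ C * b ^ 2) ∧
    ∀ b' : ℝ, 0 < b' → b' ≤ b → N ≤ n * b' → b ^ 3 ≤ G * b' ^ 2 →
      ∀ t ∈ around n k r b h,
        maxNorm (covHat K (P.obs n ω) n k r b' h t - P.cov t) ≤ C * b' := by
  obtain ⟨B, hB, hKB, -⟩ := hK.exists_bounds
  obtain ⟨c, N₀, hc, hN₀, hS⟩ := hK.exists_sum_ge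
  obtain ⟨C, hC, hA⟩ := hK.exists_abs_sum_le
  obtain ⟨D, hD, hMom⟩ := hK.exists_abs_moment_le
  set V : ℝ := max ν 1 ^ 2 with hV
  have hV0 : 0 < V := by positivity
  -- A change point window `n h ≤ 2 H (n b / 2)` costs a factor `4 H + 1` on `15 n b³`, which is to
  -- equal `n ε / 2` with `ε = E b³`.
  set E : ℝ := 30 * (4 * H + 1) with hE
  have hE0 : 0 < E := by positivity
  -- The precision of the estimates in units of `b³`; the `1` absorbs the rounding `1 / n ≤ b³`.
  set Δ : ℝ := 8 * E / c₂ + 1 with hΔ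
  have hΔ0 : 0 < Δ := by positivity
  set x₁ : ℝ := E * H ^ 2 with hx₁
  set x₂ : ℝ := Δ * H ^ 2 with hx₂
  set x₃ : ℝ := 32 * (1 + L) * H / c₂ with hx₃
  set x₄ : ℝ := 8 * H / c₁ with hx₄
  set x₅ : ℝ := 4 * (1 + H ^ 2) / c₁ with hx₅
  set C' : ℝ := (C * 195 + (L + |M|) * D) / c + |M| with hC'
  set C'' : ℝ := (C * (2 * (195 * G)) + B * (2 * V) * (2 * Δ * G + G)) / c + L with hC''
  have hC'0 : 0 < C' := by positivity
  have hC''0 : 0 < C'' := by positivity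
  -- Every smallness condition has the form `x b ≤ 1`, or `x b < 1` where strictness is needed; the
  -- reciprocal of the sum meets them all at once.
  refine ⟨(2 + x₁ + x₂ + x₃ + x₄ + x₅ + 2 * H)⁻¹, N₀ + 2 * H + 2, max C' C'', by positivity, by linarith,
    lt_max_of_lt_left hC'0, ?_⟩
  intro Ω _ μ _ p P ι τ hs hdep hj n b h ω k r hb hbβ hnb hnb4 hhb hbh hout hnoise
  have hbX : 2 * b + x₁ * b + x₂ * b + x₃ * b + x₄ * b + x₅ * b + 2 * H * b ≤ 1 := by
    have := mul_le_mul_of_nonneg_left hbβ (by positivity : 0 ≤ 2 + x₁ + x₂ + x₃ + x₄ + x₅ + 2 * H)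
    rw [mul_inv_cancel₀ (by positivity)] at this
    linarith
  have p1 : 0 < x₁ * b := by positivity
  have p2 : 0 < x₂ * b := by positivity
  have p3 : 0 < x₃ * b := by positivity
  have p4 : 0 < x₄ * b := by positivity
  have p5 : 0 < x₅ * b := by positivity
  have p6 : 0 < 2 * H * b := by positivity
  have hb1 : b ≤ 1 := by linarith
  have hnb0 : 0 < (n : ℝ) * b := by linarith
  have hn0 : (0 : ℝ) < n := pos_of_mul_pos_left hnb0 hb.le
  have hn : 0 < n := by exact_mod_cast hn0
  have hh0 : 0 < h := pos_of_mul_pos_right (hb.trans_le hbh) hH.le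
  have hb2 : b ^ 2 ≤ H ^ 2 * h ^ 2 := by rw [← mul_pow]; gcongr
  have hb3 : ∀ y, 0 < y → y * H ^ 2 * b < 1 → y * b ^ 3 < h ^ 2 := fun y hy hyb => by
    calc y * b ^ 3 = y * b * b ^ 2 := by ring
      _ ≤ y * b * (H ^ 2 * h ^ 2) := by gcongr
      _ = y * H ^ 2 * b * h ^ 2 := by ring
      _ < 1 * h ^ 2 := by gcongr
      _ = h ^ 2 := one_mul _
  have hnh : 2 ≤ n * h := by
    have h1 : (n : ℝ) * b ≤ n * (H * h) := by gcongr
    have h2 : H * 2 ≤ H * (n * h) := by linarith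
    exact le_of_mul_le_mul_left h2 hH
  have hlong : ∀ R, 0 ≤ R → ∀ j k, ∀ a a' : ℕ, 1 ≤ a → a ≤ a' → a' ≤ n + 1 →
      ((a' - a : ℕ) : ℝ) ≤ R * (n * b / 2) →
      |∑ i ∈ Finset.Ico a a', P.noise n ω j k i| ≤ (2 * R + 1) * (15 * (n * b ^ 3)) :=
    fun R hR j k a a' h1 h2 h3 h4 =>
      abs_sum_Ico_le_of_short (by linarith) hR (hnoise j k) h1 h2 h3 h4
  -- A kernel window has length at most `3 n b = 6 (n b / 2)`, and `(2 · 6 + 1) · 15 = 195`.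
  have hy195 : ∀ b', 0 < b' → b' ≤ b → ∀ j l, ∀ a a' : ℕ, 1 ≤ a → a ≤ a' → a' ≤ n + 1 →
      ((a' - a : ℕ) : ℝ) ≤ 3 * (n * b') →
      |∑ i ∈ Finset.Ico a a', P.noise n ω j l i| ≤ 195 * (n * b ^ 3) := by
    intro b' hb' hbb' j l a a' h1 h2 h3 h4
    have h5 : (n : ℝ) * b' ≤ n * b := by gcongr
    refine (hlong 6 (by norm_num) j l a a' h1 h2 h3 (by linarith)).trans (le_of_eq (by ring))
  have hhH : h ≤ 1 / 2 := by linarith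
  have hε : E * b ^ 3 < h ^ 2 := hb3 E hE0 (by linarith)
  have hδ : Δ * b ^ 3 < h ^ 2 := hb3 Δ hΔ0 (by linarith)
  have hinv3 : 1 / (n : ℝ) ≤ b ^ 3 := hnb4.trans (pow_le_pow_of_le_one hb.le hb1 (by norm_num))
  obtain ⟨hloc₁, hloc₂⟩ := abs_changePoint_sub_le hs hj hL hc₂ hn hnh
    (by
      have : x₃ * b ≤ 1 := by linarith
      rw [hx₃, div_mul_eq_mul_div, div_le_one hc₂] at this
      calc 32 * (1 + L) * h ≤ 32 * (1 + L) * (H * b) := by gcongr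
        _ ≤ c₂ := by linarith)
    (by
      have : x₄ * b ≤ 1 := by linarith
      rw [hx₄, div_mul_eq_mul_div, div_le_one hc₁] at this
      linarith)
    (by positivity) hε hout
    (fun j k a a' h1 h2 h3 h4 => by
      have h5 : (n : ℝ) * h ≤ n * (H * b) := by gcongr
      refine (hlong (2 * H) (by positivity) j k a a' h1 h2 h3 (by linarith)).trans (le_of_eq ?_)
      rw [hE]; ring)
  have hδle : 8 * (E * b ^ 3) / c₂ + 1 / n ≤ Δ * b ^ 3 := by
    rw [hΔ, add_mul, one_mul]
    refine add_le_add (le_of_eq (by ring)) hinv3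
  replace hloc₁ : ∀ l < k, ∃ w, |(r l : ℝ) / n - brk τ w| ≤ Δ * b ^ 3 := fun l hl =>
    (hloc₁ l hl).imp fun w hw => hw.trans hδle
  replace hloc₂ : ∀ w, ∃ l < k, |(r l : ℝ) / n - brk τ w| ≤ Δ * b ^ 3 := fun w =>
    (hloc₂ w).imp fun l hl => ⟨hl.1, hl.2.trans hδle⟩
  have hbc : 4 * (b + h ^ 2) ≤ c₁ := by
    have : x₅ * b ≤ 1 := by linarith
    rw [hx₅, div_mul_eq_mul_div, div_le_one hc₁] at this
    have h1 : h ^ 2 ≤ H ^ 2 * b := by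
      calc h ^ 2 ≤ (H * b) ^ 2 := by gcongr
        _ = H ^ 2 * b * b := by ring
        _ ≤ H ^ 2 * b * 1 := by gcongr
        _ = _ := mul_one _
    linarith
  constructor
  · intro t ht
    refine maxNorm_le (by positivity) fun j l => ?_
    have hM0 := hs.nonneg j
    rw [Matrix.sub_apply]
    have ht01 : t ∈ Icc (0 : ℝ) 1 := ⟨hb.le.trans ht.1.1, by linarith [ht.1.2]⟩
    have key := abs_covHat_sub_le_of_far (h := h) hK hs hL hb (by linarith : 1 ≤ (n : ℝ) * b) hc hC
      (y := 195 * (n * b ^ 3)) (by positivity) (hS n b t hb (by linarith) ht01 (by linarith))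
      (fun y g hy hg => hA n b t y g hb (by linarith) hy hg)
      (hMom n b t hb (by linarith) ht.1) (hy195 b hb le_rfl) ht.1
      (fun j hj => by rw [add_comm b]; exact ht.2 j hj)
      (fun w => by
        by_contra hcon
        obtain ⟨l, hl, hlw⟩ := hloc₂ w
        have h1 := abs_le.1 (not_lt.1 hcon)
        have h2 := abs_le.1 hlw
        exact ht.2 l hl ⟨by linarith [h1.1, h2.2], by linarith [h1.2, h2.1]⟩) j l
    refine key.trans ((le_trans ?_ (mul_le_mul_of_nonneg_right (le_max_left C' C'') (sq_nonneg b))))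
    have h0 : C' * b ^ 2 = (C * 195 + (L + M) * D) / c * b ^ 2 + M * b ^ 2 := by
      rw [hC', abs_of_nonneg hM0, add_mul]
    rw [h0]
    refine add_le_add ?_ (le_refl (M * b ^ 2))
    have h1 : (C * (195 * (n * b ^ 3)) + (L + M * b) * (D * b)) / (c * (n * b)) =
        C * 195 / c * b ^ 2 + (L + M * b) * D / c * (1 / n) := by
      field_simp
    have h3 : (C * 195 + (L + M) * D) / c * b ^ 2 =
        C * 195 / c * b ^ 2 + (L + M) * D / c * b ^ 2 := by ring
    rw [h1, h3]
    refine add_le_add (le_refl _) ?_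
    have h2 : 1 / (n : ℝ) ≤ b ^ 2 := hnb4.trans (pow_le_pow_of_le_one hb.le hb1 (by norm_num))
    gcongr
    exact mul_le_of_le_one_right hM0 hb1
  · intro b' hb' hbb' hnb' hbG t ht
    refine maxNorm_le (by positivity) fun j l => ?_
    rw [Matrix.sub_apply]
    have key := abs_covHat_sub_le_of_reflected (h := h) hK hs hj hL hb' (by linarith : 1 ≤ (n : ℝ) * b')
      hc hC (y := 195 * (n * b ^ 3)) (by positivity) hKB hB hh0
      (fun t ht j l => hdep.abs_cov_le hq ht j l) (hS n b' t hb' (by linarith) ht.1 (by linarith))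
      (fun y g hy hg => hA n b' t y g hb' (by linarith) hy hg) (hy195 b' hb' hbb') ht.1
      (not_mem_nbhd_of_mem_around hs hj hn hb hnh hout hhH hδ hbc hloc₁ ht)
      (by positivity) hδ (by linarith) hloc₁ hloc₂ j l
    refine key.trans ((le_trans ?_ (mul_le_mul_of_nonneg_right (le_max_right C' C'') hb'.le)))
    have h0 : C'' * b' =
        (C * (2 * (195 * G)) + B * (2 * V) * (2 * Δ * G + G)) / c * b' + L * b' := add_mul _ _ _
    rw [h0]
    refine add_le_add ?_ (le_refl (L * b'))
    rw [← hV]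
    have h1 : (C * (2 * (195 * (n * b ^ 3))) + B * (2 * V) * (2 * (Δ * b ^ 3 * n) + 1)) / (c * (n * b'))
        = (C * (2 * (195 * b ^ 3)) + B * (2 * V) * (2 * Δ * b ^ 3 + 1 / n)) / (c * b') := by
      field_simp
    -- Over the common denominator `c b'` the comparison reduces to `b³ ≤ G b'²` and `1 / n ≤ G
    -- b'²`.
    have h2 : (C * (2 * (195 * G)) + B * (2 * V) * (2 * Δ * G + G)) / c * b'
        = (C * (2 * (195 * (G * b' ^ 2))) + B * (2 * V) * (2 * Δ * (G * b' ^ 2) + G * b' ^ 2))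
          / (c * b') := by
      field_simp
    rw [h1, h2]
    have h3 := hinv3.trans hbG
    gcongr

end CausalProcess

/-! ### Stochastic conclusions -/

section Stochastic

variable {Ω : ℕ → Type*} [∀ n, MeasurableSpace (Ω n)] {μ : ∀ n, Measure (Ω n)}

theorem isBigOP_iSup_of_forall_notMem {bad : ∀ n, Set (Ω n)} {T : ∀ n, Ω n → Set ℝ}
    {Y : ∀ n, Ω n → ℝ → ℝ} {a : ℕ → ℝ} {C : ℝ}
    (hbad : Tendsto (fun n => μ n (bad n)) atTop (𝓝 0)) (hC : 0 < C)
    (h : ∀ᶠ n in atTop, ∀ ω ∉ bad n, ∀ t ∈ T n ω, Y n ω t ≤ C * a n) :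
    IsBigOP μ (fun n ω => ⨆ t ∈ T n ω, ENNReal.ofReal (Y n ω t)) a := by
  intro ε hε
  refine ⟨C, hC, ?_⟩
  filter_upwards [h, hbad.eventually (gt_mem_nhds (ENNReal.ofReal_pos.2 hε))] with n hn hn'
  refine (measure_mono fun ω hω => ?_).trans_lt hn'
  by_contra hcon
  exact absurd hω (not_lt.2 (iSup₂_le fun t ht => ENNReal.ofReal_le_ofReal (hn ω hcon t ht)))

theorem withProbToOne_of_forall_notMem {bad E : ∀ n, Set (Ω n)}
    (hbad : Tendsto (fun n => μ n (bad n)) atTop (𝓝 0))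
    (h : ∀ᶠ n in atTop, ∀ ω ∉ bad n, ω ∈ E n) : WithProbToOne μ E := by
  refine tendsto_of_tendsto_of_tendsto_of_le_of_le' tendsto_const_nhds hbad
    (Eventually.of_forall fun n => zero_le) ?_
  filter_upwards [h] with n hn
  refine measure_mono fun ω hω => ?_
  by_contra hcon
  exact hω (hn ω hcon)

end Stochastic

/-! ### From covariance errors to graph recovery, and the size of the bandwidth -/

namespace CausalProcess

variable {p : ℕ → ℕ} {Ω : ℕ → Type*} [∀ n, MeasurableSpace (Ω n)]
  {μ : ∀ n, Measure (Ω n)} [∀ n, IsProbabilityMeasure (μ n)] {P : ∀ n, CausalProcess (μ n) (p n)}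

/-- Uniform error bounds for covariance estimates give the rates and the graph recovery for the
CLIME estimates. -/
theorem clime_consistency {κ ρ : ℕ → ℝ} {bad : ∀ n, Set (Ω n)} {T : ∀ n, Ω n → Set ℝ}
    {S W : ∀ n, Ω n → ℝ → Matrix (Fin (p n)) (Fin (p n)) ℝ} {C Cl C₀ : ℝ}
    (hbad : Tendsto (fun n => μ n (bad n)) atTop (𝓝 0)) (hC : 0 < C) (hCl : C ≤ Cl)
    (hC₀ : 4 * Cl ≤ C₀) (hsp : ∀ n, (P n).Sparse (κ n)) (hκ : ∀ᶠ n in atTop, 0 < κ n)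
    (hρ : ∀ᶠ n in atTop, 0 < ρ n) (hT : ∀ n ω, T n ω ⊆ Icc (0 : ℝ) 1)
    (hW : ∀ n ω t, IsClime (S n ω t) (Cl * κ n * ρ n) (W n ω t))
    (h : ∀ᶠ n in atTop, ∀ ω ∉ bad n, ∀ t ∈ T n ω, maxNorm (S n ω t - (P n).cov t) ≤ C * ρ n) :
    IsBigOP μ (fun n ω => ⨆ t ∈ T n ω, ENNReal.ofReal (maxNorm (S n ω t - (P n).cov t))) ρ ∧
    IsBigOP μ (fun n ω => ⨆ t ∈ T n ω, ENNReal.ofReal (maxNorm (W n ω t - (P n).prec t)))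
      (fun n => κ n ^ 2 * ρ n) ∧
    WithProbToOne μ (fun n => {ω | ∀ t ∈ T n ω,
      estEdges (W n ω t) (C₀ * κ n ^ 2 * ρ n) ⊆ edges ((P n).prec t)}) ∧
    WithProbToOne μ (fun n => {ω | ∀ t ∈ T n ω,
      sigEdges ((P n).prec t) (2 * (C₀ * κ n ^ 2 * ρ n)) ⊆
        estEdges (W n ω t) (C₀ * κ n ^ 2 * ρ n)}) := by
  have hCl0 : 0 < Cl := hC.trans_le hCl
  have herr : ∀ᶠ n in atTop, ∀ ω ∉ bad n, ∀ t ∈ T n ω,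
      maxNorm (W n ω t - (P n).prec t) ≤ 2 * Cl * (κ n ^ 2 * ρ n) := by
    filter_upwards [h, hκ, hρ] with n hn hκn hρn ω hω t ht
    have h1 := (hW n ω t).maxNorm_sub_le ((hsp n).invertible t (hT n ω ht)) (cov_transpose t)
      ((hsp n).colL1_le t (hT n ω ht)) (hn ω hω t ht) (by
        calc κ n * (C * ρ n) ≤ κ n * (Cl * ρ n) := by gcongr
          _ = _ := by ring) hκn.le
    refine h1.trans (le_of_eq (by ring))
  -- The factor `4` in `4 * Cl ≤ C₀`, against the `2 * Cl` of the error bound, makes the inequality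
  -- strict, as the edge statements require.
  have hlt : ∀ᶠ n in atTop, ∀ ω ∉ bad n, ∀ t ∈ T n ω,
      maxNorm (W n ω t - (P n).prec t) < C₀ * κ n ^ 2 * ρ n := by
    filter_upwards [herr, hκ, hρ] with n hn hκn hρn ω hω t ht
    refine (hn ω hω t ht).trans_lt ?_
    have : 0 < κ n ^ 2 * ρ n := by positivity
    rw [mul_assoc C₀]
    exact mul_lt_mul_of_pos_right (by linarith) this
  refine ⟨isBigOP_iSup_of_forall_notMem hbad hC h,
    isBigOP_iSup_of_forall_notMem hbad (by positivity) herr, ?_, ?_⟩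
  · refine withProbToOne_of_forall_notMem hbad ?_
    filter_upwards [hlt] with n hn ω hω t ht
    exact estEdges_subset (prec_transpose t) (hn ω hω t ht)
  · refine withProbToOne_of_forall_notMem hbad ?_
    filter_upwards [hlt] with n hn ω hω t ht
    exact sigEdges_subset (prec_transpose t) (hn ω hω t ht)

theorem one_le_mul_of_sparse {q A ν κ' : ℝ} {n : ℕ} (hq : 2 < q)
    (hdep : (P n).Dependence q A ν) (hsp : (P n).Sparse κ') (hp : 1 ≤ p n) :
    1 ≤ max ν 1 ^ 2 * κ' := by
  have hκ := hsp.nonneg ⟨0, hp⟩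
  refine (hsp.one_le hdep hq ⟨0, hp⟩).trans ?_
  rw [sq]
  have := hdep.eLpNorm_two_le hq (t := 0) ⟨le_rfl, zero_le_one⟩ ⟨0, hp⟩
  gcongr

/-- The noise is negligible, and `b` is small but not too small, when `κ b → 0` and `n b → ∞`. -/
theorem bandwidth_asymptotics {ι : ℕ} {q A ν L M B₁ B₂ : ℝ} (hq : 2 < q) (hA : 0 < A) (hB₁ : 0 < B₁)
    (hB₂ : 0 < B₂) {τ : ℕ → Fin (ι + 2) → ℝ} {κ b : ℕ → ℝ} (hp : Tendsto p atTop atTop)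
    (hs : ∀ n, (P n).PiecewiseSmooth (τ n) L M) (hdep : ∀ n, (P n).Dependence q A ν)
    (hsp : ∀ n, (P n).Sparse (κ n)) (hb : ∀ n, b n = (P n).cubeRootRate q A B₁ B₂ n)
    (hnb : Tendsto (fun n : ℕ => n * b n) atTop atTop)
    (hκb : Tendsto (fun n => κ n * b n) atTop (𝓝 0)) :
    Tendsto b atTop (𝓝 0) ∧ (∀ᶠ n : ℕ in atTop, 1 / (n : ℝ) ≤ b n ^ 4) ∧
    Tendsto (fun n => μ n {ω | ∃ j k, ∃ a a' : ℕ, 1 ≤ a ∧ a ≤ a' ∧ a' ≤ n + 1 ∧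
      ((a' - a : ℕ) : ℝ) ≤ n * b n / 2 ∧
      15 * (n * b n ^ 3) ≤ |∑ i ∈ Finset.Ico a a', (P n).noise n ω j k i|}) atTop (𝓝 0) := by
  have hp1 : ∀ᶠ n in atTop, 1 ≤ p n := hp.eventually_ge_atTop 1
  have hbpos : ∀ᶠ n in atTop, 0 < b n := by
    filter_upwards [hnb.eventually_gt_atTop 0] with n hn
    exact pos_of_mul_pos_right hn (Nat.cast_nonneg n)
  have hNX : ∀ᶠ n in atTop, 1 ≤ (P n).NX A * max ν 1 * κ n := by
    filter_upwards [hp1] with n hn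
    exact (hsp n).one_le_NX (hs n) (hdep n) hq ⟨0, hn⟩
  have hNX0 : ∀ᶠ n in atTop, 0 < (P n).NX A := by
    filter_upwards [hNX] with n hn
    refine NX_nonneg.lt_of_ne fun h0 => ?_
    rw [← h0] at hn
    norm_num at hn
  -- `κ` is bounded below by a positive constant.
  have hb0 : Tendsto b atTop (𝓝 0) := by
    have h1 := hκb.const_mul (max ν 1 ^ 2)
    rw [mul_zero] at h1
    refine squeeze_zero' (hbpos.mono fun n hn => hn.le) ?_ h1
    filter_upwards [hp1, hbpos] with n hn hbn
    have := mul_le_mul_of_nonneg_right (one_le_mul_of_sparse hq (hdep n) (hsp n) hn) hbn.le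
    linarith
  refine ⟨hb0, ?_, tendsto_measure_noise hq hA hB₁ hB₂ P hp hdep (fun n => (hs n).centred) hNX0
    (Eventually.of_forall fun n j => (hsp n).dan_pos (hs n) (hdep n) hq j) hb hb0 hnb⟩
  have hlog : ∀ᶠ n in atTop, 1 ≤ B₂ ^ 6 * Real.log (p n) :=
    ((Real.tendsto_log_atTop.comp (tendsto_natCast_atTop_atTop.comp hp)).const_mul_atTop
      (by positivity : 0 < B₂ ^ 6)).eventually_ge_atTop 1
  have h1 := hκb.const_mul (max ν 1)
  rw [mul_zero] at h1
  filter_upwards [hNX, hbpos, hlog, h1.eventually (gt_mem_nhds zero_lt_one), eventually_gt_atTop 0]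
    with n hn hbn hln hκn hn0
  have hn0' : (0 : ℝ) < n := by exact_mod_cast hn0
  -- `1 ≤ N_X max(ν, 1) κ`, and `max(ν, 1) κ b ≤ 1` eventually.
  have hle : b n ≤ (P n).NX A := by
    have e1 : b n * 1 ≤ b n * ((P n).NX A * max ν 1 * κ n) := by gcongr
    have e2 : (P n).NX A * (max ν 1 * (κ n * b n)) ≤ (P n).NX A * 1 :=
      mul_le_mul_of_nonneg_left hκn.le NX_nonneg
    linarith
  have h2 := (cubeRootRate_ge (P := P n) (q := q) (A := A) (n := n) hB₁.le hB₂.le).2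
  rw [← hb n] at h2
  -- The Gaussian part of the bandwidth gives `N_X² / n ≤ b⁶` once `B₂⁶ log p ≥ 1`, and `b ≤ N_X`
  -- turns this into `b² / n ≤ b⁶`.
  have h3 : b n ^ 2 * (1 / n) ≤ b n ^ 2 * b n ^ 4 := by
    calc b n ^ 2 * (1 / n) ≤ (P n).NX A ^ 2 * (1 / n) * 1 := by rw [mul_one]; gcongr
      _ ≤ (P n).NX A ^ 2 * (1 / n) * (B₂ ^ 6 * Real.log (p n)) := by gcongr
      _ = B₂ ^ 6 * ((P n).NX A ^ 2 * Real.log (p n) / n) := by ring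
      _ ≤ b n ^ 6 := h2
      _ = _ := by ring
  exact le_of_mul_le_mul_left h3 (by positivity)

end CausalProcess

theorem tendsto_zero_of_pow {x : ℕ → ℝ} {m : ℕ} (hm : m ≠ 0) (hx : ∀ᶠ n in atTop, 0 ≤ x n)
    (h : Tendsto (fun n => x n ^ m) atTop (𝓝 0)) : Tendsto x atTop (𝓝 0) := by
  have h1 := h.rpow_const (p := (m : ℝ)⁻¹) (Or.inr (by positivity))
  rw [Real.zero_rpow (by positivity)] at h1
  refine h1.congr' ?_
  filter_upwards [hx] with n hn
  exact Real.pow_rpow_inv_natCast hn hm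

end TVGraph

end

/-! ### The theorem -/

open TVGraph in
theorem theorem2
    -- constants that do not depend on the sample size and the dimension
    (ι : ℕ) (q A ν L M c₁ c₂ : ℝ) (hq : 2 < q) (hA : 0 < A) (hL : 0 < L)
    (hc₁ : 0 < c₁) (hc₁' : c₁ < 1) (hc₂ : 0 < c₂)
    (K : ℝ → ℝ) (hK : IsKernel K)
    -- constants of the bandwidths `b_♯`, `h_⋄`, `b_⋆`
    (B₁ B₂ H₁ H₂ S₁ S₂ : ℝ) (hB₁ : 0 < B₁) (hB₂ : 0 < B₂) (hH₁ : 0 < H₁) (hH₂ : 0 < H₂)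
    (hS₁ : 0 < S₁) (hS₂ : 0 < S₂) :
    ∃ Λ : ℝ, 0 < Λ ∧ ∀ Cl : ℝ, Λ ≤ Cl → ∃ U : ℝ, 0 < U ∧ ∀ C₀ : ℝ, U ≤ C₀ →
    -- the sequence of models, `p = p n → ∞`
    ∀ (p : ℕ → ℕ) (Ω : ℕ → Type*) [∀ n, MeasurableSpace (Ω n)] (μ : ∀ n, Measure (Ω n))
      [∀ n, IsProbabilityMeasure (μ n)] (P : ∀ n, CausalProcess (μ n) (p n))
      (τ : ℕ → Fin (ι + 2) → ℝ) (κ : ℕ → ℝ),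
    Tendsto p atTop atTop →
    (∀ n, (P n).PiecewiseSmooth (τ n) L M) →
    (∀ n, (P n).Dependence q A ν) →
    (∀ n, (P n).Jumps (τ n) c₁ c₂) →
    (∀ n, (P n).Sparse (κ n)) →
    -- the bandwidths
    ∀ (b h bs : ℕ → ℝ), (∀ n, b n = (P n).cubeRootRate q A B₁ B₂ n) →
    (∀ n, h n = (P n).cubeRootRate q A H₁ H₂ n) →
    (∀ n, bs n = (P n).sqrtRate q A S₁ S₂ n) →
    -- the change point estimates
    ∀ (k : ∀ n, Ω n → ℕ) (r : ∀ n, Ω n → ℕ → ℤ),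
    (∀ n ω, IsChangePointOutput ((P n).obs n ω) n ⌊n * h n⌋₊ ((1 + L) * h n ^ 2)
      (k n ω) (r n ω)) →
    -- (i) between change points
    ((∀ W : ∀ n, Ω n → ℝ → Matrix (Fin (p n)) (Fin (p n)) ℝ,
      (∀ n ω t, IsClime (covHat K ((P n).obs n ω) n (k n ω) (r n ω) (b n) (h n) t)
        (Cl * κ n * b n ^ 2) (W n ω t)) →
      Tendsto (fun n => n * b n) atTop atTop →
      Tendsto (fun n => C₀ * κ n ^ 2 * b n ^ 2) atTop (𝓝 0) →
      IsBigOP μ (fun n ω => ⨆ t ∈ between n (k n ω) (r n ω) (b n) (h n), ENNReal.ofReal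
          (maxNorm (covHat K ((P n).obs n ω) n (k n ω) (r n ω) (b n) (h n) t - (P n).cov t)))
        (fun n => b n ^ 2) ∧
      IsBigOP μ (fun n ω => ⨆ t ∈ between n (k n ω) (r n ω) (b n) (h n), ENNReal.ofReal
          (maxNorm (W n ω t - (P n).prec t)))
        (fun n => κ n ^ 2 * b n ^ 2) ∧
      WithProbToOne μ (fun n => {ω | ∀ t ∈ between n (k n ω) (r n ω) (b n) (h n),
        estEdges (W n ω t) (C₀ * κ n ^ 2 * b n ^ 2) ⊆ edges ((P n).prec t)}) ∧
      WithProbToOne μ (fun n => {ω | ∀ t ∈ between n (k n ω) (r n ω) (b n) (h n),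
        sigEdges ((P n).prec t) (2 * (C₀ * κ n ^ 2 * b n ^ 2)) ⊆
          estEdges (W n ω t) (C₀ * κ n ^ 2 * b n ^ 2)})) ∧
    -- (ii) around change points
    (∀ W : ∀ n, Ω n → ℝ → Matrix (Fin (p n)) (Fin (p n)) ℝ,
      (∀ n ω t, IsClime (covHat K ((P n).obs n ω) n (k n ω) (r n ω) (bs n) (h n) t)
        (Cl * κ n * bs n) (W n ω t)) →
      Tendsto (fun n => n * bs n) atTop atTop →
      Tendsto (fun n => C₀ * κ n ^ 2 * bs n) atTop (𝓝 0) →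
      IsBigOP μ (fun n ω => ⨆ t ∈ around n (k n ω) (r n ω) (b n) (h n), ENNReal.ofReal
          (maxNorm (covHat K ((P n).obs n ω) n (k n ω) (r n ω) (bs n) (h n) t - (P n).cov t)))
        (fun n => bs n) ∧
      IsBigOP μ (fun n ω => ⨆ t ∈ around n (k n ω) (r n ω) (b n) (h n), ENNReal.ofReal
          (maxNorm (W n ω t - (P n).prec t)))
        (fun n => κ n ^ 2 * bs n) ∧
      WithProbToOne μ (fun n => {ω | ∀ t ∈ around n (k n ω) (r n ω) (b n) (h n),
        estEdges (W n ω t) (C₀ * κ n ^ 2 * bs n) ⊆ edges ((P n).prec t)}) ∧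
      WithProbToOne μ (fun n => {ω | ∀ t ∈ around n (k n ω) (r n ω) (b n) (h n),
        sigEdges ((P n).prec t) (2 * (C₀ * κ n ^ 2 * bs n)) ⊆
          estEdges (W n ω t) (C₀ * κ n ^ 2 * bs n)}))) := by

  -- `H` compares `h` with `b` in both directions; `G` and `G'` compare `b³` with `bs²`. They depend
  -- only on the constants of the bandwidths.
  set H : ℝ := max (max 1 (4 * max H₁ H₂ ^ 3 / min B₁ B₂ ^ 3))
    (max 1 (4 * max B₁ B₂ ^ 3 / min H₁ H₂ ^ 3)) with hH
  set G : ℝ := 4 * max B₁ B₂ ^ 3 / min S₁ S₂ ^ 2 with hG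
  set G' : ℝ := 2 * max S₁ S₂ ^ 2 / min B₁ B₂ ^ 3 with hG'
  have hH0 : 0 < H := lt_max_of_lt_left (lt_max_of_lt_left one_pos)
  have hBm : 0 < max B₁ B₂ := lt_max_of_lt_left hB₁
  have hSm : 0 < max S₁ S₂ := lt_max_of_lt_left hS₁
  have hSn : 0 < min S₁ S₂ := lt_min hS₁ hS₂
  have hBn : 0 < min B₁ B₂ := lt_min hB₁ hB₂
  have hG0 : 0 < G := by positivity
  have hG'0 : 0 < G' := by positivity
  obtain ⟨β, N, C, hβ, hN, hC, key⟩ := CausalProcess.exists_covHat_error_le (A := A) (ν := ν) (M := M)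
    hq hL hc₁ hc₂ hK hH0 hG0
  -- `Λ` is the constant of the covariance error, so the tuning parameter is at least `κ` times that
  -- error. `U = 4 Cl` puts the threshold above the CLIME error.
  refine ⟨C, hC, fun Cl hCl => ⟨4 * Cl, by linarith, fun C₀ hC₀ => ?_⟩⟩
  intro p Ω _ μ _ P τ κ hp hs hdep hj hsp b h bs hb hh hbs k r hout
  have hCl0 : 0 < Cl := hC.trans_le hCl
  have hC₀0 : 0 < C₀ := by linarith
  have hb0 : ∀ n, 0 ≤ b n := fun n => by
    rw [hb]; exact (CausalProcess.cubeRootRate_bounds hB₁ hB₂).1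
  have hbs0 : ∀ n, 0 ≤ bs n := fun n => by
    rw [hbs]; exact (CausalProcess.sqrtRate_bounds hS₁ hS₂).1
  have hh0 : ∀ n, 0 ≤ h n := fun n => by
    rw [hh]; exact (CausalProcess.cubeRootRate_bounds hH₁ hH₂).1
  have hhb : ∀ n, h n ≤ H * b n := fun n => by
    have h1 : h n ≤ max 1 (4 * max H₁ H₂ ^ 3 / min B₁ B₂ ^ 3) * b n := by
      rw [hh, hb]; exact CausalProcess.cubeRootRate_le_mul hH₁ hH₂ hB₁ hB₂
    exact h1.trans (mul_le_mul_of_nonneg_right (le_max_left _ _) (hb0 n))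
  have hbh : ∀ n, b n ≤ H * h n := fun n => by
    have h1 : b n ≤ max 1 (4 * max B₁ B₂ ^ 3 / min H₁ H₂ ^ 3) * h n := by
      rw [hh, hb]; exact CausalProcess.cubeRootRate_le_mul hB₁ hB₂ hH₁ hH₂
    exact h1.trans (mul_le_mul_of_nonneg_right (le_max_right _ _) (hh0 n))
  have hbbs : ∀ n, b n ^ 3 ≤ G * bs n ^ 2 := fun n => by
    rw [hb, hbs]; exact CausalProcess.cubeRootRate_cube_le_mul hB₁ hB₂ hS₁ hS₂
  have hbsb : ∀ n, bs n ^ 2 ≤ G' * b n ^ 3 := fun n => by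
    rw [hb, hbs]; exact CausalProcess.sqrtRate_sq_le_mul hS₁ hS₂ hB₁ hB₂
  have hκV : ∀ᶠ n in Filter.atTop, 1 ≤ max ν 1 ^ 2 * κ n := by
    filter_upwards [hp.eventually_ge_atTop 1] with n hn
    exact CausalProcess.one_le_mul_of_sparse hq (hdep n) (hsp n) hn
  have hκ : ∀ᶠ n in Filter.atTop, 0 < κ n := by
    filter_upwards [hκV] with n hn
    exact pos_of_mul_pos_right (one_pos.trans_le hn) (by positivity)
  refine ⟨fun W hW hnb hu => ?_, fun W hW hnbs hu => ?_⟩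
  · have hκb : Filter.Tendsto (fun n => κ n * b n) Filter.atTop (nhds 0) := by
      refine tendsto_zero_of_pow two_ne_zero (hκ.mono fun n hn => mul_nonneg hn.le (hb0 n)) ?_
      have h1 := hu.const_mul C₀⁻¹
      rw [mul_zero] at h1
      refine h1.congr fun n => ?_
      field_simp
    obtain ⟨hbt, hb4, hbad⟩ := CausalProcess.bandwidth_asymptotics hq hA hB₁ hB₂ hp hs hdep hsp hb hnb hκb
    refine CausalProcess.clime_consistency (S := fun n ω t =>
      covHat K ((P n).obs n ω) n (k n ω) (r n ω) (b n) (h n) t) (P := P) (ρ := fun n => b n ^ 2)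
      hbad hC hCl hC₀ hsp hκ ?_ (fun n ω t ht => ⟨(hb0 n).trans ht.1.1, ?_⟩) hW ?_
    · filter_upwards [hnb.eventually_gt_atTop 0] with n hn
      have := pos_of_mul_pos_right hn (Nat.cast_nonneg n)
      positivity
    · linarith [ht.1.2, hb0 n]
    · filter_upwards [hnb.eventually_gt_atTop 0, hnb.eventually_ge_atTop N, hb4,
        hbt.eventually (ge_mem_nhds hβ)] with n h1 h2 h3 h4 ω hω
      refine (key (hs n) (hdep n) (hj n) (pos_of_mul_pos_right h1 (Nat.cast_nonneg n)) h4 h2 h3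
        (hhb n) (hbh n) (hout n ω) fun j l a a' g1 g2 g3 g4 => ?_).1
      by_contra hcon
      exact hω ⟨j, l, a, a', g1, g2, g3, g4, (not_le.1 hcon).le⟩
  · have hκbs : Filter.Tendsto (fun n => κ n ^ 2 * bs n) Filter.atTop (nhds 0) := by
      have h1 := hu.const_mul C₀⁻¹
      rw [mul_zero] at h1
      refine h1.congr fun n => ?_
      field_simp
    -- The noise event is stated at the bandwidth `b`, so its conditions have to be recovered from
    -- those on `bs`. Here `(κ b)³` is bounded by a constant times `(κ² bs)²`: `b³ ≤ G bs²`, and the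
    -- missing factor `κ` is supplied by its lower bound.
    have hκb : Filter.Tendsto (fun n => κ n * b n) Filter.atTop (nhds 0) := by
      refine tendsto_zero_of_pow three_ne_zero (hκ.mono fun n hn => mul_nonneg hn.le (hb0 n)) ?_
      have h1 := (hκbs.pow 2).const_mul (G * max ν 1 ^ 2)
      norm_num at h1
      refine squeeze_zero' (hκ.mono fun n hn => pow_nonneg (mul_nonneg hn.le (hb0 n)) 3) ?_ h1
      filter_upwards [hκ, hκV] with n hn hn'
      calc (κ n * b n) ^ 3 = 1 * (κ n ^ 3 * b n ^ 3) := by ring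
        _ ≤ (max ν 1 ^ 2 * κ n) * (κ n ^ 3 * (G * bs n ^ 2)) := by
          have := hbbs n
          have := hb0 n
          gcongr
        _ = _ := by ring
    have hbst : Filter.Tendsto bs Filter.atTop (nhds 0) := by
      have h1 := hκbs.const_mul ((max ν 1 ^ 2) ^ 2)
      rw [mul_zero] at h1
      refine squeeze_zero' (Filter.Eventually.of_forall hbs0) ?_ h1
      filter_upwards [hκV] with n hn
      calc bs n = 1 ^ 2 * bs n := by ring
        _ ≤ (max ν 1 ^ 2 * κ n) ^ 2 * bs n := by have := hbs0 n; gcongr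
        _ = _ := by ring
    have hbt : Filter.Tendsto b Filter.atTop (nhds 0) := by
      refine tendsto_zero_of_pow three_ne_zero (Filter.Eventually.of_forall hb0) ?_
      have h1 := (hbst.pow 2).const_mul G
      norm_num at h1
      exact squeeze_zero (fun n => pow_nonneg (hb0 n) 3) hbbs h1
    -- `bs² ≤ G' b · b²` and `b → 0`. Besides `n b → ∞`, this yields that windows of width `bs` are
    -- covered by the noise bound at `b`.
    have hle : ∀ᶠ n in Filter.atTop, bs n ≤ b n := by
      have h1 := hbt.const_mul G'
      rw [mul_zero] at h1
      filter_upwards [h1.eventually (ge_mem_nhds one_pos)] with n hn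
      refine le_of_sq_le_sq ?_ (hb0 n)
      calc bs n ^ 2 ≤ G' * b n ^ 3 := hbsb n
        _ = G' * b n * b n ^ 2 := by ring
        _ ≤ 1 * b n ^ 2 := by gcongr
        _ = b n ^ 2 := one_mul _
    have hnb : Filter.Tendsto (fun n : ℕ => n * b n) Filter.atTop Filter.atTop := by
      refine Filter.tendsto_atTop_mono' _ ?_ hnbs
      filter_upwards [hle] with n hn
      gcongr
    obtain ⟨-, hb4, hbad⟩ := CausalProcess.bandwidth_asymptotics hq hA hB₁ hB₂ hp hs hdep hsp hb hnb hκb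
    refine CausalProcess.clime_consistency (S := fun n ω t =>
      covHat K ((P n).obs n ω) n (k n ω) (r n ω) (bs n) (h n) t) (P := P) (ρ := bs)
      hbad hC hCl hC₀ hsp hκ ?_ (fun n ω t ht => ht.1) hW ?_
    · filter_upwards [hnbs.eventually_gt_atTop 0] with n hn
      exact pos_of_mul_pos_right hn (Nat.cast_nonneg n)
    · filter_upwards [hnb.eventually_gt_atTop 0, hnb.eventually_ge_atTop N, hb4,
        hbt.eventually (ge_mem_nhds hβ), hle, hnbs.eventually_gt_atTop 0,
        hnbs.eventually_ge_atTop N] with n h1 h2 h3 h4 h5 h6 h7 ω hω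
      refine (key (hs n) (hdep n) (hj n) (pos_of_mul_pos_right h1 (Nat.cast_nonneg n)) h4 h2 h3
        (hhb n) (hbh n) (hout n ω) fun j l a a' g1 g2 g3 g4 => ?_).2 (bs n)
        (pos_of_mul_pos_right h6 (Nat.cast_nonneg n)) h5 h7 (hbbs n)
      by_contra hcon
      exact hω ⟨j, l, a, a', g1, g2, g3, g4, (not_le.1 hcon).le⟩
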